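/- Throughout, $z=x+iy$ lies in the upper half-plane $\mathbb H$, $e(x)=e^{2\pi i x}$, $\lambda\in\mathbb Z$, $k=\lambda+\tfrac12$, $N=4N'$ with $N'\ge 1$ an odd integer, and complex powers are principal. **Notation.** Let $M_{\mu,\nu}$, $W_{\mu,\nu}$ be the Whittaker functions and $J_\alpha$, $I_\alpha$ the Bessel and modified Bessel functions of the first kind. For $n\in\mathbb Z$ put $$\mathcal M_{n,k}(y,s)=\begin{cases}\Gamma(2s)^{-1}(4\pi|n|y)^{-k/2}M_{\frac k2\mathrm{sgn}(n),\,s-\frac12}(4\pi|n|y),&n\ne0,\\ y^{s-k/2},&n=0,\end{cases}$$ $$\mathcal W_{n,k}(y,s)=\begin{cases}\Gamma(s+\frac k2\mathrm{sgn}(n))^{-1}|n|^{k/2-1}(4\pi y)^{-k/2}W_{\frac k2\mathrm{sgn}(n),\,s-\frac12}(4\pi|n|y),&n\ne0,\\ \dfrac{(4\pi)^{1-k}y^{1-s-k/2}}{(2s-1)\Gamma(s-k/2)\Gamma(s+k/2)},&n=0.\end{cases}$$ Let $\varepsilon_d=1$ or $i$ according as $d\equiv1$ or $3\pmod 4$.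 For odd $d$ let $\left(\frac cd\right)$ be the Jacobi symbol $\left(\frac c{|d|}\right)$, multiplied by $-1$ if $c<0$ and $d<0$ (so $\left(\frac0{\pm1}\right)=1$). For $\gamma=\begin{pmatrix}a&b\\c&d\end{pmatrix}\in\Gamma_0(4)$ let $j(\gamma,z)=\left(\frac cd\right)\varepsilon_d^{-1}\sqrt{cz+d}$ and $(f|_k\gamma)(z)=j(\gamma,z)^{-2k}f(\gamma z)$. With $\varphi_{m,k}(z,s)=\mathcal M_{m,k}(y,s)e(mx)$ and $\Gamma_\infty=\{\pm\begin{pmatrix}1&n\\0&1\end{pmatrix}:n\in\mathbb Z\}$, the Poincaré series is $$F_{m,k,N}(z,s)=\sum_{\gamma\in\Gamma_\infty\backslash\Gamma_0(N)}(\varphi_{m,k}(\cdot,s)|_k\gamma)(z).$$ The plus-space projection is $$pr_k^+(f)=\tfrac12f+(-1)^{\lfloor(\lambda+1)/2\rfloor}\frac1{2\sqrt2}\sum_{\nu=0}^{3}(f|B)|_kA_\nu,\qquad (f|B)(z)=e^{-(2\lambda+1)\pi i/4}f\left(z+\tfrac14\right),\quad A_\nu=\begin{pmatrix}1&0\\N\nu&1\end{pmatrix},$$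 and $F^+_{m,k,N}(\cdot,s)=pr_k^+(F_{m,k,N}(\cdot,s))$. For a positive integer $c$ divisible by $4$ the Kloosterman sum is $$K_k(m,n,c)=\sum_{v\,(c)^*}\left(\frac cv\right)^{2k}\varepsilon_v^{2k}\,e\left(\frac{m\bar v+nv}c\right),$$ where $v$ runs over the primitive residue classes modulo $c$ and $v\bar v\equiv1\pmod c$. **Theorem.** Let $m\in\mathbb Z$ with $(-1)^\lambda m\equiv0,1\pmod4$ and let $s\in\mathbb C$ with $\mathrm{Re}(s)>1$. Then the series defining $F_{m,k,N}(z,s)$ converges absolutely for every $z\in\mathbb H$, and for every $z\in\mathbb H$ $$F^+_{m,k,N}(z,s)=\mathcal M_{m,k}(y,s)e(mx)+\sum_{(-1)^\lambda n\equiv0,1\,(4)}b_{m,k}(n,s)\,\mathcal W_{n,k}(y,s)\,e(nx),$$ where the sum over $n\in\mathbb Z$ converges absolutely and the coefficients are given by the absolutely convergent series $$b_{m,k}(n,s)=2\pi i^{-k}\sum_{c>0}\left(1+\left(\frac4{N'c}\right)\right)\frac{K_k(m,n,Nc)}{Nc}\times\begin{cases}|mn|^{\frac{1-k}2}J_{2s-1}\left(\frac{4\pi\sqrt{|mn|}}{Nc}\right),&mn>0,\\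 |mn|^{\frac{1-k}2}I_{2s-1}\left(\frac{4\pi\sqrt{|mn|}}{Nc}\right),&mn<0,\\ 2^{k-1}\pi^{s+\frac k2-1}|m+n|^{s-\frac k2}(Nc)^{1-2s},&mn=0,\ m+n\ne0,\\ 2^{2k-2}\pi^{k-1}\Gamma(2s)(2Nc)^{1-2s},&m=n=0,\end{cases}$$ in which $\left(\frac4{N'c}\right)$ is $1$ if $N'c$ is odd and $0$ if $N'c$ is even. -/

import Mathlib

open scoped UpperHalfPlane MatrixGroups Topology

noncomputable section

namespace PlusPoincare

/-! ### Special functions -/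

/-- `e(x) = exp (2 π i x)`. -/
def expI (x : ℂ) : ℂ := Complex.exp (2 * Real.pi * Complex.I * x)

/-- Kummer's function `M(a, b, x) = ∑ (a)ₙ / (b)ₙ * xⁿ / n!`. -/
def kummerM (a b x : ℂ) : ℂ :=
  ∑' n : ℕ, (ascPochhammer ℂ n).eval a / (ascPochhammer ℂ n).eval b * (x ^ n / (n.factorial : ℂ))

/-- The expression of `U(a, b, x)` through `M`, meaningful when `b` is not an integer. -/
def kummerUGeneric (a b x : ℂ) : ℂ :=
  Complex.Gamma (1 - b) / Complex.Gamma (a - b + 1) * kummerM a b x +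
    Complex.Gamma (b - 1) / Complex.Gamma a * x ^ (1 - b) * kummerM (a - b + 1) (2 - b) x

open Classical in
/-- Tricomi's confluent hypergeometric function `U(a, b, x)`; for integral `b` it is the limit
of the generic expression in the parameter `b`. -/
def kummerU (a b x : ℂ) : ℂ :=
  if ∃ n : ℤ, b = n then Filter.limUnder (𝓝[≠] b) (fun b' => kummerUGeneric a b' x)
  else kummerUGeneric a b x

/-- The Whittaker function `M_{μ,ν}(y)`, `y > 0`. -/
def whittakerM (μ ν : ℂ) (y : ℝ) : ℂ :=
  Complex.exp (-(y : ℂ) / 2) * (y : ℂ) ^ (ν + 1 / 2) * kummerM (ν - μ + 1 / 2) (1 + 2 * ν) y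

/-- The Whittaker function `W_{μ,ν}(y)`, `y > 0`. -/
def whittakerW (μ ν : ℂ) (y : ℝ) : ℂ :=
  Complex.exp (-(y : ℂ) / 2) * (y : ℂ) ^ (ν + 1 / 2) * kummerU (ν - μ + 1 / 2) (1 + 2 * ν) y

/-- The Bessel function `J_α(x)`, `x > 0`. -/
def besselJ (α : ℂ) (x : ℝ) : ℂ :=
  ((x : ℂ) / 2) ^ α *
    ∑' j : ℕ, (-1) ^ j * ((x : ℂ) / 2) ^ (2 * j) /
      ((j.factorial : ℂ) * Complex.Gamma (α + j + 1))

/-- The modified Bessel function `I_α(x)`, `x > 0`. -/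
def besselI (α : ℂ) (x : ℝ) : ℂ :=
  ((x : ℂ) / 2) ^ α *
    ∑' j : ℕ, ((x : ℂ) / 2) ^ (2 * j) / ((j.factorial : ℂ) * Complex.Gamma (α + j + 1))

/-- `𝓜_{n,k}(y, s)`. -/
def calM (n : ℤ) (k : ℂ) (y : ℝ) (s : ℂ) : ℂ :=
  if n = 0 then (y : ℂ) ^ (s - k / 2)
  else (Complex.Gamma (2 * s))⁻¹ * ((4 * Real.pi * |(n : ℝ)| * y : ℝ) : ℂ) ^ (-k / 2) *
    whittakerM (k / 2 * (n.sign : ℂ)) (s - 1 / 2) (4 * Real.pi * |(n : ℝ)| * y)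

/-- `𝓦_{n,k}(y, s)`. Reciprocal Gamma values at poles of `Γ` are `0`, as they should be. -/
def calW (n : ℤ) (k : ℂ) (y : ℝ) (s : ℂ) : ℂ :=
  if n = 0 then
    ((4 * Real.pi : ℝ) : ℂ) ^ (1 - k) * (y : ℂ) ^ (1 - s - k / 2) /
      ((2 * s - 1) * Complex.Gamma (s - k / 2) * Complex.Gamma (s + k / 2))
  else (Complex.Gamma (s + k / 2 * (n.sign : ℂ)))⁻¹ * ((|(n : ℝ)| : ℝ) : ℂ) ^ (k / 2 - 1) *
    ((4 * Real.pi * y : ℝ) : ℂ) ^ (-k / 2) *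
    whittakerW (k / 2 * (n.sign : ℂ)) (s - 1 / 2) (4 * Real.pi * |(n : ℝ)| * y)

/-! ### The slash operator of weight `k = lam + 1/2` -/

/-- The weight `k = lam + 1/2`. -/
def wt (lam : ℤ) : ℂ := (lam : ℂ) + 1 / 2

/-- The quadratic residue symbol `(c / d)` for odd `d`, in Shimura's extension to negative `d`:
`(c / d) = (c / |d|)`, with an additional sign if both `c` and `d` are negative. In particular
`(0 / ±1) = 1`. -/
def symb (c d : ℤ) : ℤ :=
  if c < 0 ∧ d < 0 then -jacobiSym c d.natAbs else jacobiSym c d.natAbs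

/-- `ε_d` for odd `d`: `1` if `d ≡ 1 mod 4` and `i` if `d ≡ 3 mod 4`. -/
def eps (d : ℤ) : ℂ := if d % 4 = 1 then 1 else Complex.I

/-- The automorphy factor `(c / d) ε_d⁻¹ (c z + d)^{1/2}` (principal branch) of a bottom row
`(c, d)`. -/
def jRow (c d : ℤ) (z : ℍ) : ℂ :=
  (symb c d : ℂ) * (eps d)⁻¹ * ((c : ℂ) * (z : ℂ) + d) ^ (1 / 2 : ℂ)

/-- The automorphy factor `j(γ, z)`. -/
def autJ (γ : SL(2, ℤ)) (z : ℍ) : ℂ := jRow (γ 1 0) (γ 1 1) z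

/-- `(f |_k γ)(z) = j(γ, z)^{-2k} f(γ z)`; here `2k = 2 lam + 1` is an integer. -/
def slash (lam : ℤ) (f : ℍ → ℂ) (γ : SL(2, ℤ)) (z : ℍ) : ℂ :=
  autJ γ z ^ (-(2 * lam + 1)) * f (γ • z)

/-! ### The Poincaré series -/

/-- `φ_{m,k}(z, s) = 𝓜_{m,k}(y, s) e(m x)`. -/
def phi (m lam : ℤ) (s : ℂ) (z : ℍ) : ℂ :=
  calM m (wt lam) z.im s * expI ((m : ℂ) * (z.re : ℂ))

/-- The subgroup `Γ_∞` of matrices `±(1 n; 0 1)`, cut out by the vanishing of the lower left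
entry. -/
def GammaInf : Subgroup SL(2, ℤ) where
  carrier := {γ | γ 1 0 = 0}
  mul_mem' := by
    intro a b ha hb
    simp only [Set.mem_ofPred_eq] at ha hb ⊢
    simp [Matrix.SpecialLinearGroup.coe_mul, Matrix.mul_apply, Fin.sum_univ_two, ha, hb]
  one_mem' := by simp
  inv_mem' := by
    intro a ha
    simp only [Set.mem_ofPred_eq] at ha ⊢
    simp [Matrix.SpecialLinearGroup.SL2_inv_expl, ha]

/-- The index set `Γ_∞ \ Γ₀(N)`. -/
abbrev Cosets (N : ℕ) : Type :=
  Quotient (QuotientGroup.rightRel (GammaInf.subgroupOf (CongruenceSubgroup.Gamma0 N)))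

/-- The term of the Poincaré series that belongs to a coset in `Γ_∞ \ Γ₀(N)`. It is computed from
a representative; for `4 ∣ N` the choice does not matter, see `slash_phi_eq_of_coset`. -/
def poincareTerm (m lam : ℤ) (N : ℕ) (s : ℂ) (z : ℍ) (q : Cosets N) : ℂ :=
  slash lam (phi m lam s) (q.out : SL(2, ℤ)) z

/-- The Poincaré series `F_{m,k,N}(z, s)`, for `4 ∣ N`. -/
def poincare (m lam : ℤ) (N : ℕ) (s : ℂ) (z : ℍ) : ℂ :=
  ∑' q : Cosets N, poincareTerm m lam N s z q

/-! ### The plus-space projection -/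

/-- `(f |_k B)(z) = e^{-(2 lam + 1) π i / 4} f(z + 1/4)` for
`B = ((4 1; 0 4), e^{(2 lam + 1) π i / 4})`. -/
def slashB (lam : ℤ) (f : ℍ → ℂ) (z : ℍ) : ℂ :=
  Complex.exp (-((2 * lam + 1 : ℂ) * Real.pi * Complex.I / 4)) * f ((1 / 4 : ℝ) +ᵥ z)

/-- The matrix `A_ν = (1 0; N ν 1)`. -/
def matA (N : ℕ) (ν : ℤ) : SL(2, ℤ) :=
  ⟨!![1, 0; (N : ℤ) * ν, 1], by simp [Matrix.det_fin_two]⟩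

/-- The projection `pr_k^+` in level `N = 4 N'`, `N'` odd:
`f / 2 + (-1)^{⌊(lam + 1)/2⌋} (2 √2)⁻¹ ∑_{ν mod 4} f |_k B A_ν`. -/
def prPlus (lam : ℤ) (N : ℕ) (f : ℍ → ℂ) (z : ℍ) : ℂ :=
  1 / 2 * f z + (-1 : ℂ) ^ ((lam + 1) / 2) * (1 / (2 * (Real.sqrt 2 : ℂ))) *
    ∑ ν ∈ Finset.range 4, slash lam (slashB lam f) (matA N ν) z

/-- The projected Poincaré series `F^+_{m,k,N}(z, s)`. -/
def poincarePlus (m lam : ℤ) (N : ℕ) (s : ℂ) : ℍ → ℂ :=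
  prPlus lam N (poincare m lam N s)

/-! ### The coefficients -/

/-- The plus-space condition `(-1)^lam n ≡ 0, 1 mod 4` on an index `n`. -/
def PlusIndex (lam n : ℤ) : Prop :=
  (lam.negOnePow : ℤ) * n ≡ 0 [ZMOD 4] ∨ (lam.negOnePow : ℤ) * n ≡ 1 [ZMOD 4]

/-- The Kloosterman sum `∑_{v (c)^*} (c / v)^{2k} ε_v^{2k} e((m v̄ + n v) / c)`, where
`v v̄ ≡ 1 mod c` and `4 ∣ c`. -/
def kloosterman (lam m n : ℤ) (c : ℕ) : ℂ :=
  ∑ v ∈ (Finset.range c).filter (fun v => Nat.Coprime v c),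
    (symb (c : ℤ) (v : ℤ) : ℂ) ^ (2 * lam + 1) * eps (v : ℤ) ^ (2 * lam + 1) *
      expI (((m : ℂ) * ((((v : ZMod c)⁻¹).val : ℕ) : ℂ) + (n : ℂ) * (v : ℂ)) / (c : ℂ))

/-- The Bessel factor of modulus `q = N c` in the coefficients. -/
def besselFactor (m n : ℤ) (k s : ℂ) (q : ℕ) : ℂ :=
  if 0 < m * n then
    ((|(m * n : ℝ)| : ℝ) : ℂ) ^ ((1 - k) / 2) *
      besselJ (2 * s - 1) (4 * Real.pi * Real.sqrt |(m * n : ℝ)| / q)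
  else if m * n < 0 then
    ((|(m * n : ℝ)| : ℝ) : ℂ) ^ ((1 - k) / 2) *
      besselI (2 * s - 1) (4 * Real.pi * Real.sqrt |(m * n : ℝ)| / q)
  else if m + n ≠ 0 then
    (2 : ℂ) ^ (k - 1) * (Real.pi : ℂ) ^ (s + k / 2 - 1) *
      ((|(m + n : ℝ)| : ℝ) : ℂ) ^ (s - k / 2) * (q : ℂ) ^ (1 - 2 * s)
  else
    (2 : ℂ) ^ (2 * k - 2) * (Real.pi : ℂ) ^ (k - 1) * Complex.Gamma (2 * s) *
      (2 * (q : ℂ)) ^ (1 - 2 * s)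

/-- The term of index `c > 0` in the series for `b_{m,k}(n, s)`, in level `N = 4 N'`. -/
def coeffTerm (N' : ℕ) (lam m n : ℤ) (s : ℂ) (c : ℕ+) : ℂ :=
  (1 + (jacobiSym 4 (N' * c) : ℂ)) *
    (kloosterman lam m n (4 * N' * c) / ((4 * N' * c : ℕ) : ℂ)) *
    besselFactor m n (wt lam) s (4 * N' * c)

/-- The coefficient `b_{m,k}(n, s)`, in level `N = 4 N'`. -/
def coeff (N' : ℕ) (lam m n : ℤ) (s : ℂ) : ℂ :=
  2 * Real.pi * Complex.I ^ (-wt lam) * ∑' c : ℕ+, coeffTerm N' lam m n s c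

/-- The term of index `n` in the Fourier expansion. -/
def fourierTerm (N' : ℕ) (lam m : ℤ) (s : ℂ) (z : ℍ) (n : ℤ) : ℂ :=
  coeff N' lam m n s * calW n (wt lam) z.im s * expI ((n : ℂ) * (z.re : ℂ))

/-! ### The terms of the Poincaré series depend only on the cosets -/

theorem mem_GammaInf_iff (γ : SL(2, ℤ)) :
    γ ∈ GammaInf ↔ ∃ n : ℤ, γ = ModularGroup.T ^ n ∨ γ = -ModularGroup.T ^ n := by
  constructor
  · intro h
    have h0 : γ 1 0 = 0 := h
    have hdet := Matrix.det_fin_two (γ : Matrix (Fin 2) (Fin 2) ℤ)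
    rw [γ.det_coe, h0] at hdet
    have had : γ 0 0 * γ 1 1 = 1 := by linarith
    rcases Int.mul_eq_one_iff_eq_one_or_neg_one.mp had with ⟨ha, hd⟩ | ⟨ha, hd⟩
    · refine ⟨γ 0 1, Or.inl ?_⟩
      ext a b
      fin_cases a <;> fin_cases b <;> simp [ModularGroup.coe_T_zpow, h0, ha, hd]
    · refine ⟨-γ 0 1, Or.inr ?_⟩
      ext a b
      fin_cases a <;> fin_cases b <;> simp [-zpow_neg, ModularGroup.coe_T_zpow, h0, ha, hd]
  · rintro ⟨n, h | h⟩
    · change γ 1 0 = 0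
      rw [h]; simp [ModularGroup.coe_T_zpow]
    · change γ 1 0 = 0
      rw [h]; simp [ModularGroup.coe_T_zpow]

theorem sqrt_neg_of_im_pos {w : ℂ} (hw : 0 < w.im) :
    (-w) ^ (1 / 2 : ℂ) = -Complex.I * w ^ (1 / 2 : ℂ) := by
  have h0 : w ≠ 0 := by rintro rfl; simp at hw
  have hlog : Complex.log (-w) = Complex.log w - Real.pi * Complex.I := by
    rw [Complex.log, Complex.log, norm_neg, Complex.arg_neg_eq_arg_sub_pi_of_im_pos hw]
    push_cast; ring
  rw [Complex.cpow_def_of_ne_zero (neg_ne_zero.mpr h0), Complex.cpow_def_of_ne_zero h0, hlog]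
  have : (Complex.log w - Real.pi * Complex.I) * (1 / 2) =
      -(Real.pi / 2 * Complex.I) + Complex.log w * (1 / 2) := by ring
  rw [this, Complex.exp_add, Complex.exp_neg, Complex.exp_pi_div_two_mul_I, Complex.inv_I]

theorem jRow_neg_of_pos (c d : ℤ) (hd : d % 2 = 1) (hc : 0 < c) (z : ℍ) :
    jRow (-c) (-d) z = jRow c d z := by
  have him : 0 < ((c : ℂ) * (z : ℂ) + d).im := by
    have : (0 : ℝ) < c := by exact_mod_cast hc
    simpa using mul_pos this z.im_pos
  have hw : ((-c : ℤ) : ℂ) * (z : ℂ) + ((-d : ℤ) : ℂ) = -((c : ℂ) * (z : ℂ) + d) := by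
    push_cast; ring
  have hodd : Odd d.natAbs := by
    rw [Int.natAbs_odd]; exact Int.odd_iff.mpr hd
  have hJ := jacobiSym.neg c hodd
  unfold jRow
  rw [hw, sqrt_neg_of_im_pos him]
  have key : (symb (-c) (-d) : ℂ) * (eps (-d))⁻¹ * (-Complex.I) = (symb c d : ℂ) * (eps d)⁻¹ := by
    unfold symb eps
    rw [Int.natAbs_neg, hJ]
    have hcn : ¬ c < 0 := by omega
    have hcn' : -c < 0 := by omega
    have h4 : d % 4 = 1 ∨ d % 4 = 3 := by omega
    have hd0 : d < 0 ∨ 0 < d := by omega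
    rcases hd0 with hd0 | hd0 <;> rcases h4 with h4 | h4
    · have hm : d.natAbs % 4 = 3 := by omega
      have h4' : (-d) % 4 ≠ 1 := by omega
      have : ¬ (-d) < 0 := by omega
      rw [ZMod.χ₄_nat_three_mod_four hm]
      simp only [hcn, hcn', hd0, h4, h4', this]; simp [mul_assoc]
    · have hm : d.natAbs % 4 = 1 := by omega
      have h4' : (-d) % 4 = 1 := by omega
      have : ¬ (-d) < 0 := by omega
      rw [ZMod.χ₄_nat_one_mod_four hm]
      simp only [hcn, hcn', hd0, h4, h4', this]; simp
    · have hm : d.natAbs % 4 = 1 := by omega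
      have h4' : (-d) % 4 ≠ 1 := by omega
      have h1 : ¬ d < 0 := by omega
      have : (-d) < 0 := by omega
      rw [ZMod.χ₄_nat_one_mod_four hm]
      simp only [hcn, hcn', h1, h4, h4', this]; simp [mul_assoc]
    · have hm : d.natAbs % 4 = 3 := by omega
      have h4' : (-d) % 4 = 1 := by omega
      have h1 : ¬ d < 0 := by omega
      have : (-d) < 0 := by omega
      rw [ZMod.χ₄_nat_three_mod_four hm]
      simp only [hcn, hcn', h1, h4, h4', this]; simp
  rw [← key]; ring

theorem sqrt_neg_one : (-1 : ℂ) ^ (1 / 2 : ℂ) = Complex.I := by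
  rw [Complex.cpow_def_of_ne_zero (by norm_num), Complex.log_neg_one]
  have : (Real.pi : ℂ) * Complex.I * (1 / 2) = Real.pi / 2 * Complex.I := by ring
  rw [this, Complex.exp_pi_div_two_mul_I]

theorem jRow_zero (z : ℍ) : jRow 0 1 z = 1 ∧ jRow 0 (-1) z = 1 := by
  constructor
  · simp [jRow, symb, eps]
  · have h := sqrt_neg_one
    simp only [jRow, symb, eps, Int.cast_zero, zero_mul, zero_add, Int.cast_neg, Int.cast_one]
    rw [h]; simp

theorem jRow_neg (c d : ℤ) (hd : d % 2 = 1) (hc : c = 0 → d = 1 ∨ d = -1) (z : ℍ) :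
    jRow (-c) (-d) z = jRow c d z := by
  rcases lt_trichotomy c 0 with h | h | h
  · have := jRow_neg_of_pos (-c) (-d) (by omega) (by omega) z
    rw [neg_neg, neg_neg] at this
    exact this.symm
  · obtain ⟨h1, h2⟩ := jRow_zero z
    rcases hc h with h' | h' <;> subst h <;> subst h' <;> simp [h1, h2]
  · exact jRow_neg_of_pos c d hd h z

theorem phi_T_zpow (m lam n : ℤ) (s : ℂ) (z : ℍ) :
    phi m lam s (ModularGroup.T ^ n • z) = phi m lam s z := by
  unfold phi expI
  rw [UpperHalfPlane.modular_T_zpow_smul]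
  simp only [UpperHalfPlane.vadd_im, UpperHalfPlane.vadd_re]
  congr 1
  rw [Complex.exp_eq_exp_iff_exists_int]
  exact ⟨m * n, by push_cast; ring⟩

theorem slash_phi_eq_of_coset (m lam : ℤ) (s : ℂ) (z : ℍ) (δ γ : SL(2, ℤ))
    (hδ : δ ∈ GammaInf) (hγ : (4 : ℤ) ∣ γ 1 0) :
    slash lam (phi m lam s) (δ * γ) z = slash lam (phi m lam s) γ z := by
  have hdet := Matrix.det_fin_two (γ : Matrix (Fin 2) (Fin 2) ℤ)
  rw [γ.det_coe] at hdet
  have hd : γ 1 1 % 2 = 1 := by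
    obtain ⟨t, ht⟩ := hγ
    rcases Int.emod_two_eq_zero_or_one (γ 1 1) with h | h
    · obtain ⟨u, hu⟩ := Int.dvd_of_emod_eq_zero h
      rw [ht, hu] at hdet
      have : (1 : ℤ) = 2 * (γ 0 0 * u - γ 0 1 * (2 * t)) := by linarith
      omega
    · exact h
  have hc : γ 1 0 = 0 → γ 1 1 = 1 ∨ γ 1 1 = -1 := by
    intro h
    rw [h] at hdet
    have had : γ 0 0 * γ 1 1 = 1 := by linarith
    rcases Int.mul_eq_one_iff_eq_one_or_neg_one.mp had with ⟨_, h⟩ | ⟨_, h⟩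
    · exact Or.inl h
    · exact Or.inr h
  obtain ⟨n, h | h⟩ := (mem_GammaInf_iff δ).mp hδ
  · have hj : autJ (δ * γ) z = autJ γ z := by
      subst h
      simp [autJ]
    unfold slash
    rw [hj, mul_smul, h, phi_T_zpow]
  · have hj : autJ (δ * γ) z = autJ γ z := by
      subst h
      have := jRow_neg (γ 1 0) (γ 1 1) hd hc z
      simpa [autJ, Matrix.SpecialLinearGroup.coe_mul, ModularGroup.coe_T_zpow, Matrix.vecMul,
        dotProduct, Fin.sum_univ_two] using this
    unfold slash
    rw [hj, mul_smul, h, ModularGroup.SL_neg_smul, phi_T_zpow]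

end PlusPoincare

end

open PlusPoincare

/-! Write σ = (-1)^λ, α = s + k/2, β = s - k/2 and h(u) = (y - iu)^(-α) (y + iu)^(-β). The term of
the Poincaré series with bottom row (q, D), q > 0, factors into an arithmetic weight (theta
multiplier times e(m D̄/q), see `rowWeight`) and an analytic kernel evaluated at u = x + D/q
(`rowTerm_eq_rowKer`). The weight is periodic in D modulo q, so Poisson summation over D turns each
modulus into finite exponential sums of the weights times the Fourier transform of the kernel
(`tsum_periodic_mul_confKer`).

Analytic side. Since u² + y² = (y - iu)(y + iu), the kernel is a constant times h(u) e^p M(β; 2s; q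
- p) with p = iA/(y - iu), q = -iA/(y + iu), A = 2πim/C², where C is the modulus (`rowKer_eq`).
Expanding in A, the coefficient of A^j is h^(j)(u)/(j! (2s)_j) by Leibniz' rule (`hasSum_confKer`).
The Fourier transform replaces h^(j) by (2πiξ)^j ĥ(ξ), so the series sums to a ₀F₁, that is a Bessel
function, times ĥ(ξ) (`fourier_confKer`). The transform ĥ is a convolution of two Gamma densities,
hence an integral of Tricomi type; identifying that integral with U by Wronskians and analytic
continuation (`tricomiInt_eq`, `fourier_hKer_pos`) gives 𝓦 (`two_pi_mul_besselConst_mul_calW`).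

Arithmetic side. The map B A_ν carries the row (4h, d) to (4g, D) with h = g - νN'D and d = D - h.
Thus the projected series is again a sum over rows (4g, D), with a combination of transported
multipliers as weight. Reciprocity for the extended symbol shows that this combination equals 1 +
(4/g) times a combination of the original weights at D and D ± g (`IsDualWeight.weight_eq`). On the
n-th exponential sum a shift by ±g acts as i^(±n), and the resulting factor 1/2 + (1 - σi) i^n/4 +
(1 + σi) i^(-n)/4 is 1 when σn ≡ 0, 1 mod 4 and 0 otherwise (`sum_plusWeight`). This produces both
the Kloosterman sums and the restriction on n. The rows with q = 0 contribute the leading term,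
because m satisfies the same congruence (`plusTerm_zero_one`).

Convergence. The terms over rows are O(|qz + D|^(-2 Re s)), as in an Eisenstein series. After
Poisson summation the trivial bound for Kloosterman sums and a majorant in n uniform in the modulus
give absolute convergence over pairs (c, n) for Re s > 1 (`summable_modulusTerm`), which permits the
interchange of the two sums. -/

noncomputable section

namespace PlusPoincare

/-! ### Pochhammer symbols -/

/-- The rising factorial `a (a + 1) ⋯ (a + n - 1)`. -/
def poch (a : ℂ) (n : ℕ) : ℂ := (ascPochhammer ℂ n).eval a

@[simp] theorem poch_zero (a : ℂ) : poch a 0 = 1 := by simp [poch]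

theorem poch_succ (a : ℂ) (n : ℕ) : poch a (n + 1) = poch a n * (a + n) := by
  simp [poch, ascPochhammer_succ_eval]

theorem poch_succ_left (a : ℂ) (n : ℕ) : poch a (n + 1) = a * poch (a + 1) n := by
  induction n with
  | zero => simp [poch_succ]
  | succ n ih => rw [poch_succ, ih, poch_succ (a + 1) n]; push_cast; ring

theorem norm_poch_le {a : ℂ} {R : ℝ} (h : ‖a‖ ≤ R) (n : ℕ) :
    ‖poch a n‖ ≤ (R + 1) ^ n * n.factorial := by
  have hR : 0 ≤ R := (norm_nonneg a).trans h
  induction n with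
  | zero => simp
  | succ n ih =>
    have h1 : ‖a + n‖ ≤ (R + 1) * (n + 1) := by
      refine (norm_add_le _ _).trans ?_
      rw [Complex.norm_natCast]
      nlinarith [mul_nonneg hR (Nat.cast_nonneg (α := ℝ) n)]
    calc ‖poch a (n + 1)‖ = ‖poch a n‖ * ‖a + n‖ := by rw [poch_succ, norm_mul]
      _ ≤ ((R + 1) ^ n * n.factorial) * ((R + 1) * (n + 1)) := by gcongr
      _ = _ := by rw [Nat.factorial_succ]; push_cast; ring

theorem le_norm_poch {b : ℂ} {δ : ℝ} (hδ : 0 < δ) (h : ∀ j : ℕ, δ * (j + 1) ≤ ‖b + j‖) (n : ℕ) :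
    δ ^ n * n.factorial ≤ ‖poch b n‖ := by
  induction n with
  | zero => simp
  | succ n ih =>
    calc δ ^ (n + 1) * (n + 1).factorial = (δ ^ n * n.factorial) * (δ * (n + 1)) := by
          rw [Nat.factorial_succ]; push_cast; ring
      _ ≤ ‖poch b n‖ * ‖b + n‖ := by gcongr; exact h n
      _ = _ := by rw [poch_succ, norm_mul]

/-- The quotients (b + j)/(j + 1) tend to 1 and never vanish, so their inverses are bounded by some
M. A perturbation of b by less than 1/(2M) costs at most half of the lower bound (j + 1)/M. The
uniformity in j and in b' makes Kummer's series converge locally uniformly in its parameters. -/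
theorem exists_ball_le_norm_add {b : ℂ} (hb : ∀ j : ℕ, b + j ≠ 0) :
    ∃ δ > 0, ∀ b' ∈ Metric.ball b δ, ∀ j : ℕ, δ * (j + 1) ≤ ‖b' + j‖ := by
  have h1 : Filter.Tendsto (fun j : ℕ => (b + j) / ((j : ℂ) + 1)) Filter.atTop (𝓝 1) := by
    have h2 : Filter.Tendsto (fun j : ℕ => (b - 1) * (1 / ((j : ℂ) + 1)) + 1)
        Filter.atTop (𝓝 ((b - 1) * 0 + 1)) :=
      (tendsto_one_div_add_atTop_nhds_zero_nat.const_mul _).add_const _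
    simp only [mul_zero, zero_add] at h2
    refine h2.congr fun j => ?_
    have : (j : ℂ) + 1 ≠ 0 := Nat.cast_add_one_ne_zero j
    field_simp
    ring
  have h3 := (h1.inv₀ one_ne_zero).norm
  obtain ⟨M, hM⟩ := h3.bddAbove_range
  have hM' : ∀ j : ℕ, ((j : ℝ) + 1) ≤ M * ‖b + j‖ := by
    intro j
    have h4 : ‖((b + j) / ((j : ℂ) + 1))⁻¹‖ ≤ M := hM ⟨j, rfl⟩
    have h5 : ‖(j : ℂ) + 1‖ = (j : ℝ) + 1 := by
      exact_mod_cast Complex.norm_natCast (j + 1)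
    rw [inv_div, norm_div, h5, div_le_iff₀ (norm_pos_iff.mpr (hb j))] at h4
    exact h4
  have hMpos : 0 < M := by
    by_contra hneg
    have h6 := hM' 0
    have := mul_nonneg (sub_nonneg.mpr (not_lt.mp hneg)) (norm_nonneg (b + (0 : ℕ)))
    simp only [Nat.cast_zero] at *
    nlinarith
  refine ⟨1 / (2 * M), by positivity, fun b' hb' j => ?_⟩
  have h7 : ‖b' - b‖ < 1 / (2 * M) := by simpa [dist_eq_norm] using hb'
  have h8 : ‖b + j‖ ≤ ‖b' + j‖ + ‖b' - b‖ := by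
    have : b + j = (b' + j) - (b' - b) := by ring
    rw [this]; exact norm_sub_le _ _
  have h9 : ((j : ℝ) + 1) / M ≤ ‖b + j‖ := by
    rw [div_le_iff₀ hMpos, mul_comm]; exact hM' j
  have h10 : ((j : ℝ) + 1) / M = 2 * (1 / (2 * M) * (j + 1)) := by field_simp
  have h11 : 1 / (2 * M) * 1 ≤ 1 / (2 * M) * ((j : ℝ) + 1) := by
    gcongr; linarith [Nat.cast_nonneg (α := ℝ) j]
  linarith

theorem poch_ne_zero {b : ℂ} (hb : ∀ j : ℕ, b + j ≠ 0) (n : ℕ) : poch b n ≠ 0 := by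
  induction n with
  | zero => simp
  | succ n ih => rw [poch_succ]; exact mul_ne_zero ih (hb n)

theorem add_natCast_ne_zero_of_not_int {b : ℂ} (hb : ¬ ∃ n : ℤ, b = n) (j : ℕ) : b + j ≠ 0 := by
  intro h
  exact hb ⟨-j, by push_cast; linear_combination h⟩

theorem add_natCast_ne_zero_of_re_pos {b : ℂ} (hb : 0 < b.re) (j : ℕ) : b + j ≠ 0 := by
  intro h
  have := congrArg Complex.re h
  simp at this
  linarith [Nat.cast_nonneg (α := ℝ) j]

/-! ### Kummer's function -/

theorem kummerM_eq (a b x : ℂ) :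
    kummerM a b x = ∑' n : ℕ, poch a n / poch b n / n.factorial * x ^ n := by
  unfold kummerM poch
  refine tsum_congr fun n => ?_
  ring

theorem norm_kummer_coeff_le {a b : ℂ} {R δ : ℝ} (ha : ‖a‖ ≤ R) (hδ : 0 < δ)
    (hb : ∀ j : ℕ, δ * (j + 1) ≤ ‖b + j‖) (n : ℕ) :
    ‖poch a n / poch b n / n.factorial‖ ≤ ((R + 1) / δ) ^ n / n.factorial := by
  have hf : (0 : ℝ) < n.factorial := by exact_mod_cast n.factorial_pos
  have hR : 0 ≤ R := (norm_nonneg a).trans ha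
  rw [norm_div, norm_div, Complex.norm_natCast]
  gcongr
  rw [div_le_iff₀ (lt_of_lt_of_le (by positivity) (le_norm_poch hδ hb n))]
  calc ‖poch a n‖ ≤ (R + 1) ^ n * n.factorial := norm_poch_le ha n
    _ = ((R + 1) / δ) ^ n * (δ ^ n * n.factorial) := by
        rw [div_pow]; field_simp
    _ ≤ _ := by gcongr; exact le_norm_poch hδ hb n

theorem summable_of_norm_le_pow_div_factorial {c : ℕ → ℂ} {K Q : ℝ}
    (h : ∀ n, ‖c n‖ ≤ K * (Q ^ n / n.factorial)) (x : ℂ) : Summable fun n => ‖c n * x ^ n‖ := by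
  refine Summable.of_nonneg_of_le (fun _ => norm_nonneg _) (fun n => ?_)
    ((Real.summable_pow_div_factorial (Q * ‖x‖)).mul_left K)
  rw [norm_mul, norm_pow, mul_pow]
  calc ‖c n‖ * ‖x‖ ^ n ≤ K * (Q ^ n / n.factorial) * ‖x‖ ^ n := by gcongr; exact h n
    _ = _ := by ring

theorem norm_deriv_coeff_le {c : ℕ → ℂ} {K Q : ℝ}
    (h : ∀ n, ‖c n‖ ≤ K * (Q ^ n / n.factorial)) (n : ℕ) :
    ‖((n : ℂ) + 1) * c (n + 1)‖ ≤ K * Q * (Q ^ n / n.factorial) := by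
  have h5 : ‖(n : ℂ) + 1‖ = (n : ℝ) + 1 := by exact_mod_cast Complex.norm_natCast (n + 1)
  rw [norm_mul, h5]
  calc ((n : ℝ) + 1) * ‖c (n + 1)‖ ≤ (n + 1) * (K * (Q ^ (n + 1) / (n + 1).factorial)) := by
        gcongr; exact h _
    _ = _ := by
        rw [Nat.factorial_succ]; push_cast
        have : (n.factorial : ℝ) ≠ 0 := by exact_mod_cast n.factorial_ne_zero
        field_simp
        ring

/-- Coefficients bounded by K Q^n/n! keep such a bound after termwise differentiation
(`norm_deriv_coeff_le`), so the lemma can be applied a second time to obtain the second derivative.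
-/
theorem hasDerivAt_series {c : ℕ → ℂ} {K Q : ℝ} (h : ∀ n, ‖c n‖ ≤ K * (Q ^ n / n.factorial))
    (x : ℂ) : HasDerivAt (fun x : ℂ => ∑' n, c n * x ^ n)
      (∑' n : ℕ, ((n : ℂ) + 1) * c (n + 1) * x ^ n) x := by
  set r : ℝ := ‖x‖ + 1
  have hr : 0 < r := by positivity
  have hs := summable_of_norm_le_pow_div_factorial (norm_deriv_coeff_le h) (r : ℂ)
  have hu : Summable fun n : ℕ => ‖(n : ℂ) * c n * (r : ℂ) ^ (n - 1)‖ := by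
    rw [← summable_nat_add_iff 1]
    simpa using hs
  have key := hasDerivAt_tsum_of_isPreconnected (𝕜 := ℂ) (g := fun n y => c n * y ^ n)
    (g' := fun n y => (n : ℂ) * c n * y ^ (n - 1)) (t := Metric.ball 0 r) (y₀ := 0) (y := x) hu
    Metric.isOpen_ball (convex_ball _ _).isPreconnected
    (fun n y _ => by
      have := (hasDerivAt_pow n y).const_mul (c n)
      convert! this using 1; ring)
    (fun n y hy => by
      have : ‖y‖ ≤ ‖(r : ℂ)‖ := by
        rw [Complex.norm_real, Real.norm_of_nonneg hr.le]
        simpa using (mem_ball_zero_iff.mp hy).le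
      rw [norm_mul, norm_pow, norm_mul _ ((r : ℂ) ^ _), norm_pow]
      gcongr)
    (by simp [hr])
    (summable_of_norm_le_pow_div_factorial h 0).of_norm
    (by simp [r])
  convert! key using 1
  rw [(Summable.of_norm (f := fun n : ℕ => (n : ℂ) * c n * x ^ (n - 1)) ?_).tsum_eq_zero_add]
  · simp
  · rw [← summable_nat_add_iff 1]
    simpa using summable_of_norm_le_pow_div_factorial (norm_deriv_coeff_le h) x

/-- The termwise derivative of Kummer's function. -/
def kummerMDeriv (a b x : ℂ) : ℂ :=
  ∑' n : ℕ, ((n : ℂ) + 1) * (poch a (n + 1) / poch b (n + 1) / (n + 1).factorial) * x ^ n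

theorem kummer_coeff_bound {a b : ℂ} (hb : ∀ j : ℕ, b + j ≠ 0) :
    ∃ Q : ℝ, ∀ n, ‖poch a n / poch b n / n.factorial‖ ≤ 1 * (Q ^ n / n.factorial) := by
  obtain ⟨δ, hδ, h⟩ := exists_ball_le_norm_add hb
  exact ⟨_, fun n => by
    rw [one_mul]
    exact norm_kummer_coeff_le le_rfl hδ (h b (Metric.mem_ball_self hδ)) n⟩

theorem summable_kummer (a x : ℂ) {b : ℂ} (hb : ∀ j : ℕ, b + j ≠ 0) :
    Summable fun n : ℕ => ‖poch a n / poch b n / n.factorial * x ^ n‖ := by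
  obtain ⟨Q, hQ⟩ := kummer_coeff_bound (a := a) hb
  exact summable_of_norm_le_pow_div_factorial hQ x

theorem hasDerivAt_kummerM (a x : ℂ) {b : ℂ} (hb : ∀ j : ℕ, b + j ≠ 0) :
    HasDerivAt (kummerM a b) (kummerMDeriv a b x) x := by
  obtain ⟨Q, hQ⟩ := kummer_coeff_bound (a := a) hb
  rw [show kummerM a b = _ from funext (kummerM_eq a b)]
  exact hasDerivAt_series hQ x

/-- Kummer's function satisfies Kummer's differential equation. -/
theorem hasDerivAt_kummerMDeriv (a x : ℂ) {b : ℂ} (hb : ∀ j : ℕ, b + j ≠ 0) :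
    ∃ d : ℂ, HasDerivAt (kummerMDeriv a b) d x ∧
      x * d + (b - x) * kummerMDeriv a b x - a * kummerM a b x = 0 := by
  obtain ⟨Q, hQ⟩ := kummer_coeff_bound (a := a) hb
  set c : ℕ → ℂ := fun n => poch a n / poch b n / n.factorial with hc
  have hQ' := norm_deriv_coeff_le hQ
  refine ⟨_, hasDerivAt_series hQ' x, ?_⟩
  -- Kummer's equation read coefficientwise; the remaining work is to bring all series to the same
  -- power of `x`.
  have hrec : ∀ n : ℕ, ((n : ℂ) + 1) * (n + b) * c (n + 1) = (n + a) * c n := by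
    intro n
    simp only [hc]
    rw [poch_succ, poch_succ, Nat.factorial_succ]
    have h1 := poch_ne_zero hb n
    have h2 := hb n
    have h3 : (n.factorial : ℂ) ≠ 0 := by exact_mod_cast n.factorial_ne_zero
    have h4 : (n : ℂ) + 1 ≠ 0 := Nat.cast_add_one_ne_zero n
    push_cast
    field_simp
    ring
  have s0 : Summable fun n : ℕ => c n * x ^ n := (summable_of_norm_le_pow_div_factorial hQ x).of_norm
  have s1 : Summable fun n : ℕ => ((n : ℂ) + 1) * c (n + 1) * x ^ n :=
    (summable_of_norm_le_pow_div_factorial hQ' x).of_norm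
  have s2 := (summable_of_norm_le_pow_div_factorial (norm_deriv_coeff_le hQ') x).of_norm
  have e1 : x * kummerMDeriv a b x = ∑' n : ℕ, (n : ℂ) * c n * x ^ n := by
    rw [Summable.tsum_eq_zero_add (f := fun n : ℕ => (n : ℂ) * c n * x ^ n)]
    · unfold kummerMDeriv
      rw [← tsum_mul_left]
      simp only [Nat.cast_zero, zero_mul, zero_add, Nat.cast_add, Nat.cast_one]
      refine tsum_congr fun n => ?_
      simp only [hc]; ring
    · rw [← summable_nat_add_iff 1]
      refine (s1.mul_left x).congr fun n => ?_
      push_cast; ring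
  have s1' : Summable fun n : ℕ => (n : ℂ) * c n * x ^ n := by
    rw [← summable_nat_add_iff 1]
    refine (s1.mul_left x).congr fun n => ?_
    push_cast; ring
  have s2' : Summable fun n : ℕ => (n : ℂ) * (((n : ℂ) + 1) * c (n + 1)) * x ^ n := by
    rw [← summable_nat_add_iff 1]
    refine (s2.mul_left x).congr fun n => ?_
    push_cast; ring
  have e2 : x * (∑' n : ℕ, ((n : ℂ) + 1) * ((((n + 1 : ℕ) : ℂ) + 1) * c (n + 1 + 1)) * x ^ n) =
      ∑' n : ℕ, (n : ℂ) * (((n : ℂ) + 1) * c (n + 1)) * x ^ n := by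
    rw [s2'.tsum_eq_zero_add, ← tsum_mul_left]
    simp only [Nat.cast_zero, zero_mul, zero_add, Nat.cast_add, Nat.cast_one]
    refine tsum_congr fun n => ?_
    ring
  have e3 : kummerMDeriv a b x = ∑' n : ℕ, ((n : ℂ) + 1) * c (n + 1) * x ^ n := rfl
  rw [e2, sub_mul, e1, e3, kummerM_eq, ← tsum_mul_left, ← tsum_mul_left,
    ← Summable.tsum_sub (s1.mul_left b) s1', ← Summable.tsum_add s2' ((s1.mul_left b).sub s1'),
    ← Summable.tsum_sub (s2'.add ((s1.mul_left b).sub s1')) (s0.mul_left a)]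
  rw [← tsum_zero (α := ℂ) (β := ℕ)]
  refine tsum_congr fun n => ?_
  have := hrec n
  simp only [hc] at this ⊢
  linear_combination x ^ n * this

theorem kummerM_zero (a b : ℂ) : kummerM a b 0 = 1 := by
  rw [kummerM_eq, tsum_eq_single 0]
  · simp
  · intro n hn; simp [hn]

theorem differentiable_poch (n : ℕ) : Differentiable ℂ fun a => poch a n := by
  unfold poch; fun_prop

/-- Near `b` the numerator parameter stays bounded and the denominator parameter stays away from the
poles, so one exponential series dominates all terms and Weierstrass' theorem applies. -/
theorem differentiableAt_kummerM_param {f g : ℂ → ℂ} {b : ℂ} (x : ℂ)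
    (hf : Differentiable ℂ f) (hg : Differentiable ℂ g) (hb : ∀ j : ℕ, g b + j ≠ 0) :
    DifferentiableAt ℂ (fun b => kummerM (f b) (g b) x) b := by
  obtain ⟨δ, hδ, h⟩ := exists_ball_le_norm_add hb
  set S : Set ℂ := g ⁻¹' Metric.ball (g b) δ ∩ f ⁻¹' Metric.ball 0 (‖f b‖ + 1) with hS
  have hSo : IsOpen S :=
    (Metric.isOpen_ball.preimage hg.continuous).inter (Metric.isOpen_ball.preimage hf.continuous)
  have hd : DifferentiableOn ℂ
      (fun b => ∑' n : ℕ, poch (f b) n / poch (g b) n / n.factorial * x ^ n) S := by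
    refine Complex.differentiableOn_tsum_of_summable_norm
      (u := fun n : ℕ => ((‖f b‖ + 1 + 1) / δ) ^ n / n.factorial * ‖x‖ ^ n) ?_ ?_ hSo ?_
    · refine (Real.summable_pow_div_factorial ((‖f b‖ + 1 + 1) / δ * ‖x‖)).congr fun n => ?_
      rw [mul_pow]; ring
    · intro n b' hb'
      have h0 : poch (g b') n ≠ 0 := by
        have h2 := le_norm_poch hδ (h _ hb'.1) n
        rw [← norm_pos_iff]
        exact lt_of_lt_of_le (by positivity) h2
      have h3 : DifferentiableAt ℂ (fun b => poch (f b) n) b' :=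
        ((differentiable_poch n).comp hf).differentiableAt
      have h4 : DifferentiableAt ℂ (fun b => poch (g b) n) b' :=
        ((differentiable_poch n).comp hg).differentiableAt
      exact (((h3.div h4 h0).div_const _).mul_const _).differentiableWithinAt
    · intro n b' hb'
      rw [norm_mul, norm_pow]
      gcongr
      exact norm_kummer_coeff_le (mem_ball_zero_iff.mp hb'.2).le hδ (h _ hb'.1) n
  simp_rw [kummerM_eq]
  refine hd.differentiableAt (hSo.mem_nhds ⟨by simpa using hδ, ?_⟩)
  simp

end PlusPoincare

end

noncomputable section

namespace PlusPoincare

open MeasureTheory Set Filter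

/-! ### Holomorphic parameter integrals -/

/-- For a holomorphic integrand a majorant of `F` itself is enough: Cauchy's estimate on circles of
radius r/4 turns it into the majorant g/(r/4) of the derivative on the ball of radius r/2. -/
theorem differentiableAt_integral_of_dominated {X : Type*} [MeasurableSpace X] {μ : Measure X}
    {F : ℂ → X → ℂ} {z₀ : ℂ} {r : ℝ} {g : X → ℝ} (hr : 0 < r)
    (hmeas : ∀ z ∈ Metric.ball z₀ r, AEStronglyMeasurable (F z) μ)
    (hd : ∀ᵐ t ∂μ, DifferentiableOn ℂ (fun z => F z t) (Metric.ball z₀ r))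
    (hb : ∀ᵐ t ∂μ, ∀ z ∈ Metric.ball z₀ r, ‖F z t‖ ≤ g t) (hg : Integrable g μ) :
    DifferentiableAt ℂ (fun z => ∫ t, F z t ∂μ) z₀ := by
  have hr2 : 0 < r / 2 := by positivity
  have hz₀ : z₀ ∈ Metric.ball z₀ r := Metric.mem_ball_self hr
  have hder : ∀ᵐ t ∂μ, ∀ z ∈ Metric.ball z₀ (r / 2),
      HasDerivAt (fun z => F z t) (deriv (fun z => F z t) z) z := by
    filter_upwards [hd] with t ht z hz
    exact (ht.differentiableAt (Metric.isOpen_ball.mem_nhds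
      (Metric.ball_subset_ball (by linarith) hz))).hasDerivAt
  refine (hasDerivAt_integral_of_dominated_loc_of_deriv_le (bound := fun t => g t / (r / 4))
    (F' := fun z t => deriv (fun z => F z t) z) (Metric.ball_mem_nhds z₀ hr2) ?_ ?_ ?_ ?_
    (hg.div_const _) hder).2.differentiableAt
  · filter_upwards [Metric.ball_mem_nhds z₀ hr] with z hz using hmeas z hz
  · exact hg.mono' (hmeas _ hz₀) (by filter_upwards [hb] with t ht using ht z₀ hz₀)
  -- Measurability of the derivative in `t`: it is the pointwise limit of difference quotients along
  -- a sequence that stays in the ball and tends to `z₀`.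
  · have hu : Tendsto (fun n : ℕ => z₀ + ((r / 2 : ℝ) : ℂ) * (1 / ((n : ℂ) + 1))) atTop
        (𝓝[≠] z₀) := by
      refine tendsto_nhdsWithin_iff.mpr ⟨?_, Eventually.of_forall fun n => ?_⟩
      · have := ((tendsto_one_div_add_atTop_nhds_zero_nat (𝕜 := ℂ)).const_mul
          ((r / 2 : ℝ) : ℂ)).const_add z₀
        simpa using this
      · have h1 : ((r / 2 : ℝ) : ℂ) ≠ 0 := by exact_mod_cast hr2.ne'
        have h2 : (1 / ((n : ℂ) + 1)) ≠ 0 := one_div_ne_zero (Nat.cast_add_one_ne_zero n)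
        simpa using ⟨by simpa using hr.ne', by simpa using Nat.cast_add_one_ne_zero (R := ℂ) n⟩
    have hmem : ∀ n : ℕ, z₀ + ((r / 2 : ℝ) : ℂ) * (1 / ((n : ℂ) + 1)) ∈ Metric.ball z₀ r := by
      intro n
      rw [mem_ball_iff_norm, add_sub_cancel_left, norm_mul, Complex.norm_real,
        Real.norm_of_nonneg hr2.le, norm_div, norm_one]
      have h5 : ‖(n : ℂ) + 1‖ = (n : ℝ) + 1 := by exact_mod_cast Complex.norm_natCast (n + 1)
      rw [h5]
      have : 1 / ((n : ℝ) + 1) ≤ 1 := by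
        rw [div_le_one (by positivity)]; linarith [Nat.cast_nonneg (α := ℝ) n]
      nlinarith
    refine aestronglyMeasurable_of_tendsto_ae (u := atTop)
      (f := fun n : ℕ => fun t => slope (fun z => F z t) z₀
        (z₀ + ((r / 2 : ℝ) : ℂ) * (1 / ((n : ℂ) + 1)))) (fun n => ?_) ?_
    · simp only [slope_def_module]
      exact AEStronglyMeasurable.const_smul (𝕜 := ℂ) ((hmeas _ (hmem n)).sub (hmeas _ hz₀)) _
    · filter_upwards [hder] with t ht
      exact (hasDerivAt_iff_tendsto_slope.mp (ht z₀ (Metric.mem_ball_self hr2))).comp hu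
  · filter_upwards [hd, hb] with t ht hbt z hz
    have hsub : Metric.closedBall z (r / 4) ⊆ Metric.ball z₀ r := by
      intro w hw
      have h1 := Metric.mem_closedBall.mp hw
      have h2 := Metric.mem_ball.mp hz
      have := dist_triangle w z z₀
      rw [Metric.mem_ball]; linarith
    refine Complex.norm_deriv_le_of_forall_mem_sphere_norm_le (by positivity)
      (DifferentiableOn.diffContOnCl (ht.mono ?_)) fun w hw => hbt w (hsub ?_)
    · rw [closure_ball z (by positivity)]; exact hsub
    · exact Metric.sphere_subset_closedBall hw

/-! ### The integral of Tricomi's function -/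

/-- One majorant for all exponents in [-Q, Q], as needed for holomorphy in the exponent. -/
theorem one_add_rpow_le {t : ℝ} (ht : 0 < t) {q Q : ℝ} (hq : |q| ≤ Q) :
    (1 + t) ^ q ≤ 2 ^ Q * (1 + t ^ Q) := by
  have hQ : 0 ≤ Q := (abs_nonneg q).trans hq
  have h1 : (1 + t) ^ q ≤ (1 + t) ^ Q :=
    Real.rpow_le_rpow_of_exponent_le (by linarith) ((le_abs_self q).trans hq)
  refine h1.trans ?_
  have h2 : 0 ≤ t ^ Q := Real.rpow_nonneg ht.le _
  have h3 : (0 : ℝ) < 2 ^ Q := Real.rpow_pos_of_pos two_pos _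
  rcases le_total t 1 with h | h
  · calc (1 + t) ^ Q ≤ 2 ^ Q := Real.rpow_le_rpow (by linarith) (by linarith) hQ
      _ ≤ _ := by nlinarith
  · calc (1 + t) ^ Q ≤ (2 * t) ^ Q := Real.rpow_le_rpow (by linarith) (by linarith) hQ
      _ = 2 ^ Q * t ^ Q := Real.mul_rpow two_pos.le ht.le
      _ ≤ _ := by nlinarith

theorem integrableOn_rpow_mul_exp_neg_mul {r x : ℝ} (hr : -1 < r) (hx : 0 < x) :
    IntegrableOn (fun t : ℝ => t ^ r * Real.exp (-x * t)) (Ioi 0) := by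
  simpa using integrableOn_rpow_mul_exp_neg_mul_rpow hr one_pos hx

theorem integrableOn_tricomi_bound {r Q x : ℝ} (hr : -1 < r) (hQ : 0 ≤ Q) (hx : 0 < x) :
    IntegrableOn (fun t : ℝ => Real.exp (-x * t) * t ^ r * (2 ^ Q * (1 + t ^ Q))) (Ioi 0) := by
  have h1 := (integrableOn_rpow_mul_exp_neg_mul hr hx).const_mul ((2 : ℝ) ^ Q)
  have h2 := (integrableOn_rpow_mul_exp_neg_mul (r := r + Q) (by linarith) hx).const_mul
    ((2 : ℝ) ^ Q)
  refine IntegrableOn.congr_fun (h1.add h2) (fun t ht => ?_) measurableSet_Ioi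
  simp only [Pi.add_apply]
  rw [Real.rpow_add ht]
  ring

theorem cpow_add_one_of_ne {z : ℂ} (c : ℂ) (hz : z ≠ 0) : z ^ (c + 1) = z ^ c * z := by
  rw [Complex.cpow_add _ _ hz, Complex.cpow_one]

theorem hasDerivAt_ofReal_cpow {f : ℝ → ℝ} {f' t : ℝ} (c : ℂ) (hf : HasDerivAt f f' t)
    (h : 0 < f t) :
    HasDerivAt (fun t : ℝ => (f t : ℂ) ^ c) (c * (f t : ℂ) ^ (c - 1) * (f' : ℂ)) t := by
  have h1 : HasDerivAt (fun z : ℂ => z ^ c) (c * (f t : ℂ) ^ (c - 1) * 1) (f t : ℂ) :=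
    (hasDerivAt_id (f t : ℂ)).cpow_const (Or.inl (by simpa using h))
  rw [mul_one] at h1
  exact HasDerivAt.comp t h1 hf.ofReal_comp

/-- The integrand `e^{-xt} t^p (1 + t)^q`. -/
def tricomiFun (p q : ℂ) (x t : ℝ) : ℂ :=
  (Real.exp (-x * t) : ℂ) * (t : ℂ) ^ p * ((1 + t : ℝ) : ℂ) ^ q

/-- `∫₀^∞ e^{-xt} t^p (1 + t)^q dt`. -/
def tricomiInt (p q : ℂ) (x : ℝ) : ℂ := ∫ t in Ioi (0 : ℝ), tricomiFun p q x t

theorem norm_tricomiFun (p q : ℂ) (x : ℝ) {t : ℝ} (ht : 0 < t) :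
    ‖tricomiFun p q x t‖ = Real.exp (-x * t) * t ^ p.re * (1 + t) ^ q.re := by
  unfold tricomiFun
  rw [norm_mul, norm_mul, Complex.norm_cpow_eq_rpow_re_of_pos ht,
    Complex.norm_cpow_eq_rpow_re_of_pos (by linarith), Complex.norm_real,
    Real.norm_of_nonneg (Real.exp_pos _).le]

theorem continuousOn_tricomiFun (p q : ℂ) (x : ℝ) : ContinuousOn (tricomiFun p q x) (Ioi 0) := by
  intro t ht
  have ht' : (0 : ℝ) < t := ht
  have h2 : (0 : ℝ) < 1 + t := by linarith
  refine ContinuousAt.continuousWithinAt ?_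
  unfold tricomiFun
  refine ContinuousAt.mul (ContinuousAt.mul (by fun_prop) ?_) ?_
  · exact ContinuousAt.cpow (by fun_prop) (by fun_prop) (Or.inl (by simpa using ht'))
  · exact ContinuousAt.cpow (by fun_prop) (by fun_prop) (Or.inl (by simpa using h2))

theorem aestronglyMeasurable_tricomiFun (p q : ℂ) (x : ℝ) :
    AEStronglyMeasurable (tricomiFun p q x) (volume.restrict (Ioi 0)) :=
  (continuousOn_tricomiFun p q x).aestronglyMeasurable measurableSet_Ioi

theorem norm_tricomiFun_le {p q : ℂ} {x x₀ t r Q : ℝ} (ht : 0 < t) (hx : x₀ ≤ x) (hr : p.re = r)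
    (hq : |q.re| ≤ Q) :
    ‖tricomiFun p q x t‖ ≤ Real.exp (-x₀ * t) * t ^ r * (2 ^ Q * (1 + t ^ Q)) := by
  rw [norm_tricomiFun p q x ht, hr]
  have := one_add_rpow_le ht hq
  gcongr

theorem integrable_tricomiFun {p : ℂ} (q : ℂ) {x : ℝ} (hp : -1 < p.re) (hx : 0 < x) :
    IntegrableOn (tricomiFun p q x) (Ioi 0) := by
  refine (integrableOn_tricomi_bound hp (abs_nonneg q.re) hx).mono'
    (aestronglyMeasurable_tricomiFun p q x) ?_
  filter_upwards [ae_restrict_mem measurableSet_Ioi] with t ht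
  exact norm_tricomiFun_le ht le_rfl rfl le_rfl

theorem hasDerivAt_tricomiInt {p : ℂ} (q : ℂ) {x : ℝ} (hp : -1 < p.re) (hx : 0 < x) :
    HasDerivAt (tricomiInt p q) (-tricomiInt (p + 1) q x) x := by
  have hx2 : 0 < x / 2 := by positivity
  have hp' : -1 < (p + 1).re := by simp; linarith
  have key := (hasDerivAt_integral_of_dominated_loc_of_deriv_le (μ := volume.restrict (Ioi 0))
    (F := fun x t => tricomiFun p q x t) (F' := fun x t => -tricomiFun (p + 1) q x t) (x₀ := x)
    (bound := fun t => Real.exp (-(x / 2) * t) * t ^ (p + 1).re *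
      (2 ^ |q.re| * (1 + t ^ |q.re|))) (Metric.ball_mem_nhds x hx2)
    (Eventually.of_forall fun x => aestronglyMeasurable_tricomiFun p q x)
    (integrable_tricomiFun q hp hx) (aestronglyMeasurable_tricomiFun _ q x).neg ?_
    (integrableOn_tricomi_bound hp' (abs_nonneg _) hx2) ?_).2
  · rw [integral_neg] at key
    exact key
  · filter_upwards [ae_restrict_mem measurableSet_Ioi] with t ht y hy
    rw [norm_neg]
    refine norm_tricomiFun_le ht ?_ rfl le_rfl
    rw [Real.ball_eq_Ioo] at hy
    linarith [hy.1]
  · filter_upwards [ae_restrict_mem measurableSet_Ioi] with t ht y hy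
    have ht0 : (t : ℂ) ≠ 0 := by exact_mod_cast (ne_of_gt ht)
    have h1 : HasDerivAt (fun y : ℝ => -y * t) (-t) y := by
      simpa using ((hasDerivAt_id y).neg.mul_const t)
    have h2 : HasDerivAt (fun y : ℝ => (Real.exp (-y * t) : ℂ))
        ((Real.exp (-y * t) * -t : ℝ) : ℂ) y := (h1.exp).ofReal_comp
    have h3 := (h2.mul_const ((t : ℂ) ^ p)).mul_const (((1 + t : ℝ) : ℂ) ^ q)
    unfold tricomiFun
    convert! h3 using 1
    rw [Complex.cpow_add _ _ ht0, Complex.cpow_one]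
    push_cast; ring

/-- Integrate the total derivative of e^(-xt) t^a (1 + t)^(b-a), which vanishes at 0 and at ∞. Since
each derivative in x multiplies the integrand by -t, the result is Kummer's equation for `tricomiInt
(a - 1) (b - a - 1)`. -/
theorem tricomiInt_ode {a : ℂ} (b : ℂ) {x : ℝ} (ha : 0 < a.re) (hx : 0 < x) :
    (x : ℂ) * tricomiInt (a + 1) (b - a - 1) x - (b - x) * tricomiInt a (b - a - 1) x -
      a * tricomiInt (a - 1) (b - a - 1) x = 0 := by
  have i1 := integrable_tricomiFun (p := a + 1) (b - a - 1) (by simp; linarith) hx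
  have i2 := integrable_tricomiFun (p := a) (b - a - 1) (by linarith) hx
  have i3 := integrable_tricomiFun (p := a - 1) (b - a - 1) (by simp; linarith) hx
  have hderiv : ∀ t ∈ Ioi (0 : ℝ), HasDerivAt (tricomiFun a (b - a) x)
      (-(x : ℂ) * tricomiFun (a + 1) (b - a - 1) x t + (b - x) * tricomiFun a (b - a - 1) x t +
        a * tricomiFun (a - 1) (b - a - 1) x t) t := by
    intro t ht
    have ht' : (0 : ℝ) < t := ht
    have ht1 : (0 : ℝ) < 1 + t := by linarith
    have ht0 : (t : ℂ) ≠ 0 := by exact_mod_cast ht'.ne'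
    have ht10 : ((1 + t : ℝ) : ℂ) ≠ 0 := by exact_mod_cast ht1.ne'
    have h1 : HasDerivAt (fun t : ℝ => -x * t) (-x) t := by
      simpa using ((hasDerivAt_id t).const_mul (-x))
    have h2 : HasDerivAt (fun t : ℝ => (Real.exp (-x * t) : ℂ))
        ((Real.exp (-x * t) * -x : ℝ) : ℂ) t := (h1.exp).ofReal_comp
    have h3 : HasDerivAt (fun t : ℝ => (t : ℂ) ^ a) (a * (t : ℂ) ^ (a - 1) * 1) t :=
      by simpa using hasDerivAt_ofReal_cpow a (hasDerivAt_id t) ht'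
    have h4 : HasDerivAt (fun t : ℝ => ((1 + t : ℝ) : ℂ) ^ (b - a))
        ((b - a) * ((1 + t : ℝ) : ℂ) ^ (b - a - 1) * ((1 : ℝ) : ℂ)) t :=
      hasDerivAt_ofReal_cpow (b - a) ((hasDerivAt_id t).const_add 1) ht1
    have h5 := (h2.mul h3).mul h4
    unfold tricomiFun
    convert! h5 using 1
    have e1 : (t : ℂ) ^ a = (t : ℂ) ^ (a - 1) * t := by
      rw [← cpow_add_one_of_ne _ ht0, sub_add_cancel]
    have e2 : ((1 + t : ℝ) : ℂ) ^ (b - a) = ((1 + t : ℝ) : ℂ) ^ (b - a - 1) * ((1 + t : ℝ) : ℂ) := by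
      rw [← cpow_add_one_of_ne _ ht10, sub_add_cancel]
    rw [cpow_add_one_of_ne _ ht0]
    simp only [Pi.mul_apply]
    rw [e2, e1]
    push_cast
    ring
  have hint : IntegrableOn (fun t => -(x : ℂ) * tricomiFun (a + 1) (b - a - 1) x t +
      (b - x) * tricomiFun a (b - a - 1) x t + a * tricomiFun (a - 1) (b - a - 1) x t) (Ioi 0) :=
    ((i1.const_mul _).add (i2.const_mul _)).add (i3.const_mul _)
  have h0 : tricomiFun a (b - a) x 0 = 0 := by
    have : a ≠ 0 := by rintro rfl; simp at ha
    simp [tricomiFun, this]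
  have hcont : ContinuousWithinAt (tricomiFun a (b - a) x) (Ici 0) 0 := by
    refine ContinuousAt.continuousWithinAt ?_
    unfold tricomiFun
    refine ContinuousAt.mul (ContinuousAt.mul (by fun_prop) ?_) ?_
    · have := Complex.continuousAt_ofReal_cpow_const 0 a (Or.inl ha)
      simpa using this
    · exact ContinuousAt.cpow (by fun_prop) (by fun_prop) (Or.inl (by simp))
  have htend := tendsto_zero_of_hasDerivAt_of_integrableOn_Ioi hderiv hint
    (integrable_tricomiFun (b - a) (by linarith) hx)
  have := integral_Ioi_of_hasDerivAt_of_tendsto hcont hderiv hint htend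
  have e1 := integral_add ((i1.const_mul (-(x : ℂ))).add (i2.const_mul (b - (x : ℂ))))
    (i3.const_mul a)
  have e2 := integral_add (i1.const_mul (-(x : ℂ))) (i2.const_mul (b - (x : ℂ)))
  simp only [Pi.add_apply] at e1
  rw [h0, e1, e2, integral_const_mul, integral_const_mul, integral_const_mul] at this
  unfold tricomiInt
  linear_combination -this

theorem differentiable_tricomiInt_right {p : ℂ} {x : ℝ} (hp : -1 < p.re) (hx : 0 < x) :
    Differentiable ℂ fun q => tricomiInt p q x := by
  intro q₀
  refine differentiableAt_integral_of_dominated (r := 1)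
    (g := fun t => Real.exp (-x * t) * t ^ p.re * (2 ^ (|q₀.re| + 1) * (1 + t ^ (|q₀.re| + 1))))
    one_pos (fun q _ => aestronglyMeasurable_tricomiFun p q x) ?_ ?_
    (integrableOn_tricomi_bound hp (by positivity) hx)
  · filter_upwards [ae_restrict_mem measurableSet_Ioi] with t ht
    have ht1 : (0 : ℝ) < 1 + t := by have : (0 : ℝ) < t := ht; linarith
    have ht10 : ((1 + t : ℝ) : ℂ) ≠ 0 := by exact_mod_cast ht1.ne'
    unfold tricomiFun
    refine Differentiable.differentiableOn fun q => ?_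
    exact ((differentiableAt_id.const_cpow (Or.inl ht10))).const_mul _
  · filter_upwards [ae_restrict_mem measurableSet_Ioi] with t ht q hq
    refine norm_tricomiFun_le ht le_rfl rfl ?_
    have h1 : ‖q - q₀‖ < 1 := by simpa [dist_eq_norm] using hq
    have h2 := (Complex.abs_re_le_norm (q - q₀)).trans h1.le
    rw [Complex.sub_re] at h2
    have := abs_sub_abs_le_abs_sub q.re q₀.re
    linarith

end PlusPoincare

end

noncomputable section

namespace PlusPoincare

open MeasureTheory Set Filter

/-! ### The connection formula for Tricomi's function -/

/-- `∫₀^∞ e^{-t} t^p (x + t)^q dt`. -/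
def shiftInt (p q : ℂ) (x : ℝ) : ℂ :=
  ∫ t in Ioi (0 : ℝ), (Real.exp (-t) : ℂ) * (t : ℂ) ^ p * ((x + t : ℝ) : ℂ) ^ q

/-- For Re q ≤ 0 one has |(x + t)^q| ≤ t^(Re q), a majorant independent of x. This supplies the
behaviour at the origin of the Tricomi integral and of its derivative. -/
theorem tendsto_shiftInt {p q : ℂ} (hq : q.re ≤ 0) (hpq : -1 < (p + q).re) :
    Tendsto (shiftInt p q) (𝓝[>] 0) (𝓝 (Complex.Gamma (p + q + 1))) := by
  have hΓ : Complex.Gamma (p + q + 1) =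
      ∫ t in Ioi (0 : ℝ), (Real.exp (-t) : ℂ) * (t : ℂ) ^ p * (t : ℂ) ^ q := by
    rw [Complex.Gamma_eq_integral (by simp at hpq ⊢; linarith), Complex.GammaIntegral]
    refine setIntegral_congr_fun measurableSet_Ioi fun t ht => ?_
    have ht0 : (t : ℂ) ≠ 0 := by exact_mod_cast (ne_of_gt ht)
    simp only [add_sub_cancel_right]
    rw [Complex.cpow_add _ _ ht0, mul_assoc]
  rw [hΓ]
  refine tendsto_integral_filter_of_dominated_convergence
    (fun t => t ^ (p + q).re * Real.exp (-1 * t)) ?_ ?_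
    (integrableOn_rpow_mul_exp_neg_mul hpq one_pos) ?_
  · filter_upwards [self_mem_nhdsWithin] with x hx
    have hx' : (0 : ℝ) < x := hx
    refine ContinuousOn.aestronglyMeasurable (fun t ht => ?_) measurableSet_Ioi
    have ht' : (0 : ℝ) < t := ht
    refine ContinuousAt.continuousWithinAt ?_
    refine ContinuousAt.mul (ContinuousAt.mul (by fun_prop) ?_) ?_
    · exact ContinuousAt.cpow (by fun_prop) (by fun_prop) (Or.inl (by simpa using ht'))
    · exact ContinuousAt.cpow (by fun_prop) (by fun_prop) (Or.inl (by simp; linarith))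
  · filter_upwards [self_mem_nhdsWithin] with x hx
    have hx' : (0 : ℝ) < x := hx
    filter_upwards [ae_restrict_mem measurableSet_Ioi] with t ht
    have ht' : (0 : ℝ) < t := ht
    rw [norm_mul, norm_mul, Complex.norm_cpow_eq_rpow_re_of_pos ht',
      Complex.norm_cpow_eq_rpow_re_of_pos (by linarith), Complex.norm_real,
      Real.norm_of_nonneg (Real.exp_pos _).le, Complex.add_re, Real.rpow_add ht', neg_one_mul]
    have : (x + t) ^ q.re ≤ t ^ q.re := Real.rpow_le_rpow_of_nonpos ht' (by linarith) hq
    have h2 : 0 ≤ Real.exp (-t) * t ^ p.re := by positivity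
    nlinarith [mul_le_mul_of_nonneg_left this h2]
  · filter_upwards [ae_restrict_mem measurableSet_Ioi] with t ht
    have ht' : (0 : ℝ) < t := ht
    refine Tendsto.const_mul _ ?_
    have hc : ContinuousAt (fun x : ℝ => ((x + t : ℝ) : ℂ) ^ q) 0 :=
      ContinuousAt.cpow (by fun_prop) (by fun_prop) (Or.inl (by simpa using ht'))
    have := hc.tendsto
    simp only [zero_add] at this
    exact this.mono_left nhdsWithin_le_nhds

theorem cpow_mul_tricomiInt (p q : ℂ) {x : ℝ} (hx : 0 < x) :
    (x : ℂ) ^ (p + q + 1) * tricomiInt p q x = shiftInt p q x := by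
  have hx0 : (x : ℂ) ≠ 0 := by exact_mod_cast hx.ne'
  have h := integral_comp_mul_left_Ioi'
    (fun t : ℝ => (Real.exp (-t) : ℂ) * (t : ℂ) ^ p * ((x + t : ℝ) : ℂ) ^ q) 0 hx
  rw [mul_zero] at h
  unfold shiftInt
  rw [← h]
  unfold tricomiInt
  rw [Complex.cpow_add _ _ hx0, Complex.cpow_one, Complex.real_smul, mul_comm _ (x : ℂ), mul_assoc,
    ← integral_const_mul]
  congr 1
  refine setIntegral_congr_fun measurableSet_Ioi fun t ht => ?_
  have ht' : (0 : ℝ) < t := ht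
  have e1 : ((x * t : ℝ) : ℂ) ^ p = (x : ℂ) ^ p * (t : ℂ) ^ p := by
    rw [Complex.ofReal_mul, Complex.mul_cpow_ofReal_nonneg hx.le ht'.le]
  have e2 : ((x + x * t : ℝ) : ℂ) ^ q = (x : ℂ) ^ q * ((1 + t : ℝ) : ℂ) ^ q := by
    rw [show x + x * t = x * (1 + t) by ring, Complex.ofReal_mul,
      Complex.mul_cpow_ofReal_nonneg hx.le (by linarith)]
  simp only [tricomiFun]
  rw [e1, e2, Complex.cpow_add _ _ hx0, neg_mul]
  ring

/-- Replace Γ(c)(1 + t)^(-c) by ∫ r^(c-1) e^(-(1+t)r) dr and integrate over t first; the inner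
integral is then Γ(a)(x + r)^(-a). The new form has a limit as x → 0 when 0 < Re b < 1 and c = a - b
+ 1. -/
theorem Gamma_mul_tricomiInt {a c : ℂ} {x : ℝ} (ha : 0 < a.re) (hc : 0 < c.re) (hx : 0 < x) :
    Complex.Gamma c * tricomiInt (a - 1) (-c) x = Complex.Gamma a * shiftInt (c - 1) (-a) x := by
  set F : ℝ → ℝ → ℂ := fun t r => (Real.exp (-x * t) : ℂ) * (t : ℂ) ^ (a - 1) *
    ((r : ℂ) ^ (c - 1) * Complex.exp (-(((1 + t : ℝ) : ℂ) * r))) with hF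
  have hmeas : Measurable (Function.uncurry F) := by
    unfold Function.uncurry
    simp only [hF]
    fun_prop
  have hnorm : ∀ t > (0 : ℝ), ∀ r > (0 : ℝ), ‖F t r‖ =
      Real.exp (-x * t) * t ^ (a.re - 1) * (r ^ (c.re - 1) * Real.exp (-((1 + t) * r))) := by
    intro t ht r hr
    simp only [hF]
    rw [norm_mul, norm_mul, norm_mul, Complex.norm_cpow_eq_rpow_re_of_pos ht,
      Complex.norm_cpow_eq_rpow_re_of_pos hr, Complex.norm_real,
      Real.norm_of_nonneg (Real.exp_pos _).le, Complex.norm_exp]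
    simp
  have hint : Integrable (Function.uncurry F)
      ((volume.restrict (Ioi 0)).prod (volume.restrict (Ioi 0))) := by
    rw [integrable_prod_iff hmeas.aestronglyMeasurable]
    constructor
    · filter_upwards [ae_restrict_mem measurableSet_Ioi] with t ht
      have ht' : (0 : ℝ) < t := ht
      have h1 := (integrableOn_rpow_mul_exp_neg_mul (r := c.re - 1) (x := 1 + t) (by linarith)
        (by linarith)).const_mul (Real.exp (-x * t) * t ^ (a.re - 1))
      refine h1.mono' (hmeas.comp measurable_prodMk_left).aestronglyMeasurable ?_
      filter_upwards [ae_restrict_mem measurableSet_Ioi] with r hr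
      have := hnorm t ht r hr
      simp only [Function.uncurry]
      rw [this, neg_mul (1 + t) r]
    · have h1 : ∀ t ∈ Ioi (0 : ℝ), ∫ r in Ioi (0 : ℝ), ‖Function.uncurry F (t, r)‖ =
          Real.Gamma c.re * (Real.exp (-x * t) * t ^ (a.re - 1) * (1 + t) ^ (-c.re)) := by
        intro t ht
        have ht' : (0 : ℝ) < t := ht
        change ∫ r in Ioi (0 : ℝ), ‖F t r‖ = _
        rw [setIntegral_congr_fun measurableSet_Ioi (fun r hr => hnorm t ht r hr),
          integral_const_mul, Real.integral_rpow_mul_exp_neg_mul_Ioi hc (by linarith), one_div,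
          Real.inv_rpow (by linarith), Real.rpow_neg (by linarith)]
        ring
      have h2 := ((integrable_tricomiFun (p := a - 1) (-c) (by simpa using ha) hx).norm).const_mul
        (Real.Gamma c.re)
      refine IntegrableOn.congr_fun h2 (fun t ht => ?_) measurableSet_Ioi
      rw [h1 t ht]
      simp only [norm_tricomiFun _ _ x ht]
      simp
  have hswap := integral_integral_swap hint
  have e1 : ∫ t in Ioi (0 : ℝ), ∫ r in Ioi (0 : ℝ), F t r =
      Complex.Gamma c * tricomiInt (a - 1) (-c) x := by
    unfold tricomiInt
    rw [← integral_const_mul]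
    refine setIntegral_congr_fun measurableSet_Ioi fun t ht => ?_
    have ht' : (0 : ℝ) < t := ht
    have h1t : (0 : ℝ) < 1 + t := by linarith
    simp only [hF]
    rw [integral_const_mul, Complex.integral_cpow_mul_exp_neg_mul_Ioi hc h1t, tricomiFun, one_div,
      Complex.inv_cpow _ _ (by
        rw [Complex.arg_ofReal_of_nonneg h1t.le]; exact Real.pi_pos.ne), ← Complex.cpow_neg]
    ring
  have e2 : ∫ r in Ioi (0 : ℝ), ∫ t in Ioi (0 : ℝ), F t r =
      Complex.Gamma a * shiftInt (c - 1) (-a) x := by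
    unfold shiftInt
    rw [← integral_const_mul]
    refine setIntegral_congr_fun measurableSet_Ioi fun r hr => ?_
    have hr' : (0 : ℝ) < r := hr
    have h1r : (0 : ℝ) < x + r := by linarith
    have h3 : ∀ t : ℝ, F t r = (Real.exp (-r) : ℂ) * (r : ℂ) ^ (c - 1) *
        ((t : ℂ) ^ (a - 1) * Complex.exp (-(((x + r : ℝ) : ℂ) * t))) := by
      intro t
      simp only [hF]
      have : (Real.exp (-x * t) : ℂ) * Complex.exp (-(((1 + t : ℝ) : ℂ) * r)) =
          (Real.exp (-r) : ℂ) * Complex.exp (-(((x + r : ℝ) : ℂ) * t)) := by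
        push_cast
        rw [← Complex.exp_add, ← Complex.exp_add]
        congr 1; ring
      linear_combination (t : ℂ) ^ (a - 1) * (r : ℂ) ^ (c - 1) * this
    simp only [h3]
    rw [integral_const_mul, Complex.integral_cpow_mul_exp_neg_mul_Ioi ha h1r, one_div,
      Complex.inv_cpow _ _ (by
        rw [Complex.arg_ofReal_of_nonneg h1r.le]; exact Real.pi_pos.ne), ← Complex.cpow_neg]
    ring
  rw [← e1, ← e2, hswap]

/-- `f` solves Kummer's equation with parameters `a`, `b` on `(0, ∞)`, with derivative `f'`. -/
def KummerSol (a b : ℂ) (f f' : ℝ → ℂ) : Prop :=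
  ∀ x : ℝ, 0 < x → HasDerivAt f (f' x) x ∧
    ∃ d : ℂ, HasDerivAt f' d x ∧ x * d + (b - x) * f' x - a * f x = 0

/-- Abel's identity: x^b e^(-x) is the integrating factor belonging to the first-order coefficient
(b - x)/x. -/
theorem KummerSol.wronskian {a b : ℂ} {f f' g g' : ℝ → ℂ} (hf : KummerSol a b f f')
    (hg : KummerSol a b g g') :
    ∃ C : ℂ, ∀ x : ℝ, 0 < x →
      (x : ℂ) ^ b * Complex.exp (-x) * (f x * g' x - f' x * g x) = C := by
  have hder : ∀ x : ℝ, 0 < x → HasDerivAt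
      (fun x : ℝ => (x : ℂ) ^ b * Complex.exp (-x) * (f x * g' x - f' x * g x)) 0 x := by
    intro x hx
    obtain ⟨h1, d, h2, h3⟩ := hf x hx
    obtain ⟨h4, e, h5, h6⟩ := hg x hx
    have hx0 : (x : ℂ) ≠ 0 := by exact_mod_cast hx.ne'
    have hb : HasDerivAt (fun x : ℝ => (x : ℂ) ^ b) (b * (x : ℂ) ^ (b - 1)) x := by
      simpa using hasDerivAt_ofReal_cpow b (hasDerivAt_id x) hx
    have he : HasDerivAt (fun x : ℝ => Complex.exp (-(x : ℂ))) (Complex.exp (-(x : ℂ)) * -1) x :=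
      (((hasDerivAt_id x).ofReal_comp).neg).cexp
    have h7 := (hb.mul he).mul ((h1.mul h5).sub (h2.mul h4))
    convert! h7 using 1
    have e1 : (x : ℂ) ^ b = (x : ℂ) ^ (b - 1) * x := by
      rw [← cpow_add_one_of_ne _ hx0, sub_add_cancel]
    simp only [Pi.mul_apply, Pi.sub_apply]
    rw [e1]
    linear_combination (x : ℂ) ^ (b - 1) * Complex.exp (-(x : ℂ)) * (-f x * h6 + g x * h3)
  obtain ⟨C, hC⟩ := isOpen_Ioi.exists_is_const_of_deriv_eq_zero (𝕜 := ℝ) (s := Ioi (0 : ℝ))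
    (convex_Ioi 0).isPreconnected
    (fun x hx => (hder x hx).differentiableAt.differentiableWithinAt)
    (fun x hx => (hder x hx).deriv)
  exact ⟨C, fun x hx => hC x hx⟩

theorem kummerSol_kummerM (a : ℂ) {b : ℂ} (hb : ∀ j : ℕ, b + j ≠ 0) :
    KummerSol a b (fun x => kummerM a b x) (fun x => kummerMDeriv a b x) := by
  intro x _
  obtain ⟨d, h1, h2⟩ := hasDerivAt_kummerMDeriv a x hb
  exact ⟨(hasDerivAt_kummerM a x hb).comp_ofReal, d, h1.comp_ofReal, h2⟩

theorem kummerSol_tricomiInt {a : ℂ} (b : ℂ) (ha : 0 < a.re) :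
    KummerSol a b (tricomiInt (a - 1) (b - a - 1)) (fun x => -tricomiInt a (b - a - 1) x) := by
  intro x hx
  have h1 := hasDerivAt_tricomiInt (p := a - 1) (b - a - 1) (by simpa using ha) hx
  have h2 := hasDerivAt_tricomiInt (p := a) (b - a - 1) (by linarith) hx
  rw [sub_add_cancel] at h1
  refine ⟨h1, _, h2.neg, ?_⟩
  have := tricomiInt_ode b ha hx
  linear_combination this

/-- The substitution f = x^(1-b) g turns the equation with parameters (a, b) into the one with (a -
b + 1, 2 - b). The derivative is displayed with x^(-b) pulled out, to be cancelled by the x^b of the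
Wronskian. -/
theorem kummerSol_second (a : ℂ) {b : ℂ} (hb : ∀ j : ℕ, 2 - b + j ≠ 0) :
    KummerSol a b (fun x => (x : ℂ) ^ (1 - b) * kummerM (a - b + 1) (2 - b) x)
      (fun x => (x : ℂ) ^ (-b) * ((1 - b) * kummerM (a - b + 1) (2 - b) x +
        x * kummerMDeriv (a - b + 1) (2 - b) x)) := by
  intro x hx
  have hx0 : (x : ℂ) ≠ 0 := by exact_mod_cast hx.ne'
  obtain ⟨d, h1, h2⟩ := hasDerivAt_kummerMDeriv (a - b + 1) (x : ℂ) hb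
  have h3 := (hasDerivAt_kummerM (a - b + 1) (x : ℂ) hb).comp_ofReal
  have h4 := h1.comp_ofReal
  have hp : ∀ c : ℂ, HasDerivAt (fun x : ℝ => (x : ℂ) ^ c) (c * (x : ℂ) ^ (c - 1)) x := fun c => by
    simpa using hasDerivAt_ofReal_cpow c (hasDerivAt_id x) hx
  have e1 : (x : ℂ) ^ (1 - b) = (x : ℂ) ^ (-b) * x := by
    rw [← cpow_add_one_of_ne _ hx0]; congr 1; ring
  have e2 : (x : ℂ) ^ (-b) = (x : ℂ) ^ (-b - 1) * x := by
    rw [← cpow_add_one_of_ne _ hx0]; congr 1; ring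
  have e3 : (1 - b - 1 : ℂ) = -b := by ring
  refine ⟨?_, _, (hp (-b)).mul ((h3.const_mul (1 - b)).add
    ((hasDerivAt_id x).ofReal_comp.mul h4)), ?_⟩
  · convert! (hp (1 - b)).mul h3 using 1
    rw [e3, e1]; ring
  · simp only [id]
    rw [e1, e2]
    push_cast
    linear_combination (x : ℂ) ^ (-b - 1) * x * x * h2

/-- The integral, M and the second solution satisfy the same second-order equation, hence are
linearly dependent, with their pairwise Wronskians as coefficients. These are constants, evaluated
as x → 0+. The restriction 0 < Re b < 1 makes both V and x^b V' converge there while x^b and x^(1-b)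
tend to 0. -/
theorem tricomiInt_eq_of_strip {a b : ℂ} {x : ℝ} (ha : 0 < a.re) (hb0 : 0 < b.re) (hb1 : b.re < 1)
    (hx : 0 < x) : tricomiInt (a - 1) (b - a - 1) x = Complex.Gamma a * kummerUGeneric a b x := by
  have hbj : ∀ j : ℕ, b + j ≠ 0 := add_natCast_ne_zero_of_re_pos hb0
  have hbj' : ∀ j : ℕ, 2 - b + j ≠ 0 := add_natCast_ne_zero_of_re_pos (by simp; linarith)
  have hΓa : Complex.Gamma a ≠ 0 := Complex.Gamma_ne_zero_of_re_pos ha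
  have hc : 0 < (a - b + 1).re := by simp; linarith
  have hΓc : Complex.Gamma (a - b + 1) ≠ 0 := Complex.Gamma_ne_zero_of_re_pos hc
  set V := tricomiInt (a - 1) (b - a - 1) with hV
  set V0 : ℂ := Complex.Gamma a * Complex.Gamma (1 - b) / Complex.Gamma (a - b + 1) with hV0
  set M := fun x : ℝ => kummerM a b x with hM
  set M' := fun x : ℝ => kummerMDeriv a b x with hM'
  set g := fun x : ℝ => kummerM (a - b + 1) (2 - b) x with hg
  set g' := fun x : ℝ => kummerMDeriv (a - b + 1) (2 - b) x with hg'
  obtain ⟨C1, hC1⟩ := (kummerSol_kummerM a hbj).wronskian (kummerSol_second a hbj')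
  obtain ⟨C2, hC2⟩ := (kummerSol_tricomiInt b ha).wronskian (kummerSol_second a hbj')
  obtain ⟨C3, hC3⟩ := (kummerSol_tricomiInt b ha).wronskian (kummerSol_kummerM a hbj)
  -- behaviour at the origin
  have cM : Tendsto M (𝓝[>] 0) (𝓝 1) := by
    have := ((hasDerivAt_kummerM a ((0 : ℝ) : ℂ) hbj).comp_ofReal).continuousAt.tendsto
    simp only [Complex.ofReal_zero, kummerM_zero] at this
    exact this.mono_left nhdsWithin_le_nhds
  have cg : Tendsto g (𝓝[>] 0) (𝓝 1) := by
    have := ((hasDerivAt_kummerM (a - b + 1) ((0 : ℝ) : ℂ) hbj').comp_ofReal).continuousAt.tendsto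
    simp only [Complex.ofReal_zero, kummerM_zero] at this
    exact this.mono_left nhdsWithin_le_nhds
  have cM' : Tendsto M' (𝓝[>] 0) (𝓝 (M' 0)) := by
    obtain ⟨d, h1, _⟩ := hasDerivAt_kummerMDeriv a ((0 : ℝ) : ℂ) hbj
    exact (h1.comp_ofReal).continuousAt.tendsto.mono_left nhdsWithin_le_nhds
  have cg' : Tendsto g' (𝓝[>] 0) (𝓝 (g' 0)) := by
    obtain ⟨d, h1, _⟩ := hasDerivAt_kummerMDeriv (a - b + 1) ((0 : ℝ) : ℂ) hbj'
    exact (h1.comp_ofReal).continuousAt.tendsto.mono_left nhdsWithin_le_nhds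
  have cx : Tendsto (fun x : ℝ => (x : ℂ)) (𝓝[>] 0) (𝓝 0) := by
    have := Complex.continuous_ofReal.tendsto 0
    exact (by simpa using this : Tendsto _ _ _).mono_left nhdsWithin_le_nhds
  have ce : Tendsto (fun x : ℝ => Complex.exp (-(x : ℂ))) (𝓝[>] 0) (𝓝 1) := by
    have h : Continuous fun x : ℝ => Complex.exp (-(x : ℂ)) := by fun_prop
    have := h.tendsto 0
    exact (by simpa using this : Tendsto _ _ _).mono_left nhdsWithin_le_nhds
  have cpow0 : ∀ c : ℂ, 0 < c.re → Tendsto (fun x : ℝ => (x : ℂ) ^ c) (𝓝[>] 0) (𝓝 0) := by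
    intro c hc
    have := (Complex.continuousAt_ofReal_cpow_const 0 c (Or.inl hc)).tendsto
    have hc0 : c ≠ 0 := by rintro rfl; simp at hc
    simp only [Complex.ofReal_zero, Complex.zero_cpow hc0] at this
    exact this.mono_left nhdsWithin_le_nhds
  -- Here c = a - b + 1, so that -c is the second exponent b - a - 1 of `V`.
  have cV : Tendsto V (𝓝[>] 0) (𝓝 V0) := by
    have h1 := (tendsto_shiftInt (p := a - b + 1 - 1) (q := -a) (by simpa using ha.le)
      (by simp; linarith)).const_mul (Complex.Gamma a / Complex.Gamma (a - b + 1))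
    have h2 : Complex.Gamma a / Complex.Gamma (a - b + 1) *
        Complex.Gamma (a - b + 1 - 1 + -a + 1) = V0 := by
      rw [hV0, show a - b + 1 - 1 + -a + 1 = 1 - b by ring]; ring
    rw [h2] at h1
    refine h1.congr' ?_
    filter_upwards [self_mem_nhdsWithin] with x hx
    have h3 := Gamma_mul_tricomiInt ha hc (x := x) hx
    rw [show -(a - b + 1) = b - a - 1 by ring] at h3
    rw [hV]
    field_simp
    rw [h3]
  have cV' : Tendsto (fun x : ℝ => (x : ℂ) ^ b * tricomiInt a (b - a - 1) x) (𝓝[>] 0)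
      (𝓝 (Complex.Gamma b)) := by
    have h1 := tendsto_shiftInt (p := a) (q := b - a - 1) (by simp; linarith) (by simp; linarith)
    rw [show a + (b - a - 1) + 1 = b by ring] at h1
    refine h1.congr' ?_
    filter_upwards [self_mem_nhdsWithin] with x hx
    have := cpow_mul_tricomiInt a (b - a - 1) (x := x) hx
    rw [show a + (b - a - 1) + 1 = b by ring] at this
    exact this.symm
  have hxb : ∀ x : ℝ, 0 < x → (x : ℂ) ^ b * (x : ℂ) ^ (-b) = 1 := by
    intro x hx
    have hx0 : (x : ℂ) ≠ 0 := by exact_mod_cast hx.ne'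
    rw [← Complex.cpow_add _ _ hx0]; simp
  have hxb1 : ∀ x : ℝ, 0 < x → (x : ℂ) ^ (1 - b) = (x : ℂ) ^ (-b) * x := by
    intro x hx
    have hx0 : (x : ℂ) ≠ 0 := by exact_mod_cast hx.ne'
    rw [← cpow_add_one_of_ne _ hx0]; congr 1; ring
  have v1 : C1 = 1 - b := by
    have h1 : Tendsto (fun x : ℝ => Complex.exp (-(x : ℂ)) *
        (M x * ((1 - b) * g x + x * g' x) - x * M' x * g x)) (𝓝[>] 0)
        (𝓝 (1 * (1 * ((1 - b) * 1 + 0 * g' 0) - 0 * M' 0 * 1))) :=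
      ce.mul ((cM.mul ((cg.const_mul _).add (cx.mul cg'))).sub ((cx.mul cM').mul cg))
    have h2 : Tendsto (fun x : ℝ => Complex.exp (-(x : ℂ)) *
        (M x * ((1 - b) * g x + x * g' x) - x * M' x * g x)) (𝓝[>] 0) (𝓝 C1) := by
      refine tendsto_const_nhds.congr' ?_
      filter_upwards [self_mem_nhdsWithin] with x hx
      rw [← hC1 x hx, hxb1 x hx]
      linear_combination Complex.exp (-(x : ℂ)) *
        (M x * ((1 - b) * g x + x * g' x) - x * M' x * g x) * hxb x hx
    rw [tendsto_nhds_unique h2 h1]; ring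
  have v2 : C2 = (1 - b) * V0 := by
    have h1 : Tendsto (fun x : ℝ => Complex.exp (-(x : ℂ)) *
        (V x * ((1 - b) * g x + x * g' x) +
          (x : ℂ) ^ (1 - b) * ((x : ℂ) ^ b * tricomiInt a (b - a - 1) x) * g x)) (𝓝[>] 0)
        (𝓝 (1 * (V0 * ((1 - b) * 1 + 0 * g' 0) + 0 * Complex.Gamma b * 1))) :=
      ce.mul ((cV.mul ((cg.const_mul _).add (cx.mul cg'))).add
        (((cpow0 _ (by simp; linarith)).mul cV').mul cg))
    have h2 : Tendsto (fun x : ℝ => Complex.exp (-(x : ℂ)) *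
        (V x * ((1 - b) * g x + x * g' x) +
          (x : ℂ) ^ (1 - b) * ((x : ℂ) ^ b * tricomiInt a (b - a - 1) x) * g x)) (𝓝[>] 0)
        (𝓝 C2) := by
      refine tendsto_const_nhds.congr' ?_
      filter_upwards [self_mem_nhdsWithin] with x hx
      rw [← hC2 x hx]
      linear_combination Complex.exp (-(x : ℂ)) *
        (V x * ((1 - b) * g x + x * g' x)) * hxb x hx
    rw [tendsto_nhds_unique h2 h1]; ring
  have v3 : C3 = Complex.Gamma b := by
    have h1 : Tendsto (fun x : ℝ => Complex.exp (-(x : ℂ)) *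
        ((x : ℂ) ^ b * V x * M' x + ((x : ℂ) ^ b * tricomiInt a (b - a - 1) x) * M x)) (𝓝[>] 0)
        (𝓝 (1 * (0 * V0 * M' 0 + Complex.Gamma b * 1))) :=
      ce.mul ((((cpow0 _ hb0).mul cV).mul cM').add (cV'.mul cM))
    have h2 : Tendsto (fun x : ℝ => Complex.exp (-(x : ℂ)) *
        ((x : ℂ) ^ b * V x * M' x + ((x : ℂ) ^ b * tricomiInt a (b - a - 1) x) * M x)) (𝓝[>] 0)
        (𝓝 C3) := by
      refine tendsto_const_nhds.congr' ?_
      filter_upwards [self_mem_nhdsWithin] with x hx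
      rw [← hC3 x hx]
      ring
    rw [tendsto_nhds_unique h2 h1]; ring
  have h1b : (1 - b : ℂ) ≠ 0 := by
    intro h
    have := congrArg Complex.re h
    simp at this
    linarith
  -- The identity f W(g, h) - g W(f, h) + h W(f, g) = 0, valid for any three functions.
  have key : V x * C1 - M x * C2 + (x : ℂ) ^ (1 - b) * g x * C3 = 0 := by
    rw [← hC1 x hx, ← hC2 x hx, ← hC3 x hx]
    ring
  have hΓb : Complex.Gamma b = (b - 1) * Complex.Gamma (b - 1) := by
    have := Complex.Gamma_add_one (b - 1) (by intro h; apply h1b; linear_combination -h)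
    rwa [sub_add_cancel] at this
  rw [v1, v2, v3, hΓb] at key
  have key2 : V x = V0 * M x + Complex.Gamma (b - 1) * ((x : ℂ) ^ (1 - b) * g x) := by
    apply mul_left_cancel₀ h1b
    linear_combination key
  rw [key2, kummerUGeneric, hV0]
  simp only [hM, hg]
  field_simp

end PlusPoincare

end

/-! ### Analytic continuation of the integral representation in the parameter b. -/

noncomputable section

namespace PlusPoincare

open MeasureTheory Set Filter

theorem differentiableAt_kummerUGeneric_right (a : ℂ) {b : ℂ} {x : ℝ} (hb : ¬ ∃ n : ℤ, b = n)
    (hx : 0 < x) : DifferentiableAt ℂ (fun b => kummerUGeneric a b x) b := by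
  have hx0 : (x : ℂ) ≠ 0 := by exact_mod_cast hx.ne'
  have h1 : DifferentiableAt ℂ (fun b => Complex.Gamma (1 - b)) b :=
    (Complex.differentiableAt_Gamma _ fun m h => hb ⟨m + 1, by push_cast; linear_combination -h⟩).comp
      b (by fun_prop)
  have h2 : DifferentiableAt ℂ (fun b => Complex.Gamma (b - 1)) b :=
    (Complex.differentiableAt_Gamma _ fun m h => hb ⟨1 - m, by push_cast; linear_combination h⟩).comp
      b (by fun_prop)
  have h3 : DifferentiableAt ℂ (fun b => (Complex.Gamma (a - b + 1))⁻¹) b :=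
    (Complex.differentiable_one_div_Gamma.differentiableAt).comp b (by fun_prop)
  have h4 : DifferentiableAt ℂ (fun b => kummerM a b x) b :=
    differentiableAt_kummerM_param (f := fun _ => a) (g := fun b => b) x (by fun_prop)
      (by fun_prop) (add_natCast_ne_zero_of_not_int hb)
  have h5 : DifferentiableAt ℂ (fun b => kummerM (a - b + 1) (2 - b) x) b :=
    differentiableAt_kummerM_param (f := fun b => a - b + 1) (g := fun b => 2 - b) x (by fun_prop)
      (by fun_prop) (fun j h => hb ⟨2 + j, by push_cast; linear_combination -h⟩)
  have h6 : DifferentiableAt ℂ (fun b => (x : ℂ) ^ (1 - b)) b :=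
    DifferentiableAt.const_cpow (by fun_prop) (Or.inl hx0)
  unfold kummerUGeneric
  simp only [div_eq_mul_inv]
  exact ((h1.mul h3).mul h4).add (((h2.mul_const _).mul h6).mul h5)

theorem differentiable_kummerUGeneric_left {b : ℂ} {x : ℝ} (hb : ¬ ∃ n : ℤ, b = n) :
    Differentiable ℂ fun a => kummerUGeneric a b x := by
  intro a
  have h3 : DifferentiableAt ℂ (fun a => (Complex.Gamma (a - b + 1))⁻¹) a :=
    (Complex.differentiable_one_div_Gamma.differentiableAt).comp a (by fun_prop)
  have h3' : DifferentiableAt ℂ (fun a => (Complex.Gamma a)⁻¹) a :=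
    Complex.differentiable_one_div_Gamma.differentiableAt
  have h4 : DifferentiableAt ℂ (fun a => kummerM a b x) a :=
    differentiableAt_kummerM_param (f := fun a => a) (g := fun _ => b) x (by fun_prop)
      (by fun_prop) (add_natCast_ne_zero_of_not_int hb)
  have h5 : DifferentiableAt ℂ (fun a => kummerM (a - b + 1) (2 - b) x) a :=
    differentiableAt_kummerM_param (f := fun a => a - b + 1) (g := fun _ => 2 - b) x (by fun_prop)
      (by fun_prop) (fun j h => hb ⟨2 + j, by push_cast; linear_combination -h⟩)
  unfold kummerUGeneric
  simp only [div_eq_mul_inv]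
  exact ((h3.const_mul _).mul h4).add (((h3'.const_mul _).mul_const _).mul h5)

theorem setOf_int_eq_range : {b : ℂ | ∃ n : ℤ, b = n} = range ((↑) : ℤ → ℂ) := by
  ext b; constructor <;> rintro ⟨n, hn⟩ <;> exact ⟨n, hn.symm⟩

theorem isOpen_not_int : IsOpen {b : ℂ | ¬ ∃ n : ℤ, b = n} := by
  have : IsClosed (range ((↑) : ℤ → ℂ)) := Complex.isClosed_range_intCast
  rw [← setOf_int_eq_range] at this
  exact this.isOpen_compl

theorem isPreconnected_not_int : IsPreconnected {b : ℂ | ¬ ∃ n : ℤ, b = n} := by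
  have hc : ({b : ℂ | ∃ n : ℤ, b = n}).Countable := by
    rw [setOf_int_eq_range]; exact countable_range _
  have hr : 1 < Module.rank ℝ ℂ := by rw [Complex.rank_real_complex]; norm_num
  exact (hc.isConnected_compl_of_one_lt_rank hr).isPreconnected

/-- The integral representation of Tricomi's function. -/
theorem tricomiInt_eq {a b : ℂ} {x : ℝ} (ha : 0 < a.re) (hb : ¬ ∃ n : ℤ, b = n) (hx : 0 < x) :
    tricomiInt (a - 1) (b - a - 1) x = Complex.Gamma a * kummerUGeneric a b x := by
  have hf : AnalyticOnNhd ℂ (fun b => tricomiInt (a - 1) (b - a - 1) x)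
      {b : ℂ | ¬ ∃ n : ℤ, b = n} := by
    refine DifferentiableOn.analyticOnNhd ?_ isOpen_not_int
    exact (((differentiable_tricomiInt_right (p := a - 1) (by simpa using ha) hx).comp
      (f := fun b : ℂ => b - a - 1) (by fun_prop))).differentiableOn
  have hg : AnalyticOnNhd ℂ (fun b => Complex.Gamma a * kummerUGeneric a b x)
      {b : ℂ | ¬ ∃ n : ℤ, b = n} := by
    refine DifferentiableOn.analyticOnNhd ?_ isOpen_not_int
    exact fun b hb => ((differentiableAt_kummerUGeneric_right a hb hx).const_mul _).differentiableWithinAt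
  -- Both sides are analytic off the integers, the plane minus a countable set is connected, and the
  -- strip around 1/2 is already settled.
  refine hf.eqOn_of_preconnected_of_eventuallyEq hg isPreconnected_not_int (z₀ := 1 / 2) ?_ ?_ hb
  · rintro ⟨n, hn⟩
    have h2 : (2 : ℂ) * n = 1 := by rw [← hn]; norm_num
    have h3 : 2 * n = 1 := by exact_mod_cast h2
    omega
  · have h1 : ∀ᶠ b : ℂ in 𝓝 (1 / 2), 0 < b.re ∧ b.re < 1 := by
      have hU : IsOpen {b : ℂ | 0 < b.re ∧ b.re < 1} :=
        (isOpen_lt continuous_const Complex.continuous_re).inter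
          (isOpen_lt Complex.continuous_re continuous_const)
      exact hU.mem_nhds (by constructor <;> norm_num)
    filter_upwards [h1] with b hb
    exact tricomiInt_eq_of_strip ha hb.1 hb.2 hx

/-! ### The Gamma integral with a complex scale -/

theorem norm_cpow_ofReal_mul_exp {c r : ℂ} {t : ℝ} (ht : 0 < t) :
    ‖(t : ℂ) ^ (c - 1) * Complex.exp (-(r * t))‖ = t ^ (c.re - 1) * Real.exp (-r.re * t) := by
  rw [norm_mul, Complex.norm_cpow_eq_rpow_re_of_pos ht, Complex.norm_exp]
  simp

theorem continuousOn_cpow_mul_exp (c r : ℂ) :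
    ContinuousOn (fun t : ℝ => (t : ℂ) ^ (c - 1) * Complex.exp (-(r * t))) (Ioi 0) := by
  intro t ht
  have ht' : (0 : ℝ) < t := ht
  refine ContinuousAt.continuousWithinAt (ContinuousAt.mul ?_ (by fun_prop))
  exact ContinuousAt.cpow (by fun_prop) (by fun_prop) (Or.inl (by simpa using ht'))

theorem integrableOn_cpow_mul_exp {c r : ℂ} (hc : 0 < c.re) (hr : 0 < r.re) :
    IntegrableOn (fun t : ℝ => (t : ℂ) ^ (c - 1) * Complex.exp (-(r * t))) (Ioi 0) := by
  refine (integrableOn_rpow_mul_exp_neg_mul (r := c.re - 1) (by linarith) hr).mono'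
    ((continuousOn_cpow_mul_exp c r).aestronglyMeasurable measurableSet_Ioi) ?_
  filter_upwards [ae_restrict_mem measurableSet_Ioi] with t ht
  exact (norm_cpow_ofReal_mul_exp ht).le

/-- Both sides are analytic for Re r > 0, and they agree at the real points 1 + 1/(n + 1), which
accumulate at 1. -/
theorem integral_cpow_mul_exp_neg {c r : ℂ} (hc : 0 < c.re) (hr : 0 < r.re) :
    ∫ t in Ioi (0 : ℝ), (t : ℂ) ^ (c - 1) * Complex.exp (-(r * t)) =
      Complex.Gamma c * r ^ (-c) := by
  have hU : IsOpen {r : ℂ | 0 < r.re} := isOpen_lt continuous_const Complex.continuous_re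
  have hf : AnalyticOnNhd ℂ
      (fun r : ℂ => ∫ t in Ioi (0 : ℝ), (t : ℂ) ^ (c - 1) * Complex.exp (-(r * t)))
      {r : ℂ | 0 < r.re} := by
    refine DifferentiableOn.analyticOnNhd (fun r hr => ?_) hU
    have hr : 0 < r.re := hr
    refine DifferentiableAt.differentiableWithinAt ?_
    refine differentiableAt_integral_of_dominated (r := r.re / 2)
      (g := fun t => t ^ (c.re - 1) * Real.exp (-(r.re / 2) * t)) (by positivity)
      (fun z _ => (continuousOn_cpow_mul_exp c z).aestronglyMeasurable measurableSet_Ioi) ?_ ?_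
      (integrableOn_rpow_mul_exp_neg_mul (by linarith) (by positivity))
    · filter_upwards with t
      exact Differentiable.differentiableOn (by fun_prop)
    · filter_upwards [ae_restrict_mem measurableSet_Ioi] with t ht z hz
      have ht' : (0 : ℝ) < t := ht
      rw [norm_cpow_ofReal_mul_exp ht]
      have h1 : ‖z - r‖ < r.re / 2 := by simpa [dist_eq_norm] using hz
      have h2 := (abs_le.mp ((Complex.abs_re_le_norm (z - r)).trans h1.le)).1
      rw [Complex.sub_re] at h2
      have : r.re / 2 ≤ z.re := by linarith
      gcongr
  have hg : AnalyticOnNhd ℂ (fun r : ℂ => Complex.Gamma c * r ^ (-c)) {r : ℂ | 0 < r.re} := by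
    refine DifferentiableOn.analyticOnNhd (fun r hr => ?_) hU
    exact (DifferentiableAt.const_mul (DifferentiableAt.cpow_const differentiableAt_id
      (Or.inl hr)) _).differentiableWithinAt
  have hpre : IsPreconnected {r : ℂ | 0 < r.re} := (convex_halfSpace_re_gt 0).isPreconnected
  refine hf.eqOn_of_preconnected_of_frequently_eq hg hpre (z₀ := 1) (by simp) ?_ hr
  have hu : Tendsto (fun n : ℕ => (1 : ℂ) + 1 / ((n : ℂ) + 1)) atTop (𝓝[≠] 1) := by
    refine tendsto_nhdsWithin_iff.mpr ⟨?_, Eventually.of_forall fun n => ?_⟩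
    · simpa using (tendsto_one_div_add_atTop_nhds_zero_nat (𝕜 := ℂ)).const_add 1
    · simpa using Nat.cast_add_one_ne_zero (R := ℂ) n
  refine hu.frequently (Eventually.of_forall fun n => ?_).frequently
  have hpos : (0 : ℝ) < 1 + 1 / ((n : ℝ) + 1) := by positivity
  have hcast : (1 : ℂ) + 1 / ((n : ℂ) + 1) = ((1 + 1 / ((n : ℝ) + 1) : ℝ) : ℂ) := by push_cast; ring
  simp only [hcast]
  rw [Complex.integral_cpow_mul_exp_neg_mul_Ioi hc hpos, one_div,
      Complex.inv_cpow _ _ (by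
        rw [Complex.arg_ofReal_of_nonneg hpos.le]; exact Real.pi_pos.ne), ← Complex.cpow_neg]
  ring

end PlusPoincare

end

noncomputable section

namespace PlusPoincare

open MeasureTheory Set Filter
open scoped FourierTransform

/-! ### The kernel `(y - iu)^{-α} (y + iu)^{-β}` and its Fourier transform -/

theorem norm_cpow_le_rpow_mul_exp {z w : ℂ} (hz : z ≠ 0) {K : ℝ} (hK : |w.im| ≤ K) :
    ‖z ^ w‖ ≤ ‖z‖ ^ w.re * Real.exp (Real.pi * K) := by
  rw [Complex.norm_cpow_of_ne_zero hz, div_eq_mul_inv, ← Real.exp_neg]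
  have h1 : -(z.arg * w.im) ≤ Real.pi * K := by
    have h2 := Complex.abs_arg_le_pi z
    calc -(z.arg * w.im) ≤ |z.arg * w.im| := neg_le_abs _
      _ = |z.arg| * |w.im| := abs_mul _ _
      _ ≤ Real.pi * K := by gcongr
  have h3 := Real.exp_le_exp.mpr h1
  gcongr

/-- `(y - iu)^{-α} (y + iu)^{-β}`. -/
def hKer (α β : ℂ) (y u : ℝ) : ℂ :=
  ((y : ℂ) - Complex.I * u) ^ (-α) * ((y : ℂ) + Complex.I * u) ^ (-β)

theorem re_sub_I_mul (y u : ℝ) : ((y : ℂ) - Complex.I * u).re = y := by simp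

theorem re_add_I_mul (y u : ℝ) : ((y : ℂ) + Complex.I * u).re = y := by simp

theorem sub_I_mul_ne_zero {y : ℝ} (hy : 0 < y) (u : ℝ) : (y : ℂ) - Complex.I * u ≠ 0 := by
  intro h
  have := re_sub_I_mul y u
  rw [h] at this
  simp at this; linarith

theorem add_I_mul_ne_zero {y : ℝ} (hy : 0 < y) (u : ℝ) : (y : ℂ) + Complex.I * u ≠ 0 := by
  intro h
  have := re_add_I_mul y u
  rw [h] at this
  simp at this; linarith

theorem norm_sub_I_mul (y u : ℝ) : ‖(y : ℂ) - Complex.I * u‖ = ‖(y : ℂ) + Complex.I * u‖ := by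
  rw [← Complex.norm_conj]
  congr 1
  simp

theorem norm_add_I_mul_sq (y u : ℝ) : ‖(y : ℂ) + Complex.I * u‖ ^ 2 = y ^ 2 + u ^ 2 := by
  rw [Complex.sq_norm, Complex.normSq_apply]
  simp; ring

theorem le_norm_add_I_mul (y u : ℝ) : y ≤ ‖(y : ℂ) + Complex.I * u‖ := by
  have := Complex.re_le_norm ((y : ℂ) + Complex.I * u)
  rwa [re_add_I_mul] at this

theorem continuous_sub_I_mul_cpow {y : ℝ} (hy : 0 < y) (α : ℂ) :
    Continuous fun u : ℝ => ((y : ℂ) - Complex.I * u) ^ α :=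
  Continuous.cpow (by fun_prop) (by fun_prop) fun u => Or.inl (by rw [re_sub_I_mul]; exact hy)

theorem continuous_add_I_mul_cpow {y : ℝ} (hy : 0 < y) (α : ℂ) :
    Continuous fun u : ℝ => ((y : ℂ) + Complex.I * u) ^ α :=
  Continuous.cpow (by fun_prop) (by fun_prop) fun u => Or.inl (by rw [re_add_I_mul]; exact hy)

theorem continuous_hKer {y : ℝ} (hy : 0 < y) (α β : ℂ) : Continuous (hKer α β y) :=
  (continuous_sub_I_mul_cpow hy _).mul (continuous_add_I_mul_cpow hy _)

theorem integrable_norm_rpow {y r : ℝ} (hy : 0 < y) (hr : 1 < r) :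
    Integrable fun u : ℝ => ‖(y : ℂ) + Complex.I * u‖ ^ (-r) := by
  set c : ℝ := min 1 (y ^ 2) with hc
  have hc0 : 0 < c := lt_min one_pos (by positivity)
  have h1 : Integrable fun u : ℝ => (1 + ‖u‖ ^ 2) ^ (-r / 2) :=
    integrable_rpow_neg_one_add_norm_sq (by simpa using hr)
  refine (h1.const_mul (c ^ (-r / 2))).mono' ?_ (Eventually.of_forall fun u => ?_)
  · refine Continuous.aestronglyMeasurable ?_
    refine Continuous.rpow_const (by fun_prop) fun u => Or.inl ?_
    exact norm_ne_zero_iff.mpr (add_I_mul_ne_zero hy u)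
  · have h2 : c * (1 + ‖u‖ ^ 2) ≤ ‖(y : ℂ) + Complex.I * u‖ ^ 2 := by
      rw [norm_add_I_mul_sq, Real.norm_eq_abs, sq_abs]
      nlinarith [min_le_left 1 (y ^ 2), min_le_right 1 (y ^ 2), sq_nonneg u]
    rw [Real.norm_of_nonneg (by positivity), ← Real.mul_rpow hc0.le (by positivity)]
    have h3 : ‖(y : ℂ) + Complex.I * u‖ ^ (-r) = (‖(y : ℂ) + Complex.I * u‖ ^ 2) ^ (-r / 2) := by
      rw [← Real.rpow_natCast, ← Real.rpow_mul (norm_nonneg _)]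
      congr 1; push_cast; ring
    rw [h3]
    exact Real.rpow_le_rpow_of_nonpos (by positivity) h2 (by linarith)

theorem norm_hKer_le {α β : ℂ} {y K : ℝ} (hy : 0 < y) (hα : |α.im| ≤ K) (hβ : |β.im| ≤ K) (u : ℝ) :
    ‖hKer α β y u‖ ≤
      Real.exp (Real.pi * K) ^ 2 * ‖(y : ℂ) + Complex.I * u‖ ^ (-(α + β).re) := by
  have h1 := norm_cpow_le_rpow_mul_exp (w := -α) (sub_I_mul_ne_zero hy u) (by simpa using hα)
  have h2 := norm_cpow_le_rpow_mul_exp (w := -β) (add_I_mul_ne_zero hy u) (by simpa using hβ)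
  have hpos : 0 < ‖(y : ℂ) + Complex.I * u‖ := norm_pos_iff.mpr (add_I_mul_ne_zero hy u)
  rw [hKer, norm_mul]
  calc _ ≤ (‖(y : ℂ) - Complex.I * u‖ ^ (-α).re * Real.exp (Real.pi * K)) *
        (‖(y : ℂ) + Complex.I * u‖ ^ (-β).re * Real.exp (Real.pi * K)) := by gcongr
    _ = _ := by
      rw [norm_sub_I_mul, show -(α + β).re = (-α).re + (-β).re by simp; ring, Real.rpow_add hpos]
      ring

theorem integrable_hKer {α β : ℂ} {y : ℝ} (hy : 0 < y) (h : 1 < (α + β).re) :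
    Integrable (hKer α β y) :=
  ((integrable_norm_rpow hy h).const_mul _).mono' (continuous_hKer hy α β).aestronglyMeasurable
    (Eventually.of_forall fun u => norm_hKer_le hy (le_max_left _ _) (le_max_right _ _) u)

/-- The reflection u ↦ -u exchanges the two factors. It reduces negative frequencies to positive
ones. -/
theorem fourier_hKer_neg (α β : ℂ) (y ξ : ℝ) : 𝓕 (hKer α β y) (-ξ) = 𝓕 (hKer β α y) ξ := by
  rw [Real.fourier_real_eq_integral_exp_smul, Real.fourier_real_eq_integral_exp_smul,
    ← integral_neg_eq_self]
  congr 1 with u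
  unfold hKer
  push_cast
  rw [show (y : ℂ) - Complex.I * -u = y + Complex.I * u by ring,
    show (y : ℂ) + Complex.I * -u = y - Complex.I * u by ring, mul_comm (_ ^ (-α))]
  congr 3
  ring

/-- Near z₀ the real part of α + β stays between some r₀ > 1 and some R, and the imaginary parts are
bounded. Because |y + iu| ≥ y, the excess exponent over r₀ costs at most (1 + 1/y)^(R - r₀), and |y
+ iu|^(-r₀) is integrable. -/
theorem differentiableAt_fourier_hKer {α β : ℂ → ℂ} (hα : Differentiable ℂ α)
    (hβ : Differentiable ℂ β) {y : ℝ} (hy : 0 < y) (ξ : ℝ) {z₀ : ℂ} (h : 1 < (α z₀ + β z₀).re) :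
    DifferentiableAt ℂ (fun z => 𝓕 (hKer (α z) (β z) y) ξ) z₀ := by
  set r₀ : ℝ := (1 + (α z₀ + β z₀).re) / 2 with hr₀
  set R : ℝ := (α z₀ + β z₀).re + 1 with hR
  set K : ℝ := |(α z₀).im| + |(β z₀).im| + 1 with hK
  have cα := hα.continuous
  have cβ := hβ.continuous
  have e1 : ∀ᶠ z in 𝓝 z₀, |(α z).im| < K :=
    (continuous_abs.comp (Complex.continuous_im.comp cα)).continuousAt.eventually_lt_const
      (by simp only [Function.comp]; linarith [abs_nonneg (β z₀).im])
  have e2 : ∀ᶠ z in 𝓝 z₀, |(β z).im| < K :=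
    (continuous_abs.comp (Complex.continuous_im.comp cβ)).continuousAt.eventually_lt_const
      (by simp only [Function.comp]; linarith [abs_nonneg (α z₀).im])
  have e3 : ∀ᶠ z in 𝓝 z₀, r₀ < (α z + β z).re :=
    (Complex.continuous_re.comp (cα.add cβ)).continuousAt.eventually_const_lt
      (by simp only [Function.comp, Pi.add_apply]; linarith)
  have e4 : ∀ᶠ z in 𝓝 z₀, (α z + β z).re < R :=
    (Complex.continuous_re.comp (cα.add cβ)).continuousAt.eventually_lt_const
      (by simp only [Function.comp, Pi.add_apply]; linarith)
  obtain ⟨r, hr, hball⟩ := Metric.eventually_nhds_iff_ball.mp (e1.and (e2.and (e3.and e4)))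
  simp only [Real.fourier_real_eq_integral_exp_smul]
  refine differentiableAt_integral_of_dominated (r := r)
    (g := fun u => Real.exp (Real.pi * K) ^ 2 * ((1 + 1 / y) ^ (R - r₀) *
      ‖(y : ℂ) + Complex.I * u‖ ^ (-r₀))) hr (fun z _ => ?_) ?_ ?_
    (((integrable_norm_rpow hy (by linarith)).const_mul _).const_mul _)
  · have := continuous_hKer hy (α z) (β z)
    exact Continuous.aestronglyMeasurable (by fun_prop)
  · filter_upwards with u
    refine Differentiable.differentiableOn fun z => ?_
    unfold hKer
    simp only [smul_eq_mul]
    refine DifferentiableAt.const_mul ?_ _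
    exact ((hα z).neg.const_cpow (Or.inl (sub_I_mul_ne_zero hy u))).mul
      ((hβ z).neg.const_cpow (Or.inl (add_I_mul_ne_zero hy u)))
  · filter_upwards with u z hz
    obtain ⟨b1, b2, b3, b4⟩ := hball z hz
    rw [norm_smul, Complex.norm_exp_ofReal_mul_I, one_mul]
    refine (norm_hKer_le hy b1.le b2.le u).trans ?_
    have hpos : 0 < ‖(y : ℂ) + Complex.I * u‖ := norm_pos_iff.mpr (add_I_mul_ne_zero hy u)
    have h5 : ‖(y : ℂ) + Complex.I * u‖ ^ (-(α z + β z).re) =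
        ‖(y : ℂ) + Complex.I * u‖ ^ (-((α z + β z).re - r₀)) *
          ‖(y : ℂ) + Complex.I * u‖ ^ (-r₀) := by
      rw [← Real.rpow_add hpos]; congr 1; ring
    rw [h5]
    gcongr
    calc ‖(y : ℂ) + Complex.I * u‖ ^ (-((α z + β z).re - r₀)) ≤ y ^ (-((α z + β z).re - r₀)) :=
          Real.rpow_le_rpow_of_nonpos hy (le_norm_add_I_mul y u) (by linarith)
      _ = (1 / y) ^ ((α z + β z).re - r₀) := by
          rw [Real.rpow_neg hy.le, one_div, Real.inv_rpow hy.le]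
      _ ≤ (1 + 1 / y) ^ ((α z + β z).re - r₀) := by
          gcongr
          linarith
      _ ≤ (1 + 1 / y) ^ (R - r₀) := by
          refine Real.rpow_le_rpow_of_exponent_le ?_ (by linarith)
          have : 0 < 1 / y := by positivity
          linarith

/-- `t^{a-1} e^{-yt}` on `t > 0`, extended by zero. -/
def gammaKer (a : ℂ) (y t : ℝ) : ℂ := ((max t 0 : ℝ) : ℂ) ^ (a - 1) * Complex.exp (-(y * t))

theorem gammaKer_of_pos (a : ℂ) (y : ℝ) {t : ℝ} (ht : 0 < t) :
    gammaKer a y t = (t : ℂ) ^ (a - 1) * Complex.exp (-(y * t)) := by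
  rw [gammaKer, max_eq_left ht.le]

theorem gammaKer_of_nonpos {a : ℂ} (ha : 1 < a.re) (y : ℝ) {t : ℝ} (ht : t ≤ 0) :
    gammaKer a y t = 0 := by
  have : a - 1 ≠ 0 := by
    intro h
    have := congrArg Complex.re h
    simp at this; linarith
  rw [gammaKer, max_eq_right ht, Complex.ofReal_zero, Complex.zero_cpow this, zero_mul]

theorem continuous_gammaKer {a : ℂ} (ha : 1 < a.re) (y : ℝ) : Continuous (gammaKer a y) := by
  unfold gammaKer
  refine Continuous.mul ?_ (by fun_prop)
  exact (Complex.continuous_ofReal_cpow_const (y := a - 1) (by simpa using ha)).comp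
    (by fun_prop : Continuous fun t : ℝ => max t 0)

theorem integral_mul_gammaKer {a : ℂ} (ha : 1 < a.re) (y : ℝ) (f : ℝ → ℂ) :
    ∫ t, f t * gammaKer a y t =
      ∫ t in Ioi (0 : ℝ), f t * ((t : ℂ) ^ (a - 1) * Complex.exp (-(y * t))) := by
  rw [← setIntegral_eq_integral_of_forall_compl_eq_zero (s := Ioi (0 : ℝ))
    (fun t ht => by rw [gammaKer_of_nonpos ha y (not_lt.mp ht), mul_zero])]
  refine setIntegral_congr_fun measurableSet_Ioi fun t ht => ?_
  rw [gammaKer_of_pos a y ht]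

theorem integrable_gammaKer {a : ℂ} (ha : 1 < a.re) {y : ℝ} (hy : 0 < y) :
    Integrable (gammaKer a y) := by
  rw [← integrableOn_iff_integrable_of_support_subset (s := Ioi (0 : ℝ))]
  · refine (integrableOn_cpow_mul_exp (c := a) (r := y) (by linarith) (by simpa using hy)).congr_fun
      (fun t ht => ?_) measurableSet_Ioi
    rw [gammaKer_of_pos a y ht]
  · intro t ht
    by_contra h
    exact ht (gammaKer_of_nonpos ha y (not_lt.mp h))

theorem fourier_gammaKer {a : ℂ} (ha : 1 < a.re) {y : ℝ} (hy : 0 < y) (v : ℝ) :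
    𝓕 (gammaKer a y) v =
      Complex.Gamma a * ((y : ℂ) + Complex.I * ((2 * Real.pi * v : ℝ) : ℂ)) ^ (-a) := by
  rw [Real.fourier_real_eq_integral_exp_smul]
  simp only [smul_eq_mul]
  rw [integral_mul_gammaKer ha, ← integral_cpow_mul_exp_neg (by linarith)
    (by rw [re_add_I_mul]; exact hy)]
  refine setIntegral_congr_fun measurableSet_Ioi fun t ht => ?_
  rw [mul_left_comm, ← Complex.exp_add]
  congr 2
  push_cast; ring

theorem integrable_add_I_mul_cpow {a : ℂ} (ha : 1 < a.re) {y : ℝ} (hy : 0 < y) :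
    Integrable fun u : ℝ => ((y : ℂ) + Complex.I * u) ^ (-a) := by
  have := integrable_hKer (α := 0) (β := a) hy (by simpa using ha)
  refine this.congr (Eventually.of_forall fun u => ?_)
  simp [hKer]

/-- Fourier inversion for the Gamma density, whose transform Γ(a)(y + 2πiv)^(-a) is integrable
because Re a > 1. The factor 2π comes from passing from v to u = 2πv. -/
theorem integral_exp_mul_add_I_mul_cpow {a : ℂ} (ha : 1 < a.re) {y : ℝ} (hy : 0 < y) (t : ℝ) :
    Complex.Gamma a * ∫ u : ℝ, Complex.exp (Complex.I * t * u) *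
      ((y : ℂ) + Complex.I * u) ^ (-a) = 2 * Real.pi * gammaKer a y t := by
  have hpi : (0 : ℝ) < 2 * Real.pi := by positivity
  have hF : 𝓕 (gammaKer a y) = fun v : ℝ =>
      Complex.Gamma a * ((y : ℂ) + Complex.I * ((2 * Real.pi * v : ℝ) : ℂ)) ^ (-a) :=
    funext fun v => fourier_gammaKer ha hy v
  have hint : Integrable (𝓕 (gammaKer a y)) := by
    rw [hF]
    refine Integrable.const_mul ?_ _
    exact (integrable_add_I_mul_cpow ha hy).comp_mul_left' hpi.ne'
  have hinv := congrFun (Continuous.fourierInv_fourier_eq (continuous_gammaKer ha y)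
    (integrable_gammaKer ha hy) hint) t
  rw [Real.fourierInv_eq', hF] at hinv
  rw [← hinv, ← integral_const_mul]
  have hcomp := Measure.integral_comp_mul_left (fun u : ℝ => Complex.Gamma a *
    (Complex.exp (Complex.I * t * u) * ((y : ℂ) + Complex.I * u) ^ (-a))) (2 * Real.pi)
  rw [abs_of_pos (by positivity), eq_inv_smul_iff₀ hpi.ne'] at hcomp
  rw [← hcomp, Complex.real_smul]
  push_cast
  congr 2 with v
  simp only [smul_eq_mul, RCLike.inner_apply, conj_trivial]
  have : Complex.exp (Complex.I * t * (2 * Real.pi * v)) =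
      Complex.exp (2 * Real.pi * ((t * v : ℝ) : ℂ) * Complex.I) := by
    congr 1; push_cast; ring
  rw [this]
  push_cast
  ring

/-- Write Γ(c)(y - iu)^(-c) as a Gamma integral over t and integrate over u first; the u-integral is
the inversion formula at t - 2πξ. The transform is thus a convolution of two Gamma densities. -/
theorem fourier_hKer_eq_integral {a c : ℂ} (ha : 1 < a.re) (hc : 1 < c.re) {y : ℝ} (hy : 0 < y)
    (ξ : ℝ) :
    Complex.Gamma c * Complex.Gamma a * 𝓕 (hKer c a y) ξ =
      2 * Real.pi * ∫ t, gammaKer a y (t - 2 * Real.pi * ξ) * gammaKer c y t := by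
  set F : ℝ → ℝ → ℂ := fun u t => Complex.exp (Complex.I * ((t - 2 * Real.pi * ξ : ℝ) : ℂ) * u) *
    (((y : ℂ) + Complex.I * u) ^ (-a) * gammaKer c y t) with hF
  have hint : Integrable (Function.uncurry F) (volume.prod volume) := by
    have h1 := (integrable_add_I_mul_cpow ha hy).mul_prod (integrable_gammaKer hc hy)
    refine h1.norm.mono' ?_ (Eventually.of_forall fun p => ?_)
    · refine Continuous.aestronglyMeasurable ?_
      simp only [hF, Function.uncurry_def]
      have h2 := continuous_gammaKer hc y
      have h3 := continuous_add_I_mul_cpow hy (-a)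
      exact Continuous.mul (by fun_prop) ((h3.comp continuous_fst).mul (h2.comp continuous_snd))
    · simp only [hF, Function.uncurry_def]
      rw [norm_mul, show Complex.I * ((p.2 - 2 * Real.pi * ξ : ℝ) : ℂ) * p.1 =
        (((p.2 - 2 * Real.pi * ξ) * p.1 : ℝ) : ℂ) * Complex.I by push_cast; ring,
        Complex.norm_exp_ofReal_mul_I, one_mul]
  have hswap := integral_integral_swap hint
  have e1 : ∫ u, ∫ t, F u t = Complex.Gamma c * 𝓕 (hKer c a y) ξ := by
    rw [Real.fourier_real_eq_integral_exp_smul, ← integral_const_mul]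
    congr 1 with u
    have h1 : ∀ t, F u t = (Complex.exp ((-2 * Real.pi * u * ξ : ℝ) * Complex.I) *
        ((y : ℂ) + Complex.I * u) ^ (-a)) * (Complex.exp (Complex.I * u * t) * gammaKer c y t) := by
      intro t
      simp only [hF]
      have : Complex.exp (Complex.I * ((t - 2 * Real.pi * ξ : ℝ) : ℂ) * u) =
          Complex.exp ((-2 * Real.pi * u * ξ : ℝ) * Complex.I) *
            Complex.exp (Complex.I * u * t) := by
        rw [← Complex.exp_add]; congr 1; push_cast; ring
      rw [this]; ring
    simp only [h1]
    rw [integral_const_mul, integral_mul_gammaKer hc]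
    have h2 : ∫ t in Ioi (0 : ℝ), Complex.exp (Complex.I * u * t) *
        ((t : ℂ) ^ (c - 1) * Complex.exp (-(y * t))) =
        Complex.Gamma c * ((y : ℂ) - Complex.I * u) ^ (-c) := by
      rw [← integral_cpow_mul_exp_neg (by linarith) (by rw [re_sub_I_mul]; exact hy)]
      refine setIntegral_congr_fun measurableSet_Ioi fun t ht => ?_
      rw [mul_left_comm, ← Complex.exp_add]
      congr 2
      ring
    rw [h2, hKer, smul_eq_mul]
    ring
  have e2 : Complex.Gamma a * ∫ t, ∫ u, F u t =
      2 * Real.pi * ∫ t, gammaKer a y (t - 2 * Real.pi * ξ) * gammaKer c y t := by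
    rw [← integral_const_mul, ← integral_const_mul]
    congr 1 with t
    have h1 : ∀ u, F u t = (Complex.exp (Complex.I * ((t - 2 * Real.pi * ξ : ℝ) : ℂ) * u) *
      ((y : ℂ) + Complex.I * u) ^ (-a)) * gammaKer c y t := fun u => by simp only [hF]; ring
    simp only [h1]
    rw [integral_mul_const, ← mul_assoc, integral_exp_mul_add_I_mul_cpow ha hy]
    ring
  rw [← e2, ← hswap, e1]
  ring

theorem fourier_hKer_eq_integral_Ioi {a c : ℂ} (ha : 1 < a.re) (hc : 1 < c.re) {y ξ : ℝ}
    (hy : 0 < y) (hξ : 0 ≤ ξ) :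
    Complex.Gamma c * Complex.Gamma a * 𝓕 (hKer c a y) ξ =
      2 * Real.pi * (Complex.exp (-(y * (2 * Real.pi * ξ : ℝ))) * ∫ r in Ioi (0 : ℝ),
        (Real.exp (-(2 * y * r)) : ℂ) * (r : ℂ) ^ (a - 1) *
          ((2 * Real.pi * ξ + r : ℝ) : ℂ) ^ (c - 1)) := by
  have hX : 0 ≤ 2 * Real.pi * ξ := by positivity
  rw [fourier_hKer_eq_integral ha hc hy, ← integral_add_right_eq_self _ (2 * Real.pi * ξ)]
  simp only [add_sub_cancel_right]
  simp_rw [mul_comm (gammaKer a y _)]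
  rw [integral_mul_gammaKer ha]
  congr 1
  rw [← integral_const_mul]
  refine setIntegral_congr_fun measurableSet_Ioi fun r hr => ?_
  have hr' : (0 : ℝ) < r := hr
  have hpos : 0 < r + 2 * Real.pi * ξ := by linarith
  rw [gammaKer_of_pos _ _ hpos, add_comm r]
  have : Complex.exp (-(y * (2 * Real.pi * ξ + r : ℝ))) * Complex.exp (-(y * r)) =
      Complex.exp (-(y * (2 * Real.pi * ξ : ℝ))) * (Real.exp (-(2 * y * r)) : ℂ) := by
    push_cast
    rw [← Complex.exp_add, ← Complex.exp_add]
    congr 1; ring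
  linear_combination ((2 * Real.pi * ξ + r : ℝ) : ℂ) ^ (c - 1) * (r : ℂ) ^ (a - 1) * this

/-- The scaling r = 2πξ t normalises the shift to 1 and produces Tricomi's integral at 4πyξ, the
Whittaker argument for ξ = n. -/
theorem fourier_hKer_pos_aux {a c : ℂ} (ha : 1 < a.re) (hc : 1 < c.re) {y ξ : ℝ} (hy : 0 < y)
    (hξ : 0 < ξ) :
    Complex.Gamma c * Complex.Gamma a * 𝓕 (hKer c a y) ξ =
      2 * Real.pi * Complex.exp (-(y * (2 * Real.pi * ξ : ℝ))) *
        ((2 * Real.pi * ξ : ℝ) : ℂ) ^ (a + c - 1) *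
          tricomiInt (a - 1) (c - 1) (2 * y * (2 * Real.pi * ξ)) := by
  rw [fourier_hKer_eq_integral_Ioi ha hc hy hξ.le]
  set X : ℝ := 2 * Real.pi * ξ with hX
  have hX0 : 0 < X := by positivity
  have hXC : (X : ℂ) ≠ 0 := by exact_mod_cast hX0.ne'
  have h := integral_comp_mul_left_Ioi' (fun r : ℝ => (Real.exp (-(2 * y * r)) : ℂ) *
    (r : ℂ) ^ (a - 1) * ((X + r : ℝ) : ℂ) ^ (c - 1)) 0 hX0
  rw [mul_zero] at h
  rw [← h, Complex.real_smul]
  have h2 : ∫ t in Ioi (0 : ℝ), (Real.exp (-(2 * y * (X * t))) : ℂ) * ((X * t : ℝ) : ℂ) ^ (a - 1) *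
      ((X + X * t : ℝ) : ℂ) ^ (c - 1) =
      (X : ℂ) ^ (a - 1) * (X : ℂ) ^ (c - 1) * tricomiInt (a - 1) (c - 1) (2 * y * X) := by
    unfold tricomiInt
    rw [← integral_const_mul]
    refine setIntegral_congr_fun measurableSet_Ioi fun t ht => ?_
    have ht' : (0 : ℝ) < t := ht
    have e1 : ((X * t : ℝ) : ℂ) ^ (a - 1) = (X : ℂ) ^ (a - 1) * (t : ℂ) ^ (a - 1) := by
      rw [Complex.ofReal_mul, Complex.mul_cpow_ofReal_nonneg hX0.le ht'.le]
    have e2 : ((X + X * t : ℝ) : ℂ) ^ (c - 1) =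
        (X : ℂ) ^ (c - 1) * ((1 + t : ℝ) : ℂ) ^ (c - 1) := by
      rw [show X + X * t = X * (1 + t) by ring, Complex.ofReal_mul,
        Complex.mul_cpow_ofReal_nonneg hX0.le (by linarith)]
    simp only [tricomiFun]
    rw [e1, e2, show -(2 * y * (X * t)) = -(2 * y * X) * t by ring]
    ring
  rw [h2, show a + c - 1 = (a - 1) + (c - 1) + 1 by ring, Complex.cpow_add _ _ hXC,
    Complex.cpow_add _ _ hXC, Complex.cpow_one]
  ring

theorem fourier_hKer_zero_aux {a c : ℂ} (ha : 1 < a.re) (hc : 1 < c.re) {y : ℝ} (hy : 0 < y) :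
    Complex.Gamma c * Complex.Gamma a * 𝓕 (hKer c a y) 0 =
      2 * Real.pi * (Complex.Gamma (a + c - 1) * ((2 * y : ℝ) : ℂ) ^ (1 - (a + c))) := by
  rw [fourier_hKer_eq_integral_Ioi ha hc hy le_rfl]
  have := integral_cpow_mul_exp_neg (c := a + c - 1) (r := ((2 * y : ℝ) : ℂ))
    (by simp; linarith) (by rw [Complex.ofReal_re]; positivity)
  rw [neg_sub] at this
  rw [← this]
  simp only [mul_zero, zero_add, Complex.ofReal_zero, neg_zero, Complex.exp_zero, one_mul]
  congr 1
  refine setIntegral_congr_fun measurableSet_Ioi fun r hr => ?_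
  have hr0 : (r : ℂ) ≠ 0 := by exact_mod_cast (ne_of_gt hr)
  rw [show a + c - 1 - 1 = (a - 1) + (c - 1) by ring, Complex.cpow_add _ _ hr0]
  push_cast
  ring

end PlusPoincare

end

noncomputable section

namespace PlusPoincare

open MeasureTheory Set Filter
open scoped FourierTransform

/-! ### Evaluation of the Fourier transform through Tricomi's function -/

theorem differentiable_fourier_hKer_left {b : ℂ} (hb : 1 < b.re) {y : ℝ} (hy : 0 < y) (ξ : ℝ) :
    Differentiable ℂ fun a => 𝓕 (hKer (b - a) a y) ξ := fun a =>
  differentiableAt_fourier_hKer (α := fun a => b - a) (β := fun a => a) (by fun_prop) (by fun_prop)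
    hy ξ (by simpa using hb)

/-- The strip 1 < Re a < Re b - 1 is an open neighbourhood of b/2 because Re b > 2, so the identity
theorem applies. With b fixed the transform of h is entire in a: its integrability depends only on
Re b. -/
theorem eq_of_eq_on_strip {f g : ℂ → ℂ} (hf : Differentiable ℂ f) (hg : Differentiable ℂ g) {b : ℂ}
    (hb : 2 < b.re) (h : ∀ a : ℂ, 1 < a.re → 1 < (b - a).re → f a = g a) : f = g := by
  have hf' : AnalyticOnNhd ℂ f univ := hf.differentiableOn.analyticOnNhd isOpen_univ
  have hg' : AnalyticOnNhd ℂ g univ := hg.differentiableOn.analyticOnNhd isOpen_univ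
  refine hf'.eq_of_eventuallyEq hg' (z₀ := b / 2) ?_
  have hU : IsOpen {a : ℂ | 1 < a.re ∧ 1 < (b - a).re} :=
    (isOpen_lt continuous_const Complex.continuous_re).inter
      (isOpen_lt continuous_const (Complex.continuous_re.comp (by fun_prop)))
  have hmem : b / 2 ∈ {a : ℂ | 1 < a.re ∧ 1 < (b - a).re} := by
    have h1 : (b / 2).re = b.re / 2 := by simp
    constructor
    · rw [h1]; linarith
    · rw [Complex.sub_re, h1]; linarith
  filter_upwards [hU.mem_nhds hmem] with a ha using h a ha.1 ha.2

theorem fourier_hKer_generic {b : ℂ} (hb : 2 < b.re) (hbi : ¬ ∃ n : ℤ, b = n) (a : ℂ) {y ξ : ℝ}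
    (hy : 0 < y) (hξ : 0 < ξ) :
    𝓕 (hKer (b - a) a y) ξ = 2 * Real.pi * Complex.exp (-(y * (2 * Real.pi * ξ : ℝ))) *
      ((2 * Real.pi * ξ : ℝ) : ℂ) ^ (b - 1) * (Complex.Gamma (b - a))⁻¹ *
        kummerUGeneric a b (2 * y * (2 * Real.pi * ξ) : ℝ) := by
  have hx : 0 < 2 * y * (2 * Real.pi * ξ) := by positivity
  refine congrFun (eq_of_eq_on_strip (differentiable_fourier_hKer_left (by linarith) hy ξ) ?_ hb
    (f := fun a => 𝓕 (hKer (b - a) a y) ξ)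
    (g := fun a => 2 * Real.pi * Complex.exp (-(y * (2 * Real.pi * ξ : ℝ))) *
      ((2 * Real.pi * ξ : ℝ) : ℂ) ^ (b - 1) * (Complex.Gamma (b - a))⁻¹ *
        kummerUGeneric a b (2 * y * (2 * Real.pi * ξ) : ℝ)) fun a ha hba => ?_) a
  · have h1 : Differentiable ℂ fun a => (Complex.Gamma (b - a))⁻¹ :=
      Complex.differentiable_one_div_Gamma.comp (by fun_prop)
    exact (h1.const_mul _).mul (differentiable_kummerUGeneric_left hbi)
  · have h1 := fourier_hKer_pos_aux ha hba hy hξ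
    rw [show b - a - 1 = b - a - 1 from rfl, tricomiInt_eq (by linarith) hbi hx,
      add_sub_cancel] at h1
    have h2 : Complex.Gamma a ≠ 0 := Complex.Gamma_ne_zero_of_re_pos (by linarith)
    have h3 : Complex.Gamma (b - a) ≠ 0 := Complex.Gamma_ne_zero_of_re_pos (by linarith)
    apply mul_left_cancel₀ (mul_ne_zero h3 h2)
    rw [h1]
    field_simp

theorem fourier_hKer_zero {b : ℂ} (hb : 2 < b.re) (a : ℂ) {y : ℝ} (hy : 0 < y) :
    𝓕 (hKer (b - a) a y) 0 = 2 * Real.pi * Complex.Gamma (b - 1) * ((2 * y : ℝ) : ℂ) ^ (1 - b) *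
      (Complex.Gamma (b - a))⁻¹ * (Complex.Gamma a)⁻¹ := by
  refine congrFun (eq_of_eq_on_strip (differentiable_fourier_hKer_left (by linarith) hy 0) ?_ hb
    (f := fun a => 𝓕 (hKer (b - a) a y) 0)
    (g := fun a => 2 * Real.pi * Complex.Gamma (b - 1) * ((2 * y : ℝ) : ℂ) ^ (1 - b) *
      (Complex.Gamma (b - a))⁻¹ * (Complex.Gamma a)⁻¹) fun a ha hba => ?_) a
  · have h1 : Differentiable ℂ fun a => (Complex.Gamma (b - a))⁻¹ :=
      Complex.differentiable_one_div_Gamma.comp (by fun_prop)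
    exact (h1.const_mul _).mul Complex.differentiable_one_div_Gamma
  · have h1 := fourier_hKer_zero_aux ha hba hy
    rw [add_sub_cancel] at h1
    have h2 : Complex.Gamma a ≠ 0 := Complex.Gamma_ne_zero_of_re_pos (by linarith)
    have h3 : Complex.Gamma (b - a) ≠ 0 := Complex.Gamma_ne_zero_of_re_pos (by linarith)
    apply mul_left_cancel₀ (mul_ne_zero h3 h2)
    rw [h1]
    field_simp

theorem eventually_not_int (b : ℂ) : ∀ᶠ b' : ℂ in 𝓝[≠] b, ¬ ∃ n : ℤ, b' = n := by
  by_cases hb : ∃ n : ℤ, b = n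
  · obtain ⟨n, rfl⟩ := hb
    have h1 : ∀ᶠ b' in 𝓝[≠] (n : ℂ), b' ∈ Metric.ball (n : ℂ) 1 :=
      nhdsWithin_le_nhds (Metric.ball_mem_nhds _ one_pos)
    filter_upwards [h1, self_mem_nhdsWithin] with b' hb' hne
    rintro ⟨m, rfl⟩
    apply hne
    have h2 : ‖((m - n : ℤ) : ℂ)‖ < 1 := by simpa [dist_eq_norm] using hb'
    rw [Complex.norm_intCast] at h2
    have h3 : |m - n| < 1 := by exact_mod_cast h2
    have : m = n := by
      have := Int.abs_lt_one_iff.mp h3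
      omega
    simp [this]
  · exact nhdsWithin_le_nhds (isOpen_not_int.mem_nhds hb)

/-- For integral b, U is a limit in b of the generic expression. The transform is continuous in b,
so dividing the generic formula by 1/Γ(b - a) shows that this limit exists and identifies it. Only
this division requires b - a not to be a pole of Γ. -/
theorem fourier_hKer_pos {b : ℂ} (hb : 2 < b.re) {a : ℂ}
    (hab : (∃ n : ℤ, b = n) → ∀ m : ℕ, b - a ≠ -m) {y ξ : ℝ} (hy : 0 < y) (hξ : 0 < ξ) :
    𝓕 (hKer (b - a) a y) ξ = 2 * Real.pi * Complex.exp (-(y * (2 * Real.pi * ξ : ℝ))) *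
      ((2 * Real.pi * ξ : ℝ) : ℂ) ^ (b - 1) * (Complex.Gamma (b - a))⁻¹ *
        kummerU a b (2 * y * (2 * Real.pi * ξ) : ℝ) := by
  unfold kummerU
  split_ifs with hbi
  swap
  · exact fourier_hKer_generic hb hbi a hy hξ
  have hX : 0 < 2 * Real.pi * ξ := by positivity
  have hX0 : ((2 * Real.pi * ξ : ℝ) : ℂ) ≠ 0 := by exact_mod_cast hX.ne'
  have hΓ : Complex.Gamma (b - a) ≠ 0 := Complex.Gamma_ne_zero (hab hbi)
  set e : ℂ := 2 * Real.pi * Complex.exp (-(y * (2 * Real.pi * ξ : ℝ))) with he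
  have he0 : e ≠ 0 := by
    rw [he]
    have := Real.pi_ne_zero
    have h2 := Complex.exp_ne_zero (-(y * (2 * Real.pi * ξ : ℝ)))
    refine mul_ne_zero (mul_ne_zero two_ne_zero (by exact_mod_cast this)) h2
  set G : ℂ → ℂ := fun b' => 𝓕 (hKer (b' - a) a y) ξ * Complex.Gamma (b' - a) /
    (e * ((2 * Real.pi * ξ : ℝ) : ℂ) ^ (b' - 1)) with hG
  have hpow : ∀ c : ℂ, ((2 * Real.pi * ξ : ℝ) : ℂ) ^ c ≠ 0 := fun c => by
    rw [Ne, Complex.cpow_eq_zero_iff]; tauto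
  have hcont : ContinuousAt G b := by
    have h1 : ContinuousAt (fun b' => 𝓕 (hKer (b' - a) a y) ξ) b :=
      (differentiableAt_fourier_hKer (α := fun b => b - a) (β := fun _ => a) (by fun_prop)
        (by fun_prop) hy ξ (by simp; linarith)).continuousAt
    have h2 : ContinuousAt (fun b' => Complex.Gamma (b' - a)) b :=
      ((Complex.differentiableAt_Gamma _ (hab hbi)).comp b (by fun_prop)).continuousAt
    have h3 : ContinuousAt (fun b' => ((2 * Real.pi * ξ : ℝ) : ℂ) ^ (b' - 1)) b :=
      (DifferentiableAt.const_cpow (by fun_prop) (Or.inl hX0)).continuousAt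
    exact (h1.mul h2).div (h3.const_mul e) (mul_ne_zero he0 (hpow _))
  have hU : ∀ᶠ b' in 𝓝 b, 2 < b'.re :=
    (isOpen_lt continuous_const Complex.continuous_re).mem_nhds hb
  have hΓ' : ∀ᶠ b' in 𝓝 b, Complex.Gamma (b' - a) ≠ 0 := by
    have h2 : ContinuousAt (fun b' => Complex.Gamma (b' - a)) b :=
      ((Complex.differentiableAt_Gamma _ (hab hbi)).comp b (by fun_prop)).continuousAt
    exact h2.eventually_ne hΓ
  have hlim : Tendsto (fun b' => kummerUGeneric a b' (2 * y * (2 * Real.pi * ξ) : ℝ)) (𝓝[≠] b)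
      (𝓝 (G b)) := by
    refine (hcont.tendsto.mono_left nhdsWithin_le_nhds).congr' ?_
    filter_upwards [eventually_not_int b, nhdsWithin_le_nhds hU, nhdsWithin_le_nhds hΓ']
      with b' h1 h2 h3
    simp only [hG]
    rw [fourier_hKer_generic h2 h1 a hy hξ, ← he]
    have := hpow (b' - 1)
    field_simp
  have hl : limUnder (𝓝[≠] b) (fun b' => kummerUGeneric a b' (2 * y * (2 * Real.pi * ξ) : ℝ)) = G b :=
    hlim.limUnder_eq
  rw [hl]
  have := hpow (b - 1)
  simp only [hG]
  field_simp

/-! ### Derivatives of the kernel -/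

theorem hasDerivAt_sub_I_mul_cpow {y : ℝ} (hy : 0 < y) (α : ℂ) (u : ℝ) :
    HasDerivAt (fun u : ℝ => ((y : ℂ) - Complex.I * u) ^ (-α))
      (Complex.I * α * ((y : ℂ) - Complex.I * u) ^ (-(α + 1))) u := by
  have h1 : HasDerivAt (fun z : ℂ => ((y : ℂ) - Complex.I * z) ^ (-α))
      (-α * ((y : ℂ) - Complex.I * u) ^ (-α - 1) * -Complex.I) (u : ℂ) := by
    refine HasDerivAt.cpow_const ?_ (Or.inl (by rw [re_sub_I_mul]; exact hy))
    simpa using ((hasDerivAt_id (u : ℂ)).const_mul Complex.I).const_sub (y : ℂ)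
  convert! h1.comp_ofReal using 1
  rw [neg_add']
  ring

theorem hasDerivAt_add_I_mul_cpow {y : ℝ} (hy : 0 < y) (α : ℂ) (u : ℝ) :
    HasDerivAt (fun u : ℝ => ((y : ℂ) + Complex.I * u) ^ (-α))
      (-Complex.I * α * ((y : ℂ) + Complex.I * u) ^ (-(α + 1))) u := by
  have h1 : HasDerivAt (fun z : ℂ => ((y : ℂ) + Complex.I * z) ^ (-α))
      (-α * ((y : ℂ) + Complex.I * u) ^ (-α - 1) * Complex.I) (u : ℂ) := by
    refine HasDerivAt.cpow_const ?_ (Or.inl (by rw [re_add_I_mul]; exact hy))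
    simpa using ((hasDerivAt_id (u : ℂ)).const_mul Complex.I).const_add (y : ℂ)
  convert! h1.comp_ofReal using 1
  rw [neg_add']
  ring

/-- The derivative stays in the family with α raised by 1, so the induction runs over all α at once.
-/
theorem contDiff_of_hasDerivAt_family {f : ℂ → ℝ → ℂ} {c : ℂ → ℂ}
    (h : ∀ α u, HasDerivAt (f α) (c α * f (α + 1) u) u) (n : ℕ) (α : ℂ) : ContDiff ℝ n (f α) := by
  induction n generalizing α with
  | zero => exact contDiff_zero.mpr (continuous_iff_continuousAt.mpr fun u => (h α u).continuousAt)
  | succ n ih =>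
    have hd : deriv (f α) = fun u => c α * f (α + 1) u := funext fun u => (h α u).deriv
    have := contDiff_succ_iff_deriv (𝕜 := ℝ) (n := n) (f := f α)
    push_cast
    rw [this]
    refine ⟨fun u => (h α u).differentiableAt, by simp, ?_⟩
    rw [hd]
    exact (ih (α + 1)).const_smul (c α)

theorem iteratedDeriv_of_hasDerivAt_family {f : ℂ → ℝ → ℂ} {κ : ℂ}
    (h : ∀ α u, HasDerivAt (f α) (κ * α * f (α + 1) u) u) (n : ℕ) (α : ℂ) :
    iteratedDeriv n (f α) = fun u => κ ^ n * poch α n * f (α + n) u := by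
  induction n with
  | zero => simp
  | succ n ih =>
    rw [iteratedDeriv_succ, ih]
    funext u
    rw [((h (α + n) u).const_mul (κ ^ n * poch α n)).deriv, poch_succ, pow_succ]
    rw [show α + n + 1 = α + ((n + 1 : ℕ) : ℂ) by push_cast; ring]
    ring

theorem contDiff_hKer {y : ℝ} (hy : 0 < y) (α β : ℂ) (n : ℕ) : ContDiff ℝ n (hKer α β y) :=
  (contDiff_of_hasDerivAt_family (f := fun α (u : ℝ) => ((y : ℂ) - Complex.I * u) ^ (-α))
    (fun α u => hasDerivAt_sub_I_mul_cpow hy α u) n α).mul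
  (contDiff_of_hasDerivAt_family (f := fun α (u : ℝ) => ((y : ℂ) + Complex.I * u) ^ (-α))
    (fun α u => hasDerivAt_add_I_mul_cpow hy α u) n β)

theorem iteratedDeriv_hKer {y : ℝ} (hy : 0 < y) (α β : ℂ) (j : ℕ) (u : ℝ) :
    iteratedDeriv j (hKer α β y) u = ∑ i ∈ Finset.range (j + 1), (j.choose i : ℂ) *
      (Complex.I ^ i * poch α i * ((y : ℂ) - Complex.I * u) ^ (-(α + i))) *
      ((-Complex.I) ^ (j - i) * poch β (j - i) *
        ((y : ℂ) + Complex.I * u) ^ (-(β + (j - i : ℕ)))) := by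
  have h1 := contDiff_of_hasDerivAt_family
    (f := fun α (u : ℝ) => ((y : ℂ) - Complex.I * u) ^ (-α))
    (fun α u => hasDerivAt_sub_I_mul_cpow hy α u) j α
  have h2 := contDiff_of_hasDerivAt_family
    (f := fun α (u : ℝ) => ((y : ℂ) + Complex.I * u) ^ (-α))
    (fun α u => hasDerivAt_add_I_mul_cpow hy α u) j β
  have h3 := iteratedDeriv_mul (n := j) (x := u) h1.contDiffAt h2.contDiffAt
  have h4 : hKer α β y = (fun u : ℝ => ((y : ℂ) - Complex.I * u) ^ (-α)) *
    (fun u : ℝ => ((y : ℂ) + Complex.I * u) ^ (-β)) := rfl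
  rw [h4, h3]
  refine Finset.sum_congr rfl fun i _ => ?_
  rw [congrFun (iteratedDeriv_of_hasDerivAt_family
      (f := fun α (u : ℝ) => ((y : ℂ) - Complex.I * u) ^ (-α))
      (fun α u => hasDerivAt_sub_I_mul_cpow hy α u) i α) u,
    congrFun (iteratedDeriv_of_hasDerivAt_family
      (f := fun α (u : ℝ) => ((y : ℂ) + Complex.I * u) ^ (-α))
      (fun α u => hasDerivAt_add_I_mul_cpow hy α u) (j - i) β) u]

theorem cpow_neg_add_natCast {z : ℂ} (hz : z ≠ 0) (α : ℂ) (i : ℕ) :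
    z ^ (-(α + i)) = z ^ (-α) * (z⁻¹) ^ i := by
  rw [neg_add, Complex.cpow_add _ _ hz, Complex.cpow_neg, Complex.cpow_neg, Complex.cpow_natCast,
    inv_pow]

theorem natCast_add_one_le_two_pow (j : ℕ) : ((j : ℝ) + 1) ≤ 2 ^ j := by
  have := Nat.lt_two_pow_self (n := j)
  exact_mod_cast this

/-- In the Leibniz sum the binomial coefficient times i! l! is j!, each additional factor (y ∓
iu)^(-1) is at most 1/y in size, and there are j + 1 ≤ 2^j terms. The explicit j! matters: it is
cancelled later by the denominators j! (b)_j. -/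
theorem norm_iteratedDeriv_hKer_le {α β : ℂ} {y R : ℝ} (hy : 0 < y) (hα : ‖α‖ + 1 ≤ R)
    (hβ : ‖β‖ + 1 ≤ R) (j : ℕ) (u : ℝ) :
    ‖iteratedDeriv j (hKer α β y) u‖ ≤ (2 * R / y) ^ j * j.factorial * ‖hKer α β y u‖ := by
  have hR : 0 ≤ R := by linarith [norm_nonneg α]
  have hw : y ≤ ‖(y : ℂ) + Complex.I * u‖ := le_norm_add_I_mul y u
  have hwp : 0 < ‖(y : ℂ) + Complex.I * u‖ := by linarith
  rw [iteratedDeriv_hKer hy]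
  have hterm : ∀ i ∈ Finset.range (j + 1), ‖(j.choose i : ℂ) *
      (Complex.I ^ i * poch α i * ((y : ℂ) - Complex.I * u) ^ (-(α + i))) *
      ((-Complex.I) ^ (j - i) * poch β (j - i) *
        ((y : ℂ) + Complex.I * u) ^ (-(β + (j - i : ℕ))))‖ ≤
      (R / y) ^ j * j.factorial * ‖hKer α β y u‖ := by
    intro i hi
    have hij : i ≤ j := Nat.lt_succ_iff.mp (Finset.mem_range.mp hi)
    obtain ⟨l, rfl⟩ := Nat.exists_eq_add_of_le hij
    rw [Nat.add_sub_cancel_left, cpow_neg_add_natCast (sub_I_mul_ne_zero hy u),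
      cpow_neg_add_natCast (add_I_mul_ne_zero hy u)]
    have h1 : ‖poch α i‖ ≤ R ^ i * i.factorial :=
      (norm_poch_le le_rfl i).trans (by gcongr)
    have h2 : ‖poch β l‖ ≤ R ^ l * l.factorial :=
      (norm_poch_le le_rfl l).trans (by gcongr)
    have h3 : ‖((y : ℂ) - Complex.I * u)⁻¹‖ ≤ 1 / y := by
      rw [norm_inv, norm_sub_I_mul, ← one_div]; gcongr
    have h4 : ‖((y : ℂ) + Complex.I * u)⁻¹‖ ≤ 1 / y := by
      rw [norm_inv, ← one_div]; gcongr
    have h5 : (((i + l).choose i : ℕ) : ℝ) * i.factorial * l.factorial = (i + l).factorial := by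
      rw [Nat.choose_symm_add]; exact_mod_cast Nat.add_choose_mul_factorial_mul_factorial i l
    rw [norm_mul, norm_mul, norm_mul, norm_mul, norm_mul, norm_mul, norm_mul, norm_mul, norm_pow,
      norm_pow, norm_pow, norm_pow, norm_neg, Complex.norm_I, one_pow, one_pow, one_mul, one_mul,
      Complex.norm_natCast]
    calc _ ≤ (((i + l).choose i : ℕ) : ℝ) * ((R ^ i * i.factorial) *
          (‖((y : ℂ) - Complex.I * u) ^ (-α)‖ * (1 / y) ^ i)) *
          ((R ^ l * l.factorial) * (‖((y : ℂ) + Complex.I * u) ^ (-β)‖ * (1 / y) ^ l)) := by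
          gcongr
      _ = (R / y) ^ (i + l) * ((((i + l).choose i : ℕ) : ℝ) * i.factorial * l.factorial) *
          ‖hKer α β y u‖ := by
          rw [hKer, norm_mul, div_eq_mul_one_div R y, mul_pow, pow_add, pow_add]
          ring
      _ = _ := by rw [h5]
  calc _ ≤ ∑ i ∈ Finset.range (j + 1), (R / y) ^ j * j.factorial * ‖hKer α β y u‖ :=
        (norm_sum_le _ _).trans (Finset.sum_le_sum hterm)
    _ = ((j : ℝ) + 1) * ((R / y) ^ j * j.factorial * ‖hKer α β y u‖) := by
        rw [Finset.sum_const, Finset.card_range, nsmul_eq_mul]; push_cast; ring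
    _ ≤ 2 ^ j * ((R / y) ^ j * j.factorial * ‖hKer α β y u‖) := by
        have := natCast_add_one_le_two_pow j
        gcongr
    _ = _ := by rw [mul_div_assoc, mul_pow]; ring

theorem integrable_iteratedDeriv_hKer {α β : ℂ} {y : ℝ} (hy : 0 < y) (h : 1 < (α + β).re) (j : ℕ) :
    Integrable (iteratedDeriv j (hKer α β y)) := by
  have h1 : Integrable fun u => (2 * (max ‖α‖ ‖β‖ + 1) / y) ^ j * j.factorial * ‖hKer α β y u‖ :=
    (integrable_hKer hy h).norm.const_mul _
  refine h1.mono' ?_ (Eventually.of_forall fun u => norm_iteratedDeriv_hKer_le hy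
    (by gcongr; exact le_max_left _ _) (by gcongr; exact le_max_right _ _) j u)
  exact ((contDiff_hKer hy α β j).continuous_iteratedDeriv j le_rfl).aestronglyMeasurable

theorem fourier_iteratedDeriv_hKer {α β : ℂ} {y : ℝ} (hy : 0 < y) (h : 1 < (α + β).re) (j : ℕ)
    (ξ : ℝ) : 𝓕 (iteratedDeriv j (hKer α β y)) ξ =
      (2 * Real.pi * Complex.I * ξ) ^ j * 𝓕 (hKer α β y) ξ := by
  have := Real.fourier_iteratedDeriv (N := (j : ℕ∞)) (n := j) (contDiff_hKer hy α β j)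
    (fun n _ => integrable_iteratedDeriv_hKer hy h n) le_rfl
  rw [congrFun this ξ, smul_eq_mul]

theorem norm_fourier_le (f : ℝ → ℂ) (ξ : ℝ) : ‖𝓕 f ξ‖ ≤ ∫ u, ‖f u‖ :=
  VectorFourier.norm_fourierIntegral_le_integral_norm _ _ _ _ _

/-- Decay of the transform from the L¹ norm of the j-th derivative, with the dependence on j kept
explicit so that the bound can be summed over j. -/
theorem norm_pow_mul_fourier_hKer_le {α β : ℂ} {y R : ℝ} (hy : 0 < y) (h : 1 < (α + β).re)
    (hα : ‖α‖ + 1 ≤ R) (hβ : ‖β‖ + 1 ≤ R) (j : ℕ) (ξ : ℝ) :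
    (2 * Real.pi * |ξ|) ^ j * ‖𝓕 (hKer α β y) ξ‖ ≤
      (2 * R / y) ^ j * j.factorial * ∫ u, ‖hKer α β y u‖ := by
  have h1 : ‖(2 * Real.pi * Complex.I * ξ) ^ j * 𝓕 (hKer α β y) ξ‖ =
      (2 * Real.pi * |ξ|) ^ j * ‖𝓕 (hKer α β y) ξ‖ := by
    rw [norm_mul, norm_pow]
    congr 2
    simp [abs_of_pos Real.pi_pos]
  rw [← h1, ← fourier_iteratedDeriv_hKer hy h, ← integral_const_mul]
  refine (norm_fourier_le _ ξ).trans (integral_mono (integrable_iteratedDeriv_hKer hy h j).norm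
    ((integrable_hKer hy h).norm.const_mul _) fun u => norm_iteratedDeriv_hKer_le hy hα hβ j u)

end PlusPoincare

end

noncomputable section

namespace PlusPoincare

open MeasureTheory Set Filter
open scoped FourierTransform

/-! ### The expansion of `e^p M(β; α + β; q - p)` -/

/-- The polynomial `∑ C(j, i) (α)_i (β)_l p^i q^l` over `i + l = j`. -/
def pochBinom (α β p q : ℂ) (j : ℕ) : ℂ :=
  ∑ x ∈ Finset.HasAntidiagonal.antidiagonal j, (j.choose x.1 : ℂ) * (poch α x.1 * p ^ x.1 * (poch β x.2 * q ^ x.2))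

theorem pochBinom_comm (α β p q : ℂ) (j : ℕ) : pochBinom α β p q j = pochBinom β α q p j := by
  unfold pochBinom
  rw [← Finset.Nat.sum_antidiagonal_swap]
  refine Finset.sum_congr rfl fun x hx => ?_
  have hx' := Finset.HasAntidiagonal.mem_antidiagonal.mp hx
  simp only [Prod.fst_swap, Prod.snd_swap]
  rw [Nat.choose_symm_of_eq_add (by omega : j = x.2 + x.1)]
  ring

theorem sum_antidiagonal_choose_snd (j : ℕ) (f : ℕ → ℕ → ℂ) :
    ∑ x ∈ Finset.HasAntidiagonal.antidiagonal j, (j.choose x.2 : ℂ) * f x.1 x.2 =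
      ∑ x ∈ Finset.HasAntidiagonal.antidiagonal j, (j.choose x.1 : ℂ) * f x.1 x.2 := by
  refine Finset.sum_congr rfl fun x hx => ?_
  have hx' := Finset.HasAntidiagonal.mem_antidiagonal.mp hx
  rw [Nat.choose_symm_of_eq_add (by omega : j = x.2 + x.1)]

theorem pochBinom_succ (α β p q : ℂ) (j : ℕ) :
    pochBinom α β p q (j + 1) =
      q * (β * pochBinom α (β + 1) p q j) + p * (α * pochBinom (α + 1) β p q j) := by
  unfold pochBinom
  rw [Finset.sum_antidiagonal_choose_succ_mul
    (fun i l => poch α i * p ^ i * (poch β l * q ^ l)),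
    sum_antidiagonal_choose_snd j (fun i l => poch α (i + 1) * p ^ (i + 1) * (poch β l * q ^ l))]
  simp only [Finset.mul_sum, poch_succ_left, pow_succ]
  congr 1 <;> refine Finset.sum_congr rfl fun x _ => by ring

/-- In each term i + l = j, so the factor α + β + j splits as (α + i) + (β + l), and each summand
raises one Pochhammer symbol. -/
theorem mul_pochBinom (α β p q : ℂ) (j : ℕ) :
    (α + β + j) * pochBinom α β p q j =
      β * pochBinom α (β + 1) p q j + α * pochBinom (α + 1) β p q j := by
  unfold pochBinom
  simp only [Finset.mul_sum, ← Finset.sum_add_distrib]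
  refine Finset.sum_congr rfl fun x hx => ?_
  have hx' : ((x.1 : ℂ) + x.2) = j := by exact_mod_cast Finset.HasAntidiagonal.mem_antidiagonal.mp hx
  have h1 : β * poch (β + 1) x.2 = poch β x.2 * (β + x.2) := by
    rw [← poch_succ_left, poch_succ]
  have h2 : α * poch (α + 1) x.1 = poch α x.1 * (α + x.1) := by
    rw [← poch_succ_left, poch_succ]
  rw [← hx']
  linear_combination (-(j.choose x.1 : ℂ) * poch α x.1 * p ^ x.1 * q ^ x.2) * h1 -
    (j.choose x.1 : ℂ) * p ^ x.1 * poch β x.2 * q ^ x.2 * h2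

/-- The sum is the degree-j part of the Cauchy product of e^p and M(β; α + β; q - p), up to j!.
Induction on j with Pascal's rule gives p times the old sum plus (q - p)β/(α + β) times the sum with
β raised. `mul_pochBinom` rewrites the first of these so that the total becomes the recurrence
`pochBinom_succ`. -/
theorem poch_mul_sum_eq_pochBinom (p q : ℂ) (j : ℕ) (α β : ℂ) (hb : ∀ i : ℕ, α + β + i ≠ 0) :
    poch (α + β) j * ∑ x ∈ Finset.HasAntidiagonal.antidiagonal j,
        (j.choose x.1 : ℂ) * (poch β x.1 / poch (α + β) x.1 * (q - p) ^ x.1 * p ^ x.2) =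
      pochBinom α β p q j := by
  induction j generalizing α β with
  | zero => simp [pochBinom]
  | succ j ih =>
    have hb0 : α + β ≠ 0 := by simpa using hb 0
    have hb' : ∀ i : ℕ, α + (β + 1) + i ≠ 0 := fun i => by
      have := hb (i + 1); push_cast at this; convert this using 1; ring
    rw [Finset.sum_antidiagonal_choose_succ_mul
      (fun i l => poch β i / poch (α + β) i * (q - p) ^ i * p ^ l),
      sum_antidiagonal_choose_snd j
        (fun i l => poch β (i + 1) / poch (α + β) (i + 1) * (q - p) ^ (i + 1) * p ^ l)]
    have e1 : ∑ x ∈ Finset.HasAntidiagonal.antidiagonal j, (j.choose x.1 : ℂ) *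
        (poch β x.1 / poch (α + β) x.1 * (q - p) ^ x.1 * p ^ (x.2 + 1)) =
        p * ∑ x ∈ Finset.HasAntidiagonal.antidiagonal j, (j.choose x.1 : ℂ) *
        (poch β x.1 / poch (α + β) x.1 * (q - p) ^ x.1 * p ^ x.2) := by
      rw [Finset.mul_sum]
      exact Finset.sum_congr rfl fun x _ => by ring
    have e2 : ∑ x ∈ Finset.HasAntidiagonal.antidiagonal j, (j.choose x.1 : ℂ) *
        (poch β (x.1 + 1) / poch (α + β) (x.1 + 1) * (q - p) ^ (x.1 + 1) * p ^ x.2) =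
        (q - p) * (β / (α + β)) * ∑ x ∈ Finset.HasAntidiagonal.antidiagonal j, (j.choose x.1 : ℂ) *
        (poch (β + 1) x.1 / poch (α + (β + 1)) x.1 * (q - p) ^ x.1 * p ^ x.2) := by
      rw [Finset.mul_sum]
      refine Finset.sum_congr rfl fun x _ => ?_
      have := poch_ne_zero hb' x.1
      rw [poch_succ_left, poch_succ_left, ← add_assoc] at *
      field_simp
      ring
    have i1 := ih α β hb
    have i2 := ih α (β + 1) hb'
    rw [e1, e2, pochBinom_succ, mul_add]
    have s1 := poch_succ (α + β) j
    have s2 : poch (α + β) (j + 1) = (α + β) * poch (α + (β + 1)) j := by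
      rw [poch_succ_left, add_assoc]
    have h3 := mul_pochBinom α β p q j
    set S1 := ∑ x ∈ Finset.HasAntidiagonal.antidiagonal j, (j.choose x.1 : ℂ) *
        (poch β x.1 / poch (α + β) x.1 * (q - p) ^ x.1 * p ^ x.2)
    set S2 := ∑ x ∈ Finset.HasAntidiagonal.antidiagonal j, (j.choose x.1 : ℂ) *
        (poch (β + 1) x.1 / poch (α + (β + 1)) x.1 * (q - p) ^ x.1 * p ^ x.2)
    have t1 : poch (α + β) (j + 1) * (p * S1) = p * ((α + β + j) * pochBinom α β p q j) := by
      rw [s1, ← i1]; ring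
    have t2 : poch (α + β) (j + 1) * ((q - p) * (β / (α + β)) * S2) =
        (q - p) * β * pochBinom α (β + 1) p q j := by
      rw [s2, ← i2]; field_simp
    rw [t1, t2, h3]; ring

theorem hasSum_pochBinom (p q : ℂ) {α β : ℂ} (hb : ∀ i : ℕ, α + β + i ≠ 0) :
    HasSum (fun j : ℕ => pochBinom α β p q j / (j.factorial * poch (α + β) j))
      (Complex.exp p * kummerM β (α + β) (q - p)) := by
  have h1 : Summable fun n : ℕ => ‖p ^ n / (n.factorial : ℂ)‖ :=
    NormedSpace.norm_expSeries_div_summable p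
  have h2 : Summable fun n : ℕ => ‖poch β n / poch (α + β) n / n.factorial * (q - p) ^ n‖ :=
    summable_kummer β (q - p) hb
  have hexp : Complex.exp p = ∑' n : ℕ, p ^ n / (n.factorial : ℂ) := by
    rw [Complex.exp_eq_exp_ℂ, NormedSpace.exp_eq_tsum_div]
  have hterm : ∀ j : ℕ, pochBinom α β p q j / (j.factorial * poch (α + β) j) =
      ∑ x ∈ Finset.HasAntidiagonal.antidiagonal j, poch β x.1 / poch (α + β) x.1 / x.1.factorial * (q - p) ^ x.1 *
        (p ^ x.2 / (x.2.factorial : ℂ)) := by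
    intro j
    rw [← poch_mul_sum_eq_pochBinom p q j α β hb]
    have hne := poch_ne_zero hb j
    have hf : (j.factorial : ℂ) ≠ 0 := by exact_mod_cast j.factorial_ne_zero
    rw [mul_comm (j.factorial : ℂ), mul_div_mul_left _ _ hne, Finset.sum_div]
    refine Finset.sum_congr rfl fun x hx => ?_
    have hx' := Finset.HasAntidiagonal.mem_antidiagonal.mp hx
    have hc := Nat.add_choose_mul_factorial_mul_factorial x.1 x.2
    rw [hx', ← Nat.choose_symm_of_eq_add hx'.symm] at hc
    have hc' : (j.choose x.1 : ℂ) * x.1.factorial * x.2.factorial = j.factorial := by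
      exact_mod_cast hc
    have f1 : (x.1.factorial : ℂ) ≠ 0 := by exact_mod_cast x.1.factorial_ne_zero
    have f2 : (x.2.factorial : ℂ) ≠ 0 := by exact_mod_cast x.2.factorial_ne_zero
    have hn1 := poch_ne_zero hb x.1
    rw [← hc']
    have f3 : (j.choose x.1 : ℂ) ≠ 0 := by
      intro h; rw [h] at hc'; apply hf; rw [← hc']; ring
    field_simp
  have hs := summable_norm_sum_mul_antidiagonal_of_summable_norm h2 h1
  have ht := tsum_mul_tsum_eq_tsum_sum_antidiagonal_of_summable_norm h2 h1
  rw [funext hterm, hexp, kummerM_eq, mul_comm, ht]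
  exact hs.of_norm.hasSum

/-- Kummer's transformation: the expanding polynomials are symmetric under exchanging (α, p) with
(β, q). It lets one kernel serve both signs of m. -/
theorem exp_mul_kummerM_symm (p q : ℂ) {α β : ℂ} (hb : ∀ i : ℕ, α + β + i ≠ 0) :
    Complex.exp p * kummerM β (α + β) (q - p) = Complex.exp q * kummerM α (α + β) (p - q) := by
  have h1 := hasSum_pochBinom p q hb
  have h2 := hasSum_pochBinom q p (α := β) (β := α) (by simpa [add_comm] using hb)
  rw [add_comm β α] at h2
  simp only [pochBinom_comm β α q p] at h2
  exact h1.unique h2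

end PlusPoincare
end

noncomputable section

namespace PlusPoincare

open MeasureTheory Set Filter
open scoped FourierTransform

/-! ### The kernel of the Poincaré series and its Fourier transform -/

/-- `∑ X^j / (j! (b)_j)`. -/
def hypF01 (b X : ℂ) : ℂ := ∑' j : ℕ, X ^ j / (j.factorial * poch b j)

/-- The confluent kernel `H(u) e^p M(β; α + β; q - p)` with `p = iA / (y - iu)`,
`q = -iA / (y + iu)`. -/
def confKer (A α β : ℂ) (y u : ℝ) : ℂ :=
  hKer α β y u * (Complex.exp (A * Complex.I / ((y : ℂ) - Complex.I * u)) *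
    kummerM β (α + β) (-(A * Complex.I) / ((y : ℂ) + Complex.I * u) -
      A * Complex.I / ((y : ℂ) - Complex.I * u)))

theorem pochBinom_mul (A α β p q : ℂ) (j : ℕ) :
    pochBinom α β (A * p) (A * q) j = A ^ j * pochBinom α β p q j := by
  unfold pochBinom
  rw [Finset.mul_sum]
  refine Finset.sum_congr rfl fun x hx => ?_
  have hx' := Finset.HasAntidiagonal.mem_antidiagonal.mp hx
  rw [← hx', mul_pow, mul_pow, pow_add]
  ring

/-- Differentiating the two factors of h brings out powers of i/(y - iu) and -i/(y + iu). These are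
p/A and q/A in the confluent kernel, which is why the Taylor coefficients in A are derivatives of h.
-/
theorem iteratedDeriv_hKer_eq_pochBinom {y : ℝ} (hy : 0 < y) (α β : ℂ) (j : ℕ) (u : ℝ) :
    iteratedDeriv j (hKer α β y) u = hKer α β y u *
      pochBinom α β (Complex.I / ((y : ℂ) - Complex.I * u))
        (-Complex.I / ((y : ℂ) + Complex.I * u)) j := by
  rw [iteratedDeriv_hKer hy, pochBinom, Finset.mul_sum,
    Finset.Nat.sum_antidiagonal_eq_sum_range_succ_mk]
  refine Finset.sum_congr rfl fun i _ => ?_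
  rw [cpow_neg_add_natCast (sub_I_mul_ne_zero hy u), cpow_neg_add_natCast (add_I_mul_ne_zero hy u)]
  simp only [hKer, div_eq_mul_inv, mul_pow]
  ring

theorem factorial_le_norm_poch {b : ℂ} (hb : 1 ≤ b.re) (j : ℕ) :
    (j.factorial : ℝ) ≤ ‖poch b j‖ := by
  have := le_norm_poch (b := b) (δ := 1) one_pos (fun i => ?_) j
  · simpa using this
  · rw [one_mul]
    refine le_trans ?_ (Complex.abs_re_le_norm _)
    rw [Complex.add_re, Complex.natCast_re]
    exact le_trans (by linarith) (le_abs_self _)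

theorem norm_pow_div_factorial_mul_poch_le {b : ℂ} (hb : 1 ≤ b.re) (X : ℂ) (j : ℕ) :
    ‖X ^ j / (j.factorial * poch b j)‖ ≤ ‖X‖ ^ j / ((j.factorial : ℝ) * j.factorial) := by
  rw [norm_div, norm_mul, norm_pow, Complex.norm_natCast]
  have := factorial_le_norm_poch hb j
  gcongr

theorem summable_pow_div_factorial_mul_factorial (x : ℝ) :
    Summable fun j : ℕ => |x| ^ j / ((j.factorial : ℝ) * j.factorial) := by
  refine Summable.of_nonneg_of_le (fun j => by positivity) (fun j => ?_)
    (Real.summable_pow_div_factorial |x|)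
  have : (1 : ℝ) ≤ j.factorial := by exact_mod_cast j.factorial_pos
  gcongr
  nlinarith

theorem hasSum_confKer {y : ℝ} (hy : 0 < y) {α β : ℂ} (hb : 1 ≤ (α + β).re) (A : ℂ) (u : ℝ) :
    HasSum (fun j : ℕ => A ^ j / (j.factorial * poch (α + β) j) * iteratedDeriv j (hKer α β y) u)
      (confKer A α β y u) := by
  have h := (hasSum_pochBinom (A * (Complex.I / ((y : ℂ) - Complex.I * u)))
    (A * (-Complex.I / ((y : ℂ) + Complex.I * u)))
    (fun j => add_natCast_ne_zero_of_re_pos (by linarith) j : ∀ j : ℕ, α + β + j ≠ 0)).mul_left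
    (hKer α β y u)
  have e : confKer A α β y u = hKer α β y u *
      (Complex.exp (A * (Complex.I / ((y : ℂ) - Complex.I * u))) *
      kummerM β (α + β) (A * (-Complex.I / ((y : ℂ) + Complex.I * u)) -
        A * (Complex.I / ((y : ℂ) - Complex.I * u)))) := by
    rw [confKer]
    congr 3 <;> ring_nf
  rw [e]
  have e' : (fun j : ℕ => A ^ j / (j.factorial * poch (α + β) j) *
      iteratedDeriv j (hKer α β y) u) = fun j : ℕ => hKer α β y u *
      (pochBinom α β (A * (Complex.I / ((y : ℂ) - Complex.I * u)))
        (A * (-Complex.I / ((y : ℂ) + Complex.I * u))) j / (j.factorial * poch (α + β) j)) := by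
    ext j
    rw [iteratedDeriv_hKer_eq_pochBinom hy, pochBinom_mul]
    ring
  rw [e']
  exact h

theorem continuous_kummerM (a : ℂ) {b : ℂ} (hb : ∀ j : ℕ, b + j ≠ 0) :
    Continuous (kummerM a b) :=
  continuous_iff_continuousAt.mpr fun x => (hasDerivAt_kummerM a x hb).continuousAt

theorem continuous_confKer {y : ℝ} (hy : 0 < y) {α β : ℂ} (hb : 1 ≤ (α + β).re) (A : ℂ) :
    Continuous (confKer A α β y) := by
  have h1 : Continuous fun u : ℝ => A * Complex.I / ((y : ℂ) - Complex.I * u) :=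
    Continuous.div (by fun_prop) (by fun_prop) (sub_I_mul_ne_zero hy)
  have h2 : Continuous fun u : ℝ => -(A * Complex.I) / ((y : ℂ) + Complex.I * u) :=
    Continuous.div (by fun_prop) (by fun_prop) (add_I_mul_ne_zero hy)
  exact (continuous_hKer hy α β).mul ((Complex.continuous_exp.comp h1).mul
    ((continuous_kummerM β (fun j => add_natCast_ne_zero_of_re_pos (by linarith) j)).comp
      (h2.sub h1)))

theorem norm_confKer_term_le {y : ℝ} (hy : 0 < y) {α β : ℂ} (hb : 1 ≤ (α + β).re) {R : ℝ}
    (hα : ‖α‖ + 1 ≤ R) (hβ : ‖β‖ + 1 ≤ R) (A : ℂ) (j : ℕ) (u : ℝ) :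
    ‖A ^ j / (j.factorial * poch (α + β) j) * iteratedDeriv j (hKer α β y) u‖ ≤
      (‖A‖ * (2 * R / y)) ^ j / j.factorial * ‖hKer α β y u‖ := by
  have hR : 0 ≤ R := by linarith [norm_nonneg α]
  rw [norm_mul]
  calc _ ≤ ‖A‖ ^ j / ((j.factorial : ℝ) * j.factorial) *
        ((2 * R / y) ^ j * j.factorial * ‖hKer α β y u‖) :=
        mul_le_mul (norm_pow_div_factorial_mul_poch_le hb A j)
          (norm_iteratedDeriv_hKer_le hy hα hβ j u) (norm_nonneg _) (by positivity)
    _ = _ := by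
        have : (j.factorial : ℝ) ≠ 0 := by exact_mod_cast j.factorial_ne_zero
        rw [mul_pow]; field_simp

theorem norm_confKer_le {y : ℝ} (hy : 0 < y) {α β : ℂ} (hb : 1 ≤ (α + β).re) {R : ℝ}
    (hα : ‖α‖ + 1 ≤ R) (hβ : ‖β‖ + 1 ≤ R) (A : ℂ) (u : ℝ) :
    ‖confKer A α β y u‖ ≤ Real.exp (‖A‖ * (2 * R / y)) * ‖hKer α β y u‖ := by
  rw [← (hasSum_confKer hy hb A u).tsum_eq]
  have h := (NormedSpace.expSeries_div_hasSum_exp (‖A‖ * (2 * R / y))).mul_right ‖hKer α β y u‖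
  rw [← Real.exp_eq_exp_ℝ] at h
  exact tsum_of_norm_bounded h fun j => norm_confKer_term_le hy hb hα hβ A j u

/-- Each derivative of h contributes a factor 2πiξ, so the series over j collapses to a ₀F₁ in
2πiAξ. Termwise integration is dominated: the j! in the bound for h^(j) cancels against |(α + β)_j|
≥ j!, leaving an exponential series times the integrable |h|. -/
theorem fourier_confKer {y : ℝ} (hy : 0 < y) {α β : ℂ} (hb : 1 < (α + β).re) (A : ℂ) (ξ : ℝ) :
    𝓕 (confKer A α β y) ξ =
      hypF01 (α + β) (2 * Real.pi * Complex.I * A * ξ) * 𝓕 (hKer α β y) ξ := by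
  set R := ‖α‖ + ‖β‖ + 1 with hR
  have hα : ‖α‖ + 1 ≤ R := by linarith [norm_nonneg β]
  have hβ : ‖β‖ + 1 ≤ R := by linarith [norm_nonneg α]
  have key : HasSum (fun j : ℕ => ∫ u : ℝ, Complex.exp (↑(-2 * Real.pi * u * ξ) * Complex.I) •
      (A ^ j / (j.factorial * poch (α + β) j) * iteratedDeriv j (hKer α β y) u))
      (∫ u : ℝ, Complex.exp (↑(-2 * Real.pi * u * ξ) * Complex.I) • confKer A α β y u) := by
    have hns : ∀ (u : ℝ) (w : ℂ),
        ‖Complex.exp (↑(-2 * Real.pi * u * ξ) * Complex.I) • w‖ = ‖w‖ := fun u w => by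
      rw [norm_smul, Complex.norm_exp_ofReal_mul_I, one_mul]
    have hcont : Continuous fun u : ℝ => Complex.exp (↑(-2 * Real.pi * u * ξ) * Complex.I) := by
      fun_prop
    have hF : ∀ j : ℕ, Continuous fun u : ℝ =>
        Complex.exp (↑(-2 * Real.pi * u * ξ) * Complex.I) •
        (A ^ j / (j.factorial * poch (α + β) j) * iteratedDeriv j (hKer α β y) u) := fun j =>
      hcont.smul (continuous_const.mul
        ((contDiff_hKer hy α β j).continuous_iteratedDeriv j le_rfl))
    refine hasSum_integral_of_dominated_convergence
      (fun j u => (‖A‖ * (2 * R / y)) ^ j / j.factorial * ‖hKer α β y u‖)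
      (fun j => (hF j).aestronglyMeasurable)
      (fun j => ae_of_all _ fun u => ?_) (ae_of_all _ fun u => ?_) ?_ (ae_of_all _ fun u => ?_)
    · rw [hns]; exact norm_confKer_term_le hy hb.le hα hβ A j u
    · exact (Real.summable_pow_div_factorial _).mul_right _
    · simp_rw [tsum_mul_right]
      exact (integrable_hKer hy hb).norm.const_mul _
    · exact (hasSum_confKer hy hb.le A u).const_smul _
  rw [Real.fourier_real_eq_integral_exp_smul, ← key.tsum_eq, hypF01, ← tsum_mul_right]
  refine tsum_congr fun j => ?_
  have h2 := fourier_iteratedDeriv_hKer hy hb j ξ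
  rw [Real.fourier_real_eq_integral_exp_smul] at h2
  have : ∀ u : ℝ, Complex.exp (↑(-2 * Real.pi * u * ξ) * Complex.I) •
      (A ^ j / (j.factorial * poch (α + β) j) * iteratedDeriv j (hKer α β y) u) =
      (A ^ j / (j.factorial * poch (α + β) j)) *
      (Complex.exp (↑(-2 * Real.pi * u * ξ) * Complex.I) • iteratedDeriv j (hKer α β y) u) :=
    fun u => by simp only [smul_eq_mul]; ring
  simp_rw [this]
  rw [integral_const_mul, h2]
  simp only [mul_pow]
  ring

theorem norm_hypF01_le {b : ℂ} (hb : 1 ≤ b.re) {X : ℂ} {x : ℝ} (hX : ‖X‖ ≤ x) :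
    ‖hypF01 b X‖ ≤ ∑' j : ℕ, x ^ j / ((j.factorial : ℝ) * j.factorial) := by
  have hx : 0 ≤ x := (norm_nonneg _).trans hX
  have h := summable_pow_div_factorial_mul_factorial x
  rw [abs_of_nonneg hx] at h
  refine tsum_of_norm_bounded h.hasSum fun j => ?_
  refine (norm_pow_div_factorial_mul_poch_le hb X j).trans ?_
  gcongr

end PlusPoincare
end

noncomputable section

namespace PlusPoincare

open MeasureTheory Set Filter
open scoped FourierTransform

/-! ### The terms of the Poincaré series in terms of the confluent kernel -/

/-- The term of the Poincaré series with bottom row `(C, D)` and `u = x + D / C`, without its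
arithmetic factor. -/
def rowKer (m lam : ℤ) (s : ℂ) (C y u : ℝ) : ℂ :=
  (((C : ℂ) * (u + y * Complex.I)) ^ (1 / 2 : ℂ)) ^ (-(2 * lam + 1)) *
    calM m (wt lam) (y / (C ^ 2 * (u ^ 2 + y ^ 2))) s *
      expI (-(m * (u / (C ^ 2 * (u ^ 2 + y ^ 2)) : ℝ)))

/-- The constant by which `𝓜_{m,k}(y, s)` is normalised. -/
def mConst (m lam : ℤ) (s : ℂ) : ℂ :=
  if m = 0 then 1 else
    (Complex.Gamma (2 * s))⁻¹ * ((4 * Real.pi * |(m : ℝ)| : ℝ) : ℂ) ^ (s - wt lam / 2)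

/-- The powers in front combine to v^(s - k/2). For m = 0 the exponential and Kummer's function are
both 1, so no separate case is needed afterwards. -/
theorem calM_eq (m lam : ℤ) (s : ℂ) {v : ℝ} (hv : 0 < v) :
    calM m (wt lam) v s = mConst m lam s * (v : ℂ) ^ (s - wt lam / 2) *
      (Complex.exp (-((4 * Real.pi * |(m : ℝ)| * v : ℝ) : ℂ) / 2) *
        kummerM (s - wt lam / 2 * (m.sign : ℂ)) (2 * s) ((4 * Real.pi * |(m : ℝ)| * v : ℝ) : ℂ)) := by
  unfold calM mConst
  split_ifs with h
  · subst h; simp [kummerM_zero]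
  · have hm : 0 < 4 * Real.pi * |(m : ℝ)| := by
      have : 0 < |(m : ℝ)| := by simpa using h
      positivity
    have hX : ((4 * Real.pi * |(m : ℝ)| * v : ℝ) : ℂ) ≠ 0 := by
      exact_mod_cast (mul_pos hm hv).ne'
    rw [whittakerM]
    have e1 : s - 1 / 2 + 1 / 2 = s := by ring
    have e2 : s - 1 / 2 - wt lam / 2 * (m.sign : ℂ) + 1 / 2 = s - wt lam / 2 * (m.sign : ℂ) := by ring
    have e3 : 1 + 2 * (s - 1 / 2) = 2 * s := by ring
    rw [e1, e2, e3]
    have e4 : ((4 * Real.pi * |(m : ℝ)| * v : ℝ) : ℂ) ^ (-wt lam / 2) *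
        ((4 * Real.pi * |(m : ℝ)| * v : ℝ) : ℂ) ^ s =
        ((4 * Real.pi * |(m : ℝ)| : ℝ) : ℂ) ^ (s - wt lam / 2) * (v : ℂ) ^ (s - wt lam / 2) := by
      rw [← Complex.cpow_add _ _ hX, ← Complex.mul_cpow_ofReal_nonneg hm.le hv.le,
        ← Complex.ofReal_mul]
      congr 1; ring
    linear_combination ((Complex.Gamma (2 * s))⁻¹ *
      (Complex.exp (-((4 * Real.pi * |(m : ℝ)| * v : ℝ) : ℂ) / 2) *
        kummerM (s - wt lam / 2 * (m.sign : ℂ)) (2 * s)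
          ((4 * Real.pi * |(m : ℝ)| * v : ℝ) : ℂ))) * e4

theorem I_mul_cpow_of_re_pos {w : ℂ} (hw : 0 < w.re) (c : ℂ) :
    (Complex.I * w) ^ c = Complex.I ^ c * w ^ c := by
  have h0 : w ≠ 0 := by rintro rfl; simp at hw
  have ha := Complex.abs_arg_lt_pi_div_two_iff.mpr (Or.inl hw)
  rw [abs_lt] at ha
  have hl : Complex.log (Complex.I * w) = Complex.log Complex.I + Complex.log w := by
    rw [Complex.log_mul_eq_add_log_iff Complex.I_ne_zero h0, Complex.arg_I]
    constructor <;> linarith [Real.pi_pos]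
  rw [Complex.cpow_def_of_ne_zero (mul_ne_zero Complex.I_ne_zero h0), hl, add_mul, Complex.exp_add,
    ← Complex.cpow_def_of_ne_zero Complex.I_ne_zero, ← Complex.cpow_def_of_ne_zero h0]

theorem ofReal_mul_cpow {r : ℝ} (hr : 0 < r) {w : ℂ} (hw : w ≠ 0) (c : ℂ) :
    ((r : ℂ) * w) ^ c = (r : ℂ) ^ c * w ^ c := by
  have hr' : (r : ℂ) ≠ 0 := by exact_mod_cast hr.ne'
  rw [Complex.cpow_def_of_ne_zero (mul_ne_zero hr' hw), Complex.log_ofReal_mul hr hw, add_mul,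
    Complex.exp_add, Complex.cpow_def_of_ne_zero hr', Complex.cpow_def_of_ne_zero hw,
    Complex.ofReal_log hr.le]

theorem sub_I_mul_mul_add_I_mul (y u : ℝ) :
    ((y : ℂ) - Complex.I * u) * ((y : ℂ) + Complex.I * u) = ((u ^ 2 + y ^ 2 : ℝ) : ℂ) := by
  push_cast
  linear_combination (-(u : ℂ) ^ 2) * Complex.I_sq

/-- Both factors lie in the right half-plane, so their arguments add without leaving the principal
range. -/
theorem ofReal_add_sq_cpow {y : ℝ} (hy : 0 < y) (u : ℝ) (c : ℂ) :
    ((u ^ 2 + y ^ 2 : ℝ) : ℂ) ^ c =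
      ((y : ℂ) - Complex.I * u) ^ c * ((y : ℂ) + Complex.I * u) ^ c := by
  have h1 := sub_I_mul_ne_zero hy u
  have h2 := add_I_mul_ne_zero hy u
  have a1 := Complex.abs_arg_lt_pi_div_two_iff.mpr
    (Or.inl (by simpa using hy : 0 < ((y : ℂ) - Complex.I * u).re))
  have a2 := Complex.abs_arg_lt_pi_div_two_iff.mpr
    (Or.inl (by simpa using hy : 0 < ((y : ℂ) + Complex.I * u).re))
  rw [abs_lt] at a1 a2
  have hl : Complex.log (((y : ℂ) - Complex.I * u) * ((y : ℂ) + Complex.I * u)) =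
      Complex.log ((y : ℂ) - Complex.I * u) + Complex.log ((y : ℂ) + Complex.I * u) := by
    rw [Complex.log_mul_eq_add_log_iff h1 h2]
    constructor <;> linarith [Real.pi_pos]
  rw [← sub_I_mul_mul_add_I_mul, Complex.cpow_def_of_ne_zero (mul_ne_zero h1 h2), hl, add_mul,
    Complex.exp_add, ← Complex.cpow_def_of_ne_zero h1, ← Complex.cpow_def_of_ne_zero h2]

/-- Since u + iy = i(y - iu) and u² + y² = (y - iu)(y + iu), the automorphy factor adds k to the
exponent of only one of the two conjugate factors. Hence the asymmetric exponents s ± k/2 and the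
constant i^(-k). -/
theorem rowKer_prefactor (lam : ℤ) (s : ℂ) {C y : ℝ} (hC : 0 < C) (hy : 0 < y) (u : ℝ) :
    (((C : ℂ) * (u + y * Complex.I)) ^ (1 / 2 : ℂ)) ^ (-(2 * lam + 1)) *
      ((y / (C ^ 2 * (u ^ 2 + y ^ 2)) : ℝ) : ℂ) ^ (s - wt lam / 2) =
    (y : ℂ) ^ (s - wt lam / 2) * (C : ℂ) ^ (-(2 * s)) * Complex.I ^ (-wt lam) *
      hKer (s + wt lam / 2) (s - wt lam / 2) y u := by
  have hP := sub_I_mul_ne_zero hy u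
  have hCc : (C : ℂ) ≠ 0 := by exact_mod_cast hC.ne'
  have hn : 0 < u ^ 2 + y ^ 2 := by positivity
  have hw : (u : ℂ) + y * Complex.I = Complex.I * ((y : ℂ) - Complex.I * u) := by
    linear_combination (u : ℂ) * Complex.I_sq
  have e1 : (((C : ℂ) * (u + y * Complex.I)) ^ (1 / 2 : ℂ)) ^ (-(2 * lam + 1)) =
      (C : ℂ) ^ (-wt lam) * (Complex.I ^ (-wt lam) * ((y : ℂ) - Complex.I * u) ^ (-wt lam)) := by
    rw [← Complex.cpow_mul_int, hw, ofReal_mul_cpow hC (mul_ne_zero Complex.I_ne_zero hP),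
      I_mul_cpow_of_re_pos (by simpa using hy)]
    have : (1 / 2 : ℂ) * ((-(2 * lam + 1) : ℤ) : ℂ) = -wt lam := by
      unfold wt; push_cast; ring
    rw [this]
  have e2 : ((y / (C ^ 2 * (u ^ 2 + y ^ 2)) : ℝ) : ℂ) ^ (s - wt lam / 2) =
      (y : ℂ) ^ (s - wt lam / 2) * ((C : ℂ) ^ (-(s - wt lam / 2)) * (C : ℂ) ^ (-(s - wt lam / 2)) *
        ((u ^ 2 + y ^ 2 : ℝ) : ℂ) ^ (-(s - wt lam / 2))) := by
    rw [div_eq_mul_inv, Complex.ofReal_mul, Complex.mul_cpow_ofReal_nonneg hy.le (by positivity),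
      Complex.ofReal_inv, Complex.inv_cpow _ _ (by
        rw [Complex.arg_ofReal_of_nonneg (by positivity)]; exact Real.pi_pos.ne),
      ← Complex.cpow_neg, Complex.ofReal_mul, Complex.mul_cpow_ofReal_nonneg (by positivity) hn.le,
      pow_two C, Complex.ofReal_mul, Complex.mul_cpow_ofReal_nonneg hC.le hC.le]
  rw [e1, e2, ofReal_add_sq_cpow hy, hKer]
  have e3 : (C : ℂ) ^ (-wt lam) * ((C : ℂ) ^ (-(s - wt lam / 2)) * (C : ℂ) ^ (-(s - wt lam / 2))) =
      (C : ℂ) ^ (-(2 * s)) := by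
    rw [← Complex.cpow_add _ _ hCc, ← Complex.cpow_add _ _ hCc]
    congr 1; ring
  have e4 : ((y : ℂ) - Complex.I * u) ^ (-wt lam) * ((y : ℂ) - Complex.I * u) ^ (-(s - wt lam / 2)) =
      ((y : ℂ) - Complex.I * u) ^ (-(s + wt lam / 2)) := by
    rw [← Complex.cpow_add _ _ hP]
    congr 1; ring
  rw [← e3, ← e4]
  ring

/-- With v the imaginary part of the image point, p and q are ∓2πmv plus a common imaginary part, so
q - p = 4πmv and e^p splits into e^(-2πmv) and the oscillating factor. For m > 0 this is the
Whittaker expression; for m < 0 it becomes one after Kummer's transformation. -/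
theorem rowKer_eq (m lam : ℤ) {s : ℂ} (hs : 0 < s.re) {C y : ℝ} (hC : 0 < C) (hy : 0 < y) (u : ℝ) :
    rowKer m lam s C y u = mConst m lam s * (y : ℂ) ^ (s - wt lam / 2) * (C : ℂ) ^ (-(2 * s)) *
      Complex.I ^ (-wt lam) *
      confKer (2 * Real.pi * Complex.I * m / (C : ℂ) ^ 2) (s + wt lam / 2) (s - wt lam / 2) y u := by
  have hn : 0 < u ^ 2 + y ^ 2 := by positivity
  have hP := sub_I_mul_ne_zero hy u
  have hQ := add_I_mul_ne_zero hy u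
  have hCc : (C : ℂ) ≠ 0 := by exact_mod_cast hC.ne'
  set v : ℝ := y / (C ^ 2 * (u ^ 2 + y ^ 2)) with hv
  have hv0 : 0 < v := by positivity
  set p : ℂ := 2 * Real.pi * Complex.I * m / (C : ℂ) ^ 2 * Complex.I / ((y : ℂ) - Complex.I * u)
    with hp
  set q : ℂ := -(2 * Real.pi * Complex.I * m / (C : ℂ) ^ 2 * Complex.I) /
    ((y : ℂ) + Complex.I * u) with hq
  have hPQ := sub_I_mul_mul_add_I_mul y u
  have hnc : ((u ^ 2 + y ^ 2 : ℝ) : ℂ) ≠ 0 := by exact_mod_cast hn.ne'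
  have iP : ((y : ℂ) - Complex.I * u)⁻¹ = ((y : ℂ) + Complex.I * u) / ((u ^ 2 + y ^ 2 : ℝ) : ℂ) := by
    rw [← hPQ]; field_simp
  have iQ : ((y : ℂ) + Complex.I * u)⁻¹ = ((y : ℂ) - Complex.I * u) / ((u ^ 2 + y ^ 2 : ℝ) : ℂ) := by
    rw [← hPQ]; field_simp
  have hvc : (v : ℂ) = y / ((C : ℂ) ^ 2 * ((u ^ 2 + y ^ 2 : ℝ) : ℂ)) := by
    rw [hv]; push_cast; ring
  have hp' : p = -(2 * Real.pi * m * v) + 2 * Real.pi * Complex.I *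
      (-(m * (u / (C ^ 2 * (u ^ 2 + y ^ 2)) : ℝ))) := by
    rw [hp, div_eq_mul_inv _ ((y : ℂ) - Complex.I * u), iP, hvc]
    push_cast at hnc ⊢
    field_simp
    linear_combination (m : ℂ) * ((y : ℂ) + Complex.I * u) * Complex.I_sq
  have hq' : q = 2 * Real.pi * m * v + 2 * Real.pi * Complex.I *
      (-(m * (u / (C ^ 2 * (u ^ 2 + y ^ 2)) : ℝ))) := by
    rw [hq, div_eq_mul_inv _ ((y : ℂ) + Complex.I * u), iQ, hvc]
    push_cast at hnc ⊢
    field_simp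
    linear_combination (-(m : ℂ) * ((y : ℂ) - Complex.I * u)) * Complex.I_sq
  have hb : ∀ i : ℕ, s + wt lam / 2 + (s - wt lam / 2) + i ≠ 0 := fun i =>
    add_natCast_ne_zero_of_re_pos (by
      rw [show s + wt lam / 2 + (s - wt lam / 2) = 2 * s by ring]
      simpa using hs) i
  have hb2 : s + wt lam / 2 + (s - wt lam / 2) = 2 * s := by ring
  have key : Complex.exp (-((4 * Real.pi * |(m : ℝ)| * v : ℝ) : ℂ) / 2) *
        kummerM (s - wt lam / 2 * (m.sign : ℂ)) (2 * s) ((4 * Real.pi * |(m : ℝ)| * v : ℝ) : ℂ) *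
      expI (-(m * (u / (C ^ 2 * (u ^ 2 + y ^ 2)) : ℝ))) =
      Complex.exp p * kummerM (s - wt lam / 2) (2 * s) (q - p) := by
    rcases lt_trichotomy m 0 with h | h | h
    · have hsymm := exp_mul_kummerM_symm p q hb
      rw [hb2] at hsymm
      have habs : |(m : ℝ)| = -m := abs_of_neg (by exact_mod_cast h)
      rw [hsymm, habs, Int.sign_eq_neg_one_of_neg h, expI, mul_right_comm, ← Complex.exp_add]
      congr 2
      · rw [hq']; push_cast; ring
      · push_cast; ring
      · rw [hq', hp']; push_cast; ring
    · subst h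
      simp [hp', hq', kummerM_zero, expI]
    · have habs : |(m : ℝ)| = m := abs_of_pos (by exact_mod_cast h)
      rw [habs, Int.sign_eq_one_of_pos h, expI, mul_right_comm, ← Complex.exp_add]
      congr 2
      · rw [hp']; push_cast; ring
      · push_cast; ring
      · rw [hq', hp']; push_cast; ring
  have hpre := rowKer_prefactor lam s hC hy u
  rw [← hv] at hpre
  rw [rowKer, ← hv, calM_eq m lam s hv0, confKer, ← hp, ← hq, hb2, ← key]
  linear_combination (mConst m lam s *
    (Complex.exp (-((4 * Real.pi * |(m : ℝ)| * v : ℝ) : ℂ) / 2) *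
        kummerM (s - wt lam / 2 * (m.sign : ℂ)) (2 * s) ((4 * Real.pi * |(m : ℝ)| * v : ℝ) : ℂ)) *
      expI (-(m * (u / (C ^ 2 * (u ^ 2 + y ^ 2)) : ℝ)))) * hpre

end PlusPoincare
end

noncomputable section

namespace PlusPoincare

/-! ### Properties of the extended quadratic residue symbol -/

/-- The sign of `D`, with the value `1` at `0`. -/
def sgnNonneg (D : ℤ) : ℤ := if D < 0 then -1 else 1

/-- For positive D, 4D ≡ 1 modulo the lower entry and 4 is a square. For negative D the lower entry
is 3 mod 4, so -1 contributes the sign. -/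
theorem jacobiSym_four_mul_sub_one (D : ℤ) (hD : D ≠ 0) :
    jacobiSym D (4 * D.natAbs - 1) = sgnNonneg D := by
  have hM : 0 < D.natAbs := Int.natAbs_pos.mpr hD
  have hodd : Odd (4 * D.natAbs - 1) := by rw [Nat.odd_iff]; omega
  have hpos : jacobiSym (D.natAbs : ℤ) (4 * D.natAbs - 1) = 1 := by
    have h1 : jacobiSym (4 * (D.natAbs : ℤ)) (4 * D.natAbs - 1) = 1 := by
      rw [jacobiSym.mod_left' (a₂ := 1), jacobiSym.one_left]
      have : (4 * (D.natAbs : ℤ)) = 1 + ((4 * D.natAbs - 1 : ℕ) : ℤ) := by omega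
      rw [this, Int.add_emod_right]
    rw [jacobiSym.mul_left, jacobiSym.at_four hodd, one_mul] at h1
    exact h1
  unfold sgnNonneg
  split_ifs with h
  · have hD' : D = -(D.natAbs : ℤ) := by omega
    nth_rw 1 [hD']
    rw [jacobiSym.neg _ hodd, hpos, ZMod.χ₄_nat_three_mod_four (by omega)]
    rfl
  · have hD' : D = (D.natAbs : ℤ) := by omega
    nth_rw 1 [hD']
    exact hpos

/-- Modulo 4|D| the product (4|D| - 1) r is 4|D| - r, and the Jacobi symbol with upper entry D is
periodic modulo 4|D| in odd lower entries. -/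
theorem jacobiSym_four_mul_sub (D : ℤ) {r : ℕ} (hr : Odd r) (h : r < 4 * D.natAbs) :
    jacobiSym D (4 * D.natAbs - r) = sgnNonneg D * jacobiSym D r := by
  have hD : D ≠ 0 := by rintro rfl; simp at h
  have hM : 0 < D.natAbs := Int.natAbs_pos.mpr hD
  have hodd : Odd (4 * D.natAbs - 1) := by rw [Nat.odd_iff]; omega
  have hodd' : Odd (4 * D.natAbs - r) := by rw [Nat.odd_iff] at *; omega
  have hr0 : r ≠ 0 := by rintro rfl; simp at hr
  rw [← jacobiSym_four_mul_sub_one D hD, ← jacobiSym.mul_right' D (by omega) hr0,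
    jacobiSym.mod_right D hodd', jacobiSym.mod_right D (hodd.mul hr)]
  congr 1
  have h2 : (4 * D.natAbs - 1) * r = (4 * D.natAbs - r) + 4 * D.natAbs * (r - 1) := by
    have h1 : 1 ≤ r := by omega
    have h3 : 1 ≤ 4 * D.natAbs := by omega
    zify [h1, h3, h.le]
    ring
  rw [h2, Nat.add_mul_mod_self_left]

/-- The only delicate case is that d changes sign. Then the passage from |d| to 4|D| - |d| costs the
sign of D, which is exactly the sign built into the extended symbol. -/
theorem symb_add_four_mul_natAbs (D d : ℤ) (hd : d % 2 = 1) :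
    symb D (d + 4 * D.natAbs) = symb D d := by
  have key : ∀ a : ℕ, Odd a → jacobiSym D (a + 4 * D.natAbs) = jacobiSym D a := by
    intro a ha
    have ha' : Odd (a + 4 * D.natAbs) := by rw [Nat.odd_iff] at *; omega
    rw [jacobiSym.mod_right D ha', jacobiSym.mod_right D ha, Nat.add_mod_right]
  have hodd : Odd d.natAbs := by rw [Int.natAbs_odd]; exact Int.odd_iff.mpr hd
  have hodd' : Odd (d + 4 * D.natAbs).natAbs := by
    rw [Int.natAbs_odd, Int.odd_iff]; omega
  rcases lt_or_ge d 0 with h | h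
  · rcases lt_or_ge (d + 4 * D.natAbs) 0 with h' | h'
    · have e : d.natAbs = (d + 4 * D.natAbs).natAbs + 4 * D.natAbs := by omega
      unfold symb
      rw [e, key _ hodd']
      simp only [h, h', and_true]
    · have e : (d + 4 * D.natAbs).natAbs = 4 * D.natAbs - d.natAbs := by omega
      have h1 := jacobiSym_four_mul_sub D hodd (by omega)
      unfold symb
      rw [e, h1, sgnNonneg]
      have h'' : ¬ (d + 4 * D.natAbs) < 0 := not_lt.mpr h'
      simp only [h, h'', and_true, and_false, if_false]
      split_ifs <;> ring
  · have e : (d + 4 * D.natAbs).natAbs = d.natAbs + 4 * D.natAbs := by omega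
    have h1 : ¬ d < 0 := not_lt.mpr h
    have h2 : ¬ d + 4 * D.natAbs < 0 := by omega
    unfold symb
    rw [e, key _ hodd]
    simp only [h1, h2, and_false, if_false]

theorem symb_add_four_mul (D d : ℤ) (hd : d % 2 = 1) : symb D (d + 4 * D) = symb D d := by
  rcases le_or_gt 0 D with h | h
  · have := symb_add_four_mul_natAbs D d hd
    rwa [Int.natAbs_of_nonneg h] at this
  · have := symb_add_four_mul_natAbs D (d + 4 * D) (by omega)
    rw [Int.ofNat_natAbs_of_nonpos h.le] at this
    rw [← this]
    congr 1; ring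

theorem symb_add_four_mul_mul (D d : ℤ) (hd : d % 2 = 1) (k : ℤ) :
    symb D (d + 4 * D * k) = symb D d := by
  induction k with
  | zero => simp
  | succ k ih =>
    rw [← ih, ← symb_add_four_mul D (d + 4 * D * k)]
    · congr 1; ring
    · rw [mul_assoc]; omega
  | pred k ih =>
    rw [← ih, ← symb_add_four_mul D (d + 4 * D * (-k - 1))]
    · congr 1; ring
    · rw [mul_assoc]; omega

theorem symb_four_mul (a d : ℤ) (hd : d % 2 = 1) : symb (4 * a) d = symb a d := by
  have hodd : Odd d.natAbs := by rw [Int.natAbs_odd]; exact Int.odd_iff.mpr hd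
  unfold symb
  rw [jacobiSym.mul_left, jacobiSym.at_four hodd, one_mul]
  have : 4 * a < 0 ↔ a < 0 := by omega
  simp only [this]

theorem symb_two_mul (E d : ℤ) (hd : d % 2 = 1) :
    symb (2 * E) d = (if d % 8 = 1 ∨ d % 8 = 7 then 1 else -1) * symb E d := by
  have hodd : Odd d.natAbs := by rw [Int.natAbs_odd]; exact Int.odd_iff.mpr hd
  unfold symb
  rw [jacobiSym.mul_left, jacobiSym.at_two hodd, ZMod.χ₈_nat_eq_if_mod_eight]
  have h1 : 2 * E < 0 ↔ E < 0 := by omega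
  have h2 : ¬ d.natAbs % 2 = 0 := by omega
  have h3 : (d.natAbs % 8 = 1 ∨ d.natAbs % 8 = 7) ↔ (d % 8 = 1 ∨ d % 8 = 7) := by omega
  simp only [h1, h2, h3, if_false]
  split_ifs <;> ring

theorem symb_neg_right (D d : ℤ) (hd : d ≠ 0) : symb D (-d) = sgnNonneg D * symb D d := by
  unfold symb sgnNonneg
  rw [Int.natAbs_neg]
  have : -d < 0 ↔ ¬ d < 0 := by omega
  simp only [this]
  by_cases h1 : D < 0 <;> by_cases h2 : d < 0 <;> simp [h1, h2]

theorem symb_of_pos_left {c : ℤ} (hc : 0 < c) (d : ℤ) : symb c d = jacobiSym c d.natAbs := by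
  unfold symb
  rw [if_neg (by omega)]

theorem symb_of_pos_right (c : ℤ) {d : ℤ} (hd : 0 < d) : symb c d = jacobiSym c d.natAbs := by
  unfold symb
  rw [if_neg (by omega)]

/-- The sign for D, d < 0 in the extended symbol makes reciprocity depend on residues modulo 4
alone: in the four sign cases it compensates the values of χ₄ at |D| and |d|. -/
theorem symb_reciprocity (D d : ℤ) (hD : D % 2 = 1) (hd : d % 2 = 1) :
    symb D d = (if D % 4 = 3 ∧ d % 4 = 3 then -1 else 1) * jacobiSym d D.natAbs := by
  have hDo : Odd D.natAbs := by rw [Int.natAbs_odd]; exact Int.odd_iff.mpr hD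
  have hdo : Odd d.natAbs := by rw [Int.natAbs_odd]; exact Int.odd_iff.mpr hd
  have h0 := jacobiSym.quadratic_reciprocity_if (a := D.natAbs) (b := d.natAbs)
    (Nat.odd_iff.mp hDo) (Nat.odd_iff.mp hdo)
  have n1 := jacobiSym.neg (D.natAbs : ℤ) hdo
  have n2 := jacobiSym.neg (d.natAbs : ℤ) hDo
  rw [ZMod.χ₄_nat_eq_if_mod_four] at n1 n2
  rw [if_neg (by have := Nat.odd_iff.mp hdo; omega)] at n1
  rw [if_neg (by have := Nat.odd_iff.mp hDo; omega)] at n2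
  have hD4 : D % 4 = 1 ∨ D % 4 = 3 := by omega
  have hd4 : d % 4 = 1 ∨ d % 4 = 3 := by omega
  unfold symb
  rcases lt_or_ge D 0 with s1 | s1 <;> rcases lt_or_ge d 0 with s2 | s2
  · have e1 : D = -(D.natAbs : ℤ) := by omega
    have e2 : d = -(d.natAbs : ℤ) := by omega
    rw [← e1] at n1
    rw [← e2] at n2
    rw [n1, n2, ← h0, if_pos ⟨s1, s2⟩]
    rcases hD4 with h1 | h1 <;> rcases hd4 with h2 | h2
    · have a1 : D.natAbs % 4 = 3 := by omega
      have a2 : d.natAbs % 4 = 3 := by omega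
      simp [h1, h2, a1, a2]
    · have a1 : D.natAbs % 4 = 3 := by omega
      have a2 : d.natAbs % 4 = 1 := by omega
      simp [h1, h2, a1, a2]
    · have a1 : D.natAbs % 4 = 1 := by omega
      have a2 : d.natAbs % 4 = 3 := by omega
      simp [h1, h2, a1, a2]
    · have a1 : D.natAbs % 4 = 1 := by omega
      have a2 : d.natAbs % 4 = 1 := by omega
      simp [h1, h2, a1, a2]
  · have e1 : D = -(D.natAbs : ℤ) := by omega
    have e2 : (d.natAbs : ℤ) = d := by omega
    rw [← e1] at n1
    rw [e2] at h0
    rw [n1, ← h0, if_neg (by omega)]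
    rcases hD4 with h1 | h1 <;> rcases hd4 with h2 | h2
    · have a1 : D.natAbs % 4 = 3 := by omega
      have a2 : d.natAbs % 4 = 1 := by omega
      simp [h1, h2, a1, a2]
    · have a1 : D.natAbs % 4 = 3 := by omega
      have a2 : d.natAbs % 4 = 3 := by omega
      simp [h1, h2, a1, a2]
    · have a1 : D.natAbs % 4 = 1 := by omega
      have a2 : d.natAbs % 4 = 1 := by omega
      simp [h1, h2, a1, a2]
    · have a1 : D.natAbs % 4 = 1 := by omega
      have a2 : d.natAbs % 4 = 3 := by omega
      simp [h1, h2, a1, a2]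
  · have e1 : (D.natAbs : ℤ) = D := by omega
    have e2 : d = -(d.natAbs : ℤ) := by omega
    rw [← e2] at n2
    rw [e1] at h0
    rw [n2, ← h0, if_neg (by omega)]
    rcases hD4 with h1 | h1 <;> rcases hd4 with h2 | h2
    · have a1 : D.natAbs % 4 = 1 := by omega
      have a2 : d.natAbs % 4 = 3 := by omega
      simp [h1, h2, a1, a2]
    · have a1 : D.natAbs % 4 = 1 := by omega
      have a2 : d.natAbs % 4 = 1 := by omega
      simp [h1, h2, a1, a2]
    · have a1 : D.natAbs % 4 = 3 := by omega
      have a2 : d.natAbs % 4 = 3 := by omega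
      simp [h1, h2, a1, a2]
    · have a1 : D.natAbs % 4 = 3 := by omega
      have a2 : d.natAbs % 4 = 1 := by omega
      simp [h1, h2, a1, a2]
  · have e1 : (D.natAbs : ℤ) = D := by omega
    have e2 : (d.natAbs : ℤ) = d := by omega
    rw [e1, e2] at h0
    rw [← h0, if_neg (by omega)]
    have a1 : D.natAbs % 4 = 3 ↔ D % 4 = 3 := by omega
    have a2 : d.natAbs % 4 = 3 ↔ d % 4 = 3 := by omega
    simp only [a1, a2]
    split_ifs <;> ring

theorem jacobiSym_add_natAbs_mul (d D k : ℤ) :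
    jacobiSym (d + D * k) D.natAbs = jacobiSym d D.natAbs := by
  refine jacobiSym.mod_left' ?_
  exact Int.ModEq.symm (Int.modEq_iff_dvd.mpr (by
    rw [add_sub_cancel_left]
    exact Dvd.dvd.mul_right (Int.natAbs_dvd.mpr dvd_rfl) k))

/-- After reciprocity the lower entry is |D|, so adding 2D is seen only through d mod 4, which it
changes between 1 and 3. -/
theorem symb_add_two_mul_of_odd (D d : ℤ) (hD : D % 2 = 1) (hd : d % 2 = 1) :
    symb D (d + 2 * D) = (if D % 4 = 3 then -1 else 1) * symb D d := by
  rw [symb_reciprocity D d hD hd, symb_reciprocity D _ hD (by omega), mul_comm 2 D,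
    jacobiSym_add_natAbs_mul]
  have h : (d + D * 2) % 4 = 3 ↔ ¬ d % 4 = 3 := by omega
  simp only [h]
  by_cases h1 : D % 4 = 3 <;> by_cases h2 : d % 4 = 3 <;> simp [h1, h2]

end PlusPoincare
end

noncomputable section

namespace PlusPoincare

/-! ### Theta multipliers of rows -/

/-- The multiplier `(c / d) ε_d⁻¹` of a row. -/
def thetaRow (c d : ℤ) : ℂ := (symb c d : ℂ) * (eps d)⁻¹

/-- The multiplier of the row of `(1 0; ν 1)⁻¹`-translates, as a function of `d` for fixed `D`. -/
def thetaDual (D d : ℤ) : ℂ := ((sgnNonneg D * symb D d : ℤ) : ℂ) * (eps d)⁻¹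

theorem eps_of_one {d : ℤ} (h : d % 4 = 1) : eps d = 1 := if_pos h

theorem eps_of_three {d : ℤ} (h : d % 4 = 3) : eps d = Complex.I := if_neg (by omega)

theorem eps_congr {d d' : ℤ} (h : d % 4 = d' % 4) : eps d = eps d' := by
  unfold eps; rw [h]

theorem sgnNonneg_mul_self (D : ℤ) : sgnNonneg D * sgnNonneg D = 1 := by
  unfold sgnNonneg; split_ifs <;> rfl

theorem thetaDual_add_four_mul_mul (D d : ℤ) (hd : d % 2 = 1) (k : ℤ) :
    thetaDual D (d + 4 * D * k) = thetaDual D d := by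
  unfold thetaDual
  rw [symb_add_four_mul_mul D d hd, eps_congr (d := d + 4 * D * k) (d' := d) (by
    rw [mul_assoc]; omega)]

theorem thetaDual_congr {D d d' : ℤ} (hd : d % 2 = 1) (k : ℤ) (h : d' = d + 4 * D * k) :
    thetaDual D d' = thetaDual D d := by
  rw [h, thetaDual_add_four_mul_mul D d hd]

/-- With h = g - nD and d = D - h one has h ≡ D modulo d, so the upper entry h may be replaced by
the fixed D. Then d matters only modulo 4D. The signs agree because g > 0 and n ≥ 0: h and d are
never both negative, and D < 0 forces d < 0. -/
theorem thetaRow_eq_thetaDual {g D n : ℤ} (hg : 0 < g) (hn : 0 ≤ n)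
    (hd : (D * (1 + n) - g) % 2 = 1) :
    thetaRow (4 * (g - n * D)) (D * (1 + n) - g) = thetaDual D (D * (1 + n) - g) := by
  unfold thetaRow thetaDual
  rw [symb_four_mul _ _ hd]
  congr 2
  have hjac : jacobiSym (g - n * D) (D * (1 + n) - g).natAbs =
      jacobiSym D (D * (1 + n) - g).natAbs := by
    have : g - n * D = D + (D * (1 + n) - g) * (-1) := by ring
    rw [this, jacobiSym_add_natAbs_mul]
  have hneg : ¬ (g - n * D < 0 ∧ D * (1 + n) - g < 0) := by
    rintro ⟨h1, h2⟩
    have : 0 < D := by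
      by_contra hD
      have : n * D ≤ 0 := mul_nonpos_of_nonneg_of_nonpos hn (by omega)
      linarith
    nlinarith
  unfold symb
  rw [if_neg hneg, hjac]
  unfold sgnNonneg
  by_cases hD : D < 0
  · have : D * (1 + n) - g < 0 := by nlinarith
    simp [hD, this]
  · simp [hD]

theorem thetaDual_neg (D g : ℤ) (hg : g ≠ 0) :
    thetaDual D (-g) = (symb D g : ℂ) * (eps (-g))⁻¹ := by
  unfold thetaDual
  rw [symb_neg_right D g hg, ← mul_assoc, sgnNonneg_mul_self, one_mul]

/-- Reciprocity exchanges (D/g) and (g/D); together with the ε-factors this leaves a fourth root of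
unity depending only on gD mod 4. -/
theorem thetaDual_neg_of_odd {g D : ℤ} (hg : 0 < g) (hgo : g % 2 = 1) (hD : D % 2 = 1) :
    thetaDual D (-g) = (if (g * D) % 4 = 1 then -Complex.I else 1) * thetaRow (4 * g) D := by
  rw [thetaDual_neg D g hg.ne', thetaRow, symb_four_mul g D hD, symb_of_pos_left hg,
    symb_reciprocity D g hD hgo]
  have hg4 : g % 4 = 1 ∨ g % 4 = 3 := by omega
  have hD4 : D % 4 = 1 ∨ D % 4 = 3 := by omega
  rcases hg4 with h1 | h1 <;> rcases hD4 with h2 | h2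
  · rw [eps_of_three (d := -g) (by omega), eps_of_one h2]
    have e : (g * D) % 4 = 1 := by rw [Int.mul_emod, h1, h2]; rfl
    simp [e, h1, h2]; ring
  · rw [eps_of_three (d := -g) (by omega), eps_of_three h2]
    have e : (g * D) % 4 = 3 := by rw [Int.mul_emod, h1, h2]; rfl
    simp [e, h1, h2]
  · rw [eps_of_one (d := -g) (by omega), eps_of_one h2]
    have e : (g * D) % 4 = 3 := by rw [Int.mul_emod, h1, h2]; rfl
    simp [e, h1, h2]
  · rw [eps_of_one (d := -g) (by omega), eps_of_three h2]
    have e : (g * D) % 4 = 1 := by rw [Int.mul_emod, h1, h2]; rfl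
    simp only [e, h1, h2]
    norm_num
    linear_combination (-(jacobiSym g D.natAbs : ℂ)) * Complex.I_sq

theorem thetaDual_two_mul_sub_of_odd {g D : ℤ} (hg : 0 < g) (hgo : g % 2 = 1) (hD : D % 2 = 1) :
    thetaDual D (2 * D - g) = (if (g * D) % 4 = 1 then 1 else -Complex.I) * thetaRow (4 * g) D := by
  have key : thetaDual D (2 * D - g) =
      (if (g * D) % 4 = 1 then Complex.I else -Complex.I) * thetaDual D (-g) := by
    have : 2 * D - g = -g + 2 * D := by ring
    unfold thetaDual
    rw [this, symb_add_two_mul_of_odd D (-g) hD (by omega)]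
    have hg4 : g % 4 = 1 ∨ g % 4 = 3 := by omega
    have hD4 : D % 4 = 1 ∨ D % 4 = 3 := by omega
    rcases hg4 with h1 | h1 <;> rcases hD4 with h2 | h2
    · rw [eps_of_three (d := -g) (by omega), eps_of_one (d := -g + 2 * D) (by omega)]
      have e : (g * D) % 4 = 1 := by rw [Int.mul_emod, h1, h2]; rfl
      simp [e, h1, h2]; ring_nf; simp
    · rw [eps_of_three (d := -g) (by omega), eps_of_one (d := -g + 2 * D) (by omega)]
      have e : (g * D) % 4 = 3 := by rw [Int.mul_emod, h1, h2]; rfl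
      simp [e, h1, h2]; ring_nf; simp
    · rw [eps_of_one (d := -g) (by omega), eps_of_three (d := -g + 2 * D) (by omega)]
      have e : (g * D) % 4 = 3 := by rw [Int.mul_emod, h1, h2]; rfl
      simp [e, h1, h2]; ring
    · rw [eps_of_one (d := -g) (by omega), eps_of_three (d := -g + 2 * D) (by omega)]
      have e : (g * D) % 4 = 1 := by rw [Int.mul_emod, h1, h2]; rfl
      simp [e, h1, h2]; ring
  rw [key, thetaDual_neg_of_odd hg hgo hD]
  split_ifs
  · linear_combination (-thetaRow (4 * g) D) * Complex.I_sq
  · ring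

theorem thetaDual_add_mul_of_four_dvd {D d : ℤ} (hD : D % 4 = 0) (hd : d % 2 = 1) (r : ℤ) :
    thetaDual D (d + D * r) = thetaDual D d := by
  obtain ⟨E, rfl⟩ := Int.dvd_of_emod_eq_zero hD
  have h1 : (d + 4 * E * r) % 2 = 1 := by rw [mul_assoc]; omega
  unfold thetaDual
  rw [symb_four_mul _ _ h1, symb_four_mul _ _ hd, symb_add_four_mul_mul E d hd,
    eps_congr (d := d + 4 * E * r) (d' := d) (by rw [mul_assoc]; omega)]

theorem thetaDual_add_two_mul_of_two {D d : ℤ} (hD : D % 4 = 2) (hd : d % 2 = 1) :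
    thetaDual D (d + 2 * D) = -thetaDual D d := by
  obtain ⟨E, rfl⟩ : ∃ E, D = 2 * E := ⟨D / 2, by omega⟩
  unfold thetaDual
  have h2 : d + 2 * (2 * E) = d + 4 * E := by ring
  rw [h2, symb_two_mul _ _ (by omega), symb_two_mul _ _ hd, symb_add_four_mul E d hd,
    eps_congr (d := d + 4 * E) (d' := d) (by omega)]
  have h3 : ((d + 4 * E) % 8 = 1 ∨ (d + 4 * E) % 8 = 7) ↔ ¬ (d % 8 = 1 ∨ d % 8 = 7) := by omega
  simp only [h3]
  by_cases h : (d % 8 = 1 ∨ d % 8 = 7) <;> simp [h]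

theorem symb_add_two_mul_self (E d : ℤ) (hE : E % 2 = 1) (hd : d % 2 = 1) :
    symb (2 * E) (d + 2 * E) = (if d % 4 = 1 then -1 else 1) * symb (2 * E) d := by
  rw [symb_two_mul _ _ (by omega), symb_two_mul _ _ hd, symb_add_two_mul_of_odd E d hE hd]
  have h8 : d % 8 = 1 ∨ d % 8 = 3 ∨ d % 8 = 5 ∨ d % 8 = 7 := by omega
  have hE4 : E % 4 = 1 ∨ E % 4 = 3 := by omega
  rcases hE4 with h2 | h2 <;> rcases h8 with h1 | h1 | h1 | h1
  · have a : (d + 2 * E) % 8 = 3 := by omega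
    have b : d % 4 = 1 := by omega
    simp [a, b, h1, h2]
  · have a : (d + 2 * E) % 8 = 5 := by omega
    have b : d % 4 = 3 := by omega
    simp [a, b, h1, h2]
  · have a : (d + 2 * E) % 8 = 7 := by omega
    have b : d % 4 = 1 := by omega
    simp [a, b, h1, h2]
  · have a : (d + 2 * E) % 8 = 1 := by omega
    have b : d % 4 = 3 := by omega
    simp [a, b, h1, h2]
  · have a : (d + 2 * E) % 8 = 7 := by omega
    have b : d % 4 = 1 := by omega
    simp [a, b, h1, h2]
  · have a : (d + 2 * E) % 8 = 1 := by omega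
    have b : d % 4 = 3 := by omega
    simp [a, b, h1, h2]
  · have a : (d + 2 * E) % 8 = 3 := by omega
    have b : d % 4 = 1 := by omega
    simp [a, b, h1, h2]
  · have a : (d + 2 * E) % 8 = 5 := by omega
    have b : d % 4 = 3 := by omega
    simp [a, b, h1, h2]

theorem thetaDual_add_self_of_two {D d : ℤ} (hD : D % 4 = 2) (hd : d % 2 = 1) :
    thetaDual D (d + D) = Complex.I * thetaDual D d := by
  obtain ⟨E, rfl⟩ : ∃ E, D = 2 * E := ⟨D / 2, by omega⟩
  unfold thetaDual
  rw [symb_add_two_mul_self E d (by omega) hd]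
  have h4 : d % 4 = 1 ∨ d % 4 = 3 := by omega
  rcases h4 with h | h
  · rw [eps_of_one h, eps_of_three (d := d + 2 * E) (by omega)]
    simp [h]; ring
  · rw [eps_of_three h, eps_of_one (d := d + 2 * E) (by omega)]
    simp [h]; ring_nf; simp

/-- Modulo D + g one has D ≡ -g, so the two symbols differ by χ₄(|D + g|); for negative D + g the
sign in the extended symbol makes the discrepancy a function of D + g mod 4. This identifies the
transported row for ν = 2 with the row (4g, D + g). -/
theorem thetaRow_add_eq {g D : ℤ} (hg : 0 < g) (hD : (D + g) % 2 = 1) :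
    thetaRow (4 * g) (D + g) = Complex.I * thetaDual D (-(D + g)) := by
  have hodd : Odd (D + g).natAbs := by rw [Int.natAbs_odd]; exact Int.odd_iff.mpr hD
  rw [thetaDual_neg D (D + g) (by omega), thetaRow, symb_four_mul g _ hD, symb_of_pos_left hg]
  have hjac : jacobiSym D (D + g).natAbs = ZMod.χ₄ (D + g).natAbs * jacobiSym g (D + g).natAbs := by
    rw [← jacobiSym.neg g hodd]
    have : D = -g + (D + g) * 1 := by ring
    nth_rw 1 [this]
    rw [jacobiSym_add_natAbs_mul]
  have h4 : (D + g) % 4 = 1 ∨ (D + g) % 4 = 3 := by omega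
  have hs : symb D (D + g) = (if (D + g) % 4 = 1 then 1 else -1) * jacobiSym g (D + g).natAbs := by
    unfold symb
    rw [hjac]
    by_cases hneg : D + g < 0
    · have hD0 : D < 0 := by omega
      rw [if_pos ⟨hD0, hneg⟩]
      rcases h4 with h | h
      · rw [ZMod.χ₄_nat_three_mod_four (by omega)]; simp [h]
      · rw [ZMod.χ₄_nat_one_mod_four (by omega)]; simp [h]
    · rw [if_neg (by tauto)]
      rcases h4 with h | h
      · rw [ZMod.χ₄_nat_one_mod_four (by omega)]; simp [h]
      · rw [ZMod.χ₄_nat_three_mod_four (by omega)]; simp [h]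
  rw [hs]
  rcases h4 with h | h
  · rw [eps_of_one h, eps_of_three (d := -(D + g)) (by omega)]
    simp [h]; ring_nf; simp
  · rw [eps_of_three h, eps_of_one (d := -(D + g)) (by omega)]
    simp [h]; ring

end PlusPoincare
end

noncomputable section

namespace PlusPoincare

/-! ### The weight of a row in the projected Poincaré series -/

theorem expI_add (x y : ℂ) : expI (x + y) = expI x * expI y := by
  unfold expI; rw [mul_add, Complex.exp_add]

theorem expI_int (n : ℤ) : expI n = 1 := by
  unfold expI
  rw [Complex.exp_eq_one_iff]
  exact ⟨n, by ring⟩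

theorem expI_div_four (n : ℤ) : expI ((n : ℂ) / 4) = Complex.I ^ n := by
  have h1 : expI (1 / 4) = Complex.I := by
    have : 2 * (Real.pi : ℂ) * Complex.I * (1 / 4) = Real.pi / 2 * Complex.I := by ring
    rw [expI, this, Complex.exp_pi_div_two_mul_I]
  rw [← h1]
  unfold expI
  rw [← Complex.exp_int_mul]
  congr 1; ring

theorem I_zpow_congr {a b : ℤ} (h : a ≡ b [ZMOD 4]) : Complex.I ^ a = Complex.I ^ b := by
  obtain ⟨k, hk⟩ := h.dvd
  have h4 : Complex.I ^ (4 : ℤ) = 1 := by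
    rw [show (4 : ℤ) = ((4 : ℕ) : ℤ) from rfl, zpow_natCast, Complex.I_pow_four]
  rw [show b = a + 4 * k by linarith, zpow_add₀ Complex.I_ne_zero, zpow_mul, h4, one_zpow, mul_one]

theorem expI_div_congr (m : ℤ) {q : ℕ} (hq : q ≠ 0) {a a' : ℤ} (h : a ≡ a' [ZMOD q]) :
    expI ((m : ℂ) * a / q) = expI ((m : ℂ) * a' / q) := by
  obtain ⟨k, hk⟩ := h.dvd
  have hq' : (q : ℂ) ≠ 0 := by exact_mod_cast hq
  have e : (m : ℂ) * a' / q = (m : ℂ) * a / q + ((m * k : ℤ) : ℂ) := by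
    rw [show a' = a + q * k by linarith]
    push_cast; field_simp
  rw [e, expI_add, expI_int, mul_one]

/-- The weight of the row `(q, D)` in the Poincaré series. -/
def rowWeight (lam m : ℤ) (q : ℕ) (D : ℤ) : ℂ :=
  open Classical in
  if IsCoprime (q : ℤ) D then
    thetaRow q D ^ (-(2 * lam + 1)) *
      expI ((m : ℂ) * ((((D : ZMod q)⁻¹).val : ℕ) : ℂ) / q)
  else 0

theorem rowWeight_eq (lam m : ℤ) {q : ℕ} (hq : q ≠ 0) {a D : ℤ} (h : a * D ≡ 1 [ZMOD q]) :
    rowWeight lam m q D = thetaRow q D ^ (-(2 * lam + 1)) * expI ((m : ℂ) * a / q) := by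
  have : NeZero q := ⟨hq⟩
  have hco : IsCoprime (q : ℤ) D := by
    obtain ⟨k, hk⟩ := h.dvd
    exact ⟨k, a, by linarith⟩
  rw [rowWeight, if_pos hco]
  congr 1
  have h1 : ((a : ℤ) : ZMod q) * (D : ZMod q) = 1 := by
    have := (ZMod.intCast_eq_intCast_iff (a * D) 1 q).mpr h
    simpa using this
  have h2 : ((D : ZMod q)⁻¹) = (a : ZMod q) := by
    exact ZMod.inv_eq_of_mul_eq_one q _ _ (by rw [mul_comm]; exact h1)
  rw [h2]
  have := expI_div_congr m hq (a := (((a : ZMod q).val : ℕ) : ℤ)) (a' := a) (by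
    rw [← ZMod.intCast_eq_intCast_iff]
    simp)
  rw [← this]
  push_cast; rfl

theorem rowWeight_of_not (lam m : ℤ) {q : ℕ} {D : ℤ} (h : ¬ IsCoprime (q : ℤ) D) :
    rowWeight lam m q D = 0 := by
  rw [rowWeight, if_neg h]

/-- The sign `(-1)^lam` as a complex number. -/
def sgnC (lam : ℤ) : ℂ := ((lam.negOnePow : ℤ) : ℂ)

theorem sgnC_cases (lam : ℤ) : sgnC lam = 1 ∨ sgnC lam = -1 := by
  unfold sgnC
  rcases Int.units_eq_one_or lam.negOnePow with h | h <;> simp [h]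

theorem neg_one_zpow_eq_sgnC (lam : ℤ) : (-1 : ℂ) ^ lam = sgnC lam := by
  unfold sgnC
  rcases Int.even_or_odd lam with h | h
  · rw [h.neg_one_zpow, Int.negOnePow_even _ h]; simp
  · rw [h.neg_one_zpow, Int.negOnePow_odd _ h]; simp

theorem neg_one_zpow_weight (lam : ℤ) : (-1 : ℂ) ^ (-(2 * lam + 1)) = -1 :=
  Odd.neg_one_zpow ⟨-lam - 1, by ring⟩

theorem I_zpow_weight (lam : ℤ) : Complex.I ^ (-(2 * lam + 1)) = -sgnC lam * Complex.I := by
  have h : Complex.I ^ (-(2 * lam)) = sgnC lam := by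
    rw [zpow_neg, zpow_mul, ← neg_one_zpow_eq_sgnC]
    rw [show (2 : ℤ) = ((2 : ℕ) : ℤ) from rfl, zpow_natCast, Complex.I_sq]
    rcases Int.even_or_odd lam with h | h
    · rw [h.neg_one_zpow, inv_one]
    · rw [h.neg_one_zpow]; norm_num
  rw [neg_add, zpow_add₀ Complex.I_ne_zero, h, zpow_neg_one, Complex.inv_I]
  ring

theorem neg_I_zpow_weight (lam : ℤ) : (-Complex.I) ^ (-(2 * lam + 1)) = sgnC lam * Complex.I := by
  rw [neg_eq_neg_one_mul, mul_zpow, neg_one_zpow_weight, I_zpow_weight]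
  ring

/-- The form in which the plus condition is used: i^m is 1 or σi, while i^m is -1 or -σi for the
excluded classes. -/
theorem PlusIndex.I_zpow {lam m : ℤ} (hm : PlusIndex lam m) :
    Complex.I ^ m = 1 ∨ Complex.I ^ m = sgnC lam * Complex.I := by
  unfold PlusIndex at hm
  unfold sgnC
  rcases Int.units_eq_one_or lam.negOnePow with h | h
  · rw [h] at hm ⊢
    simp only [Units.val_one, one_mul] at hm
    rcases hm with hm | hm
    · left; rw [I_zpow_congr hm, zpow_zero]
    · right; rw [I_zpow_congr hm, zpow_one]; simp
  · rw [h] at hm ⊢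
    simp only [Units.val_neg, Units.val_one] at hm
    rcases hm with hm | hm
    · left
      have : m ≡ 0 [ZMOD 4] := by simpa using hm.neg
      rw [I_zpow_congr this, zpow_zero]
    · right
      have : m ≡ -1 [ZMOD 4] := by simpa using hm.neg
      rw [I_zpow_congr this, zpow_neg_one, Complex.inv_I]; simp

theorem I_zpow_of_not_plusIndex {lam m : ℤ} (hm : ¬ PlusIndex lam m) :
    Complex.I ^ m = -1 ∨ Complex.I ^ m = -sgnC lam * Complex.I := by
  unfold PlusIndex at hm
  unfold sgnC
  have h2 : Complex.I ^ (2 : ℤ) = -1 := by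
    rw [show (2 : ℤ) = ((2 : ℕ) : ℤ) from rfl, zpow_natCast, Complex.I_sq]
  rcases Int.units_eq_one_or lam.negOnePow with h | h
  · rw [h] at hm ⊢
    simp only [Units.val_one, one_mul, Int.ModEq] at hm
    have : m ≡ 2 [ZMOD 4] ∨ m ≡ -1 [ZMOD 4] := by simp only [Int.ModEq]; omega
    rcases this with hm | hm
    · left; rw [I_zpow_congr hm, h2]
    · right; rw [I_zpow_congr hm, zpow_neg_one, Complex.inv_I]; simp
  · rw [h] at hm ⊢
    simp only [Units.val_neg, Units.val_one, Int.ModEq] at hm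
    have : m ≡ 2 [ZMOD 4] ∨ m ≡ 1 [ZMOD 4] := by simp only [Int.ModEq]; omega
    rcases this with hm | hm
    · left; rw [I_zpow_congr hm, h2]
    · right; rw [I_zpow_congr hm, zpow_one]; simp

/-- The weights of the rows `(4 (g - ν N' D), D - (g - ν N' D))`, transported by `B A_ν`. -/
def IsDualWeight (N' : ℕ) (lam m : ℤ) (g : ℕ) (D : ℤ) (Om : ℕ → ℂ) : Prop :=
  ∀ ν : ℕ, ∀ h d : ℤ, h = g - ν * N' * D → d = D - h →
    (¬ IsCoprime (4 * h) d → Om ν = 0) ∧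
    (IsCoprime (4 * h) d → ∃ a b : ℤ, a * d - b * (4 * h) = 1 ∧
      Om ν = thetaRow (4 * h) d ^ (-(2 * lam + 1)) *
        expI ((m : ℂ) * ((a + N' * ν * (a + 4 * b) : ℤ) : ℂ) / ((4 * g : ℕ) : ℂ)))

end PlusPoincare
end

/-! ### Congruences for the transported rows, and the cases ν = 0 and ν = 2. -/

noncomputable section

namespace PlusPoincare

theorem isCoprime_four_left {d : ℤ} : IsCoprime 4 d ↔ d % 2 = 1 := by
  rw [show (4 : ℤ) = 2 ^ 2 by norm_num, IsCoprime.pow_left_iff two_pos, ← Int.odd_iff]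
  exact Int.isCoprime_two_left

theorem isCoprime_four_mul_left {g D : ℤ} : IsCoprime (4 * g) D ↔ D % 2 = 1 ∧ IsCoprime g D := by
  rw [IsCoprime.mul_left_iff, isCoprime_four_left]

theorem isCoprime_dual_iff {g n D h d : ℤ} (hh : h = g - n * D) (hd : d = D - h) :
    IsCoprime (4 * h) d ↔ d % 2 = 1 ∧ IsCoprime g D := by
  rw [isCoprime_four_mul_left]
  refine and_congr_right fun _ => ?_
  have e1 : d = D + h * (-1) := by rw [hd]; ring
  have e2 : h = g + D * (-n) := by rw [hh]; ring
  rw [e1, IsCoprime.add_mul_left_right_iff, e2, IsCoprime.add_mul_left_left_iff]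

theorem modEq_four_mul {g D α a₀ x : ℤ} (hg : g % 2 = 1) (h1 : α * D ≡ 1 [ZMOD g])
    (h2 : a₀ * D ≡ 1 [ZMOD g]) (h4 : α ≡ a₀ + g * x [ZMOD 4]) :
    α ≡ a₀ + g * x [ZMOD (4 * g)] := by
  refine (Int.modEq_and_modEq_iff_modEq_mul ?_).mp ⟨h4, ?_⟩
  · have : IsCoprime (4 : ℤ) g := isCoprime_four_left.mpr hg
    rw [Int.isCoprime_iff_gcd_eq_one] at this
    exact this
  · have hD : IsCoprime g D := by
      obtain ⟨k, hk⟩ := h1.dvd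
      exact ⟨k, α, by linarith⟩
    have h3 : g ∣ (α - a₀) * D := by
      have := (h2.trans h1.symm).dvd
      rwa [← sub_mul] at this
    have h5 : g ∣ α - a₀ := hD.dvd_of_dvd_mul_right h3
    refine (Int.modEq_iff_dvd.mpr ?_)
    have : a₀ + g * x - α = g * x - (α - a₀) := by ring
    rw [this]
    exact dvd_sub (dvd_mul_right _ _) h5

theorem expI_four_mul_add (m : ℤ) {g : ℕ} (hg : 0 < g) (a₀ x : ℤ) :
    expI ((m : ℂ) * ((a₀ + g * x : ℤ) : ℂ) / ((4 * g : ℕ) : ℂ)) =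
      expI ((m : ℂ) * a₀ / ((4 * g : ℕ) : ℂ)) * Complex.I ^ (m * x) := by
  have hg' : (g : ℂ) ≠ 0 := by exact_mod_cast hg.ne'
  rw [← expI_div_four, ← expI_add]
  congr 1
  push_cast
  field_simp

theorem int_modEq_four_of_mul {a d : ℤ} (h : a * d ≡ 1 [ZMOD 4]) : a ≡ d [ZMOD 4] := by
  have ha : a % 4 = 0 ∨ a % 4 = 1 ∨ a % 4 = 2 ∨ a % 4 = 3 := by omega
  have hd : d % 4 = 0 ∨ d % 4 = 1 ∨ d % 4 = 2 ∨ d % 4 = 3 := by omega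
  simp only [Int.ModEq, Int.mul_emod a d] at *
  rcases ha with ha | ha | ha | ha <;> rcases hd with hd | hd | hd | hd <;>
    simp [ha, hd] at h ⊢

section Dual

variable {N' : ℕ} {lam m : ℤ} {g : ℕ} {D : ℤ} {Om : ℕ → ℂ}

/-- Here α = a + n(a + 4b), with n = νN', is the upper left entry after transport. It is an inverse
of D modulo g, and its class modulo 4 comes from a ≡ d, a consequence of ad ≡ 1 mod 4. -/
theorem dual_congr {n a b h d : ℤ} {g : ℤ} (hh : h = g - n * D) (hd : d = D - h)
    (hab : a * d - b * (4 * h) = 1) :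
    (a + n * (a + 4 * b)) * D = 1 + g * (a + 4 * b) ∧ a ≡ d [ZMOD 4] ∧
      a + n * (a + 4 * b) ≡ (1 + n) * d [ZMOD 4] := by
  have h1 : a ≡ d [ZMOD 4] := by
    refine int_modEq_four_of_mul (Int.modEq_iff_dvd.mpr ⟨-(b * h), ?_⟩)
    linarith
  refine ⟨?_, h1, ?_⟩
  · have hg : g = h + n * D := by linarith
    have hD : D = d + h := by linarith
    have e : a * d = 1 + b * (4 * h) := by linarith
    rw [hg]
    calc (a + n * (a + 4 * b)) * D = a * D + n * D * (a + 4 * b) := by ring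
      _ = (a * d + a * h) + n * D * (a + 4 * b) := by
        congr 1; nth_rw 1 [hD]; ring
      _ = _ := by rw [e]; ring
  · have : a + n * (a + 4 * b) = (1 + n) * a + 4 * (n * b) := by ring
    rw [this]
    have h2 : (1 + n) * a + 4 * (n * b) ≡ (1 + n) * a [ZMOD 4] :=
      Int.modEq_iff_dvd.mpr ⟨-(n * b), by ring⟩
    exact h2.trans (h1.mul_left _)

theorem IsDualWeight.zero (hOm : IsDualWeight N' lam m g D Om) (hg : 0 < g) :
    Om 0 = rowWeight lam m (4 * g) (D - g) := by
  obtain ⟨h1, h2⟩ := hOm 0 g (D - g) (by simp) rfl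
  by_cases hc : IsCoprime (4 * (g : ℤ)) (D - g)
  · obtain ⟨a, b, hab, e⟩ := h2 hc
    rw [e, rowWeight_eq lam m (by omega) (a := a)]
    · push_cast; simp
    · refine Int.modEq_iff_dvd.mpr ⟨-b, ?_⟩
      push_cast; linarith
  · rw [h1 hc, rowWeight_of_not]
    exact_mod_cast hc

/-- For odd N' one has 2N' ≡ 2 mod 4, so d differs from -(D + g) by a multiple of 4D and
`thetaRow_add_eq` applies. The factor i between the multipliers, raised to the power -2k, becomes
the constant σi. The exponential needs no correction, as α(D + g) ≡ 1 modulo 4g. -/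
theorem IsDualWeight.two (hOm : IsDualWeight N' lam m g D Om) (hN : Odd N') (hg : 0 < g) :
    Om 2 = sgnC lam * Complex.I * rowWeight lam m (4 * g) (D + g) := by
  obtain ⟨t, ht⟩ := hN
  have hn : ((2 : ℕ) : ℤ) * N' = 2 + 4 * t := by rw [ht]; push_cast; ring
  obtain ⟨h1, h2⟩ := hOm 2 (g - (2 + 4 * t) * D) (D - (g - (2 + 4 * t) * D)) (by rw [hn]) rfl
  have hd : D - (g - (2 + 4 * t) * D) = -(D + g) + 4 * D * (1 + t) := by ring
  have hd2 : D - (g - (2 + 4 * t) * D) = D * (1 + (2 + 4 * t)) - g := by ring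
  have hpar : (D - (g - (2 + 4 * t) * D)) % 2 = 1 ↔ (D + g) % 2 = 1 := by
    rw [hd, mul_assoc 4]; omega
  have hiff : IsCoprime (4 * (g - (2 + 4 * t) * D)) (D - (g - (2 + 4 * t) * D)) ↔
      IsCoprime (4 * (g : ℤ)) (D + g) := by
    rw [isCoprime_dual_iff rfl rfl, isCoprime_four_mul_left, hpar]
    refine and_congr_right fun _ => ?_
    have : D + (g : ℤ) = D + g * 1 := by ring
    rw [this, IsCoprime.add_mul_left_right_iff]
  by_cases hc : IsCoprime (4 * (g : ℤ)) (D + g)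
  · obtain ⟨a, b, hab, e⟩ := h2 (hiff.mpr hc)
    obtain ⟨f1, f2, f3⟩ := dual_congr rfl rfl hab
    have hodd : (D + g) % 2 = 1 := (isCoprime_four_mul_left.mp hc).1
    have hrow : thetaRow (4 * (g - (2 + 4 * t) * D)) (D - (g - (2 + 4 * t) * D)) =
        thetaDual D (-(D + g)) := by
      have h3 := hpar.mpr hodd
      rw [hd2] at h3 ⊢
      rw [thetaRow_eq_thetaDual (by exact_mod_cast hg) (by positivity) h3]
      exact thetaDual_congr (by omega) (1 + t) (by ring)
    rw [e, hrow, rowWeight_eq lam m (by omega) (a := a + (2 + 4 * t) * (a + 4 * b))]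
    · push_cast
      rw [thetaRow_add_eq (by exact_mod_cast hg) hodd, mul_zpow, I_zpow_weight]
      have hs : sgnC lam * sgnC lam = 1 := by rcases sgnC_cases lam with h | h <;> rw [h] <;> norm_num
      have hNc : (N' : ℂ) * 2 = 2 + 4 * t := by rw [ht]; push_cast; ring
      rw [hNc]
      linear_combination (thetaDual D (-(D + g)) ^ (-(2 * lam + 1)) *
        expI ((m : ℂ) * (a + (2 + 4 * t) * (a + 4 * b)) / (4 * g))) * (Complex.I_sq * (sgnC lam ^ 2) - hs)
    · push_cast
      obtain ⟨k, hk⟩ := f2.dvd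
      obtain ⟨l, hl⟩ := f3.dvd
      have hα : (a + (2 + 4 * t) * (a + 4 * b)) * (D + g) = 1 + g * (a + 4 * b) +
        g * (a + (2 + 4 * t) * (a + 4 * b)) := by linarith
      rw [hα]
      refine Int.modEq_iff_dvd.mpr ⟨-(b + a * (1 + t) + b * (2 + 4 * t)), ?_⟩
      ring
  · rw [h1 (mt hiff.mp hc), rowWeight_of_not]
    · simp
    · exact_mod_cast hc

end Dual

end PlusPoincare
end

/-! ### The weight identity for one row, by the parities of g and D. -/

noncomputable section

namespace PlusPoincare

section Dual

variable {N' : ℕ} {lam m : ℤ} {g : ℕ} {D : ℤ} {Om : ℕ → ℂ}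

theorem IsDualWeight.eq_zero (hOm : IsDualWeight N' lam m g D Om) {ν : ℕ}
    (h : ¬ ((D * (1 + ν * N') - g) % 2 = 1 ∧ IsCoprime (g : ℤ) D)) : Om ν = 0 := by
  refine (hOm ν _ _ rfl rfl).1 ?_
  rw [isCoprime_dual_iff rfl rfl]
  have : D - (g - ν * N' * D) = D * (1 + ν * N') - g := by ring
  rwa [this]

/-- For odd `g`, all transported weights are expressed through one root of unity. -/
theorem IsDualWeight.eq_of_odd (hOm : IsDualWeight N' lam m g D Om) (hg : g % 2 = 1)
    (hco : IsCoprime (g : ℤ) D) {a₀ : ℤ} (ha0 : a₀ ≡ 0 [ZMOD 4]) (ha1 : a₀ * D ≡ 1 [ZMOD g])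
    {ν : ℕ} {r : ℤ} (hr : (1 + ν * N' : ℤ) ≡ r [ZMOD 4]) (hodd : (D * r - g) % 2 = 1)
    {x : ℤ} (hx : x ≡ g * (r * (D * r - g)) [ZMOD 4]) :
    Om ν = thetaDual D (D * r - g) ^ (-(2 * lam + 1)) *
      (expI ((m : ℂ) * a₀ / ((4 * g : ℕ) : ℂ)) * Complex.I ^ (m * x)) := by
  have hg0 : 0 < g := by omega
  obtain ⟨k, hk⟩ := hr.dvd
  have hr' : (1 + ν * N' : ℤ) = r - 4 * k := by linarith
  have hd : D - (g - ν * N' * D) = D * r - g + 4 * D * (-k) := by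
    linear_combination D * hr'
  have hd2 : D - (g - ν * N' * D) = D * (1 + ν * N') - g := by ring
  have hodd' : (D - (g - ν * N' * D)) % 2 = 1 := by rw [hd, mul_assoc 4]; omega
  obtain ⟨a, b, hab, e⟩ := (hOm ν _ _ rfl rfl).2 ((isCoprime_dual_iff rfl rfl).mpr ⟨hodd', hco⟩)
  obtain ⟨f1, f2, f3⟩ := dual_congr rfl rfl hab
  have hrow : thetaRow (4 * (g - ν * N' * D)) (D - (g - ν * N' * D)) = thetaDual D (D * r - g) := by
    rw [hd2] at hodd' ⊢
    rw [thetaRow_eq_thetaDual (by exact_mod_cast hg0) (by positivity) hodd']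
    exact thetaDual_congr hodd (-k) (by rw [← hd2, hd])
  have hgg : (g : ℤ) * g ≡ 1 [ZMOD 4] := by
    have h4 : (g : ℤ) % 4 = 1 ∨ (g : ℤ) % 4 = 3 := by omega
    rcases h4 with h | h <;> simp [Int.ModEq, Int.mul_emod, h]
  have key : a + N' * ν * (a + 4 * b) ≡ a₀ + g * x [ZMOD (4 * g)] := by
    refine modEq_four_mul (D := D) (by omega) ?_ ha1 ?_
    · have : (a + N' * ν * (a + 4 * b)) * D = 1 + g * (a + 4 * b) := by rw [← f1]; ring
      rw [this]
      exact Int.modEq_iff_dvd.mpr ⟨-(a + 4 * b), by ring⟩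
    · have h1 : a + N' * ν * (a + 4 * b) ≡ r * (D * r - g) [ZMOD 4] := by
        have h2 : (D - (g - ν * N' * D)) ≡ D * r - g [ZMOD 4] := by
          rw [hd]; exact Int.modEq_iff_dvd.mpr ⟨D * k, by ring⟩
        have h3 := f3.trans (hr.mul h2)
        have h4 : a + N' * ν * (a + 4 * b) = a + ν * N' * (a + 4 * b) := by ring
        rwa [h4]
      refine h1.trans ?_
      have h5 : a₀ + g * x ≡ 0 + g * (g * (r * (D * r - g))) [ZMOD 4] := ha0.add (hx.mul_left _)
      refine Int.ModEq.symm (h5.trans ?_)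
      rw [zero_add, ← mul_assoc]
      simpa using hgg.mul_right (r * (D * r - g))
  rw [e, hrow, expI_div_congr m (by omega) (a' := a₀ + g * x) (by push_cast; exact key),
    expI_four_mul_add m hg0]

theorem rowWeight_eq_of_odd (lam m : ℤ) (hg : g % 2 = 1)
    (hco : IsCoprime (g : ℤ) D) {a₀ : ℤ} (ha0 : a₀ ≡ 0 [ZMOD 4]) (ha1 : a₀ * D ≡ 1 [ZMOD g])
    (hD : D % 2 = 1) :
    rowWeight lam m (4 * g) D = thetaRow (4 * g) D ^ (-(2 * lam + 1)) *
      (expI ((m : ℂ) * a₀ / ((4 * g : ℕ) : ℂ)) * Complex.I ^ (m * (g * D))) := by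
  have hg0 : 0 < g := by omega
  obtain ⟨u, a, hua⟩ : IsCoprime (4 * (g : ℤ)) D := isCoprime_four_mul_left.mpr ⟨hD, hco⟩
  have hgg : (g : ℤ) * g ≡ 1 [ZMOD 4] := by
    have h4 : (g : ℤ) % 4 = 1 ∨ (g : ℤ) % 4 = 3 := by omega
    rcases h4 with h | h <;> simp [Int.ModEq, Int.mul_emod, h]
  have h1 : a * D ≡ 1 [ZMOD (4 * g)] := Int.modEq_iff_dvd.mpr ⟨u, by linarith⟩
  have key : a ≡ a₀ + g * (g * D) [ZMOD (4 * g)] := by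
    refine modEq_four_mul (D := D) (by omega) ?_ ha1 ?_
    · exact h1.of_mul_left 4
    · have h2 : a ≡ D [ZMOD 4] := int_modEq_four_of_mul (h1.of_mul_right _)
      refine h2.trans (Int.ModEq.symm ?_)
      have h3 := ha0.add (hgg.mul_right D)
      simpa [mul_assoc] using h3
  rw [rowWeight_eq lam m (by omega) (a := a) (by push_cast; exact h1),
    expI_div_congr m (by omega) (a' := a₀ + g * (g * D)) (by push_cast; exact key),
    expI_four_mul_add m hg0]
  push_cast; rfl

theorem exists_inverse_dvd_four (hg : g % 2 = 1) (hco : IsCoprime (g : ℤ) D) :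
    ∃ a₀ : ℤ, a₀ ≡ 0 [ZMOD 4] ∧ a₀ * D ≡ 1 [ZMOD g] := by
  obtain ⟨u, a, hua⟩ := hco
  obtain ⟨v, w, hvw⟩ : IsCoprime (4 : ℤ) g := isCoprime_four_left.mpr (by omega)
  refine ⟨a * (v * 4), Int.modEq_iff_dvd.mpr ⟨-(a * v), by ring⟩,
    Int.modEq_iff_dvd.mpr ⟨u + a * D * w, ?_⟩⟩
  linear_combination (-(a * D)) * hvw - hua

/-- For odd g and D the odd ν realise the classes 0 and 2 of 1 + νN' modulo 4. The weights on both
sides are the same root of unity times the same multiplier times explicit powers of i, and the plus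
condition on m reduces the identity to finitely many checks. -/
theorem IsDualWeight.one_add_three_of_odd_odd (hOm : IsDualWeight N' lam m g D Om)
    (hN : Odd N') (hm : PlusIndex lam m) (hg : g % 2 = 1) (hD : D % 2 = 1)
    (hco : IsCoprime (g : ℤ) D) :
    (1 - sgnC lam * Complex.I) * (Om 1 + Om 3) = 2 * rowWeight lam m (4 * g) D := by
  obtain ⟨a₀, ha0, ha1⟩ := exists_inverse_dvd_four hg hco
  have hg0 : (0 : ℤ) < g := by omega
  have hgo : (g : ℤ) % 2 = 1 := by omega
  set E := expI ((m : ℂ) * a₀ / ((4 * g : ℕ) : ℂ))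
  set e := -(2 * lam + 1) with he
  have hgD : ((g : ℤ) * D) % 4 = 1 ∨ ((g : ℤ) * D) % 4 = 3 := by
    have h4 : (g : ℤ) % 4 = 1 ∨ (g : ℤ) % 4 = 3 := by omega
    have h5 : D % 4 = 1 ∨ D % 4 = 3 := by omega
    rcases h4 with h | h <;> rcases h5 with h' | h' <;> rw [Int.mul_emod, h, h'] <;> simp
  have hggD : (g : ℤ) * (2 * (D * 2 - g)) ≡ 2 [ZMOD 4] := by
    have h4 : (g : ℤ) % 4 = 1 ∨ (g : ℤ) % 4 = 3 := by omega
    have h6 : (2 * (D * 2 - (g : ℤ))) % 4 = 2 := by omega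
    rcases h4 with h | h <;> (rw [Int.ModEq, Int.mul_emod, h, h6]; rfl)
  have H0 : ∀ ν : ℕ, (1 + ν * N' : ℤ) ≡ 0 [ZMOD 4] → Om ν = thetaDual D (-g) ^ e * E := by
    intro ν hν
    rw [hOm.eq_of_odd hg hco ha0 ha1 hν (by omega) (x := 0) (by simp [Int.ModEq])]
    simp [E, he]
  have H2 : ∀ ν : ℕ, (1 + ν * N' : ℤ) ≡ 2 [ZMOD 4] →
      Om ν = thetaDual D (2 * D - g) ^ e * (E * Complex.I ^ (m * 2)) := by
    intro ν hν
    rw [hOm.eq_of_odd hg hco ha0 ha1 hν (by omega) (x := 2) hggD.symm, mul_comm D 2]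
  -- Which of ν = 1, 3 has 1 + νN' ≡ 0 mod 4 depends on N' mod 4; the sum does not.
  have hsum : Om 1 + Om 3 = thetaDual D (-g) ^ e * E +
      thetaDual D (2 * D - g) ^ e * (E * Complex.I ^ (m * 2)) := by
    obtain ⟨t, ht⟩ := hN
    have h4 : N' % 4 = 1 ∨ N' % 4 = 3 := by omega
    rcases h4 with h | h
    · rw [H2 1 (by simp only [Int.ModEq]; push_cast; omega),
        H0 3 (by simp only [Int.ModEq]; push_cast; omega), add_comm]
    · rw [H0 1 (by simp only [Int.ModEq]; push_cast; omega),
        H2 3 (by simp only [Int.ModEq]; push_cast; omega)]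
  have hs : sgnC lam ^ 2 = 1 := by rcases sgnC_cases lam with h | h <;> rw [h] <;> norm_num
  rw [hsum, rowWeight_eq_of_odd lam m hg hco ha0 ha1 hD, thetaDual_neg_of_odd hg0 hgo hD,
    thetaDual_two_mul_sub_of_odd hg0 hgo hD, mul_zpow, mul_zpow]
  rw [zpow_mul, show (2 : ℤ) = ((2 : ℕ) : ℤ) from rfl, zpow_natCast]
  have hI2 := Complex.I_sq
  rcases hgD with h | h
  · have h1 : Complex.I ^ (m * (g * D)) = Complex.I ^ m :=
      I_zpow_congr (by simpa using (show (g : ℤ) * D ≡ 1 [ZMOD 4] from h).mul_left m)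
    rw [h1, if_pos h, if_pos h, neg_I_zpow_weight, one_zpow]
    rcases hm.I_zpow with h2 | h2 <;> rw [h2]
    · linear_combination (-(thetaRow (4 * g) D) ^ e * E * sgnC lam ^ 2) * hI2 +
        (thetaRow (4 * g) D) ^ e * E * hs
    · linear_combination (-(sgnC lam * Complex.I * (thetaRow (4 * g) D ^ e * E))) * (sgnC lam ^ 2 * hI2 - hs)
  · have h1 : Complex.I ^ (m * (g * D)) = (Complex.I ^ m) ^ 3 := by
      rw [← zpow_natCast, ← zpow_mul]
      exact I_zpow_congr ((show (g : ℤ) * D ≡ 3 [ZMOD 4] from h).mul_left m)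
    rw [h1, if_neg (by omega), if_neg (by omega), neg_I_zpow_weight, one_zpow]
    rcases hm.I_zpow with h2 | h2 <;> rw [h2]
    · linear_combination (-(thetaRow (4 * g) D ^ e * E)) * (sgnC lam ^ 2 * hI2 - hs)
    · linear_combination (thetaRow (4 * g) D ^ e * E) * (1 - sgnC lam ^ 2 * Complex.I ^ 2 - sgnC lam * Complex.I) *
        (sgnC lam ^ 2 * hI2 - hs)

/-- For odd g and even D all four ν occur, and with r = 1 + νN' mod 4 the multiplier at Dr - g is
constant in r if 4 ∣ D and acquires i^r if D ≡ 2 mod 4. In both cases the plus condition makes the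
even and the odd ν contribute equally. -/
theorem IsDualWeight.one_add_three_of_odd_even (hOm : IsDualWeight N' lam m g D Om)
    (hN : Odd N') (hm : PlusIndex lam m) (hg : g % 2 = 1) (hD : D % 2 = 0)
    (hco : IsCoprime (g : ℤ) D) :
    Om 1 + Om 3 = Om 0 + Om 2 := by
  obtain ⟨a₀, ha0, ha1⟩ := exists_inverse_dvd_four hg hco
  have hg0 : (0 : ℤ) < g := by omega
  have hgo : (g : ℤ) % 2 = 1 := by omega
  set E := expI ((m : ℂ) * a₀ / ((4 * g : ℕ) : ℂ))
  set e := -(2 * lam + 1) with he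
  have H : ∀ (ν : ℕ) (r : ℤ), (1 + ν * N' : ℤ) ≡ r [ZMOD 4] →
      Om ν = thetaDual D (D * r - g) ^ e * (E * Complex.I ^ (m * (g * (r * (D * r - g))))) := by
    intro ν r hν
    have hodd : (D * r - g) % 2 = 1 := by
      rw [Int.sub_emod, Int.mul_emod, hD, hgo]; simp
    exact hOm.eq_of_odd hg hco ha0 ha1 hν hodd rfl
  have hsum : Om 1 + Om 3 = thetaDual D (D * 0 - g) ^ e *
      (E * Complex.I ^ (m * (g * (0 * (D * 0 - g))))) +
      thetaDual D (D * 2 - g) ^ e * (E * Complex.I ^ (m * (g * (2 * (D * 2 - g))))) := by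
    obtain ⟨t, ht⟩ := hN
    have h4 : N' % 4 = 1 ∨ N' % 4 = 3 := by omega
    rcases h4 with h | h
    · rw [H 1 2 (by simp only [Int.ModEq]; push_cast; omega),
        H 3 0 (by simp only [Int.ModEq]; push_cast; omega), add_comm]
    · rw [H 1 0 (by simp only [Int.ModEq]; push_cast; omega),
        H 3 2 (by simp only [Int.ModEq]; push_cast; omega)]
  have h0 := H 0 1 (by simp [Int.ModEq])
  have h2 := H 2 3 (by
    obtain ⟨t, ht⟩ := hN
    simp only [Int.ModEq]; push_cast; omega)
  have hI2 := Complex.I_sq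
  have hgg : (g : ℤ) * g ≡ 1 [ZMOD 4] := by
    have h4 : (g : ℤ) % 4 = 1 ∨ (g : ℤ) % 4 = 3 := by omega
    rcases h4 with h | h <;> simp [Int.ModEq, Int.mul_emod, h]
  have hs : sgnC lam ^ 2 = 1 := by rcases sgnC_cases lam with h | h <;> rw [h] <;> norm_num
  have hpow : ∀ (x : ℤ) (j : ℕ), x ≡ j [ZMOD 4] → Complex.I ^ (m * x) = (Complex.I ^ m) ^ j := by
    intro x j hx
    rw [← zpow_natCast, ← zpow_mul]
    exact I_zpow_congr (hx.mul_left m)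
  obtain ⟨k, hk⟩ := hgg.symm.dvd
  rw [hsum, h0, h2]
  have hD4 : D % 4 = 0 ∨ D % 4 = 2 := by omega
  rcases hD4 with h | h
  · have hT : ∀ r : ℤ, thetaDual D (D * r - g) = thetaDual D (-g) := fun r => by
      rw [← thetaDual_add_mul_of_four_dvd h (d := -(g : ℤ)) (by omega) r]
      congr 1; ring
    obtain ⟨l, hl⟩ := Int.dvd_of_emod_eq_zero h
    rw [hT, hT, hT, hT,
      hpow _ 0 (Int.modEq_iff_dvd.mpr ⟨0, by push_cast; ring⟩),
      hpow _ 2 (Int.modEq_iff_dvd.mpr ⟨1 + 2 * k - 4 * g * l, by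
        rw [hl]; push_cast; linear_combination 2 * hk⟩),
      hpow _ 3 (Int.modEq_iff_dvd.mpr ⟨1 + k - g * l, by
        rw [hl]; push_cast; linear_combination hk⟩),
      hpow _ 1 (Int.modEq_iff_dvd.mpr ⟨1 + 3 * k - 9 * g * l, by
        rw [hl]; push_cast; linear_combination 3 * hk⟩)]
    rcases hm.I_zpow with h5 | h5 <;> rw [h5]
    · ring
    · linear_combination (thetaDual D (-g) ^ e * E) * (1 - sgnC lam * Complex.I) *
        (sgnC lam ^ 2 * hI2 - hs)
  · obtain ⟨l, hl⟩ : ∃ l, D = 4 * l + 2 := ⟨D / 4, by omega⟩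
    have hT0 : thetaDual D (D * 0 - g) = thetaDual D (-g) := by congr 1; ring
    have hT1 : thetaDual D (D * 1 - g) = Complex.I * thetaDual D (-g) := by
      rw [← thetaDual_add_self_of_two h (d := -(g : ℤ)) (by omega)]
      congr 1; ring
    have hT2 : thetaDual D (D * 2 - g) = -1 * thetaDual D (-g) := by
      rw [neg_one_mul, ← thetaDual_add_two_mul_of_two h (d := -(g : ℤ)) (by omega)]
      congr 1; ring
    have hT3 : thetaDual D (D * 3 - g) = -1 * (Complex.I * thetaDual D (-g)) := by
      rw [← hT1, neg_one_mul, ← thetaDual_add_two_mul_of_two h (d := D * 1 - g) (by omega)]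
      congr 1; ring
    obtain ⟨w, hw⟩ : ∃ w : ℤ, (g : ℤ) = 2 * w + 1 := ⟨g / 2, by omega⟩
    rw [hT0, hT1, hT2, hT3,
      hpow _ 0 (Int.modEq_iff_dvd.mpr ⟨0, by push_cast; ring⟩),
      hpow _ 2 (Int.modEq_iff_dvd.mpr ⟨1 + 2 * k - 4 * g * l - 2 * g, by
        rw [hl]; push_cast; linear_combination 2 * hk⟩),
      hpow _ 1 (Int.modEq_iff_dvd.mpr ⟨k - g * l - w, by
        rw [hl]; push_cast; linear_combination hk - 2 * hw⟩),
      hpow _ 3 (Int.modEq_iff_dvd.mpr ⟨-3 + 3 * k - 9 * g * l - 9 * w, by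
        rw [hl]; push_cast; linear_combination 3 * hk - 18 * hw⟩)]
    rw [mul_zpow (-1 : ℂ), mul_zpow (-1 : ℂ), mul_zpow Complex.I, neg_one_zpow_weight,
      I_zpow_weight]
    rcases hm.I_zpow with h5 | h5 <;> rw [h5]
    · ring
    · linear_combination (thetaDual D (-g) ^ e * E) * (1 - sgnC lam ^ 2 * Complex.I ^ 2) *
        (sgnC lam ^ 2 * hI2 - hs)

/-- All terms vanish unless g and D are coprime. If g is even, only ν = 0, 2 survive and give D - g
and D + g. If g is odd and D even, the odd ν double these two and the weight at D vanishes. If g and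
D are odd, only the odd ν survive and double the weight at D. The doubling for odd g is the factor 1
+ (4/g). -/
theorem IsDualWeight.weight_eq (hOm : IsDualWeight N' lam m g D Om)
    (hN : Odd N') (hm : PlusIndex lam m) (hg : 0 < g) :
    1 / 2 * rowWeight lam m (4 * g) D +
        1 / 4 * (1 - sgnC lam * Complex.I) * ∑ ν ∈ Finset.range 4, Om ν =
      (1 + (jacobiSym 4 g : ℂ)) * (1 / 2 * rowWeight lam m (4 * g) D +
        1 / 4 * (1 - sgnC lam * Complex.I) * rowWeight lam m (4 * g) (D - g) +
        1 / 4 * (1 + sgnC lam * Complex.I) * rowWeight lam m (4 * g) (D + g)) := by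
  have hs : sgnC lam ^ 2 = 1 := by rcases sgnC_cases lam with h | h <;> rw [h] <;> norm_num
  have hI2 := Complex.I_sq
  have hz := hOm.zero hg
  have ht := hOm.two hN hg
  have hrow : ∀ x : ℤ, ¬ (x % 2 = 1 ∧ IsCoprime (g : ℤ) x) → rowWeight lam m (4 * g) x = 0 := by
    intro x hx
    refine rowWeight_of_not lam m (mt (fun h => ?_) hx)
    exact isCoprime_four_mul_left.mp (by exact_mod_cast h)
  have hNodd : (N' : ℤ) % 2 = 1 := by
    obtain ⟨t, ht⟩ := hN; omega
  have hpm : ∀ x : ℤ, IsCoprime (g : ℤ) (D + g * x) ↔ IsCoprime (g : ℤ) D := fun x =>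
    IsCoprime.add_mul_left_right_iff
  have hp1 := hpm 1
  have hm1 := hpm (-1)
  rw [mul_one] at hp1
  rw [mul_neg_one, ← sub_eq_add_neg] at hm1
  simp only [Finset.sum_range_succ, Finset.sum_range_zero, zero_add]
  by_cases hco : IsCoprime (g : ℤ) D
  swap
  · rw [hOm.eq_zero (ν := 1) (fun h => hco h.2), hOm.eq_zero (ν := 3) (fun h => hco h.2), hz, ht,
      hrow D (fun h => hco h.2), hrow (D - g) (fun h => hco (hm1.mp h.2)),
      hrow (D + g) (fun h => hco (hp1.mp h.2))]
    ring
  rcases Nat.even_or_odd g with hge | hgo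
  · have hge' : g % 2 = 0 := Nat.even_iff.mp hge
    have hDo : D % 2 = 1 := by
      by_contra hD
      have h2 : (2 : ℤ) ∣ g := by omega
      have h3 : (2 : ℤ) ∣ D := by omega
      exact absurd (hco.isUnit_of_dvd' h2 h3) (by decide)
    have hj : jacobiSym 4 g = 0 := by
      rw [jacobiSym.eq_zero_iff]
      refine ⟨by omega, fun h => ?_⟩
      have h4 : (2 : ℤ) ∣ (Int.gcd 4 g : ℤ) := Int.dvd_coe_gcd (by norm_num) (by omega)
      rw [h] at h4
      exact absurd h4 (by decide)
    have hod : ∀ ν : ℕ, ν % 2 = 1 → ¬ ((D * (1 + ν * N') - g) % 2 = 1 ∧ IsCoprime (g : ℤ) D) := by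
      rintro ν hν ⟨h, -⟩
      have h5 : (1 + ν * N' : ℤ) % 2 = 0 := by
        rw [Int.add_emod, Int.mul_emod, hNodd, show ((ν : ℤ)) % 2 = 1 by omega]; rfl
      rw [Int.sub_emod, Int.mul_emod, h5, show (g : ℤ) % 2 = 0 by omega] at h
      simp at h
    rw [hOm.eq_zero (hod 1 rfl), hOm.eq_zero (hod 3 rfl), hz, ht, hj]
    push_cast
    linear_combination (-(1 / 4 : ℂ) * rowWeight lam m (4 * g) (D + g)) * (sgnC lam ^ 2 * hI2 - hs)
  · have hgo' : g % 2 = 1 := Nat.odd_iff.mp hgo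
    have hj : jacobiSym 4 g = 1 := jacobiSym.at_four hgo
    rw [hj]
    rcases Int.emod_two_eq_zero_or_one D with hD | hD
    · have h13 := hOm.one_add_three_of_odd_even hN hm hgo' hD hco
      rw [hrow D (fun h => by omega)]
      have h13' : Om 0 + Om 1 + Om 2 + Om 3 = 2 * (Om 0 + Om 2) := by linear_combination h13
      rw [h13', hz, ht]
      push_cast
      linear_combination (-(1 / 2 : ℂ) * rowWeight lam m (4 * g) (D + g)) *
        (sgnC lam ^ 2 * hI2 - hs)
    · have h13 := hOm.one_add_three_of_odd_odd hN hm hgo' hD hco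
      have hodd : ∀ ν : ℕ, ν % 2 = 0 →
          ¬ ((D * (1 + ν * N') - g) % 2 = 1 ∧ IsCoprime (g : ℤ) D) := by
        rintro ν hν ⟨h, -⟩
        have h5 : (1 + ν * N' : ℤ) % 2 = 1 := by
          rw [Int.add_emod, Int.mul_emod, hNodd, show ((ν : ℤ)) % 2 = 0 by omega]; rfl
        rw [Int.sub_emod, Int.mul_emod, h5, hD, show (g : ℤ) % 2 = 1 by omega] at h
        simp at h
      rw [hOm.eq_zero (hodd 0 rfl), hOm.eq_zero (hodd 2 rfl),
        hrow (D - g) (fun h => by omega), hrow (D + g) (fun h => by omega)]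
      push_cast
      linear_combination (1 / 4 : ℂ) * h13

end Dual

end PlusPoincare
end

noncomputable section

namespace PlusPoincare

/-! ### Periodicity of the weights and Kloosterman sums -/

theorem thetaRow_four_mul_add {g : ℤ} {D : ℤ} (hD : D % 2 = 1) (k : ℤ) :
    thetaRow (4 * g) (D + 4 * g * k) = thetaRow (4 * g) D := by
  have h : (D + 4 * g * k) % 2 = 1 := by rw [mul_assoc]; omega
  unfold thetaRow
  rw [symb_four_mul _ _ h, symb_four_mul _ _ hD, symb_add_four_mul_mul g D hD,
    eps_congr (d := D + 4 * g * k) (d' := D) (by rw [mul_assoc]; omega)]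

theorem rowWeight_add_mul (lam m : ℤ) (g : ℕ) (D k : ℤ) :
    rowWeight lam m (4 * g) (D + (4 * g : ℕ) * k) = rowWeight lam m (4 * g) D := by
  have hco : IsCoprime ((4 * g : ℕ) : ℤ) (D + (4 * g : ℕ) * k) ↔ IsCoprime ((4 * g : ℕ) : ℤ) D :=
    IsCoprime.add_mul_left_right_iff
  by_cases h : IsCoprime ((4 * g : ℕ) : ℤ) D
  · have hodd : D % 2 = 1 := (isCoprime_four_mul_left (g := g).mp (by push_cast at h; exact h)).1
    rw [rowWeight, if_pos (hco.mpr h), rowWeight, if_pos h]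
    have : ((D + (4 * g : ℕ) * k : ℤ) : ZMod (4 * g)) = (D : ZMod (4 * g)) := by
      rw [Int.cast_add, Int.cast_mul, Int.cast_natCast, ZMod.natCast_self, zero_mul, add_zero]
    rw [this]
    congr 2
    push_cast
    exact thetaRow_four_mul_add hodd k
  · rw [rowWeight_of_not _ _ h, rowWeight_of_not _ _ (mt hco.mp h)]

theorem sum_range_add_int {f : ℤ → ℂ} {q : ℕ} (hf : ∀ x, f (x + q) = f x) (c : ℤ) :
    ∑ v ∈ Finset.range q, f (v + c) = ∑ v ∈ Finset.range q, f v := by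
  have step : ∀ h : ℤ → ℂ, (∀ x, h (x + q) = h x) →
      ∑ v ∈ Finset.range q, h (v + 1) = ∑ v ∈ Finset.range q, h v := by
    intro h hh
    have h1 := Finset.sum_range_succ (fun v : ℕ => h v) q
    have h2 := Finset.sum_range_succ' (fun v : ℕ => h v) q
    have h3 := hh 0
    rw [zero_add] at h3
    push_cast at h2
    rw [h1, h3] at h2
    exact (add_right_cancel h2).symm
  induction c with
  | zero => simp
  | succ k ih =>
    rw [← ih, ← step (fun x => f (x + k)) (fun x => by rw [← hf (x + k)]; congr 1; ring)]
    exact Finset.sum_congr rfl fun v _ => by congr 1; ring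
  | pred k ih =>
    rw [← ih, ← step (fun x => f (x + (-k - 1))) (fun x => by
      rw [← hf (x + (-k - 1))]; congr 1; ring)]
    exact Finset.sum_congr rfl fun v _ => by congr 1; ring

theorem symb_of_coprime {c d : ℤ} (h : IsCoprime c d) : symb c d = 1 ∨ symb c d = -1 := by
  have h1 : Int.gcd c d.natAbs = 1 := by
    rw [Int.isCoprime_iff_gcd_eq_one] at h
    rw [← h, Int.gcd, Int.gcd, Int.natAbs_natCast]
  have := jacobiSym.eq_one_or_neg_one h1
  unfold symb
  split_ifs
  · rcases this with h | h <;> rw [h] <;> simp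
  · exact this

/-- On coprime rows the symbol is ±1, so the sign of its exponent is irrelevant, while ε⁻¹ to the
power -2k is ε^(2k). -/
theorem thetaRow_zpow {c d : ℤ} (h : IsCoprime c d) (lam : ℤ) :
    thetaRow c d ^ (-(2 * lam + 1)) = (symb c d : ℂ) ^ (2 * lam + 1) * eps d ^ (2 * lam + 1) := by
  unfold thetaRow
  rw [mul_zpow, inv_zpow', neg_neg]
  congr 1
  rcases symb_of_coprime h with h | h <;> rw [h] <;> push_cast
  · simp
  · rw [neg_one_zpow_weight]
    exact (Odd.neg_one_zpow ⟨lam, rfl⟩).symm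

theorem kloosterman_eq (lam m n : ℤ) (q : ℕ) :
    kloosterman lam m n q =
      ∑ v ∈ Finset.range q, rowWeight lam m q v * expI ((n : ℂ) * v / q) := by
  rw [kloosterman, Finset.sum_filter]
  refine Finset.sum_congr rfl fun v _ => ?_
  have hiff : Nat.Coprime v q ↔ IsCoprime (q : ℤ) (v : ℤ) := by
    rw [Nat.isCoprime_iff_coprime, Nat.coprime_comm]
  split_ifs with h
  · have h' := hiff.mp h
    rw [rowWeight, if_pos h', thetaRow_zpow h', Int.cast_natCast, mul_assoc, mul_assoc, ← expI_add]
    rw [mul_assoc]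
    congr 3
    ring
  · rw [rowWeight_of_not _ _ (mt hiff.mpr h), zero_mul]

/-- The weight of the row `(4 g, D)` in the projected Poincaré series. -/
def plusWeight (lam m : ℤ) (g : ℕ) (D : ℤ) : ℂ :=
  (1 + (jacobiSym 4 g : ℂ)) * (1 / 2 * rowWeight lam m (4 * g) D +
    1 / 4 * (1 - sgnC lam * Complex.I) * rowWeight lam m (4 * g) (D - g) +
    1 / 4 * (1 + sgnC lam * Complex.I) * rowWeight lam m (4 * g) (D + g))

theorem plusWeight_add_mul (lam m : ℤ) (g : ℕ) (D k : ℤ) :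
    plusWeight lam m g (D + (4 * g : ℕ) * k) = plusWeight lam m g D := by
  unfold plusWeight
  have e1 : D + (4 * g : ℕ) * k - g = D - g + (4 * g : ℕ) * k := by ring
  have e2 : D + (4 * g : ℕ) * k + g = D + g + (4 * g : ℕ) * k := by ring
  rw [e1, e2, rowWeight_add_mul, rowWeight_add_mul, rowWeight_add_mul]

theorem sum_rowWeight_shift (lam m n : ℤ) {g : ℕ} (hg : 0 < g) (c : ℤ) :
    ∑ v ∈ Finset.range (4 * g), rowWeight lam m (4 * g) (v + g * c) *
      expI ((n : ℂ) * v / (4 * g : ℕ)) = Complex.I ^ (-(n * c)) * kloosterman lam m n (4 * g) := by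
  have hg' : (g : ℂ) ≠ 0 := by exact_mod_cast hg.ne'
  have h := sum_range_add_int (q := 4 * g) (f := fun D : ℤ => rowWeight lam m (4 * g) D *
    expI ((n : ℂ) * D / (4 * g : ℕ))) (fun x => by
      have h1 := rowWeight_add_mul lam m g x 1
      rw [mul_one] at h1
      have h2 := expI_div_congr n (q := 4 * g) (by omega) (a := x + (4 * g : ℕ)) (a' := x)
        (by simp [Int.ModEq])
      simp only [h1, h2]) (g * c)
  simp only [Int.cast_natCast] at h
  rw [kloosterman_eq, ← h, Finset.mul_sum]
  refine Finset.sum_congr rfl fun v _ => ?_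
  rw [← expI_div_four, mul_left_comm, ← expI_add]
  congr 2
  push_cast
  field_simp
  ring

/-- A shift of D by ∓g multiplies the n-th exponential sum by i^(±n). The total factor is the
indicator of i^n ∈ {1, σi}: this is where the plus condition on n arises. -/
theorem sum_plusWeight (lam m n : ℤ) {g : ℕ} (hg : 0 < g) [Decidable (PlusIndex lam n)] :
    ∑ v ∈ Finset.range (4 * g), plusWeight lam m g v * expI ((n : ℂ) * v / (4 * g : ℕ)) =
      if PlusIndex lam n then (1 + (jacobiSym 4 g : ℂ)) * kloosterman lam m n (4 * g) else 0 := by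
  have h0 := sum_rowWeight_shift lam m n hg 0
  have h1 := sum_rowWeight_shift lam m n hg (-1)
  have h2 := sum_rowWeight_shift lam m n hg 1
  have hs : sgnC lam ^ 2 = 1 := by rcases sgnC_cases lam with h | h <;> rw [h] <;> norm_num
  have hI2 := Complex.I_sq
  have hinv : Complex.I ^ (-n) = (Complex.I ^ n) ^ 3 := by
    rw [← zpow_natCast, ← zpow_mul]
    exact I_zpow_congr (Int.modEq_iff_dvd.mpr ⟨n, by push_cast; ring⟩)
  simp only [mul_zero, add_zero, neg_zero, zpow_zero, one_mul, mul_one, mul_neg, neg_neg] at h0 h1 h2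
  have hsum : ∑ v ∈ Finset.range (4 * g), plusWeight lam m g v * expI ((n : ℂ) * v / (4 * g : ℕ)) =
      (1 + (jacobiSym 4 g : ℂ)) * (1 / 2 + 1 / 4 * (1 - sgnC lam * Complex.I) * Complex.I ^ n +
        1 / 4 * (1 + sgnC lam * Complex.I) * Complex.I ^ (-n)) * kloosterman lam m n (4 * g) := by
    have e : ∀ v : ℕ, plusWeight lam m g v * expI ((n : ℂ) * v / (4 * g : ℕ)) =
        (1 + (jacobiSym 4 g : ℂ)) * (1 / 2 * (rowWeight lam m (4 * g) v *
          expI ((n : ℂ) * v / (4 * g : ℕ))) +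
        1 / 4 * (1 - sgnC lam * Complex.I) * (rowWeight lam m (4 * g) (v + -g) *
          expI ((n : ℂ) * v / (4 * g : ℕ))) +
        1 / 4 * (1 + sgnC lam * Complex.I) * (rowWeight lam m (4 * g) (v + g) *
          expI ((n : ℂ) * v / (4 * g : ℕ)))) := by
      intro v
      rw [plusWeight, sub_eq_add_neg (v : ℤ)]
      ring
    rw [Finset.sum_congr rfl fun v _ => e v, ← Finset.mul_sum, Finset.sum_add_distrib,
      Finset.sum_add_distrib, ← Finset.mul_sum, ← Finset.mul_sum, ← Finset.mul_sum, h0, h1, h2]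
    ring
  rw [hsum, hinv]
  split_ifs with h
  · have : 1 / 2 + 1 / 4 * (1 - sgnC lam * Complex.I) * Complex.I ^ n +
        1 / 4 * (1 + sgnC lam * Complex.I) * (Complex.I ^ n) ^ 3 = 1 := by
      rcases h.I_zpow with h | h <;> rw [h]
      · ring
      · linear_combination (1 / 4 : ℂ) * (sgnC lam * Complex.I + sgnC lam ^ 2 * Complex.I ^ 2 - 2) *
          (sgnC lam ^ 2 * hI2 - hs)
    rw [this, mul_one]
  · have : 1 / 2 + 1 / 4 * (1 - sgnC lam * Complex.I) * Complex.I ^ n +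
        1 / 4 * (1 + sgnC lam * Complex.I) * (Complex.I ^ n) ^ 3 = 0 := by
      rcases I_zpow_of_not_plusIndex h with h | h <;> rw [h]
      · ring
      · linear_combination (1 / 4 : ℂ) * (2 - sgnC lam * Complex.I - sgnC lam ^ 2 * Complex.I ^ 2) *
          (sgnC lam ^ 2 * hI2 - hs)
    rw [this]; ring

end PlusPoincare
end

noncomputable section

namespace PlusPoincare

open MeasureTheory Set Filter
open scoped FourierTransform

/-! ### Poisson summation for the rows of a fixed modulus -/

/-- A majorant of the Fourier coefficients of the confluent kernel. -/
def kerBound (X : ℝ) (α β : ℂ) (y : ℝ) (n : ℤ) : ℝ :=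
  (∑' j : ℕ, (X * |(n : ℝ)|) ^ j / ((j.factorial : ℝ) * j.factorial)) * ‖𝓕 (hKer α β y) n‖

theorem summable_mul_pow_div_factorial_sq {X : ℝ} (hX : 0 ≤ X) (n : ℤ) :
    Summable fun j : ℕ => (X * |(n : ℝ)|) ^ j / ((j.factorial : ℝ) * j.factorial) := by
  have := summable_pow_div_factorial_mul_factorial (X * |(n : ℝ)|)
  rwa [abs_of_nonneg (by positivity)] at this

/-- The ₀F₁ majorant grows in n, but its j-th term is beaten by the decay of ĥ of order j + 2. Since
(j + 2)! ≤ 2·4^j j!, one factorial is left in the denominator and the sum over j is bounded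
independently of n. -/
theorem exists_sq_mul_kerBound_le {X y : ℝ} (hX : 0 ≤ X) (hy : 0 < y) {α β : ℂ}
    (hb : 1 < (α + β).re) : ∃ K : ℝ, ∀ n : ℤ, (n : ℝ) ^ 2 * kerBound X α β y n ≤ K := by
  set R := ‖α‖ + ‖β‖ + 1 with hR
  have hα : ‖α‖ + 1 ≤ R := by linarith [norm_nonneg β]
  have hβ : ‖β‖ + 1 ≤ R := by linarith [norm_nonneg α]
  have hR0 : 0 ≤ R := by positivity
  set J := ∫ u, ‖hKer α β y u‖
  have hJ : 0 ≤ J := integral_nonneg fun _ => norm_nonneg _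
  set c : ℕ → ℝ := fun j => (2 * (2 * R / y) ^ 2 * J) * ((4 * (X * (2 * R / y))) ^ j / j.factorial)
  have hc : Summable c := (Real.summable_pow_div_factorial _).mul_left _
  refine ⟨∑' j, c j, fun n => ?_⟩
  have hs := summable_mul_pow_div_factorial_sq hX n
  rw [kerBound, ← tsum_mul_right, ← tsum_mul_left]
  refine Summable.tsum_le_tsum (fun j => ?_) ((hs.mul_right _).mul_left _) hc
  -- Of the j + 2 derivatives, j absorb the power |n|^j of the series and two provide the factor n².
  have h := norm_pow_mul_fourier_hKer_le hy hb hα hβ (j + 2) n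
  have hpi : |(n : ℝ)| ^ (j + 2) ≤ (2 * Real.pi * |(n : ℝ)|) ^ (j + 2) := by
    gcongr
    nlinarith [Real.pi_gt_three, abs_nonneg (n : ℝ)]
  have h2 : |(n : ℝ)| ^ (j + 2) * ‖𝓕 (hKer α β y) n‖ ≤ (2 * R / y) ^ (j + 2) * (j + 2).factorial * J :=
    (mul_le_mul_of_nonneg_right hpi (norm_nonneg _)).trans h
  have hf : (0 : ℝ) < j.factorial := by exact_mod_cast j.factorial_pos
  have hfac : ((j + 2).factorial : ℝ) ≤ 2 * 4 ^ j * j.factorial := by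
    rw [Nat.factorial_succ, Nat.factorial_succ]
    push_cast
    have a1 := natCast_add_one_le_two_pow j
    have a2 := natCast_add_one_le_two_pow (j + 1)
    push_cast at a2
    have e : (4 : ℝ) ^ j = 2 ^ j * 2 ^ j := by rw [← mul_pow]; norm_num
    rw [e, pow_succ] at *
    have : ((j : ℝ) + 1 + 1) * (j + 1) ≤ (2 ^ j * 2) * 2 ^ j := by gcongr
    calc ((j : ℝ) + 1 + 1) * ((j + 1) * j.factorial) = ((j : ℝ) + 1 + 1) * (j + 1) * j.factorial := by ring
      _ ≤ (2 ^ j * 2) * 2 ^ j * j.factorial := by gcongr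
      _ = _ := by ring
  calc (n : ℝ) ^ 2 * ((X * |(n : ℝ)|) ^ j / ((j.factorial : ℝ) * j.factorial) * ‖𝓕 (hKer α β y) n‖)
      = X ^ j / ((j.factorial : ℝ) * j.factorial) *
        (|(n : ℝ)| ^ (j + 2) * ‖𝓕 (hKer α β y) n‖) := by
        rw [← sq_abs (n : ℝ), mul_pow, pow_add]; ring
    _ ≤ X ^ j / ((j.factorial : ℝ) * j.factorial) *
        ((2 * R / y) ^ (j + 2) * (2 * 4 ^ j * j.factorial) * J) := by
        refine mul_le_mul_of_nonneg_left (h2.trans ?_) (by positivity)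
        gcongr
    _ = c j := by
        simp only [c, mul_pow, pow_add]
        field_simp

theorem summable_kerBound {X y : ℝ} (hX : 0 ≤ X) (hy : 0 < y) {α β : ℂ} (hb : 1 < (α + β).re) :
    Summable (kerBound X α β y) := by
  obtain ⟨K, hK⟩ := exists_sq_mul_kerBound_le hX hy hb
  refine Summable.of_norm_bounded_eventually (g := fun n : ℤ => K * (1 / (n : ℝ) ^ 2))
    ((Real.summable_one_div_int_pow.mpr one_lt_two).mul_left K) ?_
  refine ((Set.finite_singleton (0 : ℤ)).subset fun n hn => ?_)
  by_contra h0
  refine hn ?_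
  have hn0 : (n : ℝ) ≠ 0 := by exact_mod_cast h0
  have h2 : 0 < (n : ℝ) ^ 2 := by positivity
  have hnn : 0 ≤ kerBound X α β y n := by
    refine mul_nonneg (tsum_nonneg fun j => by positivity) (norm_nonneg _)
  change ‖kerBound X α β y n‖ ≤ _
  rw [Real.norm_of_nonneg hnn, mul_one_div, le_div_iff₀ h2, mul_comm]
  exact hK n

theorem norm_hypF01_mul_fourier_le {X y : ℝ} {α β : ℂ} (hb : 1 ≤ (α + β).re) {A : ℂ}
    (hA : 2 * Real.pi * ‖A‖ ≤ X) (n : ℤ) :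
    ‖hypF01 (α + β) (2 * Real.pi * Complex.I * A * n) * 𝓕 (hKer α β y) n‖ ≤ kerBound X α β y n := by
  rw [norm_mul, kerBound]
  refine mul_le_mul_of_nonneg_right (norm_hypF01_le hb ?_) (norm_nonneg _)
  rw [norm_mul, norm_mul, norm_mul, norm_mul, Complex.norm_I, Complex.norm_intCast,
    Complex.norm_of_nonneg Real.pi_pos.le, Complex.norm_ofNat, mul_one]
  gcongr

theorem norm_confKer_le_rpow {y : ℝ} (hy : 0 < y) {α β : ℂ} (hb : 1 ≤ (α + β).re) {L : ℝ} (A : ℂ)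
    (hA : ‖A‖ ≤ L) (u : ℝ) :
    ‖confKer A α β y u‖ ≤ Real.exp (L * (2 * (‖α‖ + ‖β‖ + 1) / y)) *
      Real.exp (Real.pi * (‖α‖ + ‖β‖)) ^ 2 * ‖(y : ℂ) + Complex.I * u‖ ^ (-(α + β).re) := by
  have h1 := norm_confKer_le hy hb (R := ‖α‖ + ‖β‖ + 1) (by linarith [norm_nonneg β])
    (by linarith [norm_nonneg α]) A u
  have h2 := norm_hKer_le hy (α := α) (β := β) (K := ‖α‖ + ‖β‖)
    ((Complex.abs_im_le_norm α).trans (by linarith [norm_nonneg β]))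
    ((Complex.abs_im_le_norm β).trans (by linarith [norm_nonneg α])) u
  refine h1.trans ?_
  rw [mul_assoc]
  gcongr

theorem confKer_isBigO {y : ℝ} (hy : 0 < y) {α β : ℂ} (hb : 1 ≤ (α + β).re) (A : ℂ) :
    (confKer A α β y) =O[cocompact ℝ] fun u : ℝ => |u| ^ (-(α + β).re) := by
  refine Asymptotics.IsBigO.of_bound (Real.exp (‖A‖ * (2 * (‖α‖ + ‖β‖ + 1) / y)) *
      Real.exp (Real.pi * (‖α‖ + ‖β‖)) ^ 2) ?_
  have h0 : ∀ᶠ u : ℝ in cocompact ℝ, u ≠ 0 := by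
    have := (isCompact_singleton (x := (0 : ℝ))).compl_mem_cocompact
    filter_upwards [this] with u hu using hu
  filter_upwards [h0] with u hu
  refine (norm_confKer_le_rpow hy hb A le_rfl u).trans ?_
  refine mul_le_mul_of_nonneg_left ?_ (by positivity)
  refine le_trans ?_ (le_abs_self _)
  refine Real.rpow_le_rpow_of_nonpos (abs_pos.mpr hu) ?_ (by linarith)
  have := Complex.abs_im_le_norm ((y : ℂ) + Complex.I * u)
  simpa using this

theorem tsum_confKer_add_int {y : ℝ} (hy : 0 < y) {α β : ℂ} (hb : 1 < (α + β).re) (A : ℂ) (x : ℝ) :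
    ∑' l : ℤ, confKer A α β y (x + l) =
      ∑' n : ℤ, hypF01 (α + β) (2 * Real.pi * Complex.I * A * n) * 𝓕 (hKer α β y) n *
        expI ((n : ℂ) * x) := by
  have hF : ∀ n : ℤ, 𝓕 (confKer A α β y) n =
      hypF01 (α + β) (2 * Real.pi * Complex.I * A * n) * 𝓕 (hKer α β y) n := fun n => by
    rw [fourier_confKer hy hb]; push_cast; rfl
  have hsum : Summable fun n : ℤ => 𝓕 (confKer A α β y) n := by
    refine Summable.of_norm_bounded (summable_kerBound (X := 2 * Real.pi * ‖A‖) (by positivity) hy hb)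
      fun n => ?_
    rw [hF]
    exact norm_hypF01_mul_fourier_le hb.le le_rfl n
  rw [Real.tsum_eq_tsum_fourier_of_rpow_decay_of_summable (continuous_confKer hy hb.le A) hb
    (confKer_isBigO hy hb.le A) hsum]
  refine tsum_congr fun n => ?_
  rw [hF, fourier_coe_apply, expI]
  congr 2
  push_cast; ring

theorem summable_mul_fourier_expI {y : ℝ} (hy : 0 < y) {α β : ℂ} (hb : 1 < (α + β).re) (A : ℂ)
    (x : ℝ) : Summable fun n : ℤ =>
      hypF01 (α + β) (2 * Real.pi * Complex.I * A * n) * 𝓕 (hKer α β y) n * expI ((n : ℂ) * x) := by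
  refine Summable.of_norm_bounded (summable_kerBound (X := 2 * Real.pi * ‖A‖) (by positivity) hy hb)
      fun n => ?_
  have : ‖expI ((n : ℂ) * x)‖ = 1 := by
    rw [expI, show 2 * (Real.pi : ℂ) * Complex.I * ((n : ℂ) * x) =
      ((2 * Real.pi * n * x : ℝ) : ℂ) * Complex.I by push_cast; ring, Complex.norm_exp_ofReal_mul_I]
  rw [norm_mul, this, mul_one]
  exact norm_hypF01_mul_fourier_le hb.le le_rfl n

/-- Poisson summation for a weight that is periodic modulo `q`. -/
theorem tsum_periodic_mul_confKer {y : ℝ} (hy : 0 < y) {α β : ℂ} (hb : 1 < (α + β).re) (A : ℂ)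
    (x : ℝ) {q : ℕ} (hq : 0 < q) {f : ℤ → ℂ} (hf : ∀ D k : ℤ, f (D + q * k) = f D)
    (hs : Summable fun D : ℤ => f D * confKer A α β y (x + D / q)) :
    ∑' D : ℤ, f D * confKer A α β y (x + D / q) =
      ∑' n : ℤ, hypF01 (α + β) (2 * Real.pi * Complex.I * A * n) * 𝓕 (hKer α β y) n *
        expI ((n : ℂ) * x) * ∑ v ∈ Finset.range q, f v * expI ((n : ℂ) * v / q) := by
  have : NeZero q := ⟨hq.ne'⟩
  have hq' : (q : ℝ) ≠ 0 := by exact_mod_cast hq.ne'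
  -- Write D = v + ql: the weight sees only v, and the kernel is translated by the integer l, over
  -- which ordinary Poisson summation is applied.
  have e1 : ∀ p : ℤ × Fin q, f ((Int.divModEquiv q).symm p) *
      confKer A α β y (x + ((Int.divModEquiv q).symm p : ℤ) / q) =
      f (p.2 : ℕ) * confKer A α β y (x + (p.2 : ℕ) / q + p.1) := by
    intro p
    have h1 : (Int.divModEquiv q).symm p = ((p.2 : ℕ) : ℤ) + q * p.1 := by
      change p.1 * (q : ℤ) + ((p.2 : ℕ) : ℤ) = _
      ring
    rw [h1, hf]
    congr 2
    push_cast
    field_simp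
    ring
  have hs' : Summable fun p : ℤ × Fin q => f (p.2 : ℕ) *
      confKer A α β y (x + (p.2 : ℕ) / q + p.1) := by
    have := (Int.divModEquiv q).symm.summable_iff.mpr hs
    refine this.congr fun p => ?_
    exact e1 p
  have hcomm : Summable fun p : Fin q × ℤ => f ((Equiv.prodComm (Fin q) ℤ p).2 : ℕ) *
      confKer A α β y (x + ((Equiv.prodComm (Fin q) ℤ p).2 : ℕ) / q +
        (Equiv.prodComm (Fin q) ℤ p).1) := (Equiv.prodComm (Fin q) ℤ).summable_iff.mpr hs'
  rw [← (Int.divModEquiv q).symm.tsum_eq, tsum_congr e1,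
    ← (Equiv.prodComm (Fin q) ℤ).tsum_eq, Summable.tsum_prod hcomm, tsum_fintype]
  simp only [Equiv.prodComm_apply, Prod.fst_swap, Prod.snd_swap, Prod.swap]
  have e2 : ∀ v : Fin q, ∑' l : ℤ, f (v : ℕ) * confKer A α β y (x + (v : ℕ) / q + l) =
      ∑' n : ℤ, hypF01 (α + β) (2 * Real.pi * Complex.I * A * n) * 𝓕 (hKer α β y) n *
        expI ((n : ℂ) * x) * (f (v : ℕ) * expI ((n : ℂ) * (v : ℕ) / q)) := by
    intro v
    rw [tsum_mul_left, tsum_confKer_add_int hy hb, ← tsum_mul_left]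
    refine tsum_congr fun n => ?_
    have : expI ((n : ℂ) * ((x + (v : ℕ) / q : ℝ) : ℂ)) =
        expI ((n : ℂ) * x) * expI ((n : ℂ) * (v : ℕ) / q) := by
      rw [← expI_add]; congr 1; push_cast; ring
    rw [this]; ring
  have e3 : ∀ v : Fin q, Summable fun n : ℤ =>
      hypF01 (α + β) (2 * Real.pi * Complex.I * A * n) * 𝓕 (hKer α β y) n *
        expI ((n : ℂ) * x) * (f (v : ℕ) * expI ((n : ℂ) * (v : ℕ) / q)) := by
    intro v
    refine ((summable_mul_fourier_expI hy hb A (x + (v : ℕ) / q)).mul_left (f (v : ℕ))).congr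
      fun n => ?_
    have : expI ((n : ℂ) * ((x + (v : ℕ) / q : ℝ) : ℂ)) =
        expI ((n : ℂ) * x) * expI ((n : ℂ) * (v : ℕ) / q) := by
      rw [← expI_add]; congr 1; push_cast; ring
    rw [this]; ring
  rw [Finset.sum_congr rfl fun v _ => e2 v, ← Summable.tsum_finsetSum fun v _ => e3 v]
  refine tsum_congr fun n => ?_
  rw [← Finset.mul_sum, Finset.sum_range fun v : ℕ => f v * expI ((n : ℂ) * v / q)]

end PlusPoincare
end

noncomputable section

namespace PlusPoincare

open MeasureTheory Set Filter
open scoped FourierTransform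

/-! ### The Bessel factor and the Fourier coefficients of the kernel -/

theorem Gamma_add_natCast_eq_poch {b : ℂ} (hb : ∀ j : ℕ, b + j ≠ 0) (j : ℕ) :
    Complex.Gamma (b + j) = poch b j * Complex.Gamma b := by
  induction j with
  | zero => simp
  | succ j ih =>
    have : b + ((j + 1 : ℕ) : ℂ) = b + j + 1 := by push_cast; ring
    rw [this, Complex.Gamma_add_one _ (hb j), ih, poch_succ]
    ring

theorem besselJ_eq {b : ℂ} (hb : ∀ j : ℕ, b + j ≠ 0) (x : ℝ) :
    besselJ (b - 1) x = ((x : ℂ) / 2) ^ (b - 1) * (Complex.Gamma b)⁻¹ *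
      hypF01 b (-((x : ℂ) / 2) ^ 2) := by
  rw [besselJ, hypF01, mul_assoc, ← tsum_mul_left (a := (Complex.Gamma b)⁻¹)]
  congr 1
  refine tsum_congr fun j => ?_
  have : b - 1 + j + 1 = b + j := by ring
  rw [this, Gamma_add_natCast_eq_poch hb, neg_pow (((x : ℂ) / 2) ^ 2), ← pow_mul]
  simp only [div_eq_mul_inv, mul_inv]
  ring

theorem besselI_eq {b : ℂ} (hb : ∀ j : ℕ, b + j ≠ 0) (x : ℝ) :
    besselI (b - 1) x = ((x : ℂ) / 2) ^ (b - 1) * (Complex.Gamma b)⁻¹ *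
      hypF01 b (((x : ℂ) / 2) ^ 2) := by
  rw [besselI, hypF01, mul_assoc, ← tsum_mul_left (a := (Complex.Gamma b)⁻¹)]
  congr 1
  refine tsum_congr fun j => ?_
  have : b - 1 + j + 1 = b + j := by ring
  rw [this, Gamma_add_natCast_eq_poch hb, ← pow_mul]
  simp only [div_eq_mul_inv, mul_inv]
  ring

theorem hypF01_zero (b : ℂ) : hypF01 b 0 = 1 := by
  rw [hypF01, tsum_eq_single 0]
  · simp
  · intro j hj; simp [hj]

/-- The factor of the Bessel term that does not depend on the modulus. -/
def besselConst (m n : ℤ) (k s : ℂ) : ℂ :=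
  if m * n ≠ 0 then
    ((|(m * n : ℝ)| : ℝ) : ℂ) ^ (s - k / 2) * ((2 * Real.pi : ℝ) : ℂ) ^ (2 * s - 1) *
      (Complex.Gamma (2 * s))⁻¹
  else if m + n ≠ 0 then
    (2 : ℂ) ^ (k - 1) * (Real.pi : ℂ) ^ (s + k / 2 - 1) * ((|(m + n : ℝ)| : ℝ) : ℂ) ^ (s - k / 2)
  else (2 : ℂ) ^ (2 * k - 2) * (Real.pi : ℂ) ^ (k - 1) * Complex.Gamma (2 * s) *
    (2 : ℂ) ^ (1 - 2 * s)

theorem ofReal_cpow_eq_exp {r : ℝ} (hr : 0 < r) (w : ℂ) :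
    (r : ℂ) ^ w = Complex.exp (Real.log r * w) := by
  rw [Complex.cpow_def_of_ne_zero (by exact_mod_cast hr.ne'), Complex.ofReal_log hr.le]

theorem bessel_power_eq (k s : ℂ) {M q : ℝ} (hM : 0 < M) (hq : 0 < q) :
    (M : ℂ) ^ ((1 - k) / 2) * ((2 * Real.pi * Real.sqrt M / q : ℝ) : ℂ) ^ (2 * s - 1) =
      (M : ℂ) ^ (s - k / 2) * ((2 * Real.pi : ℝ) : ℂ) ^ (2 * s - 1) * (q : ℂ) ^ (1 - 2 * s) := by
  have hs : 0 < Real.sqrt M := Real.sqrt_pos.mpr hM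
  have h2 : (0 : ℝ) < 2 * Real.pi := by positivity
  rw [ofReal_cpow_eq_exp hM, ofReal_cpow_eq_exp hM, ofReal_cpow_eq_exp h2, ofReal_cpow_eq_exp hq,
    ofReal_cpow_eq_exp (by positivity), Real.log_div (by positivity) hq.ne',
    Real.log_mul h2.ne' hs.ne', Real.log_sqrt hM.le, ← Complex.exp_add, ← Complex.exp_add,
    ← Complex.exp_add]
  congr 1
  push_cast
  ring

/-- All four cases are a constant times q^(1-2s) times ₀F₁(2s; -4π²mn/q²). The sign of mn in the
argument separates J from I, and for mn = 0 the series is 1. -/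
theorem besselFactor_eq (m n : ℤ) (k : ℂ) {s : ℂ} (hs : 0 < s.re) {q : ℕ} (hq : 0 < q) :
    besselFactor m n k s q = besselConst m n k s * (q : ℂ) ^ (1 - 2 * s) *
      hypF01 (2 * s) (2 * Real.pi * Complex.I * (2 * Real.pi * Complex.I * m / (q : ℂ) ^ 2) * n) := by
  have hb : ∀ j : ℕ, 2 * s + j ≠ 0 := fun j => add_natCast_ne_zero_of_re_pos (by simpa using hs) j
  have hq' : (0 : ℝ) < q := by exact_mod_cast hq
  have hqc : (q : ℂ) ≠ 0 := by exact_mod_cast hq.ne'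
  have hx : ∀ M : ℝ, (((4 * Real.pi * Real.sqrt M / q : ℝ) : ℂ) / 2) =
      ((2 * Real.pi * Real.sqrt M / q : ℝ) : ℂ) := fun M => by push_cast; ring
  have hx2 : ∀ M : ℝ, 0 ≤ M → (((2 * Real.pi * Real.sqrt M / q : ℝ) : ℂ)) ^ 2 =
      4 * Real.pi ^ 2 * (M : ℂ) / (q : ℂ) ^ 2 := fun M hM => by
    have := Real.sq_sqrt hM
    have h' : ((Real.sqrt M : ℝ) : ℂ) ^ 2 = M := by exact_mod_cast this
    push_cast
    rw [div_pow, mul_pow, mul_pow, h']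
    ring
  have hX : 2 * (Real.pi : ℂ) * Complex.I * (2 * Real.pi * Complex.I * m / (q : ℂ) ^ 2) * n =
      -(4 * Real.pi ^ 2 * ((m * n : ℝ) : ℂ) / (q : ℂ) ^ 2) := by
    push_cast
    linear_combination (4 * (Real.pi : ℂ) ^ 2 * m * n / (q : ℂ) ^ 2) * Complex.I_sq
  have hqpow : ∀ w : ℂ, (q : ℂ) ^ w = ((q : ℝ) : ℂ) ^ w := fun w => by rw [Complex.ofReal_natCast]
  rw [hX]
  unfold besselFactor besselConst
  rcases lt_trichotomy (m * n) 0 with h | h | h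
  · have hr : (m * n : ℝ) < 0 := by exact_mod_cast h
    have hM : 0 < |(m * n : ℝ)| := abs_pos.mpr hr.ne
    rw [if_neg (by omega), if_pos h, if_pos h.ne, besselI_eq hb, hx, hx2 _ hM.le,
      ← mul_assoc, ← mul_assoc, bessel_power_eq k s hM hq', abs_of_neg hr, hqpow]
    have : 4 * (Real.pi : ℂ) ^ 2 * ((-(m * n : ℝ) : ℝ) : ℂ) / (q : ℂ) ^ 2 =
      -(4 * Real.pi ^ 2 * ((m * n : ℝ) : ℂ) / (q : ℂ) ^ 2) := by push_cast; ring
    rw [this]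
    ring
  · have hr : (m * n : ℝ) = 0 := by exact_mod_cast h
    have h0 : -(4 * (Real.pi : ℂ) ^ 2 * ((m * n : ℝ) : ℂ) / (q : ℂ) ^ 2) = 0 := by
      rw [hr]; simp
    rw [h0, hypF01_zero, if_neg (show ¬ 0 < m * n by omega), if_neg (show ¬ m * n < 0 by omega),
      if_neg (show ¬ m * n ≠ 0 by omega)]
    split_ifs
    · ring
    · have h2 : (2 * (q : ℂ)) ^ (1 - 2 * s) = (2 : ℂ) ^ (1 - 2 * s) * (q : ℂ) ^ (1 - 2 * s) := by
        have := Complex.mul_cpow_ofReal_nonneg (zero_le_two (α := ℝ)) hq'.le (1 - 2 * s)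
        simpa using this
      rw [h2]; ring
  · have hr : (0 : ℝ) < (m * n : ℝ) := by exact_mod_cast h
    have hM : 0 < |(m * n : ℝ)| := abs_pos.mpr hr.ne'
    rw [if_pos h, if_pos h.ne', besselJ_eq hb, hx, hx2 _ hM.le,
      ← mul_assoc, ← mul_assoc, bessel_power_eq k s hM hq', abs_of_pos hr, hqpow]
    ring

/-- The powers in the `n`-th coefficient, for `n ≠ 0`. -/
theorem coefficient_power_eq (m lam : ℤ) (s : ℂ) {n : ℤ} (hn : n ≠ 0) {y : ℝ} (hy : 0 < y) :
    2 * Real.pi * besselConst m n (wt lam) s * (((|(n : ℝ)| : ℝ) : ℂ) ^ (wt lam / 2 - 1) *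
      ((4 * Real.pi * y : ℝ) : ℂ) ^ (-wt lam / 2) * ((4 * Real.pi * |(n : ℝ)| * y : ℝ) : ℂ) ^ s) =
    mConst m lam s * (y : ℂ) ^ (s - wt lam / 2) *
      (2 * Real.pi * ((2 * Real.pi * |(n : ℝ)| : ℝ) : ℂ) ^ (2 * s - 1)) := by
  have hN : 0 < |(n : ℝ)| := by simpa using hn
  have hpi := Real.pi_pos
  set k := wt lam
  have l4 : Real.log 4 = 2 * Real.log 2 := by
    rw [show (4 : ℝ) = 2 ^ 2 by norm_num, Real.log_pow]; norm_num
  have lN : ((4 * Real.pi * |(n : ℝ)| * y : ℝ) : ℂ) ^ s = Complex.exp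
      ((2 * Real.log 2 + Real.log Real.pi + Real.log |(n : ℝ)| + Real.log y) * s) := by
    rw [ofReal_cpow_eq_exp (by positivity), Real.log_mul (by positivity) hy.ne',
      Real.log_mul (by positivity) hN.ne', Real.log_mul (by norm_num) hpi.ne', l4]
    push_cast; rfl
  have ly : ((4 * Real.pi * y : ℝ) : ℂ) ^ (-k / 2) = Complex.exp
      ((2 * Real.log 2 + Real.log Real.pi + Real.log y) * (-k / 2)) := by
    rw [ofReal_cpow_eq_exp (by positivity), Real.log_mul (by positivity) hy.ne',
      Real.log_mul (by norm_num) hpi.ne', l4]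
    push_cast; rfl
  have l2N : ((2 * Real.pi * |(n : ℝ)| : ℝ) : ℂ) ^ (2 * s - 1) = Complex.exp
      ((Real.log 2 + Real.log Real.pi + Real.log |(n : ℝ)|) * (2 * s - 1)) := by
    rw [ofReal_cpow_eq_exp (by positivity), Real.log_mul (by positivity) hN.ne',
      Real.log_mul (by norm_num) hpi.ne']
    push_cast; rfl
  rw [lN, ly, l2N, ofReal_cpow_eq_exp hN, ofReal_cpow_eq_exp hy]
  unfold besselConst mConst
  by_cases hm : m = 0
  · subst hm
    have e2 : (2 : ℂ) * (2 : ℂ) ^ (k - 1) = Complex.exp (Real.log 2 * k) := by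
      have := ofReal_cpow_eq_exp two_pos (k - 1)
      push_cast at this
      rw [this]
      nth_rw 1 [show (2 : ℂ) = Complex.exp (Real.log 2) by
        rw [← Complex.ofReal_exp, Real.exp_log two_pos]; norm_num]
      rw [← Complex.exp_add]; congr 1; push_cast; ring
    have epi : (Real.pi : ℂ) * (Real.pi : ℂ) ^ (s + k / 2 - 1) =
        Complex.exp (Real.log Real.pi * (s + k / 2)) := by
      rw [ofReal_cpow_eq_exp hpi]
      nth_rw 1 [show (Real.pi : ℂ) = Complex.exp (Real.log Real.pi) by
        rw [← Complex.ofReal_exp, Real.exp_log hpi]]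
      rw [← Complex.exp_add]; congr 1; ring
    have e2pi : (2 : ℂ) * Real.pi = Complex.exp (Real.log 2 + Real.log Real.pi) := by
      rw [Complex.exp_add, ← Complex.ofReal_exp, ← Complex.ofReal_exp, Real.exp_log two_pos,
        Real.exp_log hpi]; norm_num
    have hn' : (0 : ℤ) + n ≠ 0 := by simpa using hn
    rw [if_neg (by simp), if_pos hn', if_pos rfl]
    have habs : |(((0 : ℤ) : ℝ) + (n : ℝ))| = |(n : ℝ)| := by simp
    rw [habs, ofReal_cpow_eq_exp hN]
    calc _ = ((2 : ℂ) * (2 : ℂ) ^ (k - 1)) * ((Real.pi : ℂ) * (Real.pi : ℂ) ^ (s + k / 2 - 1)) *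
          (Complex.exp (Real.log |(n : ℝ)| * (s - k / 2)) *
          (Complex.exp (Real.log |(n : ℝ)| * (k / 2 - 1)) * Complex.exp
      ((2 * Real.log 2 + Real.log Real.pi + Real.log y) * (-k / 2)) * Complex.exp
      ((2 * Real.log 2 + Real.log Real.pi + Real.log |(n : ℝ)| + Real.log y) * s))) := by ring
      _ = _ := by
        rw [e2, epi, e2pi]
        simp only [← Complex.exp_add, one_mul]
        congr 1
        ring
  · have hM : 0 < |(m : ℝ)| := by simpa using hm
    rw [if_pos (mul_ne_zero hm hn), if_neg hm, abs_mul]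
    have l1 : ((|(m : ℝ)| * |(n : ℝ)| : ℝ) : ℂ) ^ (s - k / 2) = Complex.exp
        ((Real.log |(m : ℝ)| + Real.log |(n : ℝ)|) * (s - k / 2)) := by
      rw [ofReal_cpow_eq_exp (by positivity), Real.log_mul hM.ne' hN.ne']
      push_cast; rfl
    have l2 : ((2 * Real.pi : ℝ) : ℂ) ^ (2 * s - 1) = Complex.exp
        ((Real.log 2 + Real.log Real.pi) * (2 * s - 1)) := by
      rw [ofReal_cpow_eq_exp (by positivity), Real.log_mul (by norm_num) hpi.ne']
      push_cast; rfl
    have l3 : ((4 * Real.pi * |(m : ℝ)| : ℝ) : ℂ) ^ (s - k / 2) = Complex.exp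
        ((2 * Real.log 2 + Real.log Real.pi + Real.log |(m : ℝ)|) * (s - k / 2)) := by
      rw [ofReal_cpow_eq_exp (by positivity), Real.log_mul (by positivity) hM.ne',
        Real.log_mul (by norm_num) hpi.ne', l4]
      push_cast; rfl
    rw [l1, l2, l3]
    have key : ∀ a b c d e f g h i j : ℂ, a + b + c + d + e = f + g + h →
        2 * i * (Complex.exp a * Complex.exp b * j) * (Complex.exp c * Complex.exp d * Complex.exp e) =
        j * Complex.exp f * Complex.exp g * (2 * i * Complex.exp h) := by
      intro a b c d e f g h i j habc
      have e1 : Complex.exp a * Complex.exp b * Complex.exp c * Complex.exp d * Complex.exp e =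
          Complex.exp f * Complex.exp g * Complex.exp h := by
        simp only [← Complex.exp_add, habc]
      linear_combination (2 * i * j) * e1
    refine key _ _ _ _ _ _ _ _ _ _ ?_
    ring

/-- The factor 2s - 1 in 𝓦₀ comes from Γ(2s) = (2s - 1)Γ(2s - 1). What remains is a comparison of
exponents of 2, π, |m| and y after taking logarithms. -/
theorem coefficient_power_zero (m lam : ℤ) {s : ℂ} (hs : 1 < s.re) {y : ℝ} (hy : 0 < y) :
    2 * Real.pi * besselConst m 0 (wt lam) s *
      (((4 * Real.pi : ℝ) : ℂ) ^ (1 - wt lam) * (y : ℂ) ^ (1 - s - wt lam / 2) / (2 * s - 1)) =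
    mConst m lam s * (y : ℂ) ^ (s - wt lam / 2) *
      (2 * Real.pi * Complex.Gamma (2 * s - 1) * ((2 * y : ℝ) : ℂ) ^ (1 - 2 * s)) := by
  have hpi := Real.pi_pos
  set k := wt lam
  have l4 : Real.log 4 = 2 * Real.log 2 := by
    rw [show (4 : ℝ) = 2 ^ 2 by norm_num, Real.log_pow]; norm_num
  have h2s : (2 * s - 1) ≠ 0 := by
    intro h
    have := congrArg Complex.re h
    simp at this
    linarith
  have hG : Complex.Gamma (2 * s) = (2 * s - 1) * Complex.Gamma (2 * s - 1) := by
    rw [← Complex.Gamma_add_one _ h2s]; congr 1; ring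
  have hG0 : Complex.Gamma (2 * s - 1) ≠ 0 := Complex.Gamma_ne_zero_of_re_pos (by
    simp; linarith)
  have e2 : (2 : ℂ) = Complex.exp (Real.log 2) := by
    rw [← Complex.ofReal_exp, Real.exp_log two_pos]; norm_num
  have epi : (Real.pi : ℂ) = Complex.exp (Real.log Real.pi) := by
    rw [← Complex.ofReal_exp, Real.exp_log hpi]
  have p2 : ∀ w : ℂ, (2 : ℂ) ^ w = Complex.exp (Real.log 2 * w) := fun w => by
    have := ofReal_cpow_eq_exp two_pos w
    simpa using this
  have l1 : ((4 * Real.pi : ℝ) : ℂ) ^ (1 - k) = Complex.exp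
      ((2 * Real.log 2 + Real.log Real.pi) * (1 - k)) := by
    rw [ofReal_cpow_eq_exp (by positivity), Real.log_mul (by norm_num) hpi.ne', l4]
    push_cast; rfl
  have l2 : ((2 * y : ℝ) : ℂ) ^ (1 - 2 * s) = Complex.exp
      ((Real.log 2 + Real.log y) * (1 - 2 * s)) := by
    rw [ofReal_cpow_eq_exp (by positivity), Real.log_mul (by norm_num) hy.ne']
    push_cast; rfl
  rw [l1, l2, ofReal_cpow_eq_exp hy, ofReal_cpow_eq_exp hy]
  unfold besselConst mConst
  rw [if_neg (by simp)]
  by_cases hm : m = 0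
  · subst hm
    rw [if_neg (by simp), if_pos rfl, p2, p2, ofReal_cpow_eq_exp hpi, hG]
    have key : ∀ a b c d e f g i G w : ℂ, w ≠ 0 → a + b + c + d + e = f + g →
        i * (Complex.exp a * Complex.exp b * (w * G) * Complex.exp c) *
          (Complex.exp d * Complex.exp e / w) =
        1 * Complex.exp f * (i * G * Complex.exp g) := by
      intro a b c d e f g i G w hw habc
      have e1 : Complex.exp a * Complex.exp b * Complex.exp c * Complex.exp d * Complex.exp e =
          Complex.exp f * Complex.exp g := by
        simp only [← Complex.exp_add, habc]
      field_simp
      linear_combination (i * G) * e1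
    refine key _ _ _ _ _ _ _ _ _ _ h2s ?_
    ring
  · have hM : 0 < |(m : ℝ)| := by simpa using hm
    have hm' : m + 0 ≠ 0 := by simpa using hm
    rw [if_pos hm', if_neg hm, p2, ofReal_cpow_eq_exp hpi, hG]
    have habs : |((m : ℝ) + ((0 : ℤ) : ℝ))| = |(m : ℝ)| := by simp
    have l3 : ((4 * Real.pi * |(m : ℝ)| : ℝ) : ℂ) ^ (s - k / 2) = Complex.exp
        ((2 * Real.log 2 + Real.log Real.pi + Real.log |(m : ℝ)|) * (s - k / 2)) := by
      rw [ofReal_cpow_eq_exp (by positivity), Real.log_mul (by positivity) hM.ne',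
        Real.log_mul (by norm_num) hpi.ne', l4]
      push_cast; rfl
    rw [habs, l3, ofReal_cpow_eq_exp hM]
    have key : ∀ a b c d e f g h i G w : ℂ, w ≠ 0 → G ≠ 0 → a + b + c + d + e = f + g + h →
        i * (Complex.exp a * Complex.exp b * Complex.exp c) *
          (Complex.exp d * Complex.exp e / w) =
        (w * G)⁻¹ * Complex.exp f * Complex.exp g * (i * G * Complex.exp h) := by
      intro a b c d e f g h i G w hw hG' habc
      have e1 : Complex.exp a * Complex.exp b * Complex.exp c * Complex.exp d * Complex.exp e =
          Complex.exp f * Complex.exp g * Complex.exp h := by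
        simp only [← Complex.exp_add, habc]
      field_simp
      linear_combination i * e1
    refine key _ _ _ _ _ _ _ _ _ _ _ h2s hG0 ?_
    ring

end PlusPoincare
end

/-! ### Fourier coefficients of the kernel in terms of 𝓦, and bounds for the weights. -/

noncomputable section

namespace PlusPoincare

open MeasureTheory Set Filter
open scoped FourierTransform

/-- If 2s is an integer then 4(s ± k/2) is odd, because 2k is odd, so it cannot equal -4j. This
meets the pole condition in `fourier_hKer_pos`. -/
theorem wt_half_not_pole {lam : ℤ} {s : ℂ} (h : ∃ n : ℤ, 2 * s = n) (j : ℕ) :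
    s + wt lam / 2 ≠ -j ∧ s - wt lam / 2 ≠ -j := by
  obtain ⟨n, hn⟩ := h
  constructor
  · intro h
    have h2 : (2 : ℂ) * n + 2 * lam + 1 + 4 * j = 0 := by
      unfold wt at h
      linear_combination 4 * h - 2 * hn
    have h3 : 2 * n + 2 * lam + 1 + 4 * j = 0 := by exact_mod_cast h2
    omega
  · intro h
    have h2 : (2 : ℂ) * n - 2 * lam - 1 + 4 * j = 0 := by
      unfold wt at h
      linear_combination 4 * h - 2 * hn
    have h3 : 2 * n - 2 * lam - 1 + 4 * j = 0 := by exact_mod_cast h2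
    omega

/-- The `n`-th Fourier coefficient of the kernel is `𝓦_{n,k}(y, s)` up to the constants. -/
theorem two_pi_mul_besselConst_mul_calW (m lam : ℤ) {s : ℂ} (hs : 1 < s.re) (n : ℤ) {y : ℝ}
    (hy : 0 < y) :
    2 * Real.pi * besselConst m n (wt lam) s * calW n (wt lam) y s =
      mConst m lam s * (y : ℂ) ^ (s - wt lam / 2) *
        𝓕 (hKer (s + wt lam / 2) (s - wt lam / 2) y) n := by
  have h2s : 2 < (2 * s).re := by simp; linarith
  have eα : 2 * s - (s - wt lam / 2) = s + wt lam / 2 := by ring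
  have eβ : 2 * s - (s + wt lam / 2) = s - wt lam / 2 := by ring
  have hW : ∀ (a : ℂ) (N : ℝ), whittakerW a (s - 1 / 2) (4 * Real.pi * N * y) =
      Complex.exp (-(y * (2 * Real.pi * N : ℝ))) * ((4 * Real.pi * N * y : ℝ) : ℂ) ^ s *
        kummerU (s - a) (2 * s) ((2 * y * (2 * Real.pi * N) : ℝ) : ℂ) := by
    intro a N
    have e1 : s - 1 / 2 + 1 / 2 = s := by ring
    have e2 : s - 1 / 2 - a + 1 / 2 = s - a := by ring
    have e3 : 1 + 2 * (s - 1 / 2) = 2 * s := by ring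
    rw [whittakerW, e1, e2, e3]
    congr 2
    · congr 1; push_cast; ring
    · push_cast; ring
  rcases lt_trichotomy n 0 with h | h | h
  · have hn : (n : ℝ) < 0 := by exact_mod_cast h
    have habs : |(n : ℝ)| = -n := abs_of_neg hn
    have hpos : 0 < |(n : ℝ)| := abs_pos.mpr hn.ne
    have hF := fourier_hKer_pos (b := 2 * s) h2s (a := s + wt lam / 2) (fun h j => by
      rw [eβ]; exact (wt_half_not_pole h j).2) hy hpos
    rw [eβ] at hF
    have hF' : 𝓕 (hKer (s + wt lam / 2) (s - wt lam / 2) y) n =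
        𝓕 (hKer (s - wt lam / 2) (s + wt lam / 2) y) |(n : ℝ)| := by
      rw [← fourier_hKer_neg, habs]
    have hp := coefficient_power_eq m lam s h.ne hy
    rw [hF', hF, calW, if_neg h.ne, hW, Int.sign_eq_neg_one_of_neg h]
    have e1 : s + wt lam / 2 * ((-1 : ℤ) : ℂ) = s - wt lam / 2 := by push_cast; ring
    have e2 : s - wt lam / 2 * ((-1 : ℤ) : ℂ) = s + wt lam / 2 := by push_cast; ring
    rw [e1, e2]
    linear_combination (Complex.exp (-(y * (2 * Real.pi * |(n : ℝ)| : ℝ))) *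
      (Complex.Gamma (s - wt lam / 2))⁻¹ *
      kummerU (s + wt lam / 2) (2 * s) ((2 * y * (2 * Real.pi * |(n : ℝ)|) : ℝ) : ℂ)) * hp
  · subst h
    have hF := fourier_hKer_zero (b := 2 * s) h2s (s - wt lam / 2) hy
    rw [eα] at hF
    have hp := coefficient_power_zero m lam hs hy
    rw [Int.cast_zero, hF, calW, if_pos rfl]
    simp only [div_eq_mul_inv, mul_inv] at hp ⊢
    linear_combination ((Complex.Gamma (s - wt lam * 2⁻¹))⁻¹ *
      (Complex.Gamma (s + wt lam * 2⁻¹))⁻¹) * hp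
  · have hn : (0 : ℝ) < n := by exact_mod_cast h
    have habs : |(n : ℝ)| = n := abs_of_pos hn
    have hF := fourier_hKer_pos (b := 2 * s) h2s (a := s - wt lam / 2) (fun h j => by
      rw [eα]; exact (wt_half_not_pole h j).1) hy hn
    rw [eα] at hF
    have hp := coefficient_power_eq m lam s h.ne' hy
    rw [hF, calW, if_neg h.ne', hW, Int.sign_eq_one_of_pos h]
    rw [habs] at hp ⊢
    have e1 : s + wt lam / 2 * ((1 : ℤ) : ℂ) = s + wt lam / 2 := by push_cast; ring
    have e2 : s - wt lam / 2 * ((1 : ℤ) : ℂ) = s - wt lam / 2 := by push_cast; ring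
    rw [e1, e2]
    linear_combination (Complex.exp (-(y * (2 * Real.pi * (n : ℝ) : ℝ))) *
      (Complex.Gamma (s + wt lam / 2))⁻¹ *
      kummerU (s - wt lam / 2) (2 * s) ((2 * y * (2 * Real.pi * (n : ℝ)) : ℝ) : ℂ)) * hp

/-- The constant in front of the confluent kernel for the modulus `q`. -/
def rowConst (m lam : ℤ) (s : ℂ) (y : ℝ) (q : ℕ) : ℂ :=
  mConst m lam s * (y : ℂ) ^ (s - wt lam / 2) * (q : ℂ) ^ (-(2 * s)) * Complex.I ^ (-wt lam)

/-- The parameter of the confluent kernel for the modulus `q`. -/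
def rowParam (m : ℤ) (q : ℕ) : ℂ := 2 * Real.pi * Complex.I * m / (q : ℂ) ^ 2

theorem besselFactor_div_mul_calW (m lam : ℤ) {s : ℂ} (hs : 1 < s.re) (n : ℤ) {y : ℝ}
    (hy : 0 < y) {q : ℕ} (hq : 0 < q) :
    2 * Real.pi * Complex.I ^ (-wt lam) * (besselFactor m n (wt lam) s q / q) * calW n (wt lam) y s =
      rowConst m lam s y q * (hypF01 (2 * s) (2 * Real.pi * Complex.I * rowParam m q * n) *
        𝓕 (hKer (s + wt lam / 2) (s - wt lam / 2) y) n) := by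
  have hqc : (q : ℂ) ≠ 0 := by exact_mod_cast hq.ne'
  have h := two_pi_mul_besselConst_mul_calW m lam hs n hy
  rw [besselFactor_eq m n (wt lam) (by linarith) hq, rowConst, rowParam]
  have hpow : (q : ℂ) ^ (1 - 2 * s) = (q : ℂ) ^ (-(2 * s)) * q := by
    rw [sub_eq_neg_add, Complex.cpow_add _ _ hqc, Complex.cpow_one]
  rw [hpow]
  set X := hypF01 (2 * s) (2 * Real.pi * Complex.I * (2 * Real.pi * Complex.I * m / (q : ℂ) ^ 2) * n)
  have e : besselConst m n (wt lam) s * ((q : ℂ) ^ (-(2 * s)) * q) * X / q =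
      besselConst m n (wt lam) s * (q : ℂ) ^ (-(2 * s)) * X := by field_simp
  rw [e]
  linear_combination (Complex.I ^ (-wt lam) * (q : ℂ) ^ (-(2 * s)) * X) * h

theorem norm_rowParam_le (m : ℤ) {q : ℕ} (hq : 0 < q) : ‖rowParam m q‖ ≤ 2 * Real.pi * |(m : ℝ)| := by
  have h1 : (1 : ℝ) ≤ (q : ℝ) ^ 2 := one_le_pow₀ (by exact_mod_cast hq)
  rw [rowParam, norm_div, norm_mul, norm_mul, norm_mul, Complex.norm_I, Complex.norm_intCast,
    Complex.norm_of_nonneg Real.pi_pos.le, Complex.norm_ofNat, mul_one, norm_pow,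
    Complex.norm_natCast]
  exact div_le_self (by positivity) h1

theorem norm_natCast_cpow {q : ℕ} (hq : 0 < q) (w : ℂ) : ‖(q : ℂ) ^ w‖ = (q : ℝ) ^ w.re := by
  rw [← Complex.ofReal_natCast, Complex.norm_cpow_eq_rpow_re_of_pos (by exact_mod_cast hq)]

theorem norm_eps (d : ℤ) : ‖eps d‖ = 1 := by
  unfold eps; split_ifs <;> simp

theorem norm_expI_ofReal (x : ℝ) : ‖expI x‖ = 1 := by
  rw [expI, show 2 * (Real.pi : ℂ) * Complex.I * (x : ℂ) =
      ((2 * Real.pi * x : ℝ) : ℂ) * Complex.I by push_cast; ring, Complex.norm_exp_ofReal_mul_I]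

theorem norm_thetaRow {c d : ℤ} (h : IsCoprime c d) : ‖thetaRow c d‖ = 1 := by
  unfold thetaRow
  rw [norm_mul, norm_inv, norm_eps]
  rcases symb_of_coprime h with h | h <;> rw [h] <;> simp

theorem norm_rowWeight_le (lam m : ℤ) (q : ℕ) (D : ℤ) : ‖rowWeight lam m q D‖ ≤ 1 := by
  by_cases h : IsCoprime (q : ℤ) D
  · rw [rowWeight, if_pos h, norm_mul, norm_zpow, norm_thetaRow h, one_zpow, one_mul]
    have := norm_expI_ofReal ((m : ℝ) * (((D : ZMod q)⁻¹).val : ℕ) / q)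
    push_cast at this
    exact this.le
  · rw [rowWeight_of_not _ _ h]; simp

theorem norm_sgnC (lam : ℤ) : ‖sgnC lam‖ = 1 := by
  rcases sgnC_cases lam with h | h <;> rw [h] <;> simp

theorem norm_one_add_jacobiSym_le (g : ℕ) : ‖(1 + (jacobiSym 4 g : ℂ))‖ ≤ 2 := by
  refine (norm_add_le _ _).trans ?_
  rcases jacobiSym.trichotomy 4 g with h | h | h <;> rw [h] <;> norm_num

theorem norm_plusWeight_le (lam m : ℤ) (g : ℕ) (D : ℤ) : ‖plusWeight lam m g D‖ ≤ 4 := by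
  have h1 : ‖(1 : ℂ) - sgnC lam * Complex.I‖ ≤ 2 := by
    refine (norm_sub_le _ _).trans ?_
    rw [norm_mul, norm_sgnC, Complex.norm_I]; norm_num
  have h2 : ‖(1 : ℂ) + sgnC lam * Complex.I‖ ≤ 2 := by
    refine (norm_add_le _ _).trans ?_
    rw [norm_mul, norm_sgnC, Complex.norm_I]; norm_num
  have a1 := norm_rowWeight_le lam m (4 * g) D
  have a2 := norm_rowWeight_le lam m (4 * g) (D - g)
  have a3 := norm_rowWeight_le lam m (4 * g) (D + g)
  have a4 := norm_one_add_jacobiSym_le g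
  unfold plusWeight
  rw [norm_mul]
  have h3 : ‖1 / 2 * rowWeight lam m (4 * g) D +
        1 / 4 * (1 - sgnC lam * Complex.I) * rowWeight lam m (4 * g) (D - g) +
        1 / 4 * (1 + sgnC lam * Complex.I) * rowWeight lam m (4 * g) (D + g)‖ ≤ 2 := by
    refine (norm_add₃_le).trans ?_
    rw [norm_mul, norm_mul, norm_mul, norm_mul, norm_mul]
    have e1 : ‖(1 / 2 : ℂ)‖ = 1 / 2 := by norm_num
    have e2 : ‖(1 / 4 : ℂ)‖ = 1 / 4 := by norm_num
    rw [e1, e2]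
    nlinarith [norm_nonneg (rowWeight lam m (4 * g) D), norm_nonneg (rowWeight lam m (4 * g) (D - g)),
      norm_nonneg (rowWeight lam m (4 * g) (D + g)), norm_nonneg ((1 : ℂ) - sgnC lam * Complex.I),
      norm_nonneg ((1 : ℂ) + sgnC lam * Complex.I)]
  calc _ ≤ (2 : ℝ) * 2 := mul_le_mul a4 h3 (norm_nonneg _) (by norm_num)
    _ = 4 := by norm_num

/-- The trivial bound suffices: against q^(-2 Re s) it leaves q^(1 - 2 Re s), summable for Re s > 1.
-/
theorem norm_kloosterman_le (lam m n : ℤ) (q : ℕ) : ‖kloosterman lam m n q‖ ≤ q := by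
  rw [kloosterman_eq]
  refine (norm_sum_le _ _).trans ?_
  refine (Finset.sum_le_sum (g := fun _ => (1 : ℝ)) fun v _ => ?_).trans (by simp)
  rw [norm_mul]
  have := norm_expI_ofReal ((n : ℝ) * v / q)
  push_cast at this
  rw [this, mul_one]
  exact norm_rowWeight_le lam m q v

end PlusPoincare
end

noncomputable section

namespace PlusPoincare

open MeasureTheory Set Filter

/-! ### Rows and cosets -/

open Classical in
/-- The value of the slashed function on the matrices with the bottom row `(c, d)`, and `0` if
there are none. -/
def rowTerm (m lam : ℤ) (s : ℂ) (z : ℍ) (c d : ℤ) : ℂ :=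
  if h : IsCoprime c d then slash lam (phi m lam s) (h.exists_SL2_row 1).choose z else 0

theorem mul_inv_mem_GammaInf {γ δ : SL(2, ℤ)} :
    γ * δ⁻¹ ∈ GammaInf ↔ γ 1 0 * δ 1 1 = γ 1 1 * δ 1 0 := by
  change (γ * δ⁻¹) 1 0 = 0 ↔ _
  have e : (γ * δ⁻¹) 1 0 = γ 1 0 * δ 1 1 - γ 1 1 * δ 1 0 := by
    rw [Matrix.SpecialLinearGroup.coe_mul, Matrix.SpecialLinearGroup.coe_inv,
      Matrix.adjugate_fin_two]
    simp [Matrix.mul_apply, Fin.sum_univ_two]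
    ring
  rw [e, sub_eq_zero]

theorem isCoprime_row (γ : SL(2, ℤ)) : IsCoprime (γ 1 0) (γ 1 1) := by
  have hdet := Matrix.det_fin_two (γ : Matrix (Fin 2) (Fin 2) ℤ)
  rw [γ.det_coe] at hdet
  exact ⟨-γ 0 1, γ 0 0, by linarith⟩

theorem rowTerm_eq_slash (m lam : ℤ) (s : ℂ) (z : ℍ) (γ : SL(2, ℤ)) (hγ : (4 : ℤ) ∣ γ 1 0) :
    rowTerm m lam s z (γ 1 0) (γ 1 1) = slash lam (phi m lam s) γ z := by
  have h := isCoprime_row γ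
  rw [rowTerm, dif_pos h]
  obtain ⟨h0, h1⟩ := (h.exists_SL2_row 1).choose_spec
  set ρ := (h.exists_SL2_row 1).choose
  have hδ : ρ * γ⁻¹ ∈ GammaInf := by
    rw [mul_inv_mem_GammaInf, h0, h1]; ring
  have := slash_phi_eq_of_coset m lam s z (ρ * γ⁻¹) γ hδ hγ
  rwa [inv_mul_cancel_right] at this

theorem rowTerm_of_not (m lam : ℤ) (s : ℂ) (z : ℍ) {c d : ℤ} (h : ¬ IsCoprime c d) :
    rowTerm m lam s z c d = 0 := by
  rw [rowTerm, dif_neg h]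

theorem rowTerm_neg (m lam : ℤ) (s : ℂ) (z : ℍ) {c : ℤ} (hc : (4 : ℤ) ∣ c) (d : ℤ) :
    rowTerm m lam s z (-c) (-d) = rowTerm m lam s z c d := by
  by_cases h : IsCoprime c d
  · obtain ⟨γ, h0, h1⟩ := h.exists_SL2_row 1
    have e1 := rowTerm_eq_slash m lam s z γ (by rwa [h0])
    have e2 := rowTerm_eq_slash m lam s z (-γ) (by simpa [h0] using hc)
    have e3 := slash_phi_eq_of_coset m lam s z (-γ * γ⁻¹) γ
      (by rw [mul_inv_mem_GammaInf]; simp; ring) (by rwa [h0])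
    rw [inv_mul_cancel_right] at e3
    rw [e3, ← e1] at e2
    simpa [h0, h1] using e2
  · rw [rowTerm_of_not _ _ _ _ h, rowTerm_of_not]
    rwa [IsCoprime.neg_neg_iff]

theorem isCoprime_mul_zero {q : ℤ} (d : ℤ) (h : IsCoprime (q * 0) d) : d = 1 ∨ d = -1 := by
  rw [mul_zero, isCoprime_zero_left] at h
  exact Int.isUnit_iff.mp h

/-- The normalised rows: one from each pair `±(N c, d)`. -/
abbrev NormRow (N : ℕ) : Type :=
  {p : ℤ × ℤ // IsCoprime ((N : ℤ) * p.1) p.2 ∧ (0 < p.1 ∨ p = (0, 1))}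

/-- The coset of a normalised row. -/
def NormRow.coset {N : ℕ} (p : NormRow N) : Cosets N :=
  Quotient.mk _ ⟨(p.2.1.exists_SL2_row 1).choose, by
    rw [CongruenceSubgroup.Gamma0_mem, (p.2.1.exists_SL2_row 1).choose_spec.1]
    simp⟩

theorem NormRow.coset_eq_iff {N : ℕ} (p : NormRow N) (γ : CongruenceSubgroup.Gamma0 N) :
    p.coset = Quotient.mk _ γ ↔
      (N : ℤ) * p.1.1 * (γ : SL(2, ℤ)) 1 1 = p.1.2 * (γ : SL(2, ℤ)) 1 0 := by
  have h := (p.2.1.exists_SL2_row 1).choose_spec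
  rw [NormRow.coset, eq_comm, Quotient.eq]
  change QuotientGroup.rightRel _ _ _ ↔ _
  rw [QuotientGroup.rightRel_apply, Subgroup.mem_subgroupOf]
  rw [Subgroup.coe_mul, Subgroup.coe_inv, mul_inv_mem_GammaInf, h.1, h.2]

theorem Gamma0_lower_left {N : ℕ} (γ : CongruenceSubgroup.Gamma0 N) :
    ∃ c : ℤ, (γ : SL(2, ℤ)) 1 0 = N * c := by
  have := CongruenceSubgroup.Gamma0_mem.mp γ.2
  rw [ZMod.intCast_zmod_eq_zero_iff_dvd] at this
  exact this

/-- Two cosets agree when their rows are proportional. Proportional coprime rows differ by a sign,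
and the normalisation keeps one row from each pair. -/
theorem NormRow.coset_bijective {N : ℕ} (hN : 0 < N) :
    Function.Bijective (NormRow.coset (N := N)) := by
  have hN' : (0 : ℤ) < N := by exact_mod_cast hN
  constructor
  · rintro ⟨⟨c, d⟩, hp⟩ ⟨⟨c', d'⟩, hp'⟩ h
    have h2 := (NormRow.coset_eq_iff _ _).mp (h.trans rfl)
    rw [(hp'.1.exists_SL2_row 1).choose_spec.1, (hp'.1.exists_SL2_row 1).choose_spec.2] at h2
    simp only at h2 hp hp'
    have e : c * d' = d * c' := by
      have : (N : ℤ) * (c * d') = N * (d * c') := by linarith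
      exact mul_left_cancel₀ hN'.ne' this
    obtain ⟨hco, hp⟩ := hp
    obtain ⟨hco', hp'⟩ := hp'
    have hc : IsCoprime c d := hco.of_mul_left_right
    have hc' : IsCoprime c' d' := hco'.of_mul_left_right
    rw [Subtype.mk.injEq, Prod.mk.injEq]
    rcases hp with hp | hp <;> rcases hp' with hp' | hp'
    · have d1 : c ∣ c' := hc.dvd_of_dvd_mul_left (by rw [← e]; exact dvd_mul_right _ _)
      have d2 : c' ∣ c := hc'.dvd_of_dvd_mul_right (by rw [e]; exact dvd_mul_left _ _)
      have e1 : c = c' := Int.dvd_antisymm hp.le hp'.le d1 d2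
      subst e1
      refine ⟨rfl, ?_⟩
      rw [mul_comm] at e
      exact (mul_right_cancel₀ hp.ne' e).symm
    · simp only [Prod.mk.injEq] at hp'
      rw [hp'.1, hp'.2] at e
      simp at e; omega
    · simp only [Prod.mk.injEq] at hp
      rw [hp.1, hp.2] at e
      simp at e; omega
    · simp only [Prod.mk.injEq] at hp hp'
      exact ⟨hp.1.trans hp'.1.symm, hp.2.trans hp'.2.symm⟩
  · intro q
    induction q using Quotient.inductionOn with
    | _ γ =>
    obtain ⟨c, hc⟩ := Gamma0_lower_left γ
    have hco := isCoprime_row (γ : SL(2, ℤ))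
    rw [hc] at hco
    rcases lt_trichotomy c 0 with h | h | h
    · refine ⟨⟨(-c, -(γ : SL(2, ℤ)) 1 1), ?_, Or.inl (by simpa using h)⟩, ?_⟩
      · simpa [IsCoprime.neg_neg_iff] using hco
      · rw [NormRow.coset_eq_iff, hc]; ring
    · refine ⟨⟨(0, 1), isCoprime_one_right, Or.inr rfl⟩, ?_⟩
      rw [NormRow.coset_eq_iff, hc, h]; ring
    · refine ⟨⟨(c, (γ : SL(2, ℤ)) 1 1), hco, Or.inl h⟩, ?_⟩
      rw [NormRow.coset_eq_iff, hc]; ring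

theorem poincareTerm_coset (m lam : ℤ) {N : ℕ} (hN : 4 ∣ N) (s : ℂ) (z : ℍ) (p : NormRow N) :
    poincareTerm m lam N s z p.coset = rowTerm m lam s z (N * p.1.1) p.1.2 := by
  have h4 : (4 : ℤ) ∣ N := by exact_mod_cast hN
  set γ := Quotient.out p.coset with hγ
  have h1 : p.coset = Quotient.mk _ γ := (Quotient.out_eq _).symm
  rw [NormRow.coset_eq_iff] at h1
  obtain ⟨ρ, h0, h2⟩ := p.2.1.exists_SL2_row 1
  have hδ : (γ : SL(2, ℤ)) * ρ⁻¹ ∈ GammaInf := by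
    rw [mul_inv_mem_GammaInf, h0, h2]; linarith
  have e := slash_phi_eq_of_coset m lam s z _ ρ hδ (by rw [h0]; exact h4.mul_right _)
  rw [inv_mul_cancel_right] at e
  have e2 := rowTerm_eq_slash m lam s z ρ (by rw [h0]; exact h4.mul_right _)
  rw [h0, h2] at e2
  rw [e2, ← e]; rfl

/-! ### Sums over pairs of integers -/

theorem hasSum_nonneg_part {f : ℤ × ℤ → ℂ} {a : ℂ}
    (hf : HasSum (fun p : ℕ+ × ℤ => f ((p.1 : ℕ), p.2)) a) :
    HasSum ({p : ℤ × ℤ | 0 < p.1 ∨ p = (0, 1)}.indicator f) (f (0, 1) + a) := by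
  classical
  set i : ℕ+ × ℤ → ℤ × ℤ := fun p => (((p.1 : ℕ) : ℤ), p.2) with hi
  have hinj : Function.Injective i := by
    rintro ⟨a, b⟩ ⟨c, d⟩ h
    simp only [hi, Prod.mk.injEq, Nat.cast_inj, PNat.coe_inj] at h
    exact Prod.ext h.1 h.2
  have h1 : HasSum ({p : ℤ × ℤ | 0 < p.1}.indicator f) a := by
    rw [← hinj.hasSum_iff]
    · convert! hf using 1
      ext p
      simp [Set.indicator, hi]
    · rintro ⟨c, d⟩ hx
      rw [Set.indicator_of_notMem]
      intro hc
      simp only [Set.mem_ofPred_eq] at hc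
      exact hx ⟨(⟨c.toNat, by omega⟩, d), by simp [hi]; omega⟩
  have h2 : HasSum (fun p : ℤ × ℤ => if p = (0, 1) then f p else 0) (f (0, 1)) := by
    have := hasSum_ite_eq ((0, 1) : ℤ × ℤ) (f (0, 1))
    convert! this using 2
    split_ifs with h <;> simp [h]
  convert! h2.add h1 using 1
  ext ⟨c, d⟩
  by_cases h : 0 < c
  · have : ¬ ((c, d) = ((0, 1) : ℤ × ℤ)) := by simp; omega
    simp [Set.indicator, h, this]
  · by_cases h' : (c, d) = ((0, 1) : ℤ × ℤ)
    · simp only [Prod.mk.injEq] at h'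
      simp [Set.indicator, h'.1, h'.2]
    · simp [Set.indicator, h]

theorem indicator_add_neg {f : ℤ × ℤ → ℂ} (heven : ∀ p, f (-p) = f p)
    (h0 : ∀ d, d ≠ 1 → d ≠ -1 → f (0, d) = 0) (p : ℤ × ℤ) :
    f p = {p : ℤ × ℤ | 0 < p.1 ∨ p = (0, 1)}.indicator f p +
      {p : ℤ × ℤ | 0 < p.1 ∨ p = (0, 1)}.indicator f (-p) := by
  obtain ⟨c, d⟩ := p
  have he := heven (c, d)
  rw [Prod.neg_mk] at he ⊢
  simp only [Set.indicator, Set.mem_ofPred_eq, Prod.mk.injEq, he]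
  rcases lt_trichotomy c 0 with h | h | h
  · rw [if_neg (by omega), if_pos (by omega), zero_add]
  · subst h
    by_cases h1 : d = 1
    · subst h1; simp
    · by_cases h2 : d = -1
      · subst h2; simp
      · rw [h0 d h1 h2]; simp
  · rw [if_pos (by omega), if_neg (by omega), add_zero]

/-- Sums over all of ℤ × ℤ, counting each row twice, are preferred because transport by B A_ν is a
bijection there but does not respect the normalisation of signs. -/
theorem hasSum_even {f : ℤ × ℤ → ℂ} (heven : ∀ p, f (-p) = f p)
    (h0 : ∀ d, d ≠ 1 → d ≠ -1 → f (0, d) = 0) {a : ℂ}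
    (hf : HasSum ({p : ℤ × ℤ | 0 < p.1 ∨ p = (0, 1)}.indicator f) a) : HasSum f (2 * a) := by
  have h2 := (Equiv.neg (ℤ × ℤ)).hasSum_iff.mpr hf
  have h3 := hf.add h2
  rw [two_mul]
  exact h3.congr_fun (indicator_add_neg heven h0)

end PlusPoincare
end

noncomputable section

namespace PlusPoincare

open MeasureTheory Set Filter

/-! ### The row terms as values of the kernel -/

/-- Principal roots multiply if the arguments add up to a value in (-π, π]. With Im Q ≥ 0 the sum
exceeds -π, and a sum above π would have non-positive sine, contradicting Im(PQ) > 0. It is used for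
the cocycle of B A_ν, with P and Q the two denominators. -/
theorem sqrt_mul_sqrt {P Q : ℂ} (hP : P ≠ 0) (hQ : 0 ≤ Q.im) (hPQ : 0 < (P * Q).im) :
    P ^ (1 / 2 : ℂ) * Q ^ (1 / 2 : ℂ) = (P * Q) ^ (1 / 2 : ℂ) := by
  have hQ0 : Q ≠ 0 := by rintro rfl; simp at hPQ
  have h1 := Complex.arg_mem_Ioc P
  have h2 := Complex.arg_nonneg_iff.mpr hQ
  have h3 := Complex.arg_le_pi Q
  have him : (P * Q).im = ‖P‖ * ‖Q‖ * Real.sin (P.arg + Q.arg) := by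
    rw [Real.sin_add, Complex.mul_im]
    rw [show ‖P‖ * ‖Q‖ * (Real.sin P.arg * Real.cos Q.arg + Real.cos P.arg * Real.sin Q.arg) =
      (‖P‖ * Real.sin P.arg) * (‖Q‖ * Real.cos Q.arg) +
        (‖P‖ * Real.cos P.arg) * (‖Q‖ * Real.sin Q.arg) by ring]
    simp only [Complex.norm_mul_cos_arg, Complex.norm_mul_sin_arg]
    ring
  have hmem : P.arg + Q.arg ∈ Set.Ioc (-Real.pi) Real.pi := by
    refine ⟨by linarith [h1.1], ?_⟩
    by_contra hlt
    have hs : Real.sin (P.arg + Q.arg) ≤ 0 := by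
      rw [← Real.sin_sub_two_pi]
      refine Real.sin_nonpos_of_nonpos_of_neg_pi_le ?_ ?_
      · linarith [h1.2]
      · linarith
    have : (P * Q).im ≤ 0 := by
      rw [him]
      exact mul_nonpos_of_nonneg_of_nonpos (by positivity) hs
    linarith
  rw [Complex.cpow_def_of_ne_zero hP, Complex.cpow_def_of_ne_zero hQ0,
    Complex.cpow_def_of_ne_zero (mul_ne_zero hP hQ0), ← Complex.exp_add,
    (Complex.log_mul_eq_add_log_iff hP hQ0).mpr hmem]
  congr 1; ring

/-- For c ≠ 0, γz = a/c - 1/(c(cz + d)). The real translation r = a/c contributes only e(mr), and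
the rest is the row kernel. -/
theorem sqrt_zpow_mul_phi (m lam : ℤ) (s : ℂ) {C y : ℝ} (hC : 0 < C) (hy : 0 < y) (u r : ℝ) {τ : ℍ}
    (hτ : (τ : ℂ) = r - 1 / (C * (C * (u + y * Complex.I)))) :
    (((C : ℂ) * (u + y * Complex.I)) ^ (1 / 2 : ℂ)) ^ (-(2 * lam + 1)) * phi m lam s τ =
      expI (m * r) * rowKer m lam s C y u := by
  have hn : 0 < u ^ 2 + y ^ 2 := by positivity
  have hw : (u : ℂ) + y * Complex.I ≠ 0 := by
    intro h
    have := congrArg Complex.im h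
    simp at this; exact hy.ne' this
  have hCc : (C : ℂ) ≠ 0 := by exact_mod_cast hC.ne'
  have hnc : (u : ℂ) ^ 2 + (y : ℂ) ^ 2 ≠ 0 := by exact_mod_cast hn.ne'
  have e : (τ : ℂ) = ((r - u / (C ^ 2 * (u ^ 2 + y ^ 2)) : ℝ) : ℂ) +
      ((y / (C ^ 2 * (u ^ 2 + y ^ 2)) : ℝ) : ℂ) * Complex.I := by
    rw [hτ]
    push_cast
    field_simp
    ring_nf
    rw [Complex.I_sq]; ring
  have him : τ.im = y / (C ^ 2 * (u ^ 2 + y ^ 2)) := by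
    rw [← UpperHalfPlane.coe_im, e]
    simp only [Complex.add_im, Complex.mul_im, Complex.ofReal_im, Complex.ofReal_re, Complex.I_im,
      Complex.I_re]
    ring
  have hre : τ.re = r - u / (C ^ 2 * (u ^ 2 + y ^ 2)) := by
    rw [← UpperHalfPlane.coe_re, e]
    simp only [Complex.add_re, Complex.mul_re, Complex.ofReal_im, Complex.ofReal_re, Complex.I_im,
      Complex.I_re]
    ring
  rw [phi, him, hre, rowKer]
  have : (m : ℂ) * ((r - u / (C ^ 2 * (u ^ 2 + y ^ 2)) : ℝ) : ℂ) =
      m * r + -(m * ((u / (C ^ 2 * (u ^ 2 + y ^ 2)) : ℝ) : ℂ)) := by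
    push_cast; ring
  rw [this, expI_add]
  ring

theorem coe_smul_eq_sub (γ : SL(2, ℤ)) (h : γ 1 0 ≠ 0) (z : ℍ) :
    ((γ • z : ℍ) : ℂ) = (γ 0 0 : ℂ) / γ 1 0 - 1 / (γ 1 0 * (γ 1 0 * z + γ 1 1)) := by
  have hdet := Matrix.det_fin_two (γ : Matrix (Fin 2) (Fin 2) ℤ)
  rw [γ.det_coe] at hdet
  have hd : (1 : ℂ) = γ 0 0 * γ 1 1 - γ 0 1 * γ 1 0 := by exact_mod_cast hdet
  have h0 : (γ 1 0 : ℂ) ≠ 0 := by exact_mod_cast h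
  have h1 : (γ 1 0 : ℂ) * z + γ 1 1 ≠ 0 := by
    intro h2
    have := congrArg Complex.im h2
    simp at this
    exact this.elim h z.im_ne_zero
  rw [UpperHalfPlane.coe_specialLinearGroup_apply]
  simp only [eq_intCast, Complex.ofReal_intCast]
  rw [hd]
  have h2 : (z : ℂ) * γ 1 0 + γ 1 1 ≠ 0 := by rwa [mul_comm]
  field_simp
  ring

theorem mul_coe_add_eq (z : ℍ) {q : ℝ} (hq : q ≠ 0) (D : ℝ) :
    (q : ℂ) * z + D = q * (((z.re + D / q : ℝ) : ℂ) + z.im * Complex.I) := by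
  have hq' : (q : ℂ) ≠ 0 := by exact_mod_cast hq
  have hz : (z : ℂ) = z.re + z.im * Complex.I := (Complex.re_add_im (z : ℂ)).symm
  rw [hz]
  push_cast
  field_simp
  ring

theorem rowTerm_eq_rowKer (m lam : ℤ) (s : ℂ) (z : ℍ) {q : ℕ} (hq : 0 < q) (h4 : 4 ∣ q) (D : ℤ) :
    rowTerm m lam s z q D =
      rowWeight lam m q D * rowKer m lam s q z.im (z.re + D / q) := by
  by_cases h : IsCoprime (q : ℤ) D
  · obtain ⟨γ, h0, h1⟩ := h.exists_SL2_row 1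
    have e := rowTerm_eq_slash m lam s z γ (by rw [h0]; exact_mod_cast h4)
    have hqR : (0 : ℝ) < q := by exact_mod_cast hq
    have hdet := Matrix.det_fin_two (γ : Matrix (Fin 2) (Fin 2) ℤ)
    rw [γ.det_coe, h0, h1] at hdet
    rw [h0, h1] at e
    have hτ := coe_smul_eq_sub γ (by rw [h0]; exact_mod_cast hq.ne') z
    have hm := mul_coe_add_eq z hqR.ne' D
    rw [h0, h1] at hτ
    simp only [Complex.ofReal_natCast, Complex.ofReal_intCast] at hm
    simp only [Int.cast_natCast] at hτ
    rw [hm] at hτ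
    have key := sqrt_zpow_mul_phi m lam s hqR z.im_pos (z.re + D / q) (γ 0 0 / q) (τ := γ • z)
      (by rw [hτ]; push_cast; rfl)
    rw [e, slash, autJ, jRow, h0, h1, rowWeight_eq lam m hq.ne' (a := γ 0 0)
      ((Int.modEq_iff_dvd).mpr ⟨-γ 0 1, by linarith⟩), thetaRow, mul_zpow]
    simp only [Int.cast_natCast]
    rw [hm]
    have e2 : expI ((m : ℂ) * ((γ 0 0 / q : ℝ) : ℂ)) = expI ((m : ℂ) * (γ 0 0 : ℂ) / q) := by
      congr 1; push_cast; ring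
    rw [← e2]
    simp only [Complex.ofReal_natCast] at key
    rw [mul_assoc, key]; ring
  · rw [rowTerm_of_not _ _ _ _ h, rowWeight_of_not _ _ h, zero_mul]

/-! ### Absolute convergence over the rows -/

theorem summable_norm_row {σ : ℝ} (hσ : 2 < σ) {N : ℕ} (hN : 0 < N) (z : ℍ) :
    Summable fun p : ℤ × ℤ => ‖((N * p.1 : ℤ) : ℂ) * z + p.2‖ ^ (-σ) := by
  set w : ℍ := ⟨(N : ℂ) * z, by simpa using mul_pos (by exact_mod_cast hN) z.im_pos⟩ with hw
  have h1 := (EisensteinSeries.summable_one_div_norm_rpow hσ).mul_left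
    (EisensteinSeries.r w ^ (-σ))
  have h2 := Summable.of_nonneg_of_le (fun x => by positivity)
    (EisensteinSeries.summand_bound w (by linarith : 0 ≤ σ)) h1
  have h3 := (finTwoArrowEquiv ℤ).symm.summable_iff.mpr h2
  refine h3.congr fun p => ?_
  simp only [Function.comp, finTwoArrowEquiv_symm_apply, Matrix.cons_val_zero, Matrix.cons_val_one]
  congr 2
  simp only [hw]
  push_cast; ring

/-- The constant is uniform in the modulus because the kernel parameter satisfies |A| ≤ 2π|m| for
all q ≥ 1. The factors q^(-2 Re s) and |y + iu|^(-2 Re s) combine, as q|y + iu| = |qz + D|. -/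
theorem exists_norm_rowKer_le (m lam : ℤ) {s : ℂ} (hs : 1 < s.re) (z : ℍ) :
    ∃ K : ℝ, 0 ≤ K ∧ ∀ (q : ℕ) (_ : 0 < q) (D : ℤ),
      ‖rowKer m lam s q z.im (z.re + D / q)‖ ≤ K * ‖(q : ℂ) * z + D‖ ^ (-(2 * s.re)) := by
  set α := s + wt lam / 2
  set β := s - wt lam / 2
  have hab : α + β = 2 * s := by simp only [α, β]; ring
  have hre : (α + β).re = 2 * s.re := by rw [hab]; simp
  have hy := z.im_pos
  set c := Real.exp (2 * Real.pi * |(m : ℝ)| * (2 * (‖α‖ + ‖β‖ + 1) / z.im)) *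
    Real.exp (Real.pi * (‖α‖ + ‖β‖)) ^ 2 with hc
  refine ⟨‖mConst m lam s * (z.im : ℂ) ^ β * Complex.I ^ (-wt lam)‖ * c, by positivity,
    fun q hq D => ?_⟩
  have hqR : (0 : ℝ) < q := by exact_mod_cast hq
  have h1 := norm_confKer_le_rpow (α := α) (β := β) hy (by rw [hre]; linarith) (rowParam m q)
    (norm_rowParam_le m hq) (z.re + D / q)
  rw [← hc, hre] at h1
  have hm := mul_coe_add_eq z hqR.ne' D
  simp only [Complex.ofReal_natCast, Complex.ofReal_intCast] at hm
  have hn : ‖(z.im : ℂ) + Complex.I * ((z.re + D / q : ℝ) : ℂ)‖ =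
      ‖((z.re + D / q : ℝ) : ℂ) + z.im * Complex.I‖ := by
    rw [show (z.im : ℂ) + Complex.I * ((z.re + D / q : ℝ) : ℂ) =
      Complex.I * (starRingEnd ℂ) (((z.re + D / q : ℝ) : ℂ) + z.im * Complex.I) by
        rw [map_add, map_mul, Complex.conj_ofReal, Complex.conj_ofReal, Complex.conj_I]
        linear_combination (z.im : ℂ) * Complex.I_sq]
    rw [norm_mul, Complex.norm_I, one_mul, RCLike.norm_conj]
  rw [rowKer_eq m lam (by linarith) hqR hy, hm, norm_mul (q : ℂ), Complex.norm_natCast,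
    Real.mul_rpow hqR.le (norm_nonneg _), ← hn]
  simp only [Complex.ofReal_natCast]
  rw [norm_mul, norm_mul, norm_mul _ ((q : ℂ) ^ _), norm_natCast_cpow hq, norm_mul _ (Complex.I ^ _)]
  have : (-(2 * s)).re = -(2 * s.re) := by simp
  rw [this]
  calc _ ≤ ‖mConst m lam s * (z.im : ℂ) ^ β‖ * (q : ℝ) ^ (-(2 * s.re)) *
        ‖Complex.I ^ (-wt lam)‖ *
        (c * ‖(z.im : ℂ) + Complex.I * ((z.re + D / q : ℝ) : ℂ)‖ ^ (-(2 * s.re))) := by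
        gcongr
        exact h1
    _ = _ := by ring

theorem summable_weight_mul_rowKer (m lam : ℤ) {s : ℂ} (hs : 1 < s.re) {N : ℕ} (hN : 0 < N) (z : ℍ)
    {w : ℕ+ → ℤ → ℂ} {M : ℝ} (hw : ∀ c D, ‖w c D‖ ≤ M) :
    Summable fun p : ℕ+ × ℤ =>
      w p.1 p.2 * rowKer m lam s ((N * p.1 : ℕ) : ℝ) z.im (z.re + p.2 / ((N * p.1 : ℕ) : ℝ)) := by
  obtain ⟨K, hK, hle⟩ := exists_norm_rowKer_le m lam hs z
  have hM : 0 ≤ M := (norm_nonneg _).trans (hw 1 0)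
  have h1 := summable_norm_row (σ := 2 * s.re) (by linarith) hN z
  have hinj : Function.Injective (fun p : ℕ+ × ℤ => ((((p.1 : ℕ) : ℤ), p.2) : ℤ × ℤ)) := by
    rintro ⟨a, b⟩ ⟨c, d⟩ h
    simp only [Prod.mk.injEq, Nat.cast_inj, PNat.coe_inj] at h
    exact Prod.ext h.1 h.2
  refine Summable.of_norm_bounded ((h1.comp_injective hinj).mul_left (M * K)) fun p => ?_
  rw [norm_mul, mul_assoc]
  have h2 := hle (N * p.1) (Nat.mul_pos hN p.1.pos) p.2
  refine mul_le_mul (hw _ _) (h2.trans (le_of_eq ?_)) (norm_nonneg _) hM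
  simp only [Function.comp]
  push_cast
  rfl

end PlusPoincare
end

/-! ### The Poincaré series as a sum over rows, and transport of rows by B A_ν. -/

noncomputable section

namespace PlusPoincare

open MeasureTheory Set Filter

theorem hasSum_rowTerm (m lam : ℤ) {s : ℂ} (hs : 1 < s.re) {N : ℕ} (hN : 0 < N) (h4 : 4 ∣ N)
    (z : ℍ) :
    Summable (poincareTerm m lam N s z) ∧
      HasSum (fun p : ℤ × ℤ => rowTerm m lam s z (N * p.1) p.2) (2 * poincare m lam N s z) := by
  set f : ℤ × ℤ → ℂ := fun p => rowTerm m lam s z (N * p.1) p.2 with hf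
  have h4' : (4 : ℤ) ∣ N := by exact_mod_cast h4
  have h1 : Summable (fun p : ℕ+ × ℤ => f ((p.1 : ℕ), p.2)) := by
    refine (summable_weight_mul_rowKer m lam hs hN z
      (w := fun c D => rowWeight lam m (N * c) D) (M := 1)
      (fun c D => norm_rowWeight_le lam m _ D)).congr fun p => ?_
    rw [← rowTerm_eq_rowKer m lam s z (Nat.mul_pos hN p.1.pos) (h4.mul_right _)]
    simp [hf]
  have h2 := hasSum_nonneg_part h1.hasSum
  set S : Set (ℤ × ℤ) := {p | 0 < p.1 ∨ p = (0, 1)} with hS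
  have hco : ∀ p, ¬ IsCoprime ((N : ℤ) * p.1) p.2 → f p = 0 := fun p hp =>
    rowTerm_of_not _ _ _ _ hp
  have h3 : HasSum (fun p : NormRow N => poincareTerm m lam N s z p.coset)
      (f (0, 1) + ∑' p : ℕ+ × ℤ, f ((p.1 : ℕ), p.2)) := by
    -- Pairs that are not coprime carry the value 0, so the sum over the half-plane of pairs reduces
    -- to normalised rows.
    have hsupp : ∀ p ∉ Set.range (Subtype.val : NormRow N → ℤ × ℤ),
        S.indicator f p = 0 := by
      intro p hp
      by_cases h : IsCoprime ((N : ℤ) * p.1) p.2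
      · exact Set.indicator_of_notMem (s := S) (a := p) (fun h' => hp ⟨⟨p, h, h'⟩, rfl⟩) f
      · rw [Set.indicator_apply_eq_zero]
        exact fun _ => hco p h
    have := (Function.Injective.hasSum_iff Subtype.val_injective hsupp).mpr h2
    refine this.congr_fun fun p => ?_
    rw [poincareTerm_coset m lam h4 s z p, Function.comp,
      Set.indicator_of_mem (show p.1 ∈ S from p.2.2)]
  have h5 := ((Equiv.ofBijective _ (NormRow.coset_bijective hN)).hasSum_iff
    (f := poincareTerm m lam N s z)).mp h3
  refine ⟨h5.summable, ?_⟩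
  rw [poincare, h5.tsum_eq]
  refine hasSum_even (fun p => ?_) (fun d h h' => hco _ fun hc => ?_) h2
  · rw [hf]
    simp only [Prod.fst_neg, Prod.snd_neg, mul_neg]
    exact rowTerm_neg m lam s z (h4'.mul_right _) _
  · rcases isCoprime_mul_zero d hc with h'' | h''
    · exact h h''
    · exact h' h''

/-! ### Transport of rows by `B A_ν` -/

/-- The image of `z` under `B A_ν`. -/
def dualPt (N' ν : ℕ) (z : ℍ) : ℍ := (1 / 4 : ℝ) +ᵥ (matA (4 * N') ν • z)

theorem four_mul_add_one_im (N' ν : ℕ) (z : ℍ) : 0 ≤ (4 * N' * ν * (z : ℂ) + 1).im := by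
  have : (4 * N' * ν * (z : ℂ) + 1).im = ((4 * N' * ν : ℕ) : ℝ) * z.im := by
    rw [show (4 * N' * ν * (z : ℂ) + 1) = (((4 * N' * ν : ℕ) : ℝ) : ℂ) * z + 1 by push_cast; ring]
    simp
  rw [this]
  have := z.im_pos
  positivity

theorem four_mul_add_one_ne_zero (N' ν : ℕ) (z : ℍ) : (4 * N' * ν * (z : ℂ) + 1) ≠ 0 := by
  intro h
  have h1 := congrArg Complex.im h
  rw [show (4 * N' * ν * (z : ℂ) + 1) = (((4 * N' * ν : ℕ) : ℝ) : ℂ) * z + 1 by push_cast; ring]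
    at h1
  have h2 : ((4 * N' * ν : ℕ) : ℝ) = 0 := by
    simpa [z.im_ne_zero] using h1
  have h3 : (4 * N' * ν : ℂ) = 0 := by exact_mod_cast h2
  rw [h3] at h
  simp at h

theorem coe_dualPt (N' ν : ℕ) (z : ℍ) :
    (dualPt N' ν z : ℂ) = 1 / 4 + z / (4 * N' * ν * z + 1) := by
  rw [dualPt, UpperHalfPlane.coe_vadd, UpperHalfPlane.coe_specialLinearGroup_apply]
  simp [matA]

theorem coe_dualPt_mul (N' ν : ℕ) (z : ℍ) :
    (dualPt N' ν z : ℂ) * (4 * N' * ν * z + 1) = (4 * N' * ν * z + 1) / 4 + z := by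
  rw [coe_dualPt, add_mul, div_mul_cancel₀ _ (four_mul_add_one_ne_zero N' ν z)]
  ring

theorem autJ_matA (N' ν : ℕ) (z : ℍ) :
    autJ (matA (4 * N') ν) z = (4 * N' * ν * (z : ℂ) + 1) ^ (1 / 2 : ℂ) := by
  simp [autJ, jRow, matA, symb, eps]

/-- The cocycle relation for B A_ν: the row (4h, d) at the image point corresponds to the row (4g,
D) at z. It dictates the formulas for h and d. -/
theorem dualPt_denom (N' ν : ℕ) (z : ℍ) {g D h d : ℤ} (hh : h = g - ν * N' * D) (hd : d = D - h) :
    (((4 * h : ℤ) : ℂ) * dualPt N' ν z + d) * (4 * N' * ν * z + 1) = 4 * g * z + D := by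
  rw [hd, hh]
  push_cast
  linear_combination (4 * ((g : ℂ) - ν * N' * D)) * coe_dualPt_mul N' ν z

theorem coe_smul_dualPt (N' ν : ℕ) (z : ℍ) {g D h d : ℤ} (hh : h = g - ν * N' * D) (hd : d = D - h)
    (γ : SL(2, ℤ)) (h0 : γ 1 0 = 4 * h) (h1 : γ 1 1 = d) :
    ((γ • dualPt N' ν z : ℍ) : ℂ) =
      (((γ 0 0 + 4 * γ 0 1 : ℤ) : ℂ) / 4 +
        ((γ 0 0 + N' * ν * (γ 0 0 + 4 * γ 0 1) : ℤ) : ℂ) * z) / (4 * g * z + D) := by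
  have hQ := four_mul_add_one_ne_zero N' ν z
  rw [UpperHalfPlane.coe_specialLinearGroup_apply, h0, h1, ← dualPt_denom N' ν z hh hd]
  simp only [eq_intCast, Complex.ofReal_intCast]
  rw [← mul_div_mul_right _ _ hQ]
  congr 1
  push_cast
  linear_combination (γ 0 0 : ℂ) * coe_dualPt_mul N' ν z

theorem slash_dualPt (m lam : ℤ) (s : ℂ) (N' ν : ℕ) (z : ℍ) {g D h d : ℤ}
    (γ : SL(2, ℤ)) (h0 : γ 1 0 = 4 * h) (h1 : γ 1 1 = d)
    (hs : (((4 * h : ℤ) : ℂ) * dualPt N' ν z + d) ^ (1 / 2 : ℂ) *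
      (4 * N' * ν * (z : ℂ) + 1) ^ (1 / 2 : ℂ) = (4 * g * z + D) ^ (1 / 2 : ℂ)) :
    autJ (matA (4 * N') ν) z ^ (-(2 * lam + 1)) * rowTerm m lam s (dualPt N' ν z) (4 * h) d =
      thetaRow (4 * h) d ^ (-(2 * lam + 1)) *
        (((4 * g * z + D) ^ (1 / 2 : ℂ)) ^ (-(2 * lam + 1)) *
          phi m lam s (γ • dualPt N' ν z)) := by
  have e := rowTerm_eq_slash m lam s (dualPt N' ν z) γ (by rw [h0]; exact dvd_mul_right _ _)
  rw [h0, h1] at e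
  rw [e, slash, autJ_matA, autJ, jRow, h0, h1, ← hs]
  simp only [thetaRow, mul_zpow]
  ring

/-- The relation αD = 1 + g(a + 4b) of `dual_congr` says that γ applied to the image point equals
α/(4g) - 1/(4g(4gz + D)). So the transported term has the same kernel as the row (4g, D), with α in
place of an inverse of D modulo 4g. -/
theorem exists_dualWeight (m lam : ℤ) (s : ℂ) (N' : ℕ) (z : ℍ) {g : ℕ} (hg : 0 < g) (D : ℤ)
    (ν : ℕ) {h d : ℤ} (hh : h = g - ν * N' * D) (hd : d = D - h) :
    ∃ Om : ℂ, ((¬ IsCoprime (4 * h) d → Om = 0) ∧ (IsCoprime (4 * h) d → ∃ a b : ℤ,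
        a * d - b * (4 * h) = 1 ∧ Om = thetaRow (4 * h) d ^ (-(2 * lam + 1)) *
          expI ((m : ℂ) * ((a + N' * ν * (a + 4 * b) : ℤ) : ℂ) / ((4 * g : ℕ) : ℂ)))) ∧
      autJ (matA (4 * N') ν) z ^ (-(2 * lam + 1)) * rowTerm m lam s (dualPt N' ν z) (4 * h) d =
        Om * rowKer m lam s ((4 * g : ℕ) : ℝ) z.im (z.re + D / ((4 * g : ℕ) : ℝ)) := by
  by_cases hc : IsCoprime (4 * h) d
  · obtain ⟨γ, h0, h1⟩ := hc.exists_SL2_row 1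
    have hdet := Matrix.det_fin_two (γ : Matrix (Fin 2) (Fin 2) ℤ)
    rw [γ.det_coe, h0, h1] at hdet
    refine ⟨_, ⟨fun h => absurd hc h, fun _ => ⟨γ 0 0, γ 0 1, hdet.symm, rfl⟩⟩, ?_⟩
    have hqR : (0 : ℝ) < ((4 * g : ℕ) : ℝ) := by positivity
    have hm := mul_coe_add_eq z hqR.ne' D
    have hden := dualPt_denom N' ν z hh hd
    have hm' : (4 * ((g : ℤ) : ℂ) * (z : ℂ) + D) =
      ((((4 * g : ℕ) : ℝ) : ℂ)) * (((z.re + D / ((4 * g : ℕ) : ℝ) : ℝ) : ℂ) + z.im * Complex.I) := by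
      rw [← hm]; push_cast; ring
    have him : 0 < (4 * ((g : ℤ) : ℂ) * (z : ℂ) + D).im := by
      rw [hm', ← hm]
      simpa using mul_pos hqR z.im_pos
    have hP : (((4 * h : ℤ) : ℂ) * dualPt N' ν z + d) ≠ 0 := by
      intro h
      rw [h, zero_mul] at hden
      rw [← hden] at him
      simp at him
    have hsq := sqrt_mul_sqrt hP (four_mul_add_one_im N' ν z) (by rw [hden]; exact him)
    rw [hden] at hsq
    rw [slash_dualPt m lam s N' ν z γ h0 h1 hsq, hm']
    obtain ⟨hα, -⟩ := dual_congr hh hd (a := γ 0 0) (b := γ 0 1) hdet.symm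
    rw [sqrt_zpow_mul_phi m lam s hqR z.im_pos (z.re + D / ((4 * g : ℕ) : ℝ))
      ((γ 0 0 + N' * ν * (γ 0 0 + 4 * γ 0 1) : ℤ) / ((4 * g : ℕ) : ℝ))]
    · rw [← mul_assoc]
      congr 3
      rw [mul_div_assoc]
      push_cast; rfl
    · rw [coe_smul_dualPt N' ν z hh hd γ h0 h1, ← hm']
      have hne : (4 * ((g : ℤ) : ℂ) * (z : ℂ) + D) ≠ 0 := by
        intro h; rw [h] at him; simp at him
      have hg0 : (g : ℂ) ≠ 0 := by exact_mod_cast hg.ne'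
      have hα' := congrArg (Int.cast : ℤ → ℂ) hα
      rw [div_eq_iff hne]
      push_cast at hα' hne ⊢
      rw [sub_mul, one_div_mul_eq_div, div_mul_cancel_right₀ hne]
      field_simp
      linear_combination -hα'
  · refine ⟨0, ⟨fun _ => rfl, fun h => absurd h hc⟩, ?_⟩
    rw [rowTerm_of_not _ _ _ _ hc]; simp

end PlusPoincare
end

noncomputable section

namespace PlusPoincare

open MeasureTheory Set Filter

/-! ### The projected series as a sum over rows -/

/-- The eighth root of unity is (1 ∓ i)/√2 up to a sign, according to the parity of λ. The sign is
removed by (-1)^⌊(λ+1)/2⌋ and √2 by the denominator. -/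
theorem prPlus_const (lam : ℤ) :
    (-1 : ℂ) ^ ((lam + 1) / 2) * (1 / (2 * (Real.sqrt 2 : ℂ))) *
      Complex.exp (-((2 * lam + 1 : ℂ) * Real.pi * Complex.I / 4)) =
      1 / 4 * (1 - sgnC lam * Complex.I) := by
  have h2 : ((Real.sqrt 2 : ℝ) : ℂ) ^ 2 = 2 := by
    rw [← Complex.ofReal_pow, Real.sq_sqrt (by norm_num)]; norm_num
  have hne : ((Real.sqrt 2 : ℝ) : ℂ) ≠ 0 := by
    intro h; rw [h] at h2; norm_num at h2
  have hq : Complex.exp (-(Real.pi * Complex.I / 4)) =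
      ((Real.sqrt 2 : ℝ) : ℂ) / 2 * (1 - Complex.I) := by
    rw [show -(Real.pi * Complex.I / 4) = ((-(Real.pi / 4) : ℝ) : ℂ) * Complex.I by push_cast; ring,
      Complex.exp_mul_I, ← Complex.ofReal_cos, ← Complex.ofReal_sin, Real.cos_neg, Real.sin_neg,
      Real.cos_pi_div_four, Real.sin_pi_div_four]
    push_cast; ring
  have hI : ∀ t : ℤ, Complex.exp (-(t * (Real.pi * Complex.I))) = (-1) ^ t := by
    intro t
    rw [← mul_neg, Complex.exp_int_mul, Complex.exp_neg, Complex.exp_pi_mul_I]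
    norm_num
  have hsq : ∀ t : ℤ, (-1 : ℂ) ^ t * (-1) ^ t = 1 := by
    intro t
    rw [← mul_zpow]; norm_num
  rcases Int.even_or_odd' lam with ⟨t, h | h⟩
  · have e1 : (lam + 1) / 2 = t := by omega
    have e2 : sgnC lam = 1 := by
      rw [← neg_one_zpow_eq_sgnC, Even.neg_one_zpow ⟨t, by omega⟩]
    have e3 : -((2 * lam + 1 : ℂ) * Real.pi * Complex.I / 4) =
        -(t * (Real.pi * Complex.I)) + -(Real.pi * Complex.I / 4) := by
      rw [h]; push_cast; ring
    rw [e1, e2, e3, Complex.exp_add, hI, hq]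
    field_simp
    linear_combination (1 - Complex.I) * 4 * hsq t
  · have e1 : (lam + 1) / 2 = t + 1 := by omega
    have e2 : sgnC lam = -1 := by
      rw [← neg_one_zpow_eq_sgnC, Odd.neg_one_zpow ⟨t, h⟩]
    have e3 : -((2 * lam + 1 : ℂ) * Real.pi * Complex.I / 4) =
        -(t * (Real.pi * Complex.I)) + (-(Real.pi * Complex.I / 4) + -(Real.pi / 2 * Complex.I)) := by
      rw [h]; push_cast; ring
    have e4 : Complex.exp (-(Real.pi / 2 * Complex.I)) = -Complex.I := by
      rw [Complex.exp_neg, Complex.exp_pi_div_two_mul_I, Complex.inv_I]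
    rw [e1, e2, e3, Complex.exp_add, Complex.exp_add, hI, hq, e4, zpow_add₀ (by norm_num), zpow_one]
    field_simp
    linear_combination (Complex.I - Complex.I ^ 2) * 4 * hsq t - 4 * Complex.I_sq

/-- The contribution to `F |_k B A_ν` of the row that is carried to `p`. -/
def dualTerm (m lam : ℤ) (s : ℂ) (N' ν : ℕ) (z : ℍ) (p : ℤ × ℤ) : ℂ :=
  autJ (matA (4 * N') ν) z ^ (-(2 * lam + 1)) *
    rowTerm m lam s (dualPt N' ν z) (4 * (N' * p.1 - ν * N' * p.2))
      (p.2 - (N' * p.1 - ν * N' * p.2))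

/-- The permutation of the rows that belongs to `B A_ν`. -/
def dualEquiv (N' ν : ℕ) : ℤ × ℤ ≃ ℤ × ℤ where
  toFun p := (p.1 - ν * p.2, p.2 - N' * (p.1 - ν * p.2))
  invFun p := (p.1 + ν * (p.2 + N' * p.1), p.2 + N' * p.1)
  left_inv p := by ext <;> simp
  right_inv p := by ext <;> simp

theorem hasSum_dualTerm (m lam : ℤ) {s : ℂ} (hs : 1 < s.re) {N' : ℕ} (hN : 0 < N') (ν : ℕ) (z : ℍ) :
    HasSum (dualTerm m lam s N' ν z) (autJ (matA (4 * N') ν) z ^ (-(2 * lam + 1)) *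
      (2 * poincare m lam (4 * N') s (dualPt N' ν z))) := by
  have h := (hasSum_rowTerm m lam hs (N := 4 * N') (by omega) (dvd_mul_right _ _)
    (dualPt N' ν z)).2
  refine (((dualEquiv N' ν).hasSum_iff.mpr h).mul_left _).congr_fun fun p => ?_
  rw [dualTerm]
  congr 2
  · simp only [dualEquiv, Equiv.coe_fn_mk]
    push_cast; ring
  · simp only [dualEquiv, Equiv.coe_fn_mk]
    ring

/-- The row sum of the projected Poincaré series. -/
def plusTerm (m lam : ℤ) (s : ℂ) (N' : ℕ) (z : ℍ) (p : ℤ × ℤ) : ℂ :=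
  1 / 2 * rowTerm m lam s z ((4 * N' : ℕ) * p.1) p.2 +
    1 / 4 * (1 - sgnC lam * Complex.I) * ∑ ν ∈ Finset.range 4, dualTerm m lam s N' ν z p

theorem hasSum_plusTerm (m lam : ℤ) {s : ℂ} (hs : 1 < s.re) {N' : ℕ} (hN : 0 < N') (z : ℍ) :
    HasSum (plusTerm m lam s N' z) (2 * poincarePlus m lam (4 * N') s z) := by
  have h1 := (hasSum_rowTerm m lam hs (N := 4 * N') (by omega) (dvd_mul_right _ _) z).2.mul_left
    (1 / 2)
  have h2 := (hasSum_sum fun ν (_ : ν ∈ Finset.range 4) => hasSum_dualTerm m lam hs hN ν z).mul_left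
    (1 / 4 * (1 - sgnC lam * Complex.I))
  convert! h1.add h2 using 1
  rw [poincarePlus, prPlus, ← prPlus_const, mul_add]
  congr 1
  · ring
  · rw [Finset.mul_sum, Finset.mul_sum, Finset.mul_sum]
    refine Finset.sum_congr rfl fun ν _ => ?_
    rw [slash, slashB, dualPt]
    ring

theorem dualTerm_neg (m lam : ℤ) (s : ℂ) (N' ν : ℕ) (z : ℍ) (p : ℤ × ℤ) :
    dualTerm m lam s N' ν z (-p) = dualTerm m lam s N' ν z p := by
  rw [dualTerm, dualTerm, ← rowTerm_neg m lam s _ (dvd_mul_right _ _)]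
  simp only [Prod.fst_neg, Prod.snd_neg]
  congr 2 <;> ring

theorem plusTerm_neg (m lam : ℤ) (s : ℂ) (N' : ℕ) (z : ℍ) (p : ℤ × ℤ) :
    plusTerm m lam s N' z (-p) = plusTerm m lam s N' z p := by
  have := rowTerm_neg m lam s z (c := (4 * N' : ℕ) * p.1)
    ⟨N' * p.1, by push_cast; ring⟩ p.2
  rw [plusTerm, plusTerm]
  simp only [Prod.fst_neg, Prod.snd_neg, dualTerm_neg, mul_neg, this]

theorem plusTerm_zero (m lam : ℤ) (s : ℂ) (N' : ℕ) (z : ℍ) {d : ℤ} (h1 : d ≠ 1) (h2 : d ≠ -1) :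
    plusTerm m lam s N' z (0, d) = 0 := by
  rw [plusTerm, rowTerm_of_not, Finset.sum_eq_zero]
  · simp
  · intro ν _
    rw [dualTerm, rowTerm_of_not, mul_zero]
    intro h
    have : IsUnit d := by
      refine h.isUnit_of_dvd' ⟨4 * (-(ν * N')), by ring⟩ ⟨1 + ν * N', by ring⟩
    rcases Int.isUnit_iff.mp this with h | h
    · exact h1 h
    · exact h2 h
  · intro h
    rcases isCoprime_mul_zero d h with h | h
    · exact h1 h
    · exact h2 h

theorem phi_of_coe_eq_add (m lam : ℤ) (s : ℂ) {z τ : ℍ} {r : ℝ} (h : (τ : ℂ) = r + z) :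
    phi m lam s τ = expI (m * r) * phi m lam s z := by
  have h1 : τ.re = r + z.re := by
    rw [← UpperHalfPlane.coe_re, h]; simp
  have h2 : τ.im = z.im := by
    rw [← UpperHalfPlane.coe_im, h]; simp
  rw [phi, phi, h1, h2, Complex.ofReal_add, mul_add, expI_add]
  ring

/-- The case g = 0, D = 1: here α = 1 and γ acts on the image point as z ↦ z + (a + 4b)/4, so a
power of i replaces the kernel. The exponent is md because a ≡ d modulo 4. -/
theorem dualTerm_zero_one (m lam : ℤ) (s : ℂ) (N' ν : ℕ) (z : ℍ) {d : ℤ} (hd : d = 1 + ν * N') :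
    (d % 2 = 0 → dualTerm m lam s N' ν z (0, 1) = 0) ∧
    (d % 2 = 1 → dualTerm m lam s N' ν z (0, 1) =
      thetaRow (-(4 * ν * N')) d ^ (-(2 * lam + 1)) * Complex.I ^ (m * d) * phi m lam s z) := by
  have hh : -(ν * N' : ℤ) = 0 - ν * N' * 1 := by ring
  have hd' : d = 1 - -(ν * N' : ℤ) := by rw [hd]; ring
  have e : dualTerm m lam s N' ν z (0, 1) = autJ (matA (4 * N') ν) z ^ (-(2 * lam + 1)) *
      rowTerm m lam s (dualPt N' ν z) (4 * -(ν * N' : ℤ)) d := by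
    rw [dualTerm, hd]
    congr 2 <;> ring
  have hiff := isCoprime_dual_iff (n := ν * N') (by rw [hh]) hd'
  constructor
  · intro h
    rw [e, rowTerm_of_not, mul_zero]
    intro hc
    have := (hiff.mp hc).1
    omega
  · intro h
    have hc := hiff.mpr ⟨h, isCoprime_one_right⟩
    obtain ⟨γ, h0, h1⟩ := hc.exists_SL2_row 1
    have hdet := Matrix.det_fin_two (γ : Matrix (Fin 2) (Fin 2) ℤ)
    rw [γ.det_coe, h0, h1] at hdet
    obtain ⟨hα, had, -⟩ := dual_congr (n := ν * N') (by rw [hh]) hd' hdet.symm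
    have hden := dualPt_denom N' ν z hh hd'
    have hQ := four_mul_add_one_ne_zero N' ν z
    have hQim := four_mul_add_one_im N' ν z
    simp only [Int.cast_zero, mul_zero, zero_mul, zero_add, Int.cast_one] at hden
    have hsq : (((4 * -(ν * N') : ℤ) : ℂ) * dualPt N' ν z + d) ^ (1 / 2 : ℂ) *
        (4 * N' * ν * (z : ℂ) + 1) ^ (1 / 2 : ℂ) = (4 * ((0 : ℤ) : ℂ) * z + ((1 : ℤ) : ℂ)) ^ (1 / 2 : ℂ) := by
      -- The product of the denominators is 1, with imaginary part 0, so `sqrt_mul_sqrt` does not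
      -- apply. The roots are still inverse to each other, as 4N'νz + 1 is not on the negative real
      -- axis.
      rw [eq_inv_of_mul_eq_one_left hden]
      have : (4 * N' * ν * (z : ℂ) + 1).arg ≠ Real.pi := by
        intro hpi
        obtain ⟨hre, him⟩ := Complex.arg_eq_pi_iff.mp hpi
        rw [show (4 * N' * ν * (z : ℂ) + 1) = (((4 * N' * ν : ℕ) : ℝ) : ℂ) * z + 1 by
          push_cast; ring] at hre him
        have h0 : ((4 * N' * ν : ℕ) : ℝ) = 0 := by simpa [z.im_ne_zero] using him
        rw [h0] at hre
        simp at hre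
        linarith
      rw [Complex.inv_cpow _ _ this, inv_mul_cancel₀ (by simp [Complex.cpow_eq_zero_iff, hQ])]
      simp
    rw [e, slash_dualPt m lam s N' ν z γ h0 h1 hsq]
    have hτ := coe_smul_dualPt N' ν z hh hd' γ h0 h1
    have hα' : γ 0 0 + N' * ν * (γ 0 0 + 4 * γ 0 1) = 1 := by linarith
    rw [hα'] at hτ
    rw [phi_of_coe_eq_add m lam s (r := (γ 0 0 + 4 * γ 0 1 : ℤ) / 4) (z := z)
      (by rw [hτ]; push_cast; ring)]
    have hE : expI (m * (((γ 0 0 + 4 * γ 0 1 : ℤ) / 4 : ℝ) : ℂ)) = Complex.I ^ (m * d) := by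
      rw [show (m * (((γ 0 0 + 4 * γ 0 1 : ℤ) / 4 : ℝ) : ℂ)) =
        ((m * (γ 0 0 + 4 * γ 0 1) : ℤ) : ℂ) / 4 by push_cast; ring, expI_div_four]
      refine I_zpow_congr (Int.ModEq.mul_left _ ?_)
      have : γ 0 0 + 4 * γ 0 1 ≡ γ 0 0 [ZMOD 4] := by
        exact Int.modEq_iff_dvd.mpr ⟨-γ 0 1, by ring⟩
      exact this.trans had
    rw [hE]
    have : (4 * -(ν * N' : ℤ)) = -(4 * ν * N') := by ring
    rw [this]
    simp
    ring

/-- One half comes from f/2. The other half comes from ν = 0 and ν = 2, through (1 - σi)(i^m +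
σi·i^(-m)) = 2, which is the plus condition on m. -/
theorem plusTerm_zero_one {m lam : ℤ} (hm : PlusIndex lam m) (s : ℂ) {N' : ℕ} (hN : Odd N') (z : ℍ) :
    plusTerm m lam s N' z (0, 1) = phi m lam s z := by
  have hN2 : N' % 2 = 1 := Nat.odd_iff.mp hN
  have h0 := (dualTerm_zero_one m lam s N' 0 z rfl).2 (by norm_num)
  have h1 := (dualTerm_zero_one m lam s N' 1 z rfl).1 (by push_cast; omega)
  have h2 := (dualTerm_zero_one m lam s N' 2 z rfl).2 (by push_cast; omega)
  have h3 := (dualTerm_zero_one m lam s N' 3 z rfl).1 (by push_cast; omega)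
  have hrow : rowTerm m lam s z 0 1 = phi m lam s z := by
    have := rowTerm_eq_slash m lam s z 1 (by simp)
    simpa [slash, autJ, jRow, symb, eps] using this
  have t0 : thetaRow 0 1 = 1 := by simp [thetaRow, symb, eps]
  have t2 : thetaRow (-(4 * 2 * N')) (1 + 2 * N') = -Complex.I := by
    have hd : (1 + 2 * (N' : ℤ)) % 4 = 3 := by omega
    rw [thetaRow, eps_of_three hd, show (-(4 * 2 * N') : ℤ) = 4 * (-(2 * N')) by ring,
      symb_four_mul _ _ (by omega), symb_of_pos_right _ (by omega)]
    have : jacobiSym (-(2 * N')) (1 + 2 * (N' : ℤ)).natAbs = 1 := by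
      have := jacobiSym_add_natAbs_mul 1 (1 + 2 * (N' : ℤ)) (-1)
      rw [show (1 + (1 + 2 * (N' : ℤ)) * -1) = -(2 * N') by ring] at this
      rw [this]; simp
    rw [this]; simp
  have hI2 : Complex.I ^ (m * (1 + 2 * N')) = (Complex.I ^ m)⁻¹ := by
    rw [← zpow_neg]
    refine I_zpow_congr ?_
    have h4 : (1 + 2 * (N' : ℤ)) ≡ -1 [ZMOD 4] := by
      rw [Int.ModEq]; omega
    simpa using h4.mul_left m
  have hsum : ∑ ν ∈ Finset.range 4, dualTerm m lam s N' ν z (0, 1) =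
      (Complex.I ^ m + sgnC lam * Complex.I * (Complex.I ^ m)⁻¹) * phi m lam s z := by
    simp only [Nat.cast_zero, Nat.cast_ofNat, zero_mul, mul_zero, neg_zero, add_zero, mul_one, t0,
      t2, hI2, one_zpow, one_mul, neg_I_zpow_weight] at h0 h2
    simp only [Finset.sum_range_succ, Finset.sum_range_zero, zero_add, h0, h1, h2, h3]
    ring
  rw [plusTerm, hsum]
  simp only [mul_zero, hrow]
  have hs2 : sgnC lam ^ 2 = 1 := by
    rcases sgnC_cases lam with h | h <;> rw [h] <;> norm_num
  have key : (1 - sgnC lam * Complex.I) *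
      (Complex.I ^ m + sgnC lam * Complex.I * (Complex.I ^ m)⁻¹) = 2 := by
    rcases hm.I_zpow with h | h
    · rw [h, inv_one]
      linear_combination (-sgnC lam ^ 2) * Complex.I_sq + hs2
    · rw [h]
      have : (sgnC lam * Complex.I)⁻¹ = -(sgnC lam * Complex.I) := by
        refine inv_eq_of_mul_eq_one_right ?_
        linear_combination (-sgnC lam ^ 2) * Complex.I_sq + hs2
      rw [this]
      linear_combination (sgnC lam * Complex.I - 2) * (sgnC lam ^ 2 * Complex.I_sq - hs2)
  linear_combination (1 / 4 * phi m lam s z) * key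

theorem plusTerm_pos {m lam : ℤ} (hm : PlusIndex lam m) (s : ℂ) {N' : ℕ} (hN : Odd N') (z : ℍ)
    (c : ℕ+) (D : ℤ) :
    plusTerm m lam s N' z ((c : ℕ), D) = plusWeight lam m (N' * c) D *
      rowKer m lam s ((4 * N' * c : ℕ) : ℝ) z.im (z.re + D / ((4 * N' * c : ℕ) : ℝ)) := by
  have hg : 0 < N' * c := Nat.mul_pos hN.pos c.pos
  have hex := fun ν => exists_dualWeight m lam s N' z hg D ν
    (h := ((N' * c : ℕ) : ℤ) - ν * N' * D) rfl rfl
  choose Om hOm1 hOm2 using hex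
  have hOm : IsDualWeight N' lam m (N' * c) D Om := by
    rintro ν h d rfl rfl
    exact hOm1 ν
  have hw := hOm.weight_eq hN hm hg
  rw [plusTerm, plusWeight, ← hw]
  have hrow := rowTerm_eq_rowKer m lam s z (q := 4 * (N' * c)) (by omega) (dvd_mul_right _ _) D
  have e : ((4 * N' : ℕ) : ℤ) * ((c : ℕ) : ℤ) = ((4 * (N' * c) : ℕ) : ℤ) := by push_cast; ring
  simp only
  rw [e, hrow, mul_assoc 4 N' (c : ℕ)]
  have hsum : ∑ ν ∈ Finset.range 4, dualTerm m lam s N' ν z ((c : ℕ), D) =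
      ∑ ν ∈ Finset.range 4, Om ν * rowKer m lam s ((4 * (N' * c) : ℕ) : ℝ) z.im
        (z.re + D / ((4 * (N' * c) : ℕ) : ℝ)) := by
    refine Finset.sum_congr rfl fun ν _ => ?_
    rw [← hOm2, dualTerm]
    push_cast; rfl
  rw [hsum, ← Finset.sum_mul]
  ring

theorem poincarePlus_eq {m lam : ℤ} (hm : PlusIndex lam m) {s : ℂ} (hs : 1 < s.re) {N' : ℕ}
    (hN : Odd N') (z : ℍ) :
    HasSum (fun p : ℕ+ × ℤ => plusWeight lam m (N' * p.1) p.2 *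
      rowKer m lam s ((4 * N' * p.1 : ℕ) : ℝ) z.im (z.re + p.2 / ((4 * N' * p.1 : ℕ) : ℝ)))
      (poincarePlus m lam (4 * N') s z - phi m lam s z) := by
  have h := hasSum_plusTerm m lam hs hN.pos z
  have h1 := summable_weight_mul_rowKer m lam hs (N := 4 * N') (by have := hN.pos; omega) z
      (w := fun c D => plusWeight lam m (N' * c) D) (M := 4)
      (fun c D => norm_plusWeight_le lam m _ D)
  have h2 : HasSum (fun p : ℕ+ × ℤ => plusTerm m lam s N' z ((p.1 : ℕ), p.2)) _ :=
    h1.hasSum.congr_fun fun p => plusTerm_pos hm s hN z p.1 p.2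
  have h3 := hasSum_even (plusTerm_neg m lam s N' z)
    (fun d h1 h2 => plusTerm_zero m lam s N' z h1 h2) (hasSum_nonneg_part h2)
  have h4 := h.unique h3
  rw [plusTerm_zero_one hm s hN] at h4
  have h5 := mul_left_cancel₀ two_ne_zero h4
  rw [h5, add_sub_cancel_left]
  exact h1.hasSum

end PlusPoincare
end

noncomputable section

namespace PlusPoincare

open MeasureTheory Set Filter
open scoped FourierTransform

/-! ### The Fourier expansion -/

theorem rowKer_eq_rowConst (m lam : ℤ) {s : ℂ} (hs : 0 < s.re) {q : ℕ} (hq : 0 < q) {y : ℝ}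
    (hy : 0 < y) (u : ℝ) : rowKer m lam s q y u =
      rowConst m lam s y q * confKer (rowParam m q) (s + wt lam / 2) (s - wt lam / 2) y u := by
  rw [rowKer_eq m lam hs (by exact_mod_cast hq) hy, rowConst, rowParam, Complex.ofReal_natCast]

open Classical in
/-- The contribution of the modulus `4 N' c` to the `n`-th Fourier coefficient. -/
def modulusTerm (N' : ℕ) (lam m : ℤ) (s : ℂ) (z : ℍ) (c : ℕ+) (n : ℤ) : ℂ :=
  rowConst m lam s z.im (4 * N' * c) *
    (hypF01 (2 * s) (2 * Real.pi * Complex.I * rowParam m (4 * N' * c) * n) *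
      𝓕 (hKer (s + wt lam / 2) (s - wt lam / 2) z.im) n) * expI ((n : ℂ) * (z.re : ℂ)) *
    if PlusIndex lam n then
      (1 + (jacobiSym 4 (N' * c) : ℂ)) * kloosterman lam m n (4 * N' * c) else 0

theorem half_add_half (lam : ℤ) (s : ℂ) : s + wt lam / 2 + (s - wt lam / 2) = 2 * s := by ring

theorem two_lt_re_half_add_half (lam : ℤ) {s : ℂ} (hs : 1 < s.re) :
    2 < (s + wt lam / 2 + (s - wt lam / 2)).re := by
  rw [half_add_half]; simp; linarith

theorem tsum_plusWeight_mul_rowKer (N' : ℕ) (lam m : ℤ) {s : ℂ} (hs : 1 < s.re) (z : ℍ) (c : ℕ+)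
    (hN : 0 < N')
    (hsum : Summable fun D : ℤ => plusWeight lam m (N' * c) D *
      rowKer m lam s ((4 * N' * c : ℕ) : ℝ) z.im (z.re + D / ((4 * N' * c : ℕ) : ℝ))) :
    ∑' D : ℤ, plusWeight lam m (N' * c) D *
      rowKer m lam s ((4 * N' * c : ℕ) : ℝ) z.im (z.re + D / ((4 * N' * c : ℕ) : ℝ)) =
      ∑' n : ℤ, modulusTerm N' lam m s z c n := by
  classical
  have hg : 0 < N' * c := Nat.mul_pos hN c.pos
  have hq : 0 < 4 * N' * c := by rw [mul_assoc]; omega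
  have hq4 : 4 * N' * (c : ℕ) = 4 * (N' * c) := mul_assoc _ _ _
  have hy := z.im_pos
  have e : ∀ D : ℤ, plusWeight lam m (N' * c) D *
      rowKer m lam s ((4 * N' * c : ℕ) : ℝ) z.im (z.re + D / ((4 * N' * c : ℕ) : ℝ)) =
      (rowConst m lam s z.im (4 * N' * c) * plusWeight lam m (N' * c) D) *
        confKer (rowParam m (4 * N' * c)) (s + wt lam / 2) (s - wt lam / 2) z.im
          (z.re + D / ((4 * N' * c : ℕ) : ℝ)) := by
    intro D
    rw [rowKer_eq_rowConst m lam (by linarith) hq hy]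
    ring
  simp only [e] at hsum ⊢
  rw [tsum_periodic_mul_confKer hy (by linarith [two_lt_re_half_add_half lam hs]) _ z.re hq
    (f := fun D => rowConst m lam s z.im (4 * N' * c) * plusWeight lam m (N' * c) D)
    (fun D k => by rw [hq4, plusWeight_add_mul]) hsum]
  refine tsum_congr fun n => ?_
  have h := sum_plusWeight lam m n hg
  rw [← hq4] at h
  simp only [mul_assoc (rowConst m lam s z.im (4 * N' * c)), ← Finset.mul_sum]
  rw [h, modulusTerm, half_add_half]
  ring

theorem summable_modulus_rpow {N' : ℕ} (hN : 0 < N') {r : ℝ} (hr : r < -1) :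
    Summable fun c : ℕ+ => ((4 * N' * c : ℕ) : ℝ) ^ r := by
  have hinj : Function.Injective fun c : ℕ+ => 4 * N' * (c : ℕ) := by
    intro a b h
    exact PNat.eq (Nat.eq_of_mul_eq_mul_left (by omega) h)
  exact (Real.summable_nat_rpow.mpr hr).comp_injective hinj

/-- The majorant is a product: (4N'c)^(1 - 2 Re s), summable over c since Re s > 1, times
`kerBound`, summable over n. The latter can be chosen independent of c because the kernel parameter
is bounded in c. -/
theorem summable_modulusTerm {N' : ℕ} (hN : 0 < N') (lam m : ℤ) {s : ℂ} (hs : 1 < s.re) (z : ℍ) :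
    Summable fun p : ℕ+ × ℤ => modulusTerm N' lam m s z p.1 p.2 := by
  classical
  have hy := z.im_pos
  have hb := two_lt_re_half_add_half lam hs
  set α := s + wt lam / 2 with hα
  set β := s - wt lam / 2 with hβ
  have hab : α + β = 2 * s := half_add_half lam s
  set X : ℝ := 2 * Real.pi * (2 * Real.pi * |(m : ℝ)|) with hX
  have h1 := summable_kerBound (X := X) (by positivity) hy (by linarith : 1 < (α + β).re)
  have h2 := summable_modulus_rpow hN (r := 1 - 2 * s.re) (by linarith)
  have hker : ∀ n, 0 ≤ kerBound X α β z.im n := fun n =>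
    mul_nonneg (tsum_nonneg fun j => by positivity) (norm_nonneg _)
  have h3 := (h2.mul_of_nonneg h1 (fun c => by positivity) hker).mul_left
    (2 * ‖mConst m lam s * (z.im : ℂ) ^ β * Complex.I ^ (-wt lam)‖)
  refine Summable.of_norm_bounded h3 fun p => ?_
  obtain ⟨c, n⟩ := p
  have hq : 0 < 4 * N' * c := Nat.mul_pos (by omega) c.pos
  have hqR : (0 : ℝ) < ((4 * N' * c : ℕ) : ℝ) := by exact_mod_cast hq
  have e1 := norm_hypF01_mul_fourier_le (y := z.im) (α := α) (β := β) (by linarith)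
    (A := rowParam m (4 * N' * c)) (X := X) (by
      rw [hX]; gcongr; exact norm_rowParam_le m hq) n
  rw [hab] at e1
  have e2 : ‖(if PlusIndex lam n then
      (1 + (jacobiSym 4 (N' * c) : ℂ)) * kloosterman lam m n (4 * N' * c) else 0)‖ ≤
      2 * ((4 * N' * c : ℕ) : ℝ) := by
    split_ifs
    · rw [norm_mul]
      gcongr
      · exact norm_one_add_jacobiSym_le _
      · exact norm_kloosterman_le _ _ _ _
    · rw [norm_zero]; positivity
  have e3 : ‖rowConst m lam s z.im (4 * N' * c)‖ =
      ‖mConst m lam s * (z.im : ℂ) ^ β * Complex.I ^ (-wt lam)‖ *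
        ((4 * N' * c : ℕ) : ℝ) ^ (-(2 * s.re)) := by
    rw [rowConst, norm_mul, norm_mul _ (((4 * N' * c : ℕ) : ℂ) ^ _), norm_natCast_cpow hq,
      norm_mul _ (Complex.I ^ _)]
    have : (-(2 * s)).re = -(2 * s.re) := by simp
    rw [this]; ring
  have e4 : ‖expI ((n : ℂ) * (z.re : ℂ))‖ = 1 := by
    have := norm_expI_ofReal (n * z.re)
    push_cast at this
    exact this
  have e5 : ((4 * N' * c : ℕ) : ℝ) ^ (1 - 2 * s.re) =
      ((4 * N' * c : ℕ) : ℝ) ^ (-(2 * s.re)) * ((4 * N' * c : ℕ) : ℝ) := by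
    rw [sub_eq_neg_add, Real.rpow_add hqR, Real.rpow_one]
  rw [modulusTerm, norm_mul, norm_mul, norm_mul, e4, mul_one, e3]
  simp only
  rw [e5]
  calc _ ≤ ‖mConst m lam s * (z.im : ℂ) ^ β * Complex.I ^ (-wt lam)‖ *
        ((4 * N' * c : ℕ) : ℝ) ^ (-(2 * s.re)) * kerBound X α β z.im n *
          (2 * ((4 * N' * c : ℕ) : ℝ)) := by
        have := hker n
        gcongr
    _ = _ := by ring

theorem modulusTerm_eq {N' : ℕ} (hN : 0 < N') (lam m : ℤ) {s : ℂ} (hs : 1 < s.re) (z : ℍ) (c : ℕ+)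
    {n : ℤ} (hn : PlusIndex lam n) : modulusTerm N' lam m s z c n =
      2 * Real.pi * Complex.I ^ (-wt lam) * coeffTerm N' lam m n s c * calW n (wt lam) z.im s *
        expI ((n : ℂ) * (z.re : ℂ)) := by
  have h := besselFactor_div_mul_calW m lam hs n z.im_pos (q := 4 * N' * c)
    (Nat.mul_pos (by omega) c.pos)
  rw [modulusTerm, if_pos hn, coeffTerm, ← h]
  ring

theorem modulusTerm_of_not (N' : ℕ) (lam m : ℤ) (s : ℂ) (z : ℍ) (c : ℕ+) {n : ℤ}
    (hn : ¬ PlusIndex lam n) : modulusTerm N' lam m s z c n = 0 := by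
  rw [modulusTerm, if_neg hn, mul_zero]

theorem tsum_modulusTerm {N' : ℕ} (hN : 0 < N') (lam m : ℤ) {s : ℂ} (hs : 1 < s.re) (z : ℍ) {n : ℤ}
    (hn : PlusIndex lam n) :
    ∑' c : ℕ+, modulusTerm N' lam m s z c n = fourierTerm N' lam m s z n := by
  simp only [modulusTerm_eq hN lam m hs z _ hn]
  rw [tsum_mul_right, tsum_mul_right, tsum_mul_left, fourierTerm, coeff]

theorem summable_coeffTerm {N' : ℕ} (hN : 0 < N') (lam m n : ℤ) {s : ℂ} (hs : 1 < s.re) :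
    Summable (coeffTerm N' lam m n s) := by
  set X : ℝ := 2 * Real.pi * (2 * Real.pi * |(m : ℝ)|) * |(n : ℝ)| with hX
  refine Summable.of_norm_bounded ((summable_modulus_rpow hN (r := 1 - 2 * s.re)
    (by linarith)).mul_left (2 * ‖besselConst m n (wt lam) s‖ *
      ∑' j : ℕ, X ^ j / (j.factorial * j.factorial))) fun c => ?_
  have hq : 0 < 4 * N' * c := Nat.mul_pos (by omega) c.pos
  have hqR : (0 : ℝ) < ((4 * N' * c : ℕ) : ℝ) := by exact_mod_cast hq
  have e1 : ‖hypF01 (2 * s) (2 * Real.pi * Complex.I * rowParam m (4 * N' * c) * n)‖ ≤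
      ∑' j : ℕ, X ^ j / (j.factorial * j.factorial) := by
    refine norm_hypF01_le (by simp; linarith) ?_
    rw [norm_mul, norm_mul, norm_mul, norm_mul, Complex.norm_I, Complex.norm_intCast,
      Complex.norm_of_nonneg Real.pi_pos.le, Complex.norm_ofNat, mul_one, hX]
    gcongr
    exact norm_rowParam_le m hq
  have e2 : ‖kloosterman lam m n (4 * N' * c) / ((4 * N' * c : ℕ) : ℂ)‖ ≤ 1 := by
    rw [norm_div, Complex.norm_natCast, div_le_one hqR]
    exact norm_kloosterman_le _ _ _ _
  have e3 := norm_natCast_cpow hq (1 - 2 * s)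
  have e4 : (1 - 2 * s).re = 1 - 2 * s.re := by simp
  rw [e4] at e3
  rw [coeffTerm, besselFactor_eq m n (wt lam) (by linarith) hq]
  change ‖_ * _ * (_ * _ * hypF01 (2 * s) (2 * Real.pi * Complex.I * rowParam m (4 * N' * c) * n))‖ ≤ _
  rw [norm_mul, norm_mul, norm_mul, norm_mul, e3]
  calc _ ≤ 2 * 1 * (‖besselConst m n (wt lam) s‖ * ((4 * N' * c : ℕ) : ℝ) ^ (1 - 2 * s.re) *
        ∑' j : ℕ, X ^ j / (j.factorial * j.factorial)) := by
        gcongr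
        exact norm_one_add_jacobiSym_le _
    _ = _ := by ring

theorem hasSum_fourierTerm {N' : ℕ} (hN : Odd N') {lam m : ℤ} (hm : PlusIndex lam m) {s : ℂ}
    (hs : 1 < s.re) (z : ℍ) :
    HasSum (fun n : {n : ℤ // PlusIndex lam n} => fourierTerm N' lam m s z n)
      (poincarePlus m lam (4 * N') s z - phi m lam s z) := by
  have h1 := poincarePlus_eq hm hs hN z
  have h2 := summable_modulusTerm hN.pos lam m hs z
  have h3 : HasSum (fun p : ℕ+ × ℤ => modulusTerm N' lam m s z p.1 p.2)
      (poincarePlus m lam (4 * N') s z - phi m lam s z) := by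
    -- For each modulus, Poisson summation in D replaces the sum over D by one over n. Absolute
    -- convergence over pairs (c, n) then allows summing over c first.
    rw [← h1.tsum_eq, h1.summable.tsum_prod]
    convert! h2.hasSum using 1
    rw [h2.tsum_prod]
    exact tsum_congr fun c => tsum_plusWeight_mul_rowKer N' lam m hs z c hN.pos
      (h1.summable.prod_factor c)
  have h4 : HasSum (fun p : ℤ × ℕ+ => modulusTerm N' lam m s z p.2 p.1) _ :=
    (Equiv.prodComm ℤ ℕ+).hasSum_iff.mpr h3
  have h5 := h4.prod_fiberwise fun n => (h4.summable.prod_factor n).hasSum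
  have hsupp : ∀ n ∉ Set.range (Subtype.val : {n : ℤ // PlusIndex lam n} → ℤ),
      ∑' c : ℕ+, modulusTerm N' lam m s z c n = 0 := by
    intro n hn
    rw [Subtype.range_coe_subtype] at hn
    simp only [modulusTerm_of_not N' lam m s z _ hn, tsum_zero]
  refine ((Function.Injective.hasSum_iff Subtype.val_injective hsupp).mpr h5).congr_fun fun n => ?_
  exact (tsum_modulusTerm hN.pos lam m hs z n.2).symm

end PlusPoincare
end

/-! ### The Fourier expansion of the projected Poincaré series. -/

theorem theorem4p4 (N' : ℕ) (hN' : Odd N') (lam m : ℤ) (hm : PlusIndex lam m)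
    (s : ℂ) (hs : 1 < s.re) :
    (∀ z : UpperHalfPlane, Summable (poincareTerm m lam (4 * N') s z)) ∧
    (∀ n : ℤ, PlusIndex lam n → Summable (coeffTerm N' lam m n s)) ∧
    ∀ z : UpperHalfPlane,
      Summable (fun n : {n : ℤ // PlusIndex lam n} => fourierTerm N' lam m s z n) ∧
      poincarePlus m lam (4 * N') s z =
        calM m (wt lam) z.im s * expI ((m : ℂ) * (z.re : ℂ)) +
          ∑' n : {n : ℤ // PlusIndex lam n}, fourierTerm N' lam m s z n := by
  have hN := hN'.pos
  refine ⟨fun z => (hasSum_rowTerm m lam hs (by omega) (dvd_mul_right _ _) z).1,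
    fun n _ => summable_coeffTerm hN lam m n hs, fun z => ?_⟩
  have h := hasSum_fourierTerm hN' hm hs z
  refine ⟨h.summable, ?_⟩
  rw [h.tsum_eq, phi]
  ring
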